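/- Let $k$ be a scheme and let $\mathcal V$ be a full subcategory of the category of $k$-schemes such that: all schemes in $\mathcal V$ are quasi-compact and quasi-separated; $k,\varnothing\in\mathcal V$; $\mathcal V$ is closed under $X\sqcup Y$, $X\times_kY$ and quasi-compact open subschemes (and isomorphisms); and if $X\in\mathcal V$ and $Y$ is a quasi-compact open subscheme of a Grassmannian bundle over $X$ with $Y\to X$ affine, then $Y\in\mathcal V$. Closed subsets are understood to have quasi-compact complement. A ring cohomology theory $B$ on $\mathcal V$ assigns functorially an abelian group $B_Z(X)$ to each closed $Z\subset X\in\mathcal V$ (with pullbacks $f^B\colon B_Z(X)\to B_{Z'}(X')$ for $f\colon X'\to X$, $f^{-1}(Z)\subset Z'$; put $B(X)=B_X(X)$) and natural maps $\partial\colon B(X\smallsetminus Z)\to B_Z(X)$ with exact localization sequences $B(X\smallsetminus Z)\xrightarrow{\partial}B_Z(X)\to B(X)\to B(X\smallsetminus Z)\xrightarrow{\partial}B_Z(X)$, étale excision and homotopy invariance $B(X)\cong B(X\times\mathbb A^1)$, together with functorial bilinear associative cup products $B_Z(X)\times B_W(X)\to B_{Z\cap W}(X)$ with a unit in $B(k)$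 and with $\partial(a\cup b)=\partial a\cup b$ for $a\in B(X\smallsetminus Z)$, $b\in B(X)$. For a symplectic bundle $(F,\psi)$ over $S$, $\mathrm{HP}_S(F,\psi)$ is the $S$-scheme parametrizing rank $2$ subbundles of $F$ on which $\psi$ is nondegenerate; it carries the tautological subbundle $\mathcal U$. Write $\mathrm{HP}^1$ for $\mathrm{HP}_k$ of the trivial symplectic bundle of rank $4$ over $k$. A symplectic Thom structure on $B$ is a rule assigning to every rank $2$ symplectic bundle $(E,\phi)$ on $X\in\mathcal V$ a $B(X)$-central class $\mathrm{Th}(E,\phi)\in B_X(E)$ (supported on the zero section), compatible with isometries and pullbacks, such that $\cup\,\mathrm{Th}\colon B(X)\to B_X(X\times\mathbb A^2)$ is an isomorphism for the trivial bundle. Its Pontryagin classes are $p(E,\phi)=-z^Be^B\mathrm{Th}(E,\phi)\in B(X)$, where $e^B\colon B_X(E)\to B(E)$ extends the support and $z^B\colon B(E)\to B(X)$ restricts to the zero section. A Pontryagin structure on $B$ is a rule assigning to every rank $2$ symplectic bundle $(E,\phi)$ on $S\in\mathcal V$ a central class $p(E,\phi)\in B(S)$, compatible with isometries and pullbacks,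 such that $(1,p(\mathcal U))\colon B(S)\oplus B(S)\to B(\mathrm{HP}^1\times S)$ is an isomorphism for all $S\in\mathcal V$, and which vanishes on the trivial bundle of rank $2$ over $k$. **Theorem.** Let $p$ be a Pontryagin structure on a ring cohomology theory $B$ on $\mathcal V$. There is exactly one symplectic Thom structure $\mathrm{Th}$ on $B$ whose Pontryagin classes are $p$. It is given as follows. For a rank $2$ symplectic bundle $(E,\phi)$ on $S\in\mathcal V$, let $F=\mathcal O_S\oplus E\oplus\mathcal O_S$ with the form $\psi((a,v,b),(a',v',b'))=ab'+\phi(v,v')-ba'$, let $P=\mathrm{HP}_S(F,\psi)$ with tautological subbundle $\mathcal U\subset F_P$, let $N^+\subset P$ be the closed locus where $\mathcal U\subset\mathcal O\oplus E\oplus 0$, and let $f\colon E\to P$ be the morphism over $S$ that sends $v$ to the subbundle $\{(0,w,\phi(v,w))\}$ (so that $f^{-1}(N^+)$ is the zero section). Then there is a unique class $\theta_{E,\phi}\in B_{N^+}(P)$ whose image in $B(P)$ is $p(\mathcal U,\psi|_{\mathcal U})$, and $$\mathrm{Th}(E,\phi)=-f^B(\theta_{E,\phi})\in B_S(E).$$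 -/

import Mathlib

open CategoryTheory CategoryTheory.Limits AlgebraicGeometry Opposite TopologicalSpace

universe u w

noncomputable section

namespace Symplectic

/-! ## Vector bundles -/

/-- A (geometric) vector bundle of rank `n` on a scheme `X`: an `X`-scheme `tot` (the total space)
whose set of `T`-points `E(T) = Hom_X(T, tot)` is, functorially in the `X`-scheme `T`, a module over
`Γ(T, 𝒪_T)`, and which has frames Zariski locally on `X`: over some neighbourhood `U` of each point
there are `n` sections whose pullbacks to every `T ⟶ U` form a basis of `E(T)`
(that is, they give a fibrewise linear isomorphism of `tot ×_X U` with affine `n`-space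
over `U`). -/
structure VectorBundle (X : Scheme.{u}) (n : ℕ) where
  tot : Over X
  acg : ∀ T : Over X, AddCommGroup (T ⟶ tot)
  mod : ∀ T : Over X, Module Γ(T.left, ⊤) (T ⟶ tot)
  comp_add : ∀ {T T' : Over X} (g : T' ⟶ T) (v v' : T ⟶ tot), g ≫ (v + v') = g ≫ v + g ≫ v'
  comp_smul : ∀ {T T' : Over X} (g : T' ⟶ T) (a : Γ(T.left, ⊤)) (v : T ⟶ tot),
    g ≫ (a • v) = g.left.appTop a • (g ≫ v)
  exists_frame : ∀ x : X, ∃ U : X.Opens, x ∈ U ∧ ∃ b : Fin n → (Over.mk U.ι ⟶ tot),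
    ∀ (T : Over X) (g : T ⟶ Over.mk U.ι) (v : T ⟶ tot),
      ∃! c : Fin n → Γ(T.left, ⊤), v = ∑ i, c i • (g ≫ b i)

attribute [instance] VectorBundle.acg VectorBundle.mod

/-- The zero section `X ⟶ E`. -/
def VectorBundle.zero {X : Scheme.{u}} {n : ℕ} (E : VectorBundle X n) :
    Over.mk (𝟙 X) ⟶ E.tot := 0

/-- The zero section, as a subset of the total space. -/
def VectorBundle.zeroLocus {X : Scheme.{u}} {n : ℕ} (E : VectorBundle X n) : Set E.tot.left :=
  Set.range E.zero.left

theorem VectorBundle.comp_zero {X : Scheme.{u}} {n : ℕ} (E : VectorBundle X n) {T T' : Over X}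
    (g : T' ⟶ T) : g ≫ (0 : T ⟶ E.tot) = 0 := by
  have h := E.comp_add g 0 0
  rw [add_zero] at h
  exact left_eq_add.mp h

/-- A vector bundle from a representing object of a functor `M` of modules. -/
def VectorBundle.ofEquiv {X : Scheme.{u}} {n : ℕ} (tot : Over X) (M : Over X → Type u)
    [∀ T, AddCommGroup (M T)] [∀ T : Over X, Module Γ(T.left, ⊤) (M T)]
    (e : ∀ T, (T ⟶ tot) ≃ M T) (res : ∀ {T T' : Over X}, (T' ⟶ T) → M T → M T')
    (he : ∀ {T T' : Over X} (g : T' ⟶ T) (v : T ⟶ tot), e T' (g ≫ v) = res g (e T v))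
    (res_add : ∀ {T T' : Over X} (g : T' ⟶ T) (m m' : M T),
      res g (m + m') = res g m + res g m')
    (res_smul : ∀ {T T' : Over X} (g : T' ⟶ T) (a : Γ(T.left, ⊤)) (m : M T),
      res g (a • m) = g.left.appTop a • res g m)
    (frame : ∀ x : X, ∃ U : X.Opens, x ∈ U ∧ ∃ b : Fin n → M (Over.mk U.ι),
      ∀ (T : Over X) (g : T ⟶ Over.mk U.ι) (v : M T),
        ∃! c : Fin n → Γ(T.left, ⊤), v = ∑ i, c i • res g (b i)) :
    VectorBundle X n :=
  letI (T : Over X) : AddCommGroup (T ⟶ tot) := (e T).addCommGroup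
  letI (T : Over X) : Module Γ(T.left, ⊤) (T ⟶ tot) := (e T).module Γ(T.left, ⊤)
  { tot := tot
    acg := fun T => inferInstance
    mod := fun T => inferInstance
    comp_add := fun {T T'} g v v' => (e T').injective (by
      rw [he]
      change res g (e T ((e T).symm (e T v + e T v'))) =
        e T' ((e T').symm (e T' (g ≫ v) + e T' (g ≫ v')))
      rw [Equiv.apply_symm_apply, Equiv.apply_symm_apply, res_add, he, he])
    comp_smul := fun {T T'} g a v => (e T').injective (by
      rw [he]
      change res g (e T ((e T).symm (a • e T v))) =
        e T' ((e T').symm (g.left.appTop a • e T' (g ≫ v)))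
      rw [Equiv.apply_symm_apply, Equiv.apply_symm_apply, res_smul, he])
    exists_frame := fun x => by
      obtain ⟨U, hx, b, hb⟩ := frame x
      refine ⟨U, hx, fun i => (e _).symm (b i), fun T g v => ?_⟩
      have key : ∀ c : Fin n → Γ(T.left, ⊤),
          (v = ∑ i, c i • (g ≫ (e _).symm (b i))) ↔ e T v = ∑ i, c i • res g (b i) := by
        intro c
        have h1 : e T (∑ i, c i • (g ≫ (e _).symm (b i))) = ∑ i, c i • res g (b i) := by
          change (e T).linearEquiv Γ(T.left, ⊤) _ = _
          rw [map_sum]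
          refine Finset.sum_congr rfl fun i _ => ?_
          rw [map_smul]
          change c i • e T (g ≫ (e _).symm (b i)) = _
          rw [he, Equiv.apply_symm_apply]
        rw [← h1, (e T).apply_eq_iff_eq]
      simpa only [key] using hb T g (e T v) }

/-- A symplectic bundle of rank `n`: a vector bundle with an alternating bilinear form, functorial
on `T`-points, which is nondegenerate: on affine `T` it identifies `E(T)` with its dual. -/
structure SympBundle (X : Scheme.{u}) (n : ℕ) extends VectorBundle X n where
  form : ∀ T : Over X, LinearMap.BilinForm Γ(T.left, ⊤) (T ⟶ tot)
  form_self : ∀ (T : Over X) (v : T ⟶ tot), form T v v = 0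
  form_comp : ∀ {T T' : Over X} (g : T' ⟶ T) (v v' : T ⟶ tot),
    form T' (g ≫ v) (g ≫ v') = g.left.appTop (form T v v')
  nondeg : ∀ T : Over X, IsAffine T.left → (form T).IsPerfPair

/-- For `f : Y ⟶ X`, a morphism of vector bundles `W ⟶ E` over `f` (equivalently a linear map
`W ⟶ f^*E` of bundles on `Y`): a morphism of total spaces over `f`, linear on `T`-points for
every `Y`-scheme `T`. -/
structure BundleMap {X Y : Scheme.{u}} (f : Y ⟶ X) {m n : ℕ}
    (W : VectorBundle Y m) (E : VectorBundle X n) where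
  hom : (Over.map f).obj W.tot ⟶ E.tot
  map_add : ∀ (T : Over Y) (v v' : T ⟶ W.tot),
    (Over.map f).map (v + v') ≫ hom = (Over.map f).map v ≫ hom + (Over.map f).map v' ≫ hom
  map_smul : ∀ (T : Over Y) (a : Γ(T.left, ⊤)) (v : T ⟶ W.tot),
    (Over.map f).map (a • v) ≫ hom =
      (show Γ(((Over.map f).obj T).left, ⊤) from a) • ((Over.map f).map v ≫ hom)

namespace BundleMap

variable {X Y : Scheme.{u}} {f : Y ⟶ X} {m n : ℕ}

/-- The map induced on `T`-points. -/
def app {W : VectorBundle Y m} {E : VectorBundle X n} (j : BundleMap f W E) (T : Over Y)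
    (v : T ⟶ W.tot) : (Over.map f).obj T ⟶ E.tot := (Over.map f).map v ≫ j.hom

/-- The map of total spaces. -/
def left {W : VectorBundle Y m} {E : VectorBundle X n} (j : BundleMap f W E) :
    W.tot.left ⟶ E.tot.left := j.hom.left

/-- `W ⟶ f^*E` is the inclusion of a subbundle: it is injective on `T`-points for all `T`
(in particular injective on all fibres, hence locally split). -/
def IsSubbundle {W : VectorBundle Y m} {E : VectorBundle X n} (j : BundleMap f W E) : Prop :=
  ∀ T : Over Y, Function.Injective (j.app T)

/-- `W ⟶ f^*E` is an isomorphism: `j` exhibits `W` as the pullback of `E` along `f`. For `f = 𝟙 X`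
this says that `j` is an isomorphism of bundles. -/
def IsCartesian {W : VectorBundle Y m} {E : VectorBundle X n} (j : BundleMap f W E) : Prop :=
  ∀ T : Over Y, Function.Bijective (j.app T)

/-- `j` is compatible with the symplectic forms. -/
def IsIsometric {W : SympBundle Y m} {E : SympBundle X n}
    (j : BundleMap f W.toVectorBundle E.toVectorBundle) : Prop :=
  ∀ (T : Over Y) (v v' : T ⟶ W.tot),
    E.form ((Over.map f).obj T) (j.app T v) (j.app T v') = W.form T v v'

theorem preimage_zeroLocus {W : VectorBundle Y m} {E : VectorBundle X n} (j : BundleMap f W E)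
    (hj : j.IsSubbundle) : j.left ⁻¹' E.zeroLocus ⊆ W.zeroLocus := by
  rintro y ⟨x, hx⟩
  obtain ⟨q, hq, -⟩ := Scheme.Pullback.exists_preimage_pullback (f := j.left) (g := E.zero.left)
    y x hx.symm
  let Q : Scheme.{u} := pullback j.left E.zero.left
  let T : Over Y := Over.mk ((pullback.fst j.left E.zero.left : Q ⟶ _) ≫ W.tot.hom)
  let v : T ⟶ W.tot := Over.homMk (pullback.fst j.left E.zero.left)
  have hw : j.left ≫ E.tot.hom = W.tot.hom ≫ f := Over.w j.hom
  have hz : E.zero.left ≫ E.tot.hom = 𝟙 X := Over.w E.zero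
  have hc : pullback.fst j.left E.zero.left ≫ j.left =
    pullback.snd j.left E.zero.left ≫ E.zero.left := pullback.condition
  let s : (Over.map f).obj T ⟶ Over.mk (𝟙 X) := Over.homMk (pullback.snd j.left E.zero.left) (by
    change pullback.snd j.left E.zero.left ≫ 𝟙 X =
      (pullback.fst j.left E.zero.left ≫ W.tot.hom) ≫ f
    rw [Category.assoc, ← hw, ← Category.assoc, hc, Category.assoc, hz])
  have h1 : j.app T v = 0 := by
    have : j.app T v = s ≫ E.zero := by
      ext1
      exact hc
    rw [this]
    exact E.comp_zero s
  have h2 : j.app T 0 = 0 := by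
    have h := j.map_add T 0 0
    rw [add_zero] at h
    exact left_eq_add.mp h
  have h3 : v = 0 := hj T (h1.trans h2.symm)
  let t : T ⟶ Over.mk (𝟙 Y) := Over.homMk T.hom (Category.comp_id _)
  have h4 : v = t ≫ W.zero := h3.trans (W.comp_zero t).symm
  have h5 : pullback.fst j.left E.zero.left = T.hom ≫ W.zero.left :=
    congrArg CommaMorphism.left h4
  refine ⟨T.hom q, ?_⟩
  rw [← hq, h5]
  rfl

end BundleMap

/-- For bundles `𝒰` on `Y` and `W` on `T`, both mapped to a bundle `E` on `X`: the `X`-morphism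
`g : T ⟶ Y` pulls `𝒰 ⟶ E_Y` back to `W ⟶ E_T` (the latter is given by the map `j` of total
spaces), that is, `W` and `g^*𝒰` are identified compatibly with their maps to `E`. -/
def Classifies {X : Scheme.{u}} {n r : ℕ} {E : VectorBundle X n} {Y T : Over X}
    {𝒰 : VectorBundle Y.left r} (ι : BundleMap Y.hom 𝒰 E)
    (W : VectorBundle T.left r) (j : W.tot.left ⟶ E.tot.left) (g : T ⟶ Y) : Prop :=
  ∃ m : BundleMap g.left W 𝒰, m.IsCartesian ∧ m.left ≫ ι.left = j

/-- `Y` is an open subscheme of the Grassmannian bundle `Gr_X(r, E)`, expressed through the functor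
of points of the latter (`T ↦` rank `r` subbundles of `E_T`): `Y` carries a rank `r` subbundle
`𝒰 ⊂ E_Y`, and for every rank `r` subbundle `W ⊂ E_T` there is an open `T₀ ⊆ T` such that for all
`t : T' ⟶ T` the subbundle `t^*W` is the pullback of `𝒰` along a morphism `T' ⟶ Y`, which is then
unique, precisely when `t` factors through `T₀`. -/
def IsOpenInGrassmannian {X : Scheme.{u}} {n : ℕ} (E : VectorBundle X n) (r : ℕ) (Y : Over X) :
    Prop :=
  ∃ (𝒰 : VectorBundle Y.left r) (ι : BundleMap Y.hom 𝒰 E), ι.IsSubbundle ∧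
    ∀ (T : Over X) (W : VectorBundle T.left r) (j : BundleMap T.hom W E), j.IsSubbundle →
      ∃ T₀ : T.left.Opens, ∀ (T' : Over X) (t : T' ⟶ T) (W' : VectorBundle T'.left r)
        (c : BundleMap t.left W' W), c.IsCartesian →
          (Set.range t.left ⊆ T₀ → ∃! g : T' ⟶ Y, Classifies ι W' (c.left ≫ j.left) g) ∧
          ((∃ g : T' ⟶ Y, Classifies ι W' (c.left ≫ j.left) g) → Set.range t.left ⊆ T₀)

/-! ## Two explicit symplectic bundles -/

theorem isPerfPair_of_alt {R M : Type*} [CommRing R] [AddCommGroup M] [Module R M]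
    (B : LinearMap.BilinForm R M) (halt : ∀ v, B v v = 0)
    (h : Function.Bijective (fun v : M => (B v : Module.Dual R M))) : B.IsPerfPair := by
  have hf : ∀ v, LinearMap.flip B v = -B v := by
    intro v
    ext w
    exact (LinearMap.IsAlt.neg (B := B) halt v w).symm
  refine ⟨h, ?_, ?_⟩
  · intro v w hvw
    rw [hf, hf] at hvw
    exact h.1 (neg_injective hvw)
  · intro l
    obtain ⟨v, hv⟩ := h.2 (-l)
    exact ⟨v, by rw [hf]; exact (congrArg Neg.neg hv).trans (neg_neg l)⟩

/-- The bilinear form on `R²` with matrix `(0, -1; 1, 0)`. -/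
def hypForm (R : Type*) [CommRing R] : LinearMap.BilinForm R (Fin 2 → R) :=
  LinearMap.mk₂ R (fun v w => v 1 * w 0 - v 0 * w 1)
    (by intro a b c; simp only [Pi.add_apply]; ring)
    (by intro a b c; simp only [Pi.smul_apply, smul_eq_mul]; ring)
    (by intro a b c; simp only [Pi.add_apply]; ring)
    (by intro a b c; simp only [Pi.smul_apply, smul_eq_mul]; ring)

theorem hypForm_apply (R : Type*) [CommRing R] (v w : Fin 2 → R) :
    hypForm R v w = v 1 * w 0 - v 0 * w 1 := rfl

theorem hypForm_self (R : Type*) [CommRing R] (v : Fin 2 → R) : hypForm R v v = 0 := by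
  rw [hypForm_apply]; ring

theorem hypForm_isPerfPair (R : Type*) [CommRing R] : (hypForm R).IsPerfPair := by
  refine isPerfPair_of_alt _ (hypForm_self R) ⟨?_, ?_⟩
  · intro v w hvw
    have h0 := LinearMap.congr_fun hvw ![1, 0]
    have h1 := LinearMap.congr_fun hvw ![0, 1]
    simp [hypForm_apply] at h0 h1
    funext i
    fin_cases i
    · exact h1
    · exact h0
  · intro l
    refine ⟨![-l ![0, 1], l ![1, 0]], ?_⟩
    refine LinearMap.ext fun w => ?_
    have hw : w = w 0 • ![1, 0] + w 1 • ![0, 1] := by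
      funext i
      fin_cases i <;> simp
    have hl : l w = w 0 * l ![1, 0] + w 1 * l ![0, 1] := by
      conv_lhs => rw [hw, map_add, map_smul, map_smul, smul_eq_mul, smul_eq_mul]
    rw [hl]
    simp [hypForm_apply]
    ring

/-- The bilinear form `((a, v, b), (a', v', b')) ↦ a b' + φ(v, v') - b a'`, which has matrix
`(0, 0, 1; 0, φ, 0; -1, 0, 0)`. -/
def tripleForm {R M : Type*} [CommRing R] [AddCommGroup M] [Module R M]
    (φ : LinearMap.BilinForm R M) : LinearMap.BilinForm R (R × M × R) :=
  LinearMap.mk₂ R (fun x y => x.1 * y.2.2 + φ x.2.1 y.2.1 - x.2.2 * y.1)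
    (by intro a b c
        simp only [Prod.fst_add, Prod.snd_add, map_add, LinearMap.add_apply]; ring)
    (by intro a b c
        simp only [Prod.smul_fst, Prod.smul_snd, smul_eq_mul, map_smul, LinearMap.smul_apply]
        ring)
    (by intro a b c; simp only [map_add, Prod.fst_add, Prod.snd_add]; ring)
    (by intro a b c; simp only [map_smul, Prod.smul_fst, Prod.smul_snd, smul_eq_mul]; ring)

theorem tripleForm_apply {R M : Type*} [CommRing R] [AddCommGroup M] [Module R M]
    (φ : LinearMap.BilinForm R M) (x y : R × M × R) :
    tripleForm φ x y = x.1 * y.2.2 + φ x.2.1 y.2.1 - x.2.2 * y.1 := rfl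

theorem tripleForm_self {R M : Type*} [CommRing R] [AddCommGroup M] [Module R M]
    (φ : LinearMap.BilinForm R M) (h : ∀ v, φ v v = 0) (x : R × M × R) :
    tripleForm φ x x = 0 := by
  rw [tripleForm_apply, h]; ring

theorem tripleForm_isPerfPair {R M : Type*} [CommRing R] [AddCommGroup M] [Module R M]
    (φ : LinearMap.BilinForm R M) (h : ∀ v, φ v v = 0) (hφ : φ.IsPerfPair) :
    (tripleForm φ).IsPerfPair := by
  refine isPerfPair_of_alt _ (tripleForm_self φ h) ⟨?_, ?_⟩
  · intro x y hxy
    have h (q : R × M × R) := LinearMap.congr_fun hxy q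
    simp only [tripleForm_apply] at h
    refine Prod.ext ?_ (Prod.ext ?_ ?_)
    · simpa using h (0, 0, 1)
    · apply hφ.bijective_left.1
      refine LinearMap.ext fun w => ?_
      simpa using h (0, w, 0)
    · simpa using h (1, 0, 0)
  · intro l
    obtain ⟨v, hv⟩ := hφ.bijective_left.2 (l ∘ₗ
      LinearMap.inr R R (M × R) ∘ₗ LinearMap.inl R M R)
    refine ⟨(l (0, 0, 1), v, -l (1, 0, 0)), ?_⟩
    refine LinearMap.ext fun q => ?_
    have hv' : φ v q.2.1 = l (0, q.2.1, 0) := LinearMap.congr_fun hv q.2.1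
    have hq : q = q.1 • ((1, 0, 0) : R × M × R) + (0, q.2.1, 0) +
        q.2.2 • ((0, 0, 1) : R × M × R) := by
      refine Prod.ext ?_ (Prod.ext ?_ ?_) <;> simp
    conv_rhs => rw [hq]
    simp only [tripleForm_apply, hv', map_add, map_smul, smul_eq_mul]
    ring

/-- The `T`-points of affine `2`-space over an `X`-scheme `Y`. -/
def affineEquiv {X : Scheme.{u}} (Y T : Over X) :
    (T ⟶ Over.mk ((𝔸(ULift.{u} (Fin 2); Y.left) ↘ Y.left) ≫ Y.hom)) ≃
      (T ⟶ Y) × (Fin 2 → Γ(T.left, ⊤)) where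
  toFun v := (Over.homMk (v.left ≫ (𝔸(ULift.{u} (Fin 2); Y.left) ↘ Y.left)) (by
      rw [Category.assoc]; exact Over.w v),
    fun i => v.left.appTop (AffineSpace.coord Y.left ⟨i⟩))
  invFun p := Over.homMk (AffineSpace.homOfVector p.1.left fun i => p.2 i.down) (by
      simp)
  left_inv v := by
    ext1
    apply AffineSpace.hom_ext
    · simp
    · intro i
      exact AffineSpace.homOfVector_appTop_coord _ _ _
  right_inv p := by
    refine Prod.ext ?_ ?_
    · ext1
      simp
    · funext i
      exact AffineSpace.homOfVector_appTop_coord _ _ _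

theorem affineEquiv_comp {X : Scheme.{u}} (Y : Over X) {T T' : Over X} (g : T' ⟶ T)
    (v : T ⟶ Over.mk ((𝔸(ULift.{u} (Fin 2); Y.left) ↘ Y.left) ≫ Y.hom)) :
    affineEquiv Y T' (g ≫ v) =
      (g ≫ (affineEquiv Y T v).1, fun i => g.left.appTop ((affineEquiv Y T v).2 i)) := by
  refine Prod.ext ?_ ?_
  · ext1
    exact Category.assoc _ _ _
  · funext i
    change (g.left ≫ v.left).appTop _ = g.left.appTop (v.left.appTop _)
    rw [Scheme.Hom.comp_appTop]
    rfl

/-- The `T`-points of the trivial bundle of rank `2`. -/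
def trivialEquiv (X : Scheme.{u}) (T : Over X) :
    (T ⟶ Over.mk ((𝔸(ULift.{u} (Fin 2); X) ↘ X) ≫ 𝟙 X)) ≃ (Fin 2 → Γ(T.left, ⊤)) :=
  (affineEquiv (Over.mk (𝟙 X)) T).trans
    { toFun := fun p => p.2
      invFun := fun c => (Over.homMk T.hom (Category.comp_id _), c)
      left_inv := fun p => Prod.ext (by
        ext1
        exact ((Category.comp_id _).symm.trans (Over.w p.1)).symm) rfl
      right_inv := fun _ => rfl }

theorem trivialEquiv_comp (X : Scheme.{u}) {T T' : Over X} (g : T' ⟶ T)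
    (v : T ⟶ Over.mk ((𝔸(ULift.{u} (Fin 2); X) ↘ X) ≫ 𝟙 X)) :
    trivialEquiv X T' (g ≫ v) = fun i => g.left.appTop (trivialEquiv X T v i) :=
  congrArg Prod.snd (affineEquiv_comp (Over.mk (𝟙 X)) g v)

/-- The trivial vector bundle of rank `2`, with total space `X × 𝔸²`. -/
def trivialBundle (X : Scheme.{u}) : VectorBundle X 2 :=
  VectorBundle.ofEquiv (Over.mk ((𝔸(ULift.{u} (Fin 2); X) ↘ X) ≫ 𝟙 X))
    (fun T => Fin 2 → Γ(T.left, ⊤)) (trivialEquiv X)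
    (fun g m i => g.left.appTop (m i)) (trivialEquiv_comp X)
    (fun g m m' => funext fun i => map_add _ _ _)
    (fun g a m => funext fun i => map_mul _ _ _)
    (fun x => ⟨⊤, trivial, fun i => Pi.single i 1, fun T g v => by
      have key : ∀ c : Fin 2 → Γ(T.left, ⊤),
          (∑ i, c i • fun j => g.left.appTop ((Pi.single i 1 :
            Fin 2 → Γ((Over.mk (⊤ : X.Opens).ι).left, ⊤)) j)) = c := by
        intro c
        funext j
        fin_cases j <;> simp [Fin.sum_univ_two]
      refine ⟨v, (key v).symm, fun c hc => ?_⟩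
      exact ((key c).symm.trans hc.symm)⟩)

/-- Coordinates on the trivial bundle. -/
def trivialCoord (X : Scheme.{u}) (T : Over X) :
    (T ⟶ (trivialBundle X).tot) ≃ₗ[Γ(T.left, ⊤)] (Fin 2 → Γ(T.left, ⊤)) :=
  { trivialEquiv X T with
    map_add' := fun _ _ => (trivialEquiv X T).apply_symm_apply _
    map_smul' := fun _ _ => (trivialEquiv X T).apply_symm_apply _ }

/-- The trivial symplectic bundle `Hyp(𝒪)` of rank `2`: the form has matrix `(0, -1; 1, 0)`. -/
def trivialSymp (X : Scheme.{u}) : SympBundle X 2 where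
  toVectorBundle := trivialBundle X
  form T := (hypForm Γ(T.left, ⊤)).compl₁₂ (trivialCoord X T).toLinearMap
    (trivialCoord X T).toLinearMap
  form_self T v := hypForm_self _ _
  form_comp {T T'} g v w := by
    have h : ∀ v : T ⟶ (trivialBundle X).tot,
        trivialCoord X T' (g ≫ v) = fun i => g.left.appTop.hom (trivialCoord X T v i) :=
      fun v => trivialEquiv_comp X g v
    refine (congrArg₂ (fun x y => hypForm Γ(T'.left, ⊤) x y) (h v) (h w)).trans ?_
    simp only [LinearMap.compl₁₂_apply, LinearEquiv.coe_coe, hypForm_apply]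
    exact ((RingHom.map_sub _ _ _).trans
      (congrArg₂ HSub.hSub (RingHom.map_mul _ _ _) (RingHom.map_mul _ _ _))).symm
  nondeg T _ := by
    have := hypForm_isPerfPair Γ(T.left, ⊤)
    exact LinearMap.IsPerfPair.compl₁₂ _ (trivialCoord X T) (trivialCoord X T)

/-- The module of triples `(a, v, b)`, the `T`-points of `𝒪 ⊕ E ⊕ 𝒪`. -/
abbrev Triple {X : Scheme.{u}} {n : ℕ} (E : VectorBundle X n) (T : Over X) : Type u :=
  Γ(T.left, ⊤) × (T ⟶ E.tot) × Γ(T.left, ⊤)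

/-- The `T`-points of `𝒪 ⊕ E ⊕ 𝒪`, whose total space is affine `2`-space over `E`. -/
def tripleEquiv {X : Scheme.{u}} {n : ℕ} (E : VectorBundle X n) (T : Over X) :
    (T ⟶ Over.mk ((𝔸(ULift.{u} (Fin 2); E.tot.left) ↘ E.tot.left) ≫ E.tot.hom)) ≃
      Triple E T :=
  (affineEquiv E.tot T).trans
    { toFun := fun p => (p.2 0, p.1, p.2 1)
      invFun := fun q => (q.2.1, ![q.1, q.2.2])
      left_inv := fun p => Prod.ext rfl (by funext i; fin_cases i <;> rfl)
      right_inv := fun _ => rfl }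

theorem tripleEquiv_comp {X : Scheme.{u}} {n : ℕ} (E : VectorBundle X n) {T T' : Over X}
    (g : T' ⟶ T)
    (v : T ⟶ Over.mk ((𝔸(ULift.{u} (Fin 2); E.tot.left) ↘ E.tot.left) ≫ E.tot.hom)) :
    tripleEquiv E T' (g ≫ v) = (g.left.appTop (tripleEquiv E T v).1,
      g ≫ (tripleEquiv E T v).2.1, g.left.appTop (tripleEquiv E T v).2.2) :=
  congrArg (fun p : (T' ⟶ E.tot) × (Fin 2 → Γ(T'.left, ⊤)) => (p.2 0, p.1, p.2 1))
    (affineEquiv_comp E.tot g v)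

/-- The vector bundle `𝒪 ⊕ E ⊕ 𝒪`. -/
def tripleBundle {X : Scheme.{u}} {n : ℕ} (E : VectorBundle X n) : VectorBundle X (n + 2) :=
  VectorBundle.ofEquiv
    (Over.mk ((𝔸(ULift.{u} (Fin 2); E.tot.left) ↘ E.tot.left) ≫ E.tot.hom))
    (Triple E) (tripleEquiv E)
    (fun g m => (g.left.appTop m.1, g ≫ m.2.1, g.left.appTop m.2.2)) (tripleEquiv_comp E)
    (fun g m m' => Prod.ext (map_add _ _ _) (Prod.ext (E.comp_add _ _ _) (map_add _ _ _)))
    (fun g a m => Prod.ext (map_mul _ _ _) (Prod.ext (E.comp_smul _ _ _) (map_mul _ _ _)))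
    (fun x => by
      obtain ⟨U, hx, b, hb⟩ := E.exists_frame x
      refine ⟨U, hx, Fin.cons (1, 0, 0) (Fin.snoc (fun i => (0, b i, 0)) (0, 0, 1) :
        Fin (n + 1) → Triple E (Over.mk U.ι)), fun T g v => ?_⟩
      have key : ∀ c : Fin (n + 2) → Γ(T.left, ⊤),
          (∑ i, c i • ((fun m : Triple E (Over.mk U.ι) =>
            ((g.left.appTop m.1, g ≫ m.2.1, g.left.appTop m.2.2) : Triple E T))
            ((Fin.cons (1, 0, 0) (Fin.snoc (fun i => (0, b i, 0)) (0, 0, 1) :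
              Fin (n + 1) → Triple E (Over.mk U.ι)) :
              Fin (n + 2) → Triple E (Over.mk U.ι)) i))) =
          (c 0, ∑ i : Fin n, c i.castSucc.succ • (g ≫ b i), c (Fin.last n).succ) := by
        intro c
        rw [Fin.sum_univ_succ, Fin.sum_univ_castSucc]
        simp only [Fin.cons_zero, Fin.cons_succ, Fin.snoc_castSucc, Fin.snoc_last, map_one,
          map_zero, E.comp_zero, Prod.smul_mk, smul_zero, smul_eq_mul, mul_one]
        refine Prod.ext ?_ (Prod.ext ?_ ?_)
        · simp [Prod.fst_sum]
        · simp [Prod.fst_sum, Prod.snd_sum]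
        · simp [Prod.snd_sum]
      obtain ⟨c, hc, hc'⟩ := hb T g v.2.1
      refine ⟨Fin.cons v.1 (Fin.snoc c v.2.2 : Fin (n + 1) → Γ(T.left, ⊤)), ?_, ?_⟩
      · refine Eq.trans ?_ (key _).symm
        refine Prod.ext ?_ (Prod.ext ?_ ?_)
        · simp
        · simpa using hc
        · simp
      · intro d hd
        have hd' := hd.trans (key d)
        have h1 : v.1 = d 0 := congrArg Prod.fst hd'
        have h2 : v.2.1 = ∑ i : Fin n, d i.castSucc.succ • (g ≫ b i) :=
          congrArg (fun p => p.2.1) hd'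
        have h3 : v.2.2 = d (Fin.last n).succ := congrArg (fun p => p.2.2) hd'
        have h4 := hc' (fun i => d i.castSucc.succ) h2
        funext i
        refine Fin.cases ?_ (fun i => Fin.lastCases ?_ (fun i => ?_) i) i
        · simp [h1]
        · simp [h3]
        · simp [← h4])

/-- The coordinates `(a, v, b)` on `𝒪 ⊕ E ⊕ 𝒪`. -/
def tripleCoord {X : Scheme.{u}} {n : ℕ} (E : VectorBundle X n) (T : Over X) :
    (T ⟶ (tripleBundle E).tot) ≃ₗ[Γ(T.left, ⊤)] Triple E T :=
  { tripleEquiv E T with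
    map_add' := fun _ _ => (tripleEquiv E T).apply_symm_apply _
    map_smul' := fun _ _ => (tripleEquiv E T).apply_symm_apply _ }

/-- The symplectic bundle `F = 𝒪 ⊕ E ⊕ 𝒪` with the form
`ψ((a, v, b), (a', v', b')) = a b' + φ(v, v') - b a'`, of matrix `(0, 0, 1; 0, φ, 0; -1, 0, 0)`. -/
def hypExt {X : Scheme.{u}} {n : ℕ} (E : SympBundle X n) : SympBundle X (n + 2) where
  toVectorBundle := tripleBundle E.toVectorBundle
  form T := (tripleForm (E.form T)).compl₁₂ (tripleCoord E.toVectorBundle T).toLinearMap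
    (tripleCoord E.toVectorBundle T).toLinearMap
  form_self T v := tripleForm_self _ (E.form_self T) _
  form_comp {T T'} g v w := by
    have h : ∀ (v : T ⟶ (tripleBundle E.toVectorBundle).tot),
        tripleCoord E.toVectorBundle T' (g ≫ v) =
          (g.left.appTop.hom (tripleCoord E.toVectorBundle T v).1,
            g ≫ (tripleCoord E.toVectorBundle T v).2.1,
            g.left.appTop.hom (tripleCoord E.toVectorBundle T v).2.2) :=
      fun v => tripleEquiv_comp E.toVectorBundle g v
    refine (congrArg₂ (fun x y => tripleForm (E.form T') x y) (h v) (h w)).trans ?_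
    simp only [LinearMap.compl₁₂_apply, LinearEquiv.coe_coe, tripleForm_apply]
    exact ((RingHom.map_sub _ _ _).trans (congrArg₂ HSub.hSub
      ((RingHom.map_add _ _ _).trans (congrArg₂ HAdd.hAdd (RingHom.map_mul _ _ _)
        (E.form_comp g _ _).symm)) (RingHom.map_mul _ _ _))).symm
  nondeg T hT := by
    have := tripleForm_isPerfPair (E.form T) (E.form_self T) (E.nondeg T hT)
    exact LinearMap.IsPerfPair.compl₁₂ _ (tripleCoord E.toVectorBundle T)
      (tripleCoord E.toVectorBundle T)

/-! ## Quaternionic projective bundles -/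

/-- The quaternionic projective bundle `HP_X(F, ψ)`: the `X`-scheme representing the functor which
sends `T` to the set of rank `2` symplectic subbundles of `(F, ψ)_T` (those on which `ψ` is
nondegenerate), together with its tautological subbundle. A rank `2` symplectic subbundle is given
by a rank `2` symplectic bundle `W` on `T` and an isometric map `W ⟶ F_T` (automatically injective
and split); `Classifies` compares them as subbundles. -/
structure HPBundle {X : Scheme.{u}} {n : ℕ} (F : SympBundle X n) where
  tot : Over X
  taut : SympBundle tot.left 2
  incl : BundleMap tot.hom taut.toVectorBundle F.toVectorBundle
  isometric : incl.IsIsometric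
  existsUnique : ∀ (T : Over X) (W : SympBundle T.left 2)
    (j : BundleMap T.hom W.toVectorBundle F.toVectorBundle), j.IsIsometric →
      ∃! g : T ⟶ tot, Classifies incl W.toVectorBundle j.left g

/-- For `P = HP_X(𝒪 ⊕ E ⊕ 𝒪)`, the locus `N⁺` of those points at which the tautological subbundle
is contained in `𝒪 ⊕ E`, i.e. has vanishing third coordinate. -/
def HPBundle.plusLocus {X : Scheme.{u}} {n : ℕ} {E : SympBundle X n} (P : HPBundle (hypExt E)) :
    Set P.tot.left :=
  {x | ∀ u : Over.mk (P.tot.left.fromSpecResidueField x) ⟶ P.taut.tot,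
    (tripleCoord E.toVectorBundle _ (P.incl.app _ u)).2.2 = 0}

/-- For a rank `2` symplectic bundle `(E, φ)` and `P = HP_X(𝒪 ⊕ E ⊕ 𝒪)`: the `X`-morphism
`f : E ⟶ P` sends a vector `v` of `E` to the subbundle `{(0, w, φ(v, w))}`. It is the inclusion of
the locus `N⁻` where the tautological subbundle lies in `E ⊕ 𝒪`, composed with
`E ≅ E^∨ ≅ N⁻`. -/
def HPBundle.IsMinusInclusion {X : Scheme.{u}} {E : SympBundle X 2} (P : HPBundle (hypExt E))
    (f : E.tot ⟶ P.tot) : Prop :=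
  ∀ (T : Over X) (v : T ⟶ E.tot) (x : T ⟶ (hypExt E).tot),
    (∃ u : T.left ⟶ P.taut.tot.left,
      u ≫ P.taut.tot.hom = (v ≫ f).left ∧ u ≫ P.incl.left = x.left) ↔
    (tripleCoord E.toVectorBundle T x).1 = 0 ∧
      (tripleCoord E.toVectorBundle T x).2.2 =
        E.form T v (tripleCoord E.toVectorBundle T x).2.1

/-! ## Categories of schemes and ring cohomology theories -/

/-- A category `𝒱` of `k`-schemes (a full subcategory of all `k`-schemes): its schemes are
quasi-compact and quasi-separated, it contains `k` and `∅`, and it is closed under `⊔`, `×_k`,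
quasi-compact open subschemes (`opens`, stated for open immersions), and open subschemes `Y` of
Grassmannian bundles over a scheme `X` of `𝒱` for which `Y ⟶ X` is affine (such a `Y` is
automatically quasi-compact, as is its inclusion into the Grassmannian bundle). -/
structure SchemeCategory (k : Scheme.{u}) where
  mem : Over k → Prop
  quasiCompact : ∀ X, mem X → CompactSpace X.left
  quasiSeparated : ∀ X, mem X → QuasiSeparatedSpace X.left
  base : mem (Over.mk (𝟙 k))
  empty : mem (⊥_ (Over k))
  coprod : ∀ X Y, mem X → mem Y → mem (X ⨿ Y)
  prod : ∀ X Y, mem X → mem Y → mem (X ⨯ Y)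
  opens : ∀ {X Y : Over k} (j : Y ⟶ X), IsOpenImmersion j.left → CompactSpace Y.left →
    mem X → mem Y
  grassmannian : ∀ {X : Over k}, mem X → ∀ {n : ℕ} (E : VectorBundle X.left n) (r : ℕ)
    (Y : Over X.left), IsAffineHom Y.hom → IsOpenInGrassmannian E r Y →
      mem (Over.mk (Y.hom ≫ X.hom))

variable {k : Scheme.{u}}

/-- `Z` is a closed subset of the scheme `X` in `𝒱` whose (open) complement is quasi-compact, hence
also in `𝒱`. -/
def SchemeCategory.Adm (V : SchemeCategory k) (X : Over k) (Z : Set X.left) : Prop :=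
  V.mem X ∧ IsClosed Z ∧ IsCompact Zᶜ

theorem SchemeCategory.adm_univ (V : SchemeCategory k) {X : Over k} (hX : V.mem X) :
    V.Adm X Set.univ := ⟨hX, isClosed_univ, by simp⟩

theorem SchemeCategory.Adm.inter {V : SchemeCategory k} {X : Over k} {Z W : Set X.left}
    (hZ : V.Adm X Z) (hW : V.Adm X W) : V.Adm X (Z ∩ W) :=
  ⟨hZ.1, hZ.2.1.inter hW.2.1, by rw [Set.compl_inter]; exact hZ.2.2.union hW.2.2⟩

/-- The pairs `(X, Z)` on which a cohomology theory is defined. -/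
structure SPair (V : SchemeCategory k) where
  X : Over k
  Z : Set X.left
  adm : V.Adm X Z

/-- A morphism of pairs `(X', Z') ⟶ (X, Z)` is `f : X' ⟶ X` with `f⁻¹(Z) ⊆ Z'`. -/
@[ext]
structure SPair.Hom {V : SchemeCategory k} (P Q : SPair V) where
  f : P.X ⟶ Q.X
  sub : f.left ⁻¹' Q.Z ⊆ P.Z

instance (V : SchemeCategory k) : Category (SPair V) where
  Hom P Q := SPair.Hom P Q
  id P := ⟨𝟙 P.X, fun _ hx => hx⟩
  comp a b := ⟨a.f ≫ b.f, fun _ hx => a.sub (b.sub hx)⟩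
  id_comp a := SPair.Hom.ext (Category.id_comp a.f)
  comp_id a := SPair.Hom.ext (Category.comp_id a.f)
  assoc a b c := SPair.Hom.ext (Category.assoc a.f b.f c.f)

namespace SPair

variable {V : SchemeCategory k}

/-- The pair `(X, X)`. -/
def top {X : Over k} (hX : V.mem X) : SPair V := ⟨X, Set.univ, V.adm_univ hX⟩

/-- A morphism of schemes as a morphism `(Y, Y) ⟶ (X, X)`. -/
def topMap {X Y : Over k} (hX : V.mem X) (hY : V.mem Y) (f : Y ⟶ X) :
    (top hY : SPair V) ⟶ top hX := ⟨f, fun _ _ => trivial⟩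

/-- A morphism `f` of schemes with `f⁻¹(Z) ⊆ Z'`, as a morphism `(X', Z') ⟶ (X, Z)`. -/
def homMk {X X' : Over k} {Z : Set X.left} {Z' : Set X'.left} (hZ : V.Adm X Z)
    (hZ' : V.Adm X' Z') (f : X' ⟶ X) (hf : f.left ⁻¹' Z ⊆ Z') :
    (⟨X', Z', hZ'⟩ : SPair V) ⟶ ⟨X, Z, hZ⟩ := ⟨f, hf⟩

/-- For `Z ⊆ Z'`, the identity of `X` as a morphism `(X, Z') ⟶ (X, Z)`. -/
def incl {X : Over k} {Z Z' : Set X.left} (hZ : V.Adm X Z) (hZ' : V.Adm X Z') (h : Z ⊆ Z') :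
    (⟨X, Z', hZ'⟩ : SPair V) ⟶ ⟨X, Z, hZ⟩ := ⟨𝟙 X, h⟩

/-- The open complement `X ∖ Z`. -/
def compl (P : SPair V) : P.X.left.Opens := ⟨P.Zᶜ, P.adm.2.1.isOpen_compl⟩

/-- The `k`-scheme `X ∖ Z`. -/
def openScheme (P : SPair V) : Over k := Over.mk (P.compl.ι ≫ P.X.hom)

/-- The inclusion `X ∖ Z ⟶ X`. -/
def openι (P : SPair V) : P.openScheme ⟶ P.X := Over.homMk P.compl.ι

theorem mem_open (P : SPair V) : V.mem P.openScheme :=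
  V.opens P.openι (inferInstanceAs (IsOpenImmersion P.compl.ι))
    (isCompact_iff_compactSpace.mp P.adm.2.2) P.adm.1

/-- The morphism `X' ∖ Z' ⟶ X ∖ Z` induced by a morphism of pairs. -/
def openLift {P Q : SPair V} (a : P ⟶ Q) : P.compl.toScheme ⟶ Q.compl.toScheme :=
  IsOpenImmersion.lift Q.compl.ι (P.compl.ι ≫ a.f.left) (by
    rintro _ ⟨x, rfl⟩
    rw [Scheme.Opens.range_ι]
    exact fun hx => x.2 (a.sub hx))

/-- `openLift` as a morphism of `k`-schemes. -/
def openHom {P Q : SPair V} (a : P ⟶ Q) : P.openScheme ⟶ Q.openScheme :=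
  Over.homMk (openLift a) (by
    change openLift a ≫ Q.compl.ι ≫ Q.X.hom = P.compl.ι ≫ P.X.hom
    have h : openLift a ≫ Q.compl.ι = P.compl.ι ≫ a.f.left := IsOpenImmersion.lift_fac _ _ _
    rw [← Category.assoc, h, Category.assoc]
    exact congrArg _ (Over.w a.f))

end SPair

/-- A cohomology theory `(A, ∂)` on `𝒱`. -/
structure CohomologyTheory (V : SchemeCategory k) where
  A : (SPair V)ᵒᵖ ⥤ AddCommGrpCat.{w}
  /-- The boundary map `∂ : A(X ∖ Z) ⟶ A_Z(X)`. -/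
  bd : ∀ P : SPair V, A.obj (op (SPair.top P.mem_open)) →+ A.obj (op P)
  bd_naturality : ∀ {P Q : SPair V} (a : P ⟶ Q) (x : A.obj (op (SPair.top Q.mem_open))),
    A.map a.op (bd Q x) = bd P (A.map (SPair.topMap Q.mem_open P.mem_open (SPair.openHom a)).op x)
  /-- Localization. -/
  exact_supp : ∀ P : SPair V, Function.Exact (bd P)
    (A.map (SPair.incl P.adm (V.adm_univ P.adm.1) (Set.subset_univ _)).op)
  exact_total : ∀ P : SPair V, Function.Exact
    (A.map (SPair.incl P.adm (V.adm_univ P.adm.1) (Set.subset_univ _)).op)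
    (A.map (SPair.topMap P.adm.1 P.mem_open P.openι).op)
  exact_open : ∀ P : SPair V, Function.Exact
    (A.map (SPair.topMap P.adm.1 P.mem_open P.openι).op) (bd P)
  /-- Étale excision: `f` is étale, `Z' = f⁻¹(Z)` and the base change of `f` to `Z` (with its
  reduced structure) is an isomorphism. -/
  excision : ∀ {P Q : SPair V} (a : P ⟶ Q), Etale a.f.left → a.f.left ⁻¹' Q.Z = P.Z →
    IsIso (pullback.snd a.f.left
      (Scheme.IdealSheafData.vanishingIdeal ⟨Q.Z, Q.adm.2.1⟩).subschemeι) →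
    Function.Bijective (A.map a.op)
  /-- Homotopy invariance for the projection `X × 𝔸¹ ⟶ X`. -/
  homotopy : ∀ {X : Over k} (hX : V.mem X)
    (hA : V.mem (Over.mk ((𝔸(PUnit.{u + 1}; X.left) ↘ X.left) ≫ X.hom))),
    Function.Bijective (A.map (SPair.topMap hX hA (Over.homMk (𝔸(PUnit; X.left) ↘ X.left))).op)

namespace CohomologyTheory

variable {V : SchemeCategory k} (B : CohomologyTheory.{u, w} V)

/-- The group `B_Z(X)`. -/
abbrev grp (P : SPair V) : Type w := B.A.obj (op P)

/-- The group `B(X) = B_X(X)`. -/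
abbrev coh {X : Over k} (hX : V.mem X) : Type w := B.grp (SPair.top hX)

/-- The pullback along a morphism of pairs. -/
abbrev pull {P Q : SPair V} (a : P ⟶ Q) : B.grp Q →+ B.grp P := (B.A.map a.op).hom

/-- Pullback `f^B : B(X) ⟶ B(Y)`. -/
abbrev pullTop {X Y : Over k} (hX : V.mem X) (hY : V.mem Y) (f : Y ⟶ X) :
    B.coh hX →+ B.coh hY := B.pull (SPair.topMap hX hY f)

/-- Enlarging the support, `B_Z(X) ⟶ B_{Z'}(X)` for `Z ⊆ Z'`. -/
abbrev ext {X : Over k} {Z Z' : Set X.left} (hZ : V.Adm X Z) (hZ' : V.Adm X Z') (h : Z ⊆ Z') :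
    B.grp ⟨X, Z, hZ⟩ →+ B.grp ⟨X, Z', hZ'⟩ := B.pull (SPair.incl hZ hZ' h)

/-- Extension of supports `e : B_Z(X) ⟶ B(X)`. -/
abbrev extTop {X : Over k} {Z : Set X.left} (hZ : V.Adm X Z) :
    B.grp ⟨X, Z, hZ⟩ →+ B.coh hZ.1 := B.ext hZ (V.adm_univ hZ.1) (Set.subset_univ _)

end CohomologyTheory

/-- A ring cohomology theory on `𝒱`: a cohomology theory with functorial bilinear associative unital
cup products. -/
structure RingCohomologyTheory (V : SchemeCategory k) extends CohomologyTheory.{u, w} V where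
  cup : ∀ {X : Over k} {Z W : Set X.left} (hZ : V.Adm X Z) (hW : V.Adm X W),
    toCohomologyTheory.grp ⟨X, Z, hZ⟩ →+ toCohomologyTheory.grp ⟨X, W, hW⟩ →+
      toCohomologyTheory.grp ⟨X, Z ∩ W, hZ.inter hW⟩
  cup_pull : ∀ {X X' : Over k} {Z W : Set X.left} {Z' W' : Set X'.left} (hZ : V.Adm X Z)
    (hW : V.Adm X W) (hZ' : V.Adm X' Z') (hW' : V.Adm X' W') (f : X' ⟶ X)
    (hf : f.left ⁻¹' Z ⊆ Z') (hf' : f.left ⁻¹' W ⊆ W')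
    (a : toCohomologyTheory.grp ⟨X, Z, hZ⟩) (b : toCohomologyTheory.grp ⟨X, W, hW⟩),
    toCohomologyTheory.pull (SPair.homMk (hZ.inter hW) (hZ'.inter hW') f
        (Set.inter_subset_inter hf hf')) (cup hZ hW a b) =
      cup hZ' hW' (toCohomologyTheory.pull (SPair.homMk hZ hZ' f hf) a)
        (toCohomologyTheory.pull (SPair.homMk hW hW' f hf') b)
  cup_assoc : ∀ {X : Over k} {Z W T : Set X.left} (hZ : V.Adm X Z) (hW : V.Adm X W)
    (hT : V.Adm X T) (a : toCohomologyTheory.grp ⟨X, Z, hZ⟩)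
    (b : toCohomologyTheory.grp ⟨X, W, hW⟩) (c : toCohomologyTheory.grp ⟨X, T, hT⟩),
    toCohomologyTheory.ext ((hZ.inter hW).inter hT) (hZ.inter (hW.inter hT))
        (Set.inter_assoc Z W T).subset (cup (hZ.inter hW) hT (cup hZ hW a b) c) =
      cup hZ (hW.inter hT) a (cup hW hT b c)
  /-- The unit `1 ∈ A(k)`. -/
  one : toCohomologyTheory.coh V.base
  one_cup : ∀ {X : Over k} {Z : Set X.left} (hZ : V.Adm X Z)
    (a : toCohomologyTheory.grp ⟨X, Z, hZ⟩),
    toCohomologyTheory.ext ((V.adm_univ hZ.1).inter hZ) hZ Set.inter_subset_right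
      (cup (V.adm_univ hZ.1) hZ
        (toCohomologyTheory.pullTop V.base hZ.1 (Over.homMk X.hom (Category.comp_id _)) one) a) = a
  cup_one : ∀ {X : Over k} {Z : Set X.left} (hZ : V.Adm X Z)
    (a : toCohomologyTheory.grp ⟨X, Z, hZ⟩),
    toCohomologyTheory.ext (hZ.inter (V.adm_univ hZ.1)) hZ Set.inter_subset_left
      (cup hZ (V.adm_univ hZ.1) a
        (toCohomologyTheory.pullTop V.base hZ.1 (Over.homMk X.hom (Category.comp_id _)) one)) = a
  bd_cup : ∀ (P : SPair V) (a : toCohomologyTheory.coh P.mem_open)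
    (b : toCohomologyTheory.coh P.adm.1),
    toCohomologyTheory.bd P (toCohomologyTheory.ext
        ((V.adm_univ P.mem_open).inter (V.adm_univ P.mem_open)) (V.adm_univ P.mem_open)
        (Set.subset_univ _)
        (cup (V.adm_univ P.mem_open) (V.adm_univ P.mem_open) a
          (toCohomologyTheory.pullTop P.adm.1 P.mem_open P.openι b))) =
      toCohomologyTheory.ext (P.adm.inter (V.adm_univ P.adm.1)) P.adm Set.inter_subset_left
        (cup P.adm (V.adm_univ P.adm.1) (toCohomologyTheory.bd P a) b)

namespace RingCohomologyTheory

variable {V : SchemeCategory k} (B : RingCohomologyTheory.{u, w} V)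

/-- The left action `B(X) × B_Z(X) ⟶ B_Z(X)` by cup product. -/
def lmul {X : Over k} {Z : Set X.left} (hZ : V.Adm X Z) (a : B.coh hZ.1)
    (b : B.grp ⟨X, Z, hZ⟩) : B.grp ⟨X, Z, hZ⟩ :=
  B.ext ((V.adm_univ hZ.1).inter hZ) hZ Set.inter_subset_right (B.cup (V.adm_univ hZ.1) hZ a b)

/-- The right action `B_Z(X) × B(X) ⟶ B_Z(X)` by cup product. -/
def rmul {X : Over k} {Z : Set X.left} (hZ : V.Adm X Z) (b : B.grp ⟨X, Z, hZ⟩)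
    (a : B.coh hZ.1) : B.grp ⟨X, Z, hZ⟩ :=
  B.ext (hZ.inter (V.adm_univ hZ.1)) hZ Set.inter_subset_left (B.cup hZ (V.adm_univ hZ.1) b a)

/-- The product of `B(X)`. -/
def mul {X : Over k} (hX : V.mem X) (a b : B.coh hX) : B.coh hX :=
  B.ext ((V.adm_univ hX).inter (V.adm_univ hX)) (V.adm_univ hX) (Set.subset_univ _)
    (B.cup (V.adm_univ hX) (V.adm_univ hX) a b)

end RingCohomologyTheory

/-- An `X`-scheme, for `X` a `k`-scheme, as a `k`-scheme. -/
abbrev overBase {X : Over k} (Y : Over X.left) : Over k := Over.mk (Y.hom ≫ X.hom)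

/-- The structure map of an `X`-scheme, as a morphism of `k`-schemes. -/
abbrev overBaseHom {X : Over k} (Y : Over X.left) : overBase Y ⟶ X := Over.homMk Y.hom

/-- The zero section of a vector bundle, as a morphism of `k`-schemes. -/
def zeroSection {X : Over k} {n : ℕ} (E : VectorBundle X.left n) : X ⟶ overBase E.tot :=
  Over.homMk E.zero.left (by
    have h : E.zero.left ≫ E.tot.hom = 𝟙 X.left := Over.w E.zero
    change E.zero.left ≫ E.tot.hom ≫ X.hom = X.hom
    rw [← Category.assoc, h]
    exact Category.id_comp X.hom)

/-- A morphism of vector bundles over `f`, as a morphism of `k`-schemes between total spaces. -/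
def totMap {X Y : Over k} {f : Y ⟶ X} {m n : ℕ} {W : VectorBundle Y.left m}
    {E : VectorBundle X.left n} (j : BundleMap f.left W E) : overBase W.tot ⟶ overBase E.tot :=
  Over.homMk j.left (by
    have h : j.left ≫ E.tot.hom = W.tot.hom ≫ f.left := Over.w j.hom
    change j.left ≫ E.tot.hom ≫ X.hom = W.tot.hom ≫ Y.hom
    rw [← Category.assoc, h, Category.assoc]
    exact congrArg _ (Over.w f))

/-! ## Thom structures and Pontryagin structures -/

variable {V : SchemeCategory k}

/-- A symplectic Thom structure on `B`: a rule assigning a `B(X)`-central class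
`Th(E, φ) ∈ B_X(E)`, supported on the zero section, to each rank `2` symplectic bundle on a scheme
`X` of `𝒱`. The argument `hE` records that the total space is in `𝒱` and the zero section is an
admissible support, which is always the case. -/
@[ext]
structure ThomStructure (B : RingCohomologyTheory.{u, w} V) where
  cls : ∀ {X : Over k}, V.mem X → ∀ (E : SympBundle X.left 2)
    (hE : V.Adm (overBase E.tot) E.zeroLocus), B.grp ⟨overBase E.tot, E.zeroLocus, hE⟩
  central : ∀ {X : Over k} (hX : V.mem X) (E : SympBundle X.left 2)
    (hE : V.Adm (overBase E.tot) E.zeroLocus) (a : B.coh hX),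
    B.lmul hE (B.pullTop hX hE.1 (overBaseHom E.tot) a) (cls hX E hE) =
      B.rmul hE (cls hX E hE) (B.pullTop hX hE.1 (overBaseHom E.tot) a)
  /-- Compatibility with isometries `E ≅ E₁` (the case `f = 𝟙 X`) and with pullbacks
  `f_E : E' = f^*E ⟶ E`. -/
  pull : ∀ {X Y : Over k} (hX : V.mem X) (hY : V.mem Y) (f : Y ⟶ X) (E : SympBundle X.left 2)
    (E' : SympBundle Y.left 2) (hE : V.Adm (overBase E.tot) E.zeroLocus)
    (hE' : V.Adm (overBase E'.tot) E'.zeroLocus)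
    (j : BundleMap f.left E'.toVectorBundle E.toVectorBundle) (hj : j.IsCartesian),
    j.IsIsometric →
    B.pull (SPair.homMk hE hE' (totMap j) (j.preimage_zeroLocus fun T => (hj T).1)) (cls hX E hE) =
      cls hY E' hE'
  /-- Nondegeneracy: cup product with the Thom class of the trivial bundle is an isomorphism
  `B(X) ≅ B_X(X × 𝔸²)`. -/
  nondeg : ∀ {X : Over k} (hX : V.mem X)
    (hE : V.Adm (overBase (trivialSymp X.left).tot) (trivialSymp X.left).zeroLocus),
    Function.Bijective fun a : B.coh hX =>
      B.lmul hE (B.pullTop hX hE.1 (overBaseHom (trivialSymp X.left).tot) a)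
        (cls hX (trivialSymp X.left) hE)

/-- The Pontryagin class `p(E, φ) = - z^B e^B Th(E, φ)` defined by a symplectic Thom structure. -/
def ThomStructure.pontryaginClass {B : RingCohomologyTheory.{u, w} V} (Th : ThomStructure B)
    {X : Over k} (hX : V.mem X) (E : SympBundle X.left 2)
    (hE : V.Adm (overBase E.tot) E.zeroLocus) : B.coh hX :=
  -B.pullTop hE.1 hX (zeroSection E.toVectorBundle) (B.extTop hE (Th.cls hX E hE))

/-- A Pontryagin structure on `B`: a rule assigning a central class `p(E, φ) ∈ B(X)` to each
rank `2` symplectic bundle on a scheme `X` of `𝒱`. -/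
@[ext]
structure PontryaginStructure (B : RingCohomologyTheory.{u, w} V) where
  cls : ∀ {X : Over k} (hX : V.mem X), SympBundle X.left 2 → B.coh hX
  central : ∀ {X : Over k} (hX : V.mem X) (E : SympBundle X.left 2) (a : B.coh hX),
    B.mul hX a (cls hX E) = B.mul hX (cls hX E) a
  /-- Invariance under isometries (the case `f = 𝟙 X`) and compatibility with pullbacks
  `E' = f^*E`. -/
  pull : ∀ {X Y : Over k} (hX : V.mem X) (hY : V.mem Y) (f : Y ⟶ X) (E : SympBundle X.left 2)
    (E' : SympBundle Y.left 2) (j : BundleMap f.left E'.toVectorBundle E.toVectorBundle),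
    j.IsCartesian → j.IsIsometric → B.pullTop hX hY f (cls hX E) = cls hY E'
  /-- For the tautological subbundle `𝒰` on `HP¹ = HP_k(H)`, where `H` is the trivial symplectic
  bundle of rank `4`, the map `(1, p(𝒰)) : B(S) ⊕ B(S) ⟶ B(HP¹ × S)` is an isomorphism. -/
  projective : ∀ (P : HPBundle (hypExt (trivialSymp k)))
    (hP : V.mem (overBase (X := Over.mk (𝟙 k)) P.tot)) {S : Over k} (hS : V.mem S),
    Function.Bijective fun a : B.coh hS × B.coh hS =>
      B.pullTop hS (V.prod _ _ hP hS) Limits.prod.snd a.1 +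
      B.mul (V.prod _ _ hP hS)
        (B.pullTop hS (V.prod _ _ hP hS) Limits.prod.snd a.2)
        (B.pullTop hP (V.prod _ _ hP hS) Limits.prod.fst (cls hP P.taut))
  /-- The class of a trivial symplectic bundle on the base vanishes. -/
  cls_trivial : cls V.base (trivialSymp k) = 0

end Symplectic

end

open CategoryTheory AlgebraicGeometry Symplectic

open CategoryTheory CategoryTheory.Limits AlgebraicGeometry Opposite TopologicalSpace

noncomputable section

namespace Symplectic

/-! ### Symplectic projectors of rank two -/

section Algebra

variable {R M : Type*} [CommRing R] [AddCommGroup M] [Module R M]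

/-! A symplectic subbundle of `F = 𝒪 ⊕ E ⊕ 𝒪` amounts to the orthogonal projector onto it, a
self-adjoint idempotent. For `E` of rank two these projectors are described by triples `(a, x, y)`,
where `a` is a function and `x`, `y` are vectors of `E` with `φ(x, y) = a (1 - a)`: the projector
sends `(1, 0, 0)` to `(a, x, 0)` and `(0, 0, 1)` to `(0, y, a)`. Thus `P = HP(F)` is an affine
quadric bundle, `N⁺` is the locus `a = 0, x = 0`, and `f : E ⟶ P` is `v ↦ (0, v, 0)`. The geometry
is carried out in these coordinates (`Quad`, `HPBundle.equiv`), on points with values in arbitrary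
schemes.

Existence rests on two cohomological facts about `P`. First, the map `(x, v, c) ↦ (1 - φ(x, v), x,
(1 - φ(x, v)) v - c x)` from `E × E × 𝔸¹` to `P ∖ N⁺` has local sections and fibres closed under
affine combinations. Homotopy invariance and a Mayer–Vietoris argument then give `B(X) ≅ B(P ∖ N⁺)`
(`HPBundle.bijective_pullTop_open`). So `B(P) ⟶ B(P ∖ N⁺)` is surjective, and by the localization
sequence `B_{N⁺}(P) ⟶ B(P)` is injective (`HPBundle.injective_extTop`). The hyperbolic plane `𝒪 ⊕ 0
⊕ 𝒪` is a section of `P` avoiding `N⁺` along which `𝒰` is trivial; hence `p(𝒰)` vanishes off `N⁺`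
and lifts to a unique `θ`. Compatibility of `θ` with base change and its centrality follow from this
injectivity.

Second, where `1 - a` is invertible, the coordinates `(x, y) / (1 - a)` identify a neighbourhood of
`N⁺` with a neighbourhood of `0 × E` in `E × E`. Excision and homotopy invariance make `f^B :
B_{N⁺}(P) ⟶ B_X(E)` an isomorphism (`HPBundle.bijective_pull_minusPair`). For trivial `E` the
projective bundle isomorphism shows that `∪ θ` is an isomorphism `B(X) ≅ B_{N⁺}(P)`, which gives
nondegeneracy of `-f^B θ`. Since `f^*𝒰` is the pullback of `E` to its own total space, restricting
to the zero section recovers `p(E)`.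

Uniqueness: let `Th` have Pontryagin classes `p`. Projecting `(1, 0, 0)` to `𝒰` gives a section `σ =
(a, x, 0)` of `𝒰` whose zeros lie in `N⁺`. Without supports, `σ` and the zero section induce the
same pullback by homotopy invariance, so `-σ^B Th(𝒰)` is supported on `N⁺` and maps to `p(𝒰)`; hence
it is `θ`. Along `f`, the bundle `𝒰` becomes the pullback of `E` to `E` and `σ` becomes the diagonal
section, which pulls the Thom class of that pullback back to `Th(E)`. Therefore `Th(E) = -f^B θ`
(`PontryaginStructure.eq_thomClass`). -/

/-- The Plücker relation satisfied by alternating forms on modules with two generators. -/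
def IsPlucker (φ : LinearMap.BilinForm R M) : Prop :=
  ∀ u v w : M, φ u v • w = φ u w • v - φ v w • u

/-- The difference of the two sides is alternating and trilinear in `u`, `v`, `w`, so it vanishes as
soon as two vectors generate the module. -/
theorem isPlucker_of_generators (φ : LinearMap.BilinForm R M) (hφ : ∀ v, φ v v = 0)
    (b : Fin 2 → M) (hb : ∀ v, ∃ c : Fin 2 → R, v = ∑ i, c i • b i) : IsPlucker φ := by
  intro u v w
  obtain ⟨c, rfl⟩ := hb u
  obtain ⟨d, rfl⟩ := hb v
  obtain ⟨e, rfl⟩ := hb w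
  have h : φ (b 1) (b 0) = -φ (b 0) (b 1) := (LinearMap.IsAlt.neg (B := φ) hφ _ _).symm
  simp only [Fin.sum_univ_two, map_add, map_smul, LinearMap.add_apply, LinearMap.smul_apply,
    smul_eq_mul, hφ, h]
  module

/-- The endomorphism `(a, v, b) ↦ (αa - φ(y, v), ax + (1 - α)v + by, φ(x, v) + αb)`. -/
def tripleProj (φ : LinearMap.BilinForm R M) (α : R) (x y : M) : (R × M × R) →ₗ[R] R × M × R where
  toFun z := (α * z.1 - φ y z.2.1, z.1 • x + (1 - α) • z.2.1 + z.2.2 • y, φ x z.2.1 + α * z.2.2)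
  map_add' z z' := by
    refine Prod.ext ?_ (Prod.ext ?_ ?_)
    · simp only [Prod.fst_add, Prod.snd_add, map_add]; ring
    · simp only [Prod.fst_add, Prod.snd_add]; module
    · simp only [Prod.fst_add, Prod.snd_add, map_add]; ring
  map_smul' r z := by
    refine Prod.ext ?_ (Prod.ext ?_ ?_)
    · simp only [Prod.smul_fst, Prod.smul_snd, map_smul, smul_eq_mul, RingHom.id_apply]; ring
    · simp only [Prod.smul_fst, Prod.smul_snd, smul_eq_mul, RingHom.id_apply]; module
    · simp only [Prod.smul_fst, Prod.smul_snd, map_smul, smul_eq_mul, RingHom.id_apply]; ring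

theorem tripleProj_apply (φ : LinearMap.BilinForm R M) (α : R) (x y : M) (z : R × M × R) :
    tripleProj φ α x y z = (α * z.1 - φ y z.2.1,
      z.1 • x + (1 - α) • z.2.1 + z.2.2 • y, φ x z.2.1 + α * z.2.2) := rfl

variable {φ : LinearMap.BilinForm R M}

theorem alt_swap (hφ : ∀ v, φ v v = 0) (v w : M) : φ v w = -φ w v :=
  (LinearMap.IsAlt.neg (B := φ) hφ _ _).symm

/-- The outer components close up by `h` alone. In the middle one the leftover `φ x v • y - φ y v •
x` has to be `φ x y • v`, and this is the Plücker relation. -/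
theorem tripleProj_idem (hφ : ∀ v, φ v v = 0) (hP : IsPlucker φ) {α : R} {x y : M}
    (h : φ x y = α * (1 - α)) (z : R × M × R) :
    tripleProj φ α x y (tripleProj φ α x y z) = tripleProj φ α x y z := by
  obtain ⟨a, v, b⟩ := z
  have h' : φ y x = -(α * (1 - α)) := by rw [alt_swap hφ, h]
  have hv := hP x y v
  rw [h] at hv
  simp only [tripleProj_apply, map_add, map_smul, smul_eq_mul, hφ, h, h']
  refine Prod.ext ?_ (Prod.ext ?_ ?_)
  · simp only; ring
  · simp only
    linear_combination (norm := module) -hv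
  · simp only; ring

/-- Self-adjointness needs no relation between `α`, `x` and `y`. It makes image and kernel
orthogonal, so that a projector of this shape is determined by its image. -/
theorem tripleForm_tripleProj (hφ : ∀ v, φ v v = 0) (α : R) (x y : M) (z z' : R × M × R) :
    tripleForm φ (tripleProj φ α x y z) z' = tripleForm φ z (tripleProj φ α x y z') := by
  simp only [tripleForm_apply, tripleProj_apply, map_add, map_smul, smul_eq_mul,
    LinearMap.add_apply, LinearMap.smul_apply, alt_swap hφ z.2.1 x, alt_swap hφ z.2.1 y]
  ring

/-- For self-adjoint projectors `p`, `p'` with the same image, `ψ(p z, z') = ψ(p z, p' z') = ψ(z, p'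
z') = ψ(p' z, z')`, and nondegeneracy gives `p = p'`. -/
theorem tripleProj_ext (hφ : ∀ v, φ v v = 0) (hP : IsPlucker φ)
    (hnd : ∀ z : R × M × R, (∀ z', tripleForm φ z z' = 0) → z = 0) {α α' : R} {x y x' y' : M}
    (h : φ x y = α * (1 - α)) (h' : φ x' y' = α' * (1 - α'))
    (H : ∀ z, tripleProj φ α x y z = z ↔ tripleProj φ α' x' y' z = z) :
    α = α' ∧ x = x' ∧ y = y' := by
  have key : tripleProj φ α x y = tripleProj φ α' x' y' := by
    refine LinearMap.ext fun z => ?_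
    rw [← sub_eq_zero]
    refine hnd _ fun z' => ?_
    rw [map_sub, LinearMap.sub_apply, sub_eq_zero]
    have h1 := (H _).1 (tripleProj_idem hφ hP h z)
    have h2 := (H _).2 (tripleProj_idem hφ hP h' z')
    calc tripleForm φ (tripleProj φ α x y z) z'
        = tripleForm φ (tripleProj φ α x y z) (tripleProj φ α' x' y' z') := by
          rw [← tripleForm_tripleProj hφ, h1]
      _ = tripleForm φ z (tripleProj φ α' x' y' z') := by
          rw [tripleForm_tripleProj hφ, h2]
      _ = _ := by rw [tripleForm_tripleProj hφ]
  -- The parameters are matrix entries: the projector maps `(1, 0, 0)` to `(α, x, 0)` and `(0, 0,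
  -- 1)` to `(0, y, α)`.
  have h1 := LinearMap.congr_fun key (1, 0, 0)
  have h2 := LinearMap.congr_fun key (0, 0, 1)
  simp only [tripleProj_apply, Prod.mk.injEq, map_zero, smul_zero, zero_smul, one_smul, mul_one,
    mul_zero, add_zero, zero_add, sub_zero] at h1 h2
  exact ⟨h1.1, h1.2.1, h2.2.1⟩

/-- The parameter `y` (and, with the roles exchanged, `x`) of the projector on the span of
a pair. -/
def pairVec (w₁ w₂ : R × M × R) : R × M × M :=
  (w₁.1 * w₂.2.2 - w₂.1 * w₁.2.2, w₂.2.2 • w₁.2.1 - w₁.2.2 • w₂.2.1,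
    w₁.1 • w₂.2.1 - w₂.1 • w₁.2.1)

/-- With `v₁`, `v₂` the middle components of the pair, bilinearity gives `φ x y = α * φ v₁ v₂`, and
the normalisation of the pair says `α + φ v₁ v₂ = 1`. -/
theorem pairVec_rel (hφ : ∀ v, φ v v = 0) {w₁ w₂ : R × M × R} (h : tripleForm φ w₁ w₂ = 1) :
    φ (pairVec w₁ w₂).2.1 (pairVec w₁ w₂).2.2 =
      (pairVec w₁ w₂).1 * (1 - (pairVec w₁ w₂).1) := by
  rw [tripleForm_apply] at h
  simp only [pairVec, map_sub, map_smul, LinearMap.sub_apply, LinearMap.smul_apply, smul_eq_mul,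
    hφ, alt_swap hφ w₂.2.1 w₁.2.1]
  linear_combination (w₁.1 * w₂.2.2 - w₂.1 * w₁.2.2) * h

/-- The right side is the orthogonal projection onto the span of a pair with product one; `pairVec`
collects its parameters. The outer components match directly, the middle one by the Plücker relation
for `v₁`, `v₂` and the middle component of `z`. -/
theorem tripleProj_pairVec (hφ : ∀ v, φ v v = 0) (hP : IsPlucker φ) {w₁ w₂ : R × M × R}
    (h : tripleForm φ w₁ w₂ = 1) (z : R × M × R) :
    tripleProj φ (pairVec w₁ w₂).1 (pairVec w₁ w₂).2.1 (pairVec w₁ w₂).2.2 z =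
      tripleForm φ z w₂ • w₁ - tripleForm φ z w₁ • w₂ := by
  rw [tripleForm_apply] at h
  have hv := hP w₁.2.1 w₂.2.1 z.2.1
  have h1 : 1 - (w₁.1 * w₂.2.2 - w₂.1 * w₁.2.2) = φ w₁.2.1 w₂.2.1 := by
    linear_combination -h
  simp only [tripleForm_apply, tripleProj_apply, pairVec, map_sub, map_smul, LinearMap.sub_apply,
    LinearMap.smul_apply, smul_eq_mul, h1, alt_swap hφ z.2.1]
  refine Prod.ext ?_ (Prod.ext ?_ ?_)
  · simp only [Prod.fst_sub, Prod.smul_fst, smul_eq_mul]; ring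
  · simp only [Prod.snd_sub, Prod.smul_snd, Prod.fst_sub, Prod.smul_fst]
    linear_combination (norm := module) hv
  · simp only [Prod.snd_sub, Prod.smul_snd, smul_eq_mul]; ring

end Algebra

/-! ### Gluing morphisms over a base -/

section Gluing

variable {X : Scheme.{u}}

/-- The restriction of an `X`-scheme to an open subset. -/
abbrev resOver (T : Over X) (U : T.left.Opens) : Over X := Over.mk (U.ι ≫ T.hom)

/-- The inclusion of an open subset. -/
abbrev resι (T : Over X) (U : T.left.Opens) : resOver T U ⟶ T := Over.homMk U.ι

/-- The inclusion between two open subsets. -/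
def resLE (T : Over X) {U U' : T.left.Opens} (h : U ≤ U') : resOver T U ⟶ resOver T U' :=
  Over.homMk (T.left.homOfLE h) (by simp)

@[simp]
theorem resLE_ι (T : Over X) {U U' : T.left.Opens} (h : U ≤ U') :
    resLE T h ≫ resι T U' = resι T U := by
  ext1; simp [resLE]

/-- The open cover by chosen neighbourhoods of all points. -/
def coverOfNhds (T : Scheme.{u}) (U : T → T.Opens) (hU : ∀ t, t ∈ U t) : T.OpenCover :=
  T.openCoverOfIsOpenCover U (by
    refine top_le_iff.mp fun t _ => ?_
    exact Opens.mem_iSup.mpr ⟨t, hU t⟩)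

theorem over_hom_ext_local {T Y : Over X} {g g' : T ⟶ Y}
    (h : ∀ t : T.left, ∃ U : T.left.Opens, t ∈ U ∧ resι T U ≫ g = resι T U ≫ g') : g = g' := by
  choose U hU h using h
  ext1
  refine Scheme.Cover.hom_ext (coverOfNhds T.left U hU) _ _ fun t => ?_
  exact congrArg CommaMorphism.left (h t)

/-- A function is encoded as a section of the affine line, so that the locality of morphisms
applies. -/
theorem ring_ext_local {T : Scheme.{u}} {a b : Γ(T, ⊤)}
    (h : ∀ t : T, ∃ U : T.Opens, t ∈ U ∧ U.ι.appTop a = U.ι.appTop b) : a = b := by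
  choose U hU h using h
  have e : AffineSpace.homOfVector (n := PUnit.{u+1}) (𝟙 T) (fun _ => a) =
      AffineSpace.homOfVector (𝟙 T) fun _ => b := Scheme.Cover.hom_ext
    (coverOfNhds T U hU) _ _ (fun t => by
      change (U t).ι ≫ _ = (U t).ι ≫ _
      rw [AffineSpace.comp_homOfVector, AffineSpace.comp_homOfVector]
      congr 1
      funext _
      exact h t)
  have := congrArg (fun f => f.appTop (AffineSpace.coord T PUnit.unit)) e
  simpa using this

/-- Local solutions of a problem `Q` that is stable under base change and has at most one solution
over any `T`-scheme agree on overlaps, so no cocycle condition has to be checked. The conclusion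
stays local because `Q` itself is not assumed to be a local property. -/
theorem over_exists_glue {T Y : Over X} (Q : ∀ {T' : Over X}, (T' ⟶ T) → (T' ⟶ Y) → Prop)
    (hres : ∀ {T' T'' : Over X} (r : T'' ⟶ T') (s : T' ⟶ T) (g : T' ⟶ Y), Q s g → Q (r ≫ s) (r ≫ g))
    (huniq : ∀ {T' : Over X} (s : T' ⟶ T) (g g' : T' ⟶ Y), Q s g → Q s g' → g = g')
    (hloc : ∀ t : T.left, ∃ U : T.left.Opens, t ∈ U ∧ ∃ g, Q (resι T U) g) :
    ∃ g : T ⟶ Y, ∀ t : T.left, ∃ U : T.left.Opens, t ∈ U ∧ Q (resι T U) (resι T U ≫ g) := by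
  choose U hU g hg using hloc
  let 𝒰 := coverOfNhds T.left U hU
  have key : ∀ t t' : T.left, pullback.fst (U t).ι (U t').ι ≫ (g t).left =
      pullback.snd (U t).ι (U t').ι ≫ (g t').left := by
    intro t t'
    let S : Over X := Over.mk (pullback.fst (U t).ι (U t').ι ≫ (U t).ι ≫ T.hom)
    let p : S ⟶ resOver T (U t) := Over.homMk (pullback.fst (U t).ι (U t').ι)
    let q : S ⟶ resOver T (U t') := Over.homMk (pullback.snd (U t).ι (U t').ι) (by
      simp [S, pullback.condition_assoc])
    have hpq : p ≫ resι T (U t) = q ≫ resι T (U t') := by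
      ext1; exact pullback.condition
    have h1 := hres p _ _ (hg t)
    have h2 := hres q _ _ (hg t')
    rw [hpq] at h1
    exact congrArg CommaMorphism.left (huniq _ _ _ h1 h2)
  let G : T.left ⟶ Y.left := 𝒰.glueMorphisms (fun t => (g t).left) key
  have hG : ∀ t, (U t).ι ≫ G = (g t).left := fun t => 𝒰.ι_glueMorphisms _ key t
  have hGw : G ≫ Y.hom = T.hom := by
    refine Scheme.Cover.hom_ext 𝒰 _ _ fun t => ?_
    exact (Category.assoc _ _ _).symm.trans
      ((congrArg (· ≫ Y.hom) (hG t)).trans (Over.w (g t)))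
  refine ⟨Over.homMk G hGw, fun t => ⟨U t, hU t, ?_⟩⟩
  have : resι T (U t) ≫ Over.homMk G hGw = g t := by
    ext1; exact hG t
  rw [this]
  exact hg t

end Gluing

/-! ### The affine line over a scheme -/

section Line

variable {X : Scheme.{u}}

/-- The affine line over an `X`-scheme. -/
abbrev lineOver (Y : Over X) : Over X :=
  Over.mk ((𝔸(PUnit.{u + 1}; Y.left) ↘ Y.left) ≫ Y.hom)

/-- The `T`-points of the affine line over an `X`-scheme. -/
def lineEquiv (Y T : Over X) : (T ⟶ lineOver Y) ≃ (T ⟶ Y) × Γ(T.left, ⊤) where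
  toFun v := (Over.homMk (v.left ≫ (𝔸(PUnit.{u + 1}; Y.left) ↘ Y.left)) (by
      rw [Category.assoc]; exact Over.w v),
    v.left.appTop (AffineSpace.coord Y.left PUnit.unit))
  invFun p := Over.homMk (AffineSpace.homOfVector p.1.left fun _ => p.2) (by simp)
  left_inv v := by
    ext1
    apply AffineSpace.hom_ext
    · simp
    · intro i
      exact AffineSpace.homOfVector_appTop_coord _ _ _
  right_inv p := by
    refine Prod.ext ?_ ?_
    · ext1
      simp
    · exact AffineSpace.homOfVector_appTop_coord _ _ _

theorem lineEquiv_comp (Y : Over X) {T T' : Over X} (g : T' ⟶ T) (v : T ⟶ lineOver Y) :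
    lineEquiv Y T' (g ≫ v) = (g ≫ (lineEquiv Y T v).1, g.left.appTop (lineEquiv Y T v).2) := by
  refine Prod.ext ?_ ?_
  · ext1
    exact Category.assoc _ _ _
  · change (g.left ≫ v.left).appTop _ = g.left.appTop (v.left.appTop _)
    rw [Scheme.Hom.comp_appTop]
    rfl

theorem lineEquiv_symm_comp (Y : Over X) {T T' : Over X} (g : T' ⟶ T) (v : T ⟶ Y)
    (a : Γ(T.left, ⊤)) :
    g ≫ (lineEquiv Y T).symm (v, a) = (lineEquiv Y T').symm (g ≫ v, g.left.appTop a) := by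
  apply (lineEquiv Y T').injective
  rw [lineEquiv_comp, Equiv.apply_symm_apply, Equiv.apply_symm_apply]

end Line

/-! ### Frames, restriction and local arguments -/

namespace VectorBundle

variable {X : Scheme.{u}} {n : ℕ}

/-- Sections over `S` which form a basis after every base change. -/
def IsFrame (E : VectorBundle X n) {S : Over X} (b : Fin n → (S ⟶ E.tot)) : Prop :=
  ∀ (T : Over X) (g : T ⟶ S) (v : T ⟶ E.tot), ∃! c : Fin n → Γ(T.left, ⊤),
    v = ∑ i, c i • (g ≫ b i)

theorem IsFrame.comp {E : VectorBundle X n} {S S' : Over X} {b : Fin n → (S ⟶ E.tot)}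
    (hb : E.IsFrame b) (g : S' ⟶ S) : E.IsFrame fun i => g ≫ b i := by
  intro T h v
  simpa only [Category.assoc] using hb T (h ≫ g) v

theorem exists_frame_at (E : VectorBundle X n) (T : Over X) (t : T.left) :
    ∃ U : T.left.Opens, t ∈ U ∧ ∃ b : Fin n → (resOver T U ⟶ E.tot), E.IsFrame b := by
  obtain ⟨U, hU, b, hb⟩ := E.exists_frame (T.hom t)
  let g : resOver T (T.hom ⁻¹ᵁ U) ⟶ Over.mk U.ι := Over.homMk (T.hom ∣_ U) (by simp)
  exact ⟨T.hom ⁻¹ᵁ U, hU, fun i => g ≫ b i, IsFrame.comp (E := E) (b := b) hb g⟩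

theorem comp_sum (E : VectorBundle X n) {T T' : Over X} (g : T' ⟶ T) {ι : Type*} (s : Finset ι)
    (v : ι → (T ⟶ E.tot)) : g ≫ (∑ i ∈ s, v i) = ∑ i ∈ s, g ≫ v i :=
  map_sum (AddMonoidHom.mk' (fun v : T ⟶ E.tot => g ≫ v) (E.comp_add g)) v s

theorem comp_sub (E : VectorBundle X n) {T T' : Over X} (g : T' ⟶ T) (v w : T ⟶ E.tot) :
    g ≫ (v - w) = g ≫ v - g ≫ w :=
  map_sub (AddMonoidHom.mk' (fun v : T ⟶ E.tot => g ≫ v) (E.comp_add g)) v w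

/-- The Plücker relation for alternating forms on the sections of a bundle of rank two. -/
theorem isPlucker (E : VectorBundle X 2)
    (φ : ∀ T : Over X, LinearMap.BilinForm Γ(T.left, ⊤) (T ⟶ E.tot))
    (hself : ∀ (T : Over X) (v : T ⟶ E.tot), φ T v v = 0)
    (hcomp : ∀ {T T' : Over X} (g : T' ⟶ T) (v v' : T ⟶ E.tot),
      φ T' (g ≫ v) (g ≫ v') = g.left.appTop (φ T v v')) (T : Over X) : IsPlucker (φ T) := by
  intro x y z
  refine over_hom_ext_local fun t => ?_
  obtain ⟨U, hU, b, hb⟩ := E.exists_frame_at T t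
  refine ⟨U, hU, ?_⟩
  have := isPlucker_of_generators (φ (resOver T U)) (hself _) b (fun v => by
    obtain ⟨c, hc, -⟩ := hb _ (𝟙 _) v
    exact ⟨c, by simpa using hc⟩) (resι T U ≫ x) (resι T U ≫ y) (resι T U ≫ z)
  rw [E.comp_smul, E.comp_sub, E.comp_smul, E.comp_smul]
  simpa only [hcomp] using this

end VectorBundle

theorem SympBundle.isPlucker {X : Scheme.{u}} (E : SympBundle X 2) (T : Over X) :
    IsPlucker (E.form T) :=
  E.toVectorBundle.isPlucker E.form E.form_self E.form_comp T

/-! ### Points of schemes with values in fields -/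

section Points

variable {X : Scheme.{u}}

/-- A point of an `X`-scheme, as an `X`-scheme. -/
abbrev pointOver (T : Over X) (t : T.left) : Over X := Over.mk (T.left.fromSpecResidueField t ≫ T.hom)

/-- The inclusion of a point. -/
abbrev pointι (T : Over X) (t : T.left) : pointOver T t ⟶ T :=
  Over.homMk (T.left.fromSpecResidueField t)

theorem range_pointι (T : Over X) (t : T.left) (s : (pointOver T t).left) :
    (pointι T t).left s = t := by
  exact Scheme.fromSpecResidueField_apply _ _

/-- The spectrum of the residue field is reduced, so there an empty basic open subset forces the
function to be zero. -/
theorem notMem_basicOpen_iff {T : Scheme.{u}} (t : T) (a : Γ(T, ⊤)) :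
    t ∉ T.basicOpen a ↔ (T.fromSpecResidueField t).appTop a = 0 := by
  have h : (T.fromSpecResidueField t) ⁻¹ᵁ (T.basicOpen a) =
      (Spec (T.residueField t)).basicOpen ((T.fromSpecResidueField t).appTop a) :=
    Scheme.preimage_basicOpen _ _
  have h' : (Spec (T.residueField t)).basicOpen ((T.fromSpecResidueField t).appTop a) = ⊥ ↔
      (T.fromSpecResidueField t).appTop a = 0 := basicOpen_eq_bot_iff _
  rw [← h', ← h]
  constructor
  · intro ht
    refine bot_unique fun s hs => ht ?_
    have : (T.fromSpecResidueField t) s ∈ T.basicOpen a := hs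
    rwa [Scheme.fromSpecResidueField_apply] at this
  · intro hs ht
    have s : Spec (T.residueField t) := IsLocalRing.closedPoint _
    have : s ∈ (T.fromSpecResidueField t) ⁻¹ᵁ (T.basicOpen a) := by
      change (T.fromSpecResidueField t) s ∈ T.basicOpen a
      rwa [Scheme.fromSpecResidueField_apply]
    rw [hs] at this
    exact this

end Points

/-! ### Affineness of total spaces and the zero locus -/

namespace VectorBundle

variable {X : Scheme.{u}} {n : ℕ} (E : VectorBundle X n)

theorem zero_left_tot_hom : E.zero.left ≫ E.tot.hom = 𝟙 X := Over.w E.zero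

/-- The base change of the zero section to `T` is a closed immersion hitting the only point of `T`;
as `T` is reduced, it is an isomorphism and `v` factors through the zero section. -/
theorem eq_zero_of_mem_zeroLocus {T : Over X} [AlgebraicGeometry.IsReduced T.left]
    [Subsingleton T.left] (v : T ⟶ E.tot) (t : T.left) (ht : v.left t ∈ E.zeroLocus)
    [IsClosedImmersion E.zero.left] : v = 0 := by
  obtain ⟨x, hx⟩ := ht
  obtain ⟨q, hq, -⟩ := Scheme.Pullback.exists_preimage_pullback (f := v.left) (g := E.zero.left)
    t x hx.symm
  have : Surjective (pullback.fst v.left E.zero.left) := ⟨fun t' => ⟨q, Subsingleton.elim _ _⟩⟩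
  have := isIso_of_isClosedImmersion_of_surjective (pullback.fst v.left E.zero.left)
  let r : T.left ⟶ X := inv (pullback.fst v.left E.zero.left) ≫ pullback.snd v.left E.zero.left
  have hr : v.left = r ≫ E.zero.left := by
    rw [Category.assoc, ← pullback.condition, IsIso.inv_hom_id_assoc]
  have hr' : r = T.hom := by
    rw [← Over.w v, hr, Category.assoc, E.zero_left_tot_hom, Category.comp_id]
  have : v = Over.homMk T.hom (Category.comp_id _) ≫ E.zero := by
    ext1
    rw [hr, hr']
    rfl
  rw [this]
  exact E.comp_zero _

theorem left_mem_zeroLocus {T : Over X} (t : T.left) : (0 : T ⟶ E.tot).left t ∈ E.zeroLocus := by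
  have : (0 : T ⟶ E.tot) = Over.homMk T.hom (Category.comp_id _) ≫ E.zero := (E.comp_zero _).symm
  rw [this]
  exact ⟨T.hom t, rfl⟩

/-- Over an open subset with a frame, the total space is an affine space. -/
theorem isAffineOpen_preimage {U : X.Opens} (hU : IsAffineOpen U)
    {b : Fin n → (Over.mk U.ι ⟶ E.tot)} (hb : E.IsFrame b) : IsAffineOpen (E.tot.hom ⁻¹ᵁ U) := by
  let V := E.tot.hom ⁻¹ᵁ U
  let s : resOver E.tot V ⟶ Over.mk U.ι := Over.homMk (E.tot.hom ∣_ U) (by simp [V])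
  -- These are the coordinates of the universal vector over `V`; they define the map `φ` to affine
  -- space.
  obtain ⟨c, hc, -⟩ := hb _ s (resι E.tot V)
  let N : Type u := ULift.{u} (Fin n)
  let A : Over X := Over.mk ((𝔸(N; U.toScheme) ↘ U.toScheme) ≫ U.ι)
  let pA : A ⟶ Over.mk U.ι := Over.homMk (𝔸(N; U.toScheme) ↘ U.toScheme)
  let co : Fin n → Γ(A.left, ⊤) := fun i => AffineSpace.coord U.toScheme (⟨i⟩ : N)
  -- The linear combination of the frame with universal coefficients will be the inverse of `φ`.
  let m : A ⟶ E.tot := ∑ i, co i • (pA ≫ b i)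
  let φ : resOver E.tot V ⟶ A := Over.homMk (AffineSpace.homOfVector s.left fun i : N => c i.down)
    (by simp only [A, Over.mk_hom, AffineSpace.homOfVector_over_assoc]; exact Over.w s)
  have hm : m.left ≫ E.tot.hom = (𝔸(N; U.toScheme) ↘ U.toScheme) ≫ U.ι := Over.w m
  let ψl : A.left ⟶ V.toScheme := IsOpenImmersion.lift V.ι m.left (by
    rintro _ ⟨x, rfl⟩
    rw [Scheme.Opens.range_ι]
    change E.tot.hom (m.left x) ∈ U
    rw [← Scheme.Hom.comp_apply, hm, Scheme.Hom.comp_apply]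
    exact Subtype.property _)
  have hψl : ψl ≫ V.ι = m.left := IsOpenImmersion.lift_fac _ _ _
  let ψ : A ⟶ resOver E.tot V := Over.homMk ψl (by
    change ψl ≫ V.ι ≫ E.tot.hom = _
    rw [← Category.assoc, hψl]
    exact Over.w m)
  have hψ : ψ ≫ resι E.tot V = m := by ext1; exact hψl
  have hφp : φ ≫ pA = s := by
    ext1
    exact AffineSpace.homOfVector_over _ _
  have hφc : ∀ i, φ.left.appTop (co i) = c i := fun i =>
    AffineSpace.homOfVector_appTop_coord _ _ _
  have h1 : φ ≫ ψ = 𝟙 _ := by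
    have : φ ≫ m = resι E.tot V := by
      rw [E.comp_sum]
      simp only [E.comp_smul, hφc]
      simp only [← Category.assoc, hφp]
      exact hc.symm
    ext1
    rw [← cancel_mono V.ι]
    exact (Category.assoc _ _ _).trans ((congrArg (φ.left ≫ ·) hψl).trans
      ((congrArg Over.Hom.left this).trans (Category.id_comp _).symm))
  have hψs : ψ ≫ s = pA := by
    ext1
    rw [← cancel_mono U.ι]
    have h2 := Over.w (ψ ≫ s)
    exact h2
  have h2 : ψ ≫ φ = 𝟙 _ := by
    ext1
    apply AffineSpace.hom_ext
    · have : (ψ ≫ φ) ≫ pA = 𝟙 _ ≫ pA := by rw [Category.assoc, hφp, hψs, Category.id_comp]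
      exact congrArg Over.Hom.left this
    · intro i
      -- Both the universal coefficients and the pulled back coordinates express `m` in the frame,
      -- so uniqueness identifies them.
      have h3 : m = ∑ i, ψ.left.appTop (c i) • (pA ≫ b i) := by
        rw [← hψ, hc, E.comp_sum]
        simp only [E.comp_smul]
        simp only [← Category.assoc, hψs]
      have h4 := congrFun ((hb _ pA m).unique h3 rfl) i.down
      rw [← hφc] at h4
      have h5 : (ψ.left ≫ φ.left).appTop (co i.down) = co i.down := by
        rw [Scheme.Hom.comp_appTop]; exact h4
      refine h5.trans ?_
      rw [Over.id_left]
      change _ = (𝟙 A.left : A.left ⟶ A.left).appTop (co i.down)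
      simp
  have : IsIso φ.left := ⟨ψ.left, congrArg Over.Hom.left h1, congrArg Over.Hom.left h2⟩
  have : IsAffine U.toScheme := hU
  have : IsAffine A.left := inferInstanceAs (IsAffine 𝔸(N; U.toScheme))
  exact IsAffine.of_isIso φ.left

theorem exists_affine_frame (x : X) : ∃ U : X.Opens, x ∈ U ∧ IsAffineOpen U ∧
    ∃ b : Fin n → (Over.mk U.ι ⟶ E.tot), E.IsFrame b := by
  obtain ⟨U, hx, b, hb⟩ := E.exists_frame x
  obtain ⟨W, hW, hxW, hWU⟩ := exists_isAffineOpen_mem_and_subset hx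
  refine ⟨W, hxW, hW, _, IsFrame.comp (E := E) (b := b) hb 
    (Over.homMk (X.homOfLE hWU) (Scheme.homOfLE_ι X hWU))⟩

instance isAffineHom_tot : IsAffineHom E.tot.hom := by
  refine isAffineHom_of_forall_exists_isAffineOpen _ fun x => ?_
  obtain ⟨U, hx, hU, b, hb⟩ := E.exists_affine_frame x
  exact ⟨U, hx, hU, E.isAffineOpen_preimage hU hb⟩

/-- The zero section is a section of an affine, hence separated, morphism. -/
instance isClosedImmersion_zero : IsClosedImmersion E.zero.left := by
  have : IsClosedImmersion (E.zero.left ≫ E.tot.hom) := by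
    rw [E.zero_left_tot_hom]; exact inferInstanceAs (IsClosedImmersion (𝟙 X))
  exact IsClosedImmersion.of_comp E.zero.left E.tot.hom

theorem isClosed_zeroLocus : IsClosed E.zeroLocus :=
  E.zero.left.isClosedEmbedding.isClosed_range

/-- Membership in the zero locus is a set-theoretic condition; restricting to the reduced one-point
spectrum of the residue field turns it into an equation between vectors. -/
theorem mem_zeroLocus_iff {T : Over X} (v : T ⟶ E.tot) (t : T.left) :
    v.left t ∈ E.zeroLocus ↔ pointι T t ≫ v = 0 := by
  let s : (pointOver T t).left := IsLocalRing.closedPoint (T.left.residueField t)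
  have h : (pointι T t ≫ v).left s = v.left t :=
    congrArg v.left (range_pointι T t s)
  constructor
  · intro ht
    rw [← h] at ht
    have : AlgebraicGeometry.IsReduced (pointOver T t).left :=
      inferInstanceAs (AlgebraicGeometry.IsReduced (Spec (T.left.residueField t)))
    have : Subsingleton (pointOver T t).left :=
      inferInstanceAs (Subsingleton (Spec (T.left.residueField t)))
    exact E.eq_zero_of_mem_zeroLocus _ s ht
  · intro h0
    rw [← h, h0]
    exact E.left_mem_zeroLocus s

theorem isCompact_compl_zeroLocus [CompactSpace X] : IsCompact E.zeroLocusᶜ := by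
  choose U hxU hU b hb using fun x => E.exists_affine_frame x
  obtain ⟨s, hs⟩ := isCompact_univ.elim_nhds_subcover (fun x => (U x : Set X))
    (fun x _ => (U x).isOpen.mem_nhds (hxU x))
  have key : ∀ x, IsCompact (E.zeroLocusᶜ ∩ (E.tot.hom ⁻¹ᵁ U x : Set E.tot.left)) := by
    intro x
    let V := E.tot.hom ⁻¹ᵁ U x
    have hV : IsAffineOpen V := E.isAffineOpen_preimage (hU x) (hb x)
    have : IsAffine V.toScheme := hV
    let r : resOver E.tot V ⟶ Over.mk (U x).ι := Over.homMk (E.tot.hom ∣_ (U x)) (by simp [V])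
    obtain ⟨c, hc, -⟩ := hb x _ r (resι E.tot V)
    -- Over an affine open subset with a frame, a vector is nonzero at a point exactly when one of
    -- its finitely many coordinates is.
    have : E.zeroLocusᶜ ∩ (V : Set E.tot.left) =
        ⋃ i, V.ι '' (V.toScheme.basicOpen (c i) : Set V.toScheme) := by
      ext z
      constructor
      · rintro ⟨hz, hzV⟩
        by_contra hcon
        apply hz
        have := (E.mem_zeroLocus_iff (resι E.tot V) ⟨z, hzV⟩).2 (by
          rw [hc, E.comp_sum]
          refine Finset.sum_eq_zero fun i _ => ?_
          rw [E.comp_smul]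
          have : (pointι (resOver E.tot V) ⟨z, hzV⟩).left.appTop (c i) = 0 := by
            refine (notMem_basicOpen_iff (T := V.toScheme) ⟨z, hzV⟩ (c i)).1 fun h => hcon ?_
            exact Set.mem_iUnion.2 ⟨i, ⟨_, h, rfl⟩⟩
          rw [this, zero_smul])
        exact this
      · intro hz
        obtain ⟨i, y, hy, rfl⟩ := Set.mem_iUnion.1 hz
        refine ⟨fun h0 => ?_, y.2⟩
        have h0' := (E.mem_zeroLocus_iff (resι E.tot V) y).1 h0
        rw [hc, E.comp_sum] at h0'
        simp only [E.comp_smul] at h0'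
        simp only [← Category.assoc] at h0'
        have h1 := congrFun ((hb x _ (pointι (resOver E.tot V) y ≫ r) 0).unique
          (y₁ := fun i => (pointι (resOver E.tot V) y).left.appTop (c i)) (y₂ := 0) h0'.symm
          (by simp only [Pi.zero_apply, zero_smul, Finset.sum_const_zero])) i
        exact (notMem_basicOpen_iff (T := V.toScheme) y (c i)).2 h1 hy
    rw [this]
    refine isCompact_iUnion fun i => ?_
    exact (isCompact_basicOpen V.toScheme (U := ⊤) (by simpa using isCompact_univ) (c i)).image
      V.ι.continuous
  have : E.zeroLocusᶜ = ⋃ x ∈ s, E.zeroLocusᶜ ∩ (E.tot.hom ⁻¹ᵁ U x : Set E.tot.left) := by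
    ext z
    simp only [Set.mem_iUnion, Set.mem_inter_iff]
    constructor
    · intro hz
      obtain ⟨x, hx, hzx⟩ := Set.mem_iUnion₂.1 (hs.2 (Set.mem_univ (E.tot.hom z)))
      exact ⟨x, hx, hz, hzx⟩
    · rintro ⟨x, hx, hz, -⟩
      exact hz
  rw [this]
  exact s.isCompact_biUnion fun x _ => key x

end VectorBundle

/-! ### Constructions of bundle maps -/

section Cast

variable {X : Scheme.{u}}

/-- The identity of a scheme, as a morphism between two equal structures of an `X`-scheme. -/
def overCast {L : Scheme.{u}} {h h' : L ⟶ X} (e : h = h') : Over.mk h ⟶ Over.mk h' :=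
  Over.homMk (𝟙 L) (by simp [e])

@[simp]
theorem overCast_left {L : Scheme.{u}} {h h' : L ⟶ X} (e : h = h') :
    (overCast e).left = 𝟙 L := rfl

theorem overCast_left_appTop {L : Scheme.{u}} {h h' : L ⟶ X} (e : h = h') (a : Γ(L, ⊤)) :
    (overCast e).left.appTop a = a := by
  rw [overCast_left, Scheme.Hom.id_appTop]
  rfl

end Cast

namespace BundleMap

variable {X Y : Scheme.{u}} {f : Y ⟶ X} {m n : ℕ} {W : VectorBundle Y m} {E : VectorBundle X n}

theorem app_left (j : BundleMap f W E) (T : Over Y) (v : T ⟶ W.tot) :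
    (j.app T v).left = v.left ≫ j.left := rfl

theorem app_comp (j : BundleMap f W E) {T T' : Over Y} (g : T' ⟶ T) (v : T ⟶ W.tot) :
    j.app T' (g ≫ v) = (Over.map f).map g ≫ j.app T v := by
  simp only [app, Functor.map_comp, Category.assoc]

theorem app_add (j : BundleMap f W E) {T : Over Y} (v v' : T ⟶ W.tot) :
    j.app T (v + v') = j.app T v + j.app T v' := j.map_add T v v'

theorem app_smul (j : BundleMap f W E) {T : Over Y} (a : Γ(T.left, ⊤)) (v : T ⟶ W.tot) :
    j.app T (a • v) = (show Γ(((Over.map f).obj T).left, ⊤) from a) • j.app T v := j.map_smul T a v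

theorem app_zero (j : BundleMap f W E) {T : Over Y} : j.app T 0 = 0 :=
  map_zero (AddMonoidHom.mk' (j.app T) j.app_add)

theorem app_sub (j : BundleMap f W E) {T : Over Y} (v v' : T ⟶ W.tot) :
    j.app T (v - v') = j.app T v - j.app T v' :=
  map_sub (AddMonoidHom.mk' (j.app T) j.app_add) v v'

/-- A bundle map from a natural family of linear maps on points. -/
def ofPoints (φ : ∀ T : Over Y, (T ⟶ W.tot) → ((Over.map f).obj T ⟶ E.tot))
    (nat : ∀ {T T' : Over Y} (g : T' ⟶ T) (v : T ⟶ W.tot),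
      φ T' (g ≫ v) = (Over.map f).map g ≫ φ T v)
    (add : ∀ (T : Over Y) (v v' : T ⟶ W.tot), φ T (v + v') = φ T v + φ T v')
    (smul : ∀ (T : Over Y) (a : Γ(T.left, ⊤)) (v : T ⟶ W.tot),
      φ T (a • v) = (show Γ(((Over.map f).obj T).left, ⊤) from a) • φ T v) :
    BundleMap f W E where
  hom := φ W.tot (𝟙 _)
  map_add T v v' := by rw [← nat, ← nat, ← nat]; simpa using add T v v'
  map_smul T a v := by rw [← nat, ← nat]; simpa using smul T a v

/-- A bundle map is determined on points by its value at the universal point. -/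
theorem app_eq (j : BundleMap f W E) (φ : ∀ T : Over Y, (T ⟶ W.tot) → ((Over.map f).obj T ⟶ E.tot))
    (nat : ∀ {T T' : Over Y} (g : T' ⟶ T) (v : T ⟶ W.tot),
      φ T' (g ≫ v) = (Over.map f).map g ≫ φ T v)
    (h : j.hom = φ W.tot (𝟙 _)) (T : Over Y) (v : T ⟶ W.tot) : j.app T v = φ T v := by
  rw [app, h, ← nat, Category.comp_id]

/-- Composition of bundle maps. -/
def comp {Z : Scheme.{u}} {g : Z ⟶ Y} {h : Z ⟶ X} {l : ℕ} {W' : VectorBundle Z l}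
    (c : BundleMap g W' W) (j : BundleMap f W E) (e : g ≫ f = h) : BundleMap h W' E :=
  ofPoints (fun T v => overCast (X := X) (h := T.hom ≫ h) (h' := (T.hom ≫ g) ≫ f)
      (by rw [← e, Category.assoc]) ≫ j.app _ (c.app T v))
    (fun {T T'} g v => by
      rw [app_comp, app_comp]
      ext1
      simp)
    (fun T v v' => by rw [app_add, app_add, E.comp_add])
    (fun T a v => by
      rw [app_smul, app_smul, E.comp_smul]
      congr 1)

theorem comp_left {Z : Scheme.{u}} {g : Z ⟶ Y} {h : Z ⟶ X} {l : ℕ} {W' : VectorBundle Z l}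
    (c : BundleMap g W' W) (j : BundleMap f W E) (e : g ≫ f = h) :
    (c.comp j e).left = c.left ≫ j.left := by
  change 𝟙 _ ≫ (𝟙 _ ≫ c.left) ≫ j.left = _
  simp

theorem app_comp_bundleMap {Z : Scheme.{u}} {g : Z ⟶ Y} {h : Z ⟶ X} {l : ℕ}
    {W' : VectorBundle Z l} (c : BundleMap g W' W) (j : BundleMap f W E) (e : g ≫ f = h)
    (T : Over Z) (v : T ⟶ W'.tot) : (c.comp j e).app T v =
      overCast (X := X) (h := T.hom ≫ h) (h' := (T.hom ≫ g) ≫ f)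
      (by rw [← e, Category.assoc]) ≫ j.app _ (c.app T v) :=
  app_eq (c.comp j e) (fun T v => overCast (X := X) (h := T.hom ≫ h) (h' := (T.hom ≫ g) ≫ f)
      (by rw [← e, Category.assoc]) ≫ j.app _ (c.app T v)) (fun {T T'} g v => by
      rw [app_comp, app_comp]
      ext1
      simp) rfl T v

theorem IsSubbundle.hom_ext {j : BundleMap f W E} (hj : j.IsSubbundle) {S : Scheme.{u}}
    {u u' : S ⟶ W.tot.left} (h : u ≫ W.tot.hom = u' ≫ W.tot.hom) (h' : u ≫ j.left = u' ≫ j.left) :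
    u = u' := by
  let T : Over Y := Over.mk (u ≫ W.tot.hom)
  let v : T ⟶ W.tot := Over.homMk u
  let v' : T ⟶ W.tot := Over.homMk u' h.symm
  have : v = v' := hj T (by ext1; exact h')
  exact congrArg Over.Hom.left this

theorem IsSubbundle.comp {Z : Scheme.{u}} {g : Z ⟶ Y} {h : Z ⟶ X} {l : ℕ}
    {W' : VectorBundle Z l} {c : BundleMap g W' W} {j : BundleMap f W E} (hc : c.IsSubbundle)
    (hj : j.IsSubbundle) (e : g ≫ f = h) : (c.comp j e).IsSubbundle := by
  intro T v v' hv
  rw [app_comp_bundleMap, app_comp_bundleMap] at hv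
  refine hc T (hj _ ?_)
  have := congrArg Over.Hom.left hv
  ext1
  simpa using this

end BundleMap

/-! ### Points of subbundles -/

section Lies

variable {X : Scheme.{u}} {n r : ℕ} {E : VectorBundle X n}

/-- For a bundle map `ι` from a bundle `𝒰` on `Y` to `E_Y`: the vector `x` lies in the image
of `g^*𝒰`. -/
def Lies {Y : Over X} {𝒰 : VectorBundle Y.left r} (ι : BundleMap Y.hom 𝒰 E) {T : Over X}
    (g : T ⟶ Y) (x : T ⟶ E.tot) : Prop :=
  ∃ u : T.left ⟶ 𝒰.tot.left, u ≫ 𝒰.tot.hom = g.left ∧ u ≫ ι.left = x.left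

theorem Lies.comp {Y : Over X} {𝒰 : VectorBundle Y.left r} {ι : BundleMap Y.hom 𝒰 E} {T T' : Over X}
    {g : T ⟶ Y} {x : T ⟶ E.tot} (h : Lies ι g x) (s : T' ⟶ T) : Lies ι (s ≫ g) (s ≫ x) := by
  obtain ⟨u, hu, hu'⟩ := h
  exact ⟨s.left ≫ u, by rw [Category.assoc, hu]; rfl, by rw [Category.assoc, hu']; rfl⟩

/-- The structure morphism of a `Y`-scheme, as a morphism of `X`-schemes. -/
abbrev structHom {Y : Over X} (S : Over Y.left) : (Over.map Y.hom).obj S ⟶ Y := Over.homMk S.hom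

theorem lies_app {Y : Over X} {𝒰 : VectorBundle Y.left r} (ι : BundleMap Y.hom 𝒰 E)
    {S : Over Y.left} (u : S ⟶ 𝒰.tot) : Lies ι (structHom S) (ι.app S u) :=
  ⟨u.left, Over.w u, rfl⟩

theorem lies_iff_exists_app {Y : Over X} {𝒰 : VectorBundle Y.left r} (ι : BundleMap Y.hom 𝒰 E)
    {S : Over Y.left} (x : (Over.map Y.hom).obj S ⟶ E.tot) :
    Lies ι (structHom S) x ↔ ∃ u : S ⟶ 𝒰.tot, ι.app S u = x := by
  constructor
  · rintro ⟨u, hu, hu'⟩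
    exact ⟨Over.homMk u hu, by ext1; exact hu'⟩
  · rintro ⟨u, rfl⟩
    exact lies_app ι u

/-- Being in the image of a subbundle can be checked locally. -/
theorem lies_of_local {Y : Over X} {𝒰 : VectorBundle Y.left r} {ι : BundleMap Y.hom 𝒰 E}
    (hι : ι.IsSubbundle) {T : Over X} (g : T ⟶ Y) (x : T ⟶ E.tot)
    (h : ∀ t : T.left, ∃ U : T.left.Opens, t ∈ U ∧ Lies ι (resι T U ≫ g) (resι T U ≫ x)) :
    Lies ι g x := by
  obtain ⟨u, hu⟩ := over_exists_glue (T := Over.mk g.left) (Y := 𝒰.tot)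
    (fun {T'} s u => u.left ≫ ι.left = s.left ≫ x.left)
    (fun r s g h => by simp only [Over.comp_left, Category.assoc, h])
    (fun s g g' h h' => by
      ext1
      exact hι.hom_ext ((Over.w g).trans (Over.w g').symm) (h.trans h'.symm))
    (fun t => by
      obtain ⟨U, hU, u, hu, hu'⟩ := h t
      exact ⟨U, hU, Over.homMk u hu, hu'⟩)
  refine ⟨u.left, Over.w u, ?_⟩
  let a : T ⟶ Over.mk (𝒰.tot.hom ≫ Y.hom) := Over.homMk u.left (by
    have h1 : u.left ≫ 𝒰.tot.hom = g.left := Over.w u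
    change u.left ≫ 𝒰.tot.hom ≫ Y.hom = _
    rw [← Category.assoc, h1]
    exact Over.w g)
  let b : Over.mk (𝒰.tot.hom ≫ Y.hom) ⟶ E.tot := ι.hom
  have : a ≫ b = x := over_hom_ext_local fun t => by
    obtain ⟨U, hU, h⟩ := hu t
    refine ⟨U, hU, ?_⟩
    ext1
    exact (Category.assoc _ _ _).symm.trans h
  exact congrArg Over.Hom.left this

/-- A morphism classifies a subbundle if and only if the subbundles have the same points. -/
theorem classifies_iff {Y T : Over X} {𝒰 : VectorBundle Y.left r} {ι : BundleMap Y.hom 𝒰 E}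
    (hι : ι.IsSubbundle) {W : VectorBundle T.left r} {j : BundleMap T.hom W E}
    (hj : j.IsSubbundle) (g : T ⟶ Y) : Classifies ι W j.left g ↔
      ∀ (T' : Over X) (s : T' ⟶ T) (x : T' ⟶ E.tot), Lies j s x ↔ Lies ι (s ≫ g) x := by
  constructor
  · rintro ⟨m, hm, hmj⟩ T' s x
    have hw : m.left ≫ 𝒰.tot.hom = W.tot.hom ≫ g.left := Over.w m.hom
    constructor
    · rintro ⟨w, h, h'⟩
      exact ⟨w ≫ m.left, by rw [Category.assoc, hw, ← Category.assoc, h]; rfl,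
        by rw [Category.assoc, hmj, h']⟩
    · rintro ⟨u, h, h'⟩
      obtain ⟨w, hw⟩ := (hm (Over.mk s.left)).2 (Over.homMk u h)
      have hw' : w.left ≫ m.left = u := congrArg Over.Hom.left hw
      exact ⟨w.left, Over.w w, by rw [← hmj, ← Category.assoc, hw', h']⟩
  · intro H
    -- The hypothesis is applied to the universal vector of `W`. Linearity of the resulting map then
    -- follows from that of `j`, because `ι` is injective on points.
    obtain ⟨u, hu, hu'⟩ := (H _ (structHom W.tot) j.hom).1
      ⟨𝟙 _, Category.id_comp _, Category.id_comp _⟩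
    let m₀ : (Over.map g.left).obj W.tot ⟶ 𝒰.tot := Over.homMk u hu
    have e (S : Over T.left) : S.hom ≫ T.hom = (S.hom ≫ g.left) ≫ Y.hom := by
      rw [Category.assoc]; exact congrArg _ (Over.w g).symm
    have key (S : Over T.left) (v : S ⟶ W.tot) :
        ι.app _ ((Over.map g.left).map v ≫ m₀) = overCast (e S).symm ≫ j.app S v := by
      ext1
      change (v.left ≫ u) ≫ ι.left = 𝟙 _ ≫ v.left ≫ j.left
      rw [Category.assoc, hu', Category.id_comp]
      rfl
    let m : BundleMap g.left W 𝒰 :=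
      { hom := m₀
        map_add := fun S v v' => by
          apply hι
          rw [BundleMap.app_add, key, key, key, BundleMap.app_add, E.comp_add]
        map_smul := fun S a v => by
          apply hι
          rw [BundleMap.app_smul, key, key, BundleMap.app_smul, E.comp_smul]
          congr 1 }
    refine ⟨m, fun S => ⟨fun v v' h => ?_, fun u' => ?_⟩, hu'⟩
    · apply hj
      have h1 : overCast (e S).symm ≫ j.app S v = overCast (e S).symm ≫ j.app S v' := by
        rw [← key, ← key]
        exact congrArg _ h
      have := congrArg Over.Hom.left h1
      ext1
      simpa using this
    -- Surjectivity is the reverse implication: a vector of `𝒰` over `g` has an image in `E` that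
    -- must come from `W`.
    · obtain ⟨w, hw, hw'⟩ := (H _ (structHom S) (overCast (e S) ≫ ι.app _ u')).2
        ⟨u'.left, Over.w u', (Category.id_comp _).symm⟩
      refine ⟨Over.homMk w hw, ?_⟩
      apply hι
      refine (key S (Over.homMk w hw)).trans ?_
      ext1
      change 𝟙 _ ≫ w ≫ j.left = _
      rw [hw']
      change 𝟙 _ ≫ 𝟙 _ ≫ (ι.app _ u').left = _
      simp

end Lies

/-! ### Pullback of bundles -/

section Pullback

variable {X Y : Scheme.{u}} {n : ℕ}

/-- The points of the pullback of an `X`-scheme. -/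
def pullbackEquiv (f : Y ⟶ X) (E : Over X) (T : Over Y) :
    (T ⟶ Over.mk (pullback.snd E.hom f)) ≃ ((Over.map f).obj T ⟶ E) where
  toFun v := Over.homMk (v.left ≫ pullback.fst E.hom f) (by
    have := Over.w v
    change (v.left ≫ pullback.fst E.hom f) ≫ E.hom = T.hom ≫ f
    rw [← this, Category.assoc, pullback.condition]
    exact (Category.assoc _ _ _).symm)
  invFun w := Over.homMk (pullback.lift w.left T.hom (Over.w w)) (pullback.lift_snd _ _ _)
  left_inv v := by
    ext1
    refine pullback.hom_ext ?_ ?_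
    · exact pullback.lift_fst _ _ _
    · exact (pullback.lift_snd _ _ _).trans (Over.w v).symm
  right_inv w := by
    ext1
    exact pullback.lift_fst _ _ _

theorem pullbackEquiv_comp (f : Y ⟶ X) (E : Over X) {T T' : Over Y} (g : T' ⟶ T)
    (v : T ⟶ Over.mk (pullback.snd E.hom f)) :
    pullbackEquiv f E T' (g ≫ v) = (Over.map f).map g ≫ pullbackEquiv f E T v := by
  ext1
  exact Category.assoc _ _ _

/-- The pullback of a vector bundle. -/
def VectorBundle.pull (f : Y ⟶ X) (E : VectorBundle X n) : VectorBundle Y n :=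
  letI : ∀ T : Over Y, AddCommGroup ((Over.map f).obj T ⟶ E.tot) := fun T => E.acg _
  letI : ∀ T : Over Y, Module Γ(T.left, ⊤) ((Over.map f).obj T ⟶ E.tot) :=
    fun T => E.mod ((Over.map f).obj T)
  VectorBundle.ofEquiv (Over.mk (pullback.snd E.tot.hom f))
    (fun T => (Over.map f).obj T ⟶ E.tot) (pullbackEquiv f E.tot)
    (fun g m => (Over.map f).map g ≫ m) (pullbackEquiv_comp f E.tot)
    (fun g m m' => E.comp_add _ m m') (fun g a m => E.comp_smul _ a m)
    (fun y => by
      obtain ⟨U, hU, b, hb⟩ := E.exists_frame (f y)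
      let s : (Over.map f).obj (Over.mk (f ⁻¹ᵁ U).ι) ⟶ Over.mk U.ι := Over.homMk (f ∣_ U) (by simp)
      refine ⟨f ⁻¹ᵁ U, hU, fun i => s ≫ b i, fun T g v => ?_⟩
      exact VectorBundle.IsFrame.comp (E := E) (b := b) hb s ((Over.map f).obj T)
        ((Over.map f).map g) v)

/-- The canonical map from the pullback of a bundle. -/
def VectorBundle.pullMap (f : Y ⟶ X) (E : VectorBundle X n) : BundleMap f (E.pull f) E :=
  BundleMap.ofPoints (fun T v => pullbackEquiv f E.tot T v) (pullbackEquiv_comp f E.tot)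
    (fun T _ _ => (pullbackEquiv f E.tot T).apply_symm_apply _)
    (fun T _ _ => (pullbackEquiv f E.tot T).apply_symm_apply _)

theorem VectorBundle.pullMap_app (f : Y ⟶ X) (E : VectorBundle X n) (T : Over Y)
    (v : T ⟶ (E.pull f).tot) : (E.pullMap f).app T v = pullbackEquiv f E.tot T v :=
  BundleMap.app_eq _ (fun T v => pullbackEquiv f E.tot T v) (pullbackEquiv_comp f E.tot) rfl T v

theorem VectorBundle.pullMap_isCartesian (f : Y ⟶ X) (E : VectorBundle X n) :
    (E.pullMap f).IsCartesian := by
  intro T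
  have : (E.pullMap f).app T = pullbackEquiv f E.tot T := funext fun v => E.pullMap_app f T v
  rw [this]
  exact (pullbackEquiv f E.tot T).bijective

/-- The map `E(T) ⟶ E(T)` of points, as an isomorphism of modules. -/
def BundleMap.IsCartesian.linearEquiv {f : Y ⟶ X} {W : VectorBundle Y n} {E : VectorBundle X n}
    {j : BundleMap f W E} (hj : j.IsCartesian) (T : Over Y) :
    letI : Module Γ(T.left, ⊤) ((Over.map f).obj T ⟶ E.tot) := E.mod ((Over.map f).obj T)
    (T ⟶ W.tot) ≃ₗ[Γ(T.left, ⊤)] ((Over.map f).obj T ⟶ E.tot) :=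
  letI : Module Γ(T.left, ⊤) ((Over.map f).obj T ⟶ E.tot) := E.mod ((Over.map f).obj T)
  { Equiv.ofBijective _ (hj T) with
    map_add' := fun v v' => j.app_add v v'
    map_smul' := fun a v => j.app_smul a v }

/-- The pullback of a symplectic bundle. -/
def SympBundle.pull (f : Y ⟶ X) (E : SympBundle X n) : SympBundle Y n :=
  letI : ∀ T : Over Y, Module Γ(T.left, ⊤) ((Over.map f).obj T ⟶ E.tot) :=
    fun T => E.mod ((Over.map f).obj T)
  { toVectorBundle := E.toVectorBundle.pull f
    form := fun T => LinearMap.compl₁₂ (E.form ((Over.map f).obj T))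
      ((E.pullMap_isCartesian f).linearEquiv T).toLinearMap
      ((E.pullMap_isCartesian f).linearEquiv T).toLinearMap
    form_self := fun T v => E.form_self ((Over.map f).obj T) _
    form_comp := fun {T T'} g v v' => by
      refine Eq.trans ?_ (E.form_comp ((Over.map f).map g) ((E.pullMap f).app T v)
        ((E.pullMap f).app T v'))
      rw [← BundleMap.app_comp, ← BundleMap.app_comp]
      rfl
    nondeg := fun T hT => by
      have : (E.form ((Over.map f).obj T)).IsPerfPair := E.nondeg _ hT
      exact LinearMap.IsPerfPair.compl₁₂ _ ((E.pullMap_isCartesian f).linearEquiv T)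
        ((E.pullMap_isCartesian f).linearEquiv T) }

theorem SympBundle.pullMap_isIsometric (f : Y ⟶ X) (E : SympBundle X n) :
    BundleMap.IsIsometric (W := E.pull f) (E := E) (E.pullMap f) := fun _ _ _ => rfl

end Pullback

/-! ### Units and basic open subsets -/

theorem isUnit_of_basicOpen_eq_top {T : Scheme.{u}} {a : Γ(T, ⊤)} (h : T.basicOpen a = ⊤) :
    IsUnit a := by
  refine RingedSpace.isUnit_of_isUnit_germ T.toRingedSpace ⊤ a fun x hx => ?_
  have : x ∈ T.basicOpen a := by rw [h]; trivial
  exact (Scheme.mem_basicOpen T a x hx).1 this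

theorem isUnit_ι_appTop {T : Scheme.{u}} {a : Γ(T, ⊤)} {U : T.Opens} (h : U ≤ T.basicOpen a) :
    IsUnit (U.ι.appTop a) := by
  apply isUnit_of_basicOpen_eq_top
  have : U.ι ⁻¹ᵁ (T.basicOpen a) = U.toScheme.basicOpen (U.ι.appTop a) :=
    Scheme.preimage_basicOpen _ _
  rw [← this]
  exact top_le_iff.mp fun x _ => h x.2

theorem mem_basicOpen_or {T : Scheme.{u}} {a b : Γ(T, ⊤)} (h : a + b = 1) (t : T) :
    t ∈ T.basicOpen a ∨ t ∈ T.basicOpen b := by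
  by_contra! hcon
  have h1 := (notMem_basicOpen_iff t a).1 hcon.1
  have h2 := (notMem_basicOpen_iff t b).1 hcon.2
  have h3 := congrArg (T.fromSpecResidueField t).appTop h
  rw [map_add, h1, h2, map_one, add_zero] at h3
  have h4 : t ∉ T.basicOpen (1 : Γ(T, ⊤)) := by
    rw [notMem_basicOpen_iff, map_one, ← h3]
  apply h4
  rw [T.basicOpen_of_isUnit isUnit_one]
  trivial

/-! ### Restricting a perfect alternating form to the image of a projector -/

section Algebra

variable {R M : Type*} [CommRing R] [AddCommGroup M] [Module R M]

/-- A functional on the image extends to all of `M` by composing with `p`. If `z` represents the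
extension, self-adjointness shows that `p z` represents the functional on the image. -/
theorem isPerfPair_eqLocus (B : LinearMap.BilinForm R M) (halt : ∀ v, B v v = 0)
    (hB : B.IsPerfPair) (p : M →ₗ[R] M) (hp : ∀ v, p (p v) = p v)
    (hadj : ∀ v w, B (p v) w = B v (p w)) :
    (LinearMap.compl₁₂ B (LinearMap.eqLocus p LinearMap.id).subtype
      (LinearMap.eqLocus p LinearMap.id).subtype).IsPerfPair := by
  refine isPerfPair_of_alt _ (fun v => halt _) ⟨?_, ?_⟩
  · intro v w hvw
    apply Subtype.ext
    apply hB.bijective_left.1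
    refine LinearMap.ext fun z => ?_
    have hv : p v.1 = v.1 := v.2
    have hw : p w.1 = w.1 := w.2
    have := LinearMap.congr_fun hvw ⟨p z, hp z⟩
    change B v.1 (p z) = B w.1 (p z) at this
    rwa [← hadj, ← hadj, hv, hw] at this
  · intro l
    let q : M →ₗ[R] LinearMap.eqLocus p LinearMap.id :=
      LinearMap.codRestrict _ p fun z => hp z
    obtain ⟨z, hz⟩ := hB.bijective_left.2 (l ∘ₗ q)
    refine ⟨q z, LinearMap.ext fun v => ?_⟩
    have hv : p v.1 = v.1 := v.2
    have h1 : B z v.1 = l (q v.1) := LinearMap.congr_fun hz v.1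
    change B (p z) v.1 = l v
    rw [hadj, hv, h1]
    exact congrArg l (Subtype.ext hv)

variable {φ : LinearMap.BilinForm R M}

/-- For a fixed vector `(a, v, b)` the middle component reads `α • v = a • x + b • y`, so where `α`
is invertible the outer components determine everything. -/
theorem tripleProj_fixed_left {α : R} {x y : M} {r : R} (hr : r * α = 1) {z : R × M × R}
    (hz : tripleProj φ α x y z = z) :
    z = (r * z.1) • tripleProj φ α x y (1, 0, 0) + (r * z.2.2) • tripleProj φ α x y (0, 0, 1) := by
  have h2 : z.1 • x + (1 - α) • z.2.1 + z.2.2 • y = z.2.1 := congrArg (fun w => w.2.1) hz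
  have h3 : α • z.2.1 = z.1 • x + z.2.2 • y := by linear_combination (norm := module) -h2
  have h4 : z.2.1 = r • (z.1 • x + z.2.2 • y) := by rw [← h3, smul_smul, hr, one_smul]
  simp only [tripleProj_apply, map_zero, smul_zero, zero_smul, one_smul, mul_one,
    mul_zero, add_zero, zero_add, sub_zero]
  refine Prod.ext ?_ (Prod.ext ?_ ?_)
  · simp only [Prod.fst_add, Prod.smul_fst, smul_eq_mul]
    linear_combination -z.1 * hr
  · simp only [Prod.snd_add, Prod.fst_add, Prod.smul_snd, Prod.smul_fst]
    rw [h4]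
    module
  · simp only [Prod.snd_add, Prod.smul_snd, smul_eq_mul]
    linear_combination -z.2.2 * hr

/-- For a fixed vector `(a, v, b)` the outer components read `(1 - α) a = -φ y v` and `(1 - α) b = φ
x v`, so where `1 - α` is invertible `v` determines everything. -/
theorem tripleProj_fixed_right {α : R} {x y : M} {r : R} (hr : r * (1 - α) = 1) {z : R × M × R}
    (hz : tripleProj φ α x y z = z) :
    z = r • tripleProj φ α x y (0, z.2.1, 0) := by
  have h1 : α * z.1 - φ y z.2.1 = z.1 := congrArg (fun w => w.1) hz
  have h3 : φ x z.2.1 + α * z.2.2 = z.2.2 := congrArg (fun w => w.2.2) hz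
  simp only [tripleProj_apply, zero_smul, mul_zero, add_zero, zero_add]
  refine Prod.ext ?_ (Prod.ext ?_ ?_)
  · simp only [Prod.smul_fst, smul_eq_mul]
    linear_combination -z.1 * hr - r * h1
  · simp only [Prod.smul_snd, Prod.smul_fst]
    rw [smul_smul, hr, one_smul]
  · simp only [Prod.smul_snd, smul_eq_mul]
    linear_combination -z.2.2 * hr - r * h3

end Algebra

/-! ### Points of the quaternionic projective bundle in coordinates -/

section Quad

variable {X : Scheme.{u}}

/-- The restriction of triples. -/
def Triple.map {n : ℕ} {E : VectorBundle X n} {T T' : Over X} (t : Triple E T) (g : T' ⟶ T) :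
    Triple E T' := (g.left.appTop t.1, g ≫ t.2.1, g.left.appTop t.2.2)

theorem Triple.map_add {n : ℕ} {E : VectorBundle X n} {T T' : Over X} (t t' : Triple E T)
    (g : T' ⟶ T) : Triple.map (t + t') g = Triple.map t g + Triple.map t' g :=
  Prod.ext (_root_.map_add _ _ _) (Prod.ext (E.comp_add _ _ _) (_root_.map_add _ _ _))

theorem Triple.map_smul {n : ℕ} {E : VectorBundle X n} {T T' : Over X} (a : Γ(T.left, ⊤))
    (t : Triple E T) (g : T' ⟶ T) :
    Triple.map (a • t) g = g.left.appTop a • Triple.map t g :=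
  Prod.ext (_root_.map_mul _ _ _) (Prod.ext (E.comp_smul _ _ _) (_root_.map_mul _ _ _))

theorem tripleCoord_comp {n : ℕ} (E : VectorBundle X n) {T T' : Over X} (g : T' ⟶ T)
    (v : T ⟶ (tripleBundle E).tot) :
    tripleCoord E T' (g ≫ v) = Triple.map (tripleCoord E T v) g := tripleEquiv_comp E g v

theorem tripleCoord_symm_comp {n : ℕ} (E : VectorBundle X n) {T T' : Over X} (g : T' ⟶ T)
    (t : Triple E T) :
    g ≫ (tripleCoord E T).symm t = (tripleCoord E T').symm (Triple.map t g) := by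
  apply (tripleCoord E T').injective
  rw [tripleCoord_comp, LinearEquiv.apply_symm_apply, LinearEquiv.apply_symm_apply]

theorem tripleForm_map {n : ℕ} (E : SympBundle X n) {T T' : Over X} (g : T' ⟶ T)
    (t t' : Triple E.toVectorBundle T) :
    tripleForm (E.form T') (Triple.map t g) (Triple.map t' g) =
      g.left.appTop (tripleForm (E.form T) t t') := by
  simp only [tripleForm_apply, Triple.map, map_sub, map_add, map_mul, E.form_comp]

variable (E : SympBundle X 2)

/-- The coordinates of a `T`-point of `HP_X(𝒪 ⊕ E ⊕ 𝒪)`. -/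
@[ext]
structure Quad (T : Over X) where
  a : Γ(T.left, ⊤)
  x : T ⟶ E.tot
  y : T ⟶ E.tot
  rel : E.form T x y = a * (1 - a)

variable {E}

namespace Quad

variable {T T' : Over X}

/-- The restriction of a point. -/
def map (q : Quad E T) (g : T' ⟶ T) : Quad E T' where
  a := g.left.appTop q.a
  x := g ≫ q.x
  y := g ≫ q.y
  rel := by rw [E.form_comp, q.rel, map_mul, map_sub, map_one]

theorem map_map {T'' : Over X} (q : Quad E T) (g : T' ⟶ T) (h : T'' ⟶ T') :
    (q.map g).map h = q.map (h ≫ g) := by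
  refine Quad.ext ?_ ?_ ?_
  · simp only [map, Over.comp_left, Scheme.Hom.comp_appTop]
    rfl
  · simp [map]
  · simp [map]

theorem map_id (q : Quad E T) : q.map (𝟙 T) = q := by
  ext
  · simp [map]
  · simp [map]
  · simp [map]

/-- The projector onto the symplectic subbundle with given coordinates. -/
def proj (q : Quad E T) : Triple E.toVectorBundle T →ₗ[Γ(T.left, ⊤)] Triple E.toVectorBundle T :=
  tripleProj (E.form T) q.a q.x q.y

theorem proj_map (q : Quad E T) (g : T' ⟶ T) (t : Triple E.toVectorBundle T) :
    (q.map g).proj (Triple.map t g) = Triple.map (q.proj t) g := by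
  simp only [proj, tripleProj_apply, Triple.map, map, E.form_comp, map_sub, map_add, map_mul,
    E.comp_add, E.comp_smul, map_one]

theorem proj_proj (q : Quad E T) (t : Triple E.toVectorBundle T) :
    q.proj (q.proj t) = q.proj t :=
  tripleProj_idem (E.form_self T) (E.isPlucker T) q.rel t

theorem form_proj (q : Quad E T) (t t' : Triple E.toVectorBundle T) :
    tripleForm (E.form T) (q.proj t) t' = tripleForm (E.form T) t (q.proj t') :=
  tripleForm_tripleProj (E.form_self T) q.a q.x q.y t t'

theorem ext_local {q q' : Quad E T}
    (h : ∀ t : T.left, ∃ U : T.left.Opens, t ∈ U ∧ q.map (resι T U) = q'.map (resι T U)) :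
    q = q' := by
  choose U hU h using h
  refine Quad.ext ?_ ?_ ?_
  · exact ring_ext_local fun t => ⟨U t, hU t, congrArg Quad.a (h t)⟩
  · exact over_hom_ext_local fun t => ⟨U t, hU t, congrArg Quad.x (h t)⟩
  · exact over_hom_ext_local fun t => ⟨U t, hU t, congrArg Quad.y (h t)⟩

/-- A point is determined by its subbundle. -/
theorem ext_of_fixed {q q' : Quad E T}
    (H : ∀ (T' : Over X) (s : T' ⟶ T) (t : Triple E.toVectorBundle T'),
      (q.map s).proj t = t ↔ (q'.map s).proj t = t) : q = q' := by
  refine ext_local fun t => ?_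
  -- Nondegeneracy of the form is only postulated over affine schemes, whence the passage to an
  -- affine neighbourhood.
  obtain ⟨U, hU, htU, -⟩ := exists_isAffineOpen_mem_and_subset (X := T.left) (x := t)
    (U := ⊤) trivial
  refine ⟨U, htU, ?_⟩
  have hnd := tripleForm_isPerfPair _ (E.form_self _) (E.nondeg (resOver T U) hU)
  obtain ⟨h1, h2, h3⟩ := tripleProj_ext (E.form_self _) (E.isPlucker _) (fun z hz => by
    apply hnd.bijective_left.1
    rw [map_zero]
    exact LinearMap.ext hz) (q.map (resι T U)).rel (q'.map (resι T U)).rel (H _ (resι T U))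
  exact Quad.ext h1 h2 h3

/-- The coordinates of the span of a symplectic pair. -/
def ofPair (w₁ w₂ : Triple E.toVectorBundle T) (h : tripleForm (E.form T) w₁ w₂ = 1) : Quad E T where
  a := (pairVec w₁ w₂).1
  x := (pairVec w₁ w₂).2.1
  y := (pairVec w₁ w₂).2.2
  rel := pairVec_rel (E.form_self T) h

theorem proj_ofPair (w₁ w₂ : Triple E.toVectorBundle T) (h : tripleForm (E.form T) w₁ w₂ = 1)
    (z : Triple E.toVectorBundle T) : (ofPair w₁ w₂ h).proj z =
      tripleForm (E.form T) z w₂ • w₁ - tripleForm (E.form T) z w₁ • w₂ :=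
  tripleProj_pairVec (E.form_self T) (E.isPlucker T) h z

end Quad

/-! ### The scheme of points -/

/-- The points of a fibre product of `X`-schemes. -/
def pairEquiv (A B T : Over X) :
    (T ⟶ Over.mk (pullback.snd A.hom B.hom ≫ B.hom)) ≃ (T ⟶ A) × (T ⟶ B) where
  toFun v := (Over.homMk (v.left ≫ pullback.fst A.hom B.hom) (by
      have := Over.w v
      rw [Category.assoc, pullback.condition]
      exact this),
    Over.homMk (v.left ≫ pullback.snd A.hom B.hom) (by
      have := Over.w v
      rw [Category.assoc]
      exact this))
  invFun p := Over.homMk (pullback.lift p.1.left p.2.left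
    ((Over.w p.1).trans (Over.w p.2).symm)) (by
      change _ ≫ pullback.snd A.hom B.hom ≫ B.hom = _
      rw [pullback.lift_snd_assoc]
      exact Over.w p.2)
  left_inv v := by
    ext1
    refine pullback.hom_ext ?_ ?_
    · exact pullback.lift_fst _ _ _
    · exact pullback.lift_snd _ _ _
  right_inv p := by
    refine Prod.ext ?_ ?_
    · ext1; exact pullback.lift_fst _ _ _
    · ext1; exact pullback.lift_snd _ _ _

theorem pairEquiv_comp (A B : Over X) {T T' : Over X} (g : T' ⟶ T)
    (v : T ⟶ Over.mk (pullback.snd A.hom B.hom ≫ B.hom)) :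
    pairEquiv A B T' (g ≫ v) = (g ≫ (pairEquiv A B T v).1, g ≫ (pairEquiv A B T v).2) := by
  refine Prod.ext ?_ ?_
  · ext1; exact Category.assoc _ _ _
  · ext1; exact Category.assoc _ _ _

variable (E)

/-- The scheme `E ×_X E`. -/
abbrev pairScheme : Over X := Over.mk (pullback.snd E.tot.hom E.tot.hom ≫ E.tot.hom)

/-- The scheme `E ×_X E × 𝔸¹`. -/
abbrev tripleScheme : Over X := lineOver (pairScheme E)

/-- The points of `E ×_X E × 𝔸¹`. -/
def tripleSchemeEquiv (T : Over X) :
    (T ⟶ tripleScheme E) ≃ ((T ⟶ E.tot) × (T ⟶ E.tot)) × Γ(T.left, ⊤) :=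
  (lineEquiv (pairScheme E) T).trans
    ((pairEquiv E.tot E.tot T).prodCongr (Equiv.refl _))

theorem tripleSchemeEquiv_comp {T T' : Over X} (g : T' ⟶ T) (v : T ⟶ tripleScheme E) :
    tripleSchemeEquiv E T' (g ≫ v) = ((g ≫ (tripleSchemeEquiv E T v).1.1,
      g ≫ (tripleSchemeEquiv E T v).1.2), g.left.appTop (tripleSchemeEquiv E T v).2) := by
  simp only [tripleSchemeEquiv, Equiv.trans_apply, lineEquiv_comp, Equiv.prodCongr_apply, Prod.map,
    pairEquiv_comp, Equiv.refl_apply]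

/-- A function on an `X`-scheme, as a morphism to the affine line. -/
def funHom (T : Over X) (a : Γ(T.left, ⊤)) : T ⟶ lineOver (Over.mk (𝟙 X)) :=
  (lineEquiv (Over.mk (𝟙 X)) T).symm (Over.homMk T.hom (Category.comp_id _), a)

theorem comp_funHom {T T' : Over X} (g : T' ⟶ T) (a : Γ(T.left, ⊤)) :
    g ≫ funHom T a = funHom T' (g.left.appTop a) := by
  rw [funHom, funHom, lineEquiv_symm_comp]
  congr 2
  ext1
  exact Over.w g

theorem funHom_injective (T : Over X) : Function.Injective (funHom T) := by
  intro a b h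
  have := (lineEquiv _ T).symm.injective h
  exact congrArg Prod.snd this

/-- The functions `φ(x, y)` and `a(1 - a)` on `E ×_X E × 𝔸¹`. -/
def quadFun : Γ((tripleScheme E).left, ⊤) × Γ((tripleScheme E).left, ⊤) :=
  (E.form _ (tripleSchemeEquiv E _ (𝟙 _)).1.1 (tripleSchemeEquiv E _ (𝟙 _)).1.2,
    (tripleSchemeEquiv E _ (𝟙 _)).2 * (1 - (tripleSchemeEquiv E _ (𝟙 _)).2))

/-- The affine quadric bundle `φ(x, y) = a(1 - a)`. -/
def quadScheme : Over X :=
  equalizer (funHom _ (quadFun E).1) (funHom _ (quadFun E).2)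

/-- The inclusion of the quadric bundle. -/
def quadι : quadScheme E ⟶ tripleScheme E := equalizer.ι _ _

theorem isAffineHom_comp {X Y Z : Scheme.{u}} (f : X ⟶ Y) (g : Y ⟶ Z) (_ : IsAffineHom f)
    (_ : IsAffineHom g) : IsAffineHom (f ≫ g) := inferInstance

theorem isAffineHom_pullback_snd {X Y Z : Scheme.{u}} (f : X ⟶ Z) (g : Y ⟶ Z)
    (h : IsAffineHom f) : IsAffineHom (pullback.snd f g) :=
  isAffineHom_isStableUnderBaseChange.of_isPullback (IsPullback.of_hasPullback f g) h

instance isAffineHom_pairScheme : IsAffineHom (pairScheme E).hom :=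
  isAffineHom_comp _ _ (isAffineHom_pullback_snd _ _ E.isAffineHom_tot) E.isAffineHom_tot

instance isAffineHom_tripleScheme : IsAffineHom (tripleScheme E).hom :=
  isAffineHom_comp _ _ inferInstance (isAffineHom_pairScheme E)

instance isAffineHom_quadScheme : IsAffineHom (quadScheme E).hom := by
  have h : (quadι E).left ≫ (tripleScheme E).hom = (quadScheme E).hom := Over.w (quadι E)
  have : IsAffineHom (𝔸(PUnit.{u + 1}; X) ↘ X) := inferInstance
  have : IsSeparated (lineOver (Over.mk (𝟙 X))).hom :=
    inferInstanceAs (IsSeparated ((𝔸(PUnit.{u + 1}; X) ↘ X) ≫ 𝟙 X))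
  have : IsClosedImmersion (quadι E).left := isClosedImmersion_equalizer_ι_left _ _
  rw [← h]
  exact isAffineHom_comp _ _ inferInstance (isAffineHom_tripleScheme E)

theorem quad_rel_iff {T : Over X} (v : T ⟶ tripleScheme E) :
    v ≫ funHom _ (quadFun E).1 = v ≫ funHom _ (quadFun E).2 ↔
      E.form T (tripleSchemeEquiv E T v).1.1 (tripleSchemeEquiv E T v).1.2 =
        (tripleSchemeEquiv E T v).2 * (1 - (tripleSchemeEquiv E T v).2) := by
  have h := tripleSchemeEquiv_comp E v (𝟙 _)
  rw [Category.comp_id] at h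
  rw [comp_funHom, comp_funHom, (funHom_injective T).eq_iff, h]
  simp only [quadFun, E.form_comp, map_mul, map_sub, map_one]

/-- The points of the quadric bundle. -/
def quadEquiv (T : Over X) : (T ⟶ quadScheme E) ≃ Quad E T where
  toFun v :=
    { a := (tripleSchemeEquiv E T (v ≫ quadι E)).2
      x := (tripleSchemeEquiv E T (v ≫ quadι E)).1.1
      y := (tripleSchemeEquiv E T (v ≫ quadι E)).1.2
      rel := (quad_rel_iff E _).1 (by
        rw [Category.assoc, Category.assoc]
        exact congrArg (v ≫ ·) (equalizer.condition _ _)) }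
  invFun q := equalizer.lift ((tripleSchemeEquiv E T).symm ((q.x, q.y), q.a))
    ((quad_rel_iff E _).2 (by rw [Equiv.apply_symm_apply]; exact q.rel))
  left_inv v := by
    apply equalizer.hom_ext
    rw [equalizer.lift_ι]
    exact (tripleSchemeEquiv E T).symm_apply_apply _
  right_inv q := by
    have h := congrArg (tripleSchemeEquiv E T) (equalizer.lift_ι
      ((tripleSchemeEquiv E T).symm ((q.x, q.y), q.a))
      ((quad_rel_iff E _).2 (by rw [Equiv.apply_symm_apply]; exact q.rel)))
    replace h := h.trans ((tripleSchemeEquiv E T).apply_symm_apply _)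
    exact Quad.ext (congrArg Prod.snd h) (congrArg (fun p => p.1.1) h)
      (congrArg (fun p => p.1.2) h)

theorem quadEquiv_comp {T T' : Over X} (g : T' ⟶ T) (v : T ⟶ quadScheme E) :
    quadEquiv E T' (g ≫ v) = (quadEquiv E T v).map g := by
  have h := tripleSchemeEquiv_comp E g (v ≫ quadι E)
  rw [← Category.assoc] at h
  exact Quad.ext (congrArg Prod.snd h) (congrArg (fun p => p.1.1) h)
    (congrArg (fun p => p.1.2) h)

variable {E}

/-- Coordinates are morphisms to the quadric bundle, so they glue as morphisms do. -/
theorem Quad.exists_glue {T : Over X} (Q : ∀ {T' : Over X}, (T' ⟶ T) → Quad E T' → Prop)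
    (hres : ∀ {T' T'' : Over X} (r : T'' ⟶ T') (s : T' ⟶ T) (q : Quad E T'), Q s q →
      Q (r ≫ s) (q.map r))
    (huniq : ∀ {T' : Over X} (s : T' ⟶ T) (q q' : Quad E T'), Q s q → Q s q' → q = q')
    (hloc : ∀ t : T.left, ∃ U : T.left.Opens, t ∈ U ∧ ∃ q, Q (resι T U) q) :
    ∃ q : Quad E T, ∀ t : T.left, ∃ U : T.left.Opens, t ∈ U ∧ Q (resι T U) (q.map (resι T U)) := by
  obtain ⟨g, hg⟩ := over_exists_glue (T := T) (Y := quadScheme E)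
    (fun {T'} s g => Q s (quadEquiv E T' g))
    (fun r s g h => by rw [quadEquiv_comp]; exact hres r s _ h)
    (fun s g g' h h' => (quadEquiv E _).injective (huniq s _ _ h h'))
    (fun t => by
      obtain ⟨U, hU, q, hq⟩ := hloc t
      exact ⟨U, hU, (quadEquiv E _).symm q, by rwa [Equiv.apply_symm_apply]⟩)
  refine ⟨quadEquiv E T g, fun t => ?_⟩
  obtain ⟨U, hU, h⟩ := hg t
  exact ⟨U, hU, by rwa [← quadEquiv_comp]⟩

end Quad

/-! ### The subbundle with given coordinates -/

section Algebra

variable {R M : Type*} [CommRing R] [AddCommGroup M] [Module R M] {φ : LinearMap.BilinForm R M}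

/-- The outer components of the two generators are `(α, 0)` and `(0, α)`, so the coefficients are
read off by dividing by `α`. -/
theorem existsUnique_frame_left {α : R} {x y : M} {r : R} (hr : r * α = 1) {z : R × M × R}
    (hz : tripleProj φ α x y z = z) (b : Fin 2 → R × M × R)
    (h0 : b 0 = tripleProj φ α x y (1, 0, 0)) (h1 : b 1 = tripleProj φ α x y (0, 0, 1)) :
    ∃! c : Fin 2 → R, z = ∑ i, c i • b i := by
  refine ⟨![r * z.1, r * z.2.2], ?_, fun c hc => ?_⟩
  · simpa [Fin.sum_univ_two, h0, h1] using tripleProj_fixed_left hr hz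
  · replace hc : z = ∑ i, c i • b i := hc
    rw [Fin.sum_univ_two, h0, h1] at hc
    have e0 := congrArg Prod.fst hc
    have e1 := congrArg (fun w => w.2.2) hc
    simp [tripleProj_apply] at e0 e1
    funext i
    fin_cases i
    · simp only [Fin.zero_eta, Matrix.cons_val_zero]
      linear_combination -r * e0 - c 0 * hr
    · simp only [Fin.mk_one, Matrix.cons_val_one, Matrix.cons_val_zero]
      linear_combination -r * e1 - c 1 * hr

/-- The middle component of `tripleProj φ α x y (0, b i, 0)` is `(1 - α) • b i`; up to this unit,
coefficients are those of `z.2.1` in the given frame. -/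
theorem existsUnique_frame_right {α : R} {x y : M} {r : R} (hr : r * (1 - α) = 1) {z : R × M × R}
    (hz : tripleProj φ α x y z = z) (b : Fin 2 → M)
    (hb : ∃! d : Fin 2 → R, z.2.1 = ∑ i, d i • b i) (b' : Fin 2 → R × M × R)
    (hb' : ∀ i, b' i = tripleProj φ α x y (0, b i, 0)) :
    ∃! c : Fin 2 → R, z = ∑ i, c i • b' i := by
  obtain ⟨d, hd, hd'⟩ := hb
  have key (c : Fin 2 → R) : ∑ i, c i • b' i = tripleProj φ α x y (0, ∑ i, c i • b i, 0) := by
    simp only [hb', ← map_smul, ← map_sum]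
    congr 1
    simp [Fin.sum_univ_two]
  refine ⟨fun i => r * d i, ?_, fun c hc => ?_⟩
  · simp only [key, mul_smul, ← Finset.smul_sum]
    rw [← hd]
    refine (tripleProj_fixed_right hr hz).trans ?_
    rw [← map_smul]
  · replace hc : z = ∑ i, c i • b' i := hc
    rw [key] at hc
    have e1 : z.2.1 = ∑ i, ((1 - α) * c i) • b i := by
      have := congrArg (fun w => w.2.1) hc
      simp only [tripleProj_apply, zero_smul, zero_add, add_zero] at this
      rw [this, Finset.smul_sum]
      simp only [smul_smul]
    have e2 := hd' _ e1
    funext i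
    have e3 : (1 - α) * c i = d i := congrFun e2 i
    rw [← e3]
    linear_combination -c i * hr

end Algebra

/-! ### Linear operations on vectors of a subbundle -/

section Lies

variable {X : Scheme.{u}} {n r : ℕ} {E : VectorBundle X n}

/-- The identity of an `X`-scheme `T` over `Y`, with the structure morphism through `Y`. -/
def backHom {Y T : Over X} (g : T ⟶ Y) : (Over.map Y.hom).obj (Over.mk g.left) ⟶ T :=
  Over.homMk (𝟙 T.left) ((Category.id_comp _).trans (Over.w g).symm)

/-- The inverse of `backHom`. -/
def fwdHom {Y T : Over X} (g : T ⟶ Y) : T ⟶ (Over.map Y.hom).obj (Over.mk g.left) :=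
  Over.homMk (𝟙 T.left) (by
    rw [Category.id_comp]
    exact Over.w g)

theorem fwdHom_backHom {Y T : Over X} (g : T ⟶ Y) : fwdHom g ≫ backHom g = 𝟙 _ := by
  ext1; exact Category.id_comp _

theorem backHom_comp {Y T : Over X} (g : T ⟶ Y) : backHom g ≫ g = structHom (Over.mk g.left) := by
  ext1; exact Category.id_comp _

theorem lies_iff {Y : Over X} {𝒰 : VectorBundle Y.left r} (ι : BundleMap Y.hom 𝒰 E) {T : Over X}
    (g : T ⟶ Y) (x : T ⟶ E.tot) :
    Lies ι g x ↔ ∃ u : Over.mk g.left ⟶ 𝒰.tot, ι.app _ u = backHom g ≫ x := by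
  rw [← lies_iff_exists_app, ← backHom_comp]
  constructor
  · intro h
    exact h.comp _
  · intro h
    have := h.comp (fwdHom g)
    rwa [← Category.assoc, ← Category.assoc, fwdHom_backHom, Category.id_comp,
      Category.id_comp] at this

theorem Lies.sub {Y : Over X} {𝒰 : VectorBundle Y.left r} {ι : BundleMap Y.hom 𝒰 E} {T : Over X}
    {g : T ⟶ Y} {x x' : T ⟶ E.tot} (h : Lies ι g x) (h' : Lies ι g x') : Lies ι g (x - x') := by
  rw [lies_iff] at h h' ⊢
  obtain ⟨u, hu⟩ := h
  obtain ⟨u', hu'⟩ := h'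
  exact ⟨u - u', by rw [ι.app_sub, hu, hu', E.comp_sub]⟩

theorem Lies.smul {Y : Over X} {𝒰 : VectorBundle Y.left r} {ι : BundleMap Y.hom 𝒰 E} {T : Over X}
    {g : T ⟶ Y} {x : T ⟶ E.tot} (h : Lies ι g x) (a : Γ(T.left, ⊤)) : Lies ι g (a • x) := by
  rw [lies_iff] at h ⊢
  obtain ⟨u, hu⟩ := h
  refine ⟨(show Γ((Over.mk g.left).left, ⊤) from a) • u, ?_⟩
  rw [ι.app_smul, hu, E.comp_smul]
  congr 1

end Lies

/-! ### The symplectic bundle cut out by a projector -/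

section QuadBundle

variable {X : Scheme.{u}} {E : SympBundle X 2} {T : Over X}

theorem Triple.map_id {n : ℕ} {E : VectorBundle X n} {T : Over X} (t : Triple E T) :
    Triple.map t (𝟙 T) = t := by
  refine Prod.ext ?_ (Prod.ext ?_ ?_) <;> simp [Triple.map]

theorem Triple.map_map {n : ℕ} {E : VectorBundle X n} {T T' T'' : Over X} (t : Triple E T)
    (g : T' ⟶ T) (h : T'' ⟶ T') : Triple.map (Triple.map t g) h = Triple.map t (h ≫ g) := by
  refine Prod.ext ?_ (Prod.ext ?_ ?_)
  · simp only [Triple.map, Over.comp_left, Scheme.Hom.comp_appTop]; rfl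
  · simp [Triple.map]
  · simp only [Triple.map, Over.comp_left, Scheme.Hom.comp_appTop]; rfl

namespace Quad

variable (q : Quad E T)

/-- The restriction of `q` to a `T`-scheme. -/
abbrev at' (S : Over T.left) : Quad E ((Over.map T.hom).obj S) := q.map (structHom S)

theorem at'_map {S S' : Over T.left} (g : S' ⟶ S) :
    (q.at' S).map ((Over.map T.hom).map g) = q.at' S' := by
  rw [map_map]
  congr 1
  ext1
  exact Over.w g

/-- The sections of the subbundle. -/
abbrev Fixed (S : Over T.left) : Type u :=
  LinearMap.eqLocus (q.at' S).proj LinearMap.id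

/-- Scalars over `S` as a `T`-scheme and over `S` as an `X`-scheme are the same ring under two
names. -/
instance fixedModule (S : Over T.left) : Module Γ(S.left, ⊤) (q.Fixed S) :=
  inferInstanceAs (Module Γ(((Over.map T.hom).obj S).left, ⊤)
    (LinearMap.eqLocus (q.at' S).proj LinearMap.id))

/-- The restriction of sections of the subbundle. -/
def fixedMap {S S' : Over T.left} (g : S' ⟶ S) (m : q.Fixed S) : q.Fixed S' :=
  ⟨Triple.map m.1 ((Over.map T.hom).map g), by
    change (q.at' S').proj _ = _
    rw [← q.at'_map g, proj_map]
    exact congrArg (fun t => Triple.map t _) m.2⟩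

/-- The pullback of `𝒪 ⊕ E ⊕ 𝒪` to `T`. -/
abbrev ambient (_ : Quad E T) : Over T.left :=
  Over.mk (pullback.snd (tripleBundle E.toVectorBundle).tot.hom T.hom)

/-- The points of the pullback of `𝒪 ⊕ E ⊕ 𝒪`. -/
def ambientEquiv (S : Over T.left) :
    (S ⟶ q.ambient) ≃ Triple E.toVectorBundle ((Over.map T.hom).obj S) :=
  (pullbackEquiv T.hom (tripleBundle E.toVectorBundle).tot S).trans
    (tripleCoord E.toVectorBundle _).toEquiv

theorem ambientEquiv_comp {S S' : Over T.left} (g : S' ⟶ S) (v : S ⟶ q.ambient) :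
    q.ambientEquiv S' (g ≫ v) = Triple.map (q.ambientEquiv S v) ((Over.map T.hom).map g) := by
  refine (congrArg (tripleCoord E.toVectorBundle _) (pullbackEquiv_comp T.hom _ g v)).trans ?_
  exact tripleCoord_comp _ _ _

/-- The projector, as a morphism of schemes. -/
def projHom : q.ambient ⟶ q.ambient :=
  (q.ambientEquiv q.ambient).symm ((q.at' _).proj (q.ambientEquiv _ (𝟙 _)))

theorem ambientEquiv_comp_projHom {S : Over T.left} (v : S ⟶ q.ambient) :
    q.ambientEquiv S (v ≫ q.projHom) = (q.at' S).proj (q.ambientEquiv S v) := by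
  have h := q.ambientEquiv_comp v (𝟙 _)
  rw [Category.comp_id] at h
  rw [ambientEquiv_comp, projHom, Equiv.apply_symm_apply, ← proj_map, at'_map, ← h]

/-- The total space of the subbundle. -/
def tot : Over T.left := equalizer q.projHom (𝟙 _)

/-- The inclusion of the total space of the subbundle. -/
def totι : q.tot ⟶ q.ambient := equalizer.ι _ _

/-- The points of the total space of the subbundle. -/
def totEquiv (S : Over T.left) : (S ⟶ q.tot) ≃ q.Fixed S where
  toFun v := ⟨q.ambientEquiv S (v ≫ q.totι), by
    change (q.at' S).proj _ = _
    rw [← ambientEquiv_comp_projHom, Category.assoc]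
    have h : q.totι ≫ q.projHom = q.totι :=
      (equalizer.condition _ _).trans (Category.comp_id _)
    rw [h]
    rfl⟩
  invFun m := equalizer.lift ((q.ambientEquiv S).symm m.1) (by
    apply (q.ambientEquiv S).injective
    rw [ambientEquiv_comp_projHom, Equiv.apply_symm_apply, Category.comp_id,
      Equiv.apply_symm_apply]
    exact m.2)
  left_inv v := by
    apply equalizer.hom_ext
    rw [equalizer.lift_ι]
    exact (q.ambientEquiv S).symm_apply_apply _
  right_inv m := Subtype.ext
    ((congrArg (q.ambientEquiv S) (equalizer.lift_ι _ _)).trans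
      ((q.ambientEquiv S).apply_symm_apply _))

theorem totEquiv_comp {S S' : Over T.left} (g : S' ⟶ S) (v : S ⟶ q.tot) :
    q.totEquiv S' (g ≫ v) = q.fixedMap g (q.totEquiv S v) := by
  apply Subtype.ext
  change q.ambientEquiv S' ((g ≫ v) ≫ q.totι) = _
  rw [Category.assoc, ambientEquiv_comp]
  rfl

theorem exists_unit (t : T.left) :
    (∃ U : T.left.Opens, t ∈ U ∧ IsUnit (U.ι.appTop q.a)) ∨
    (∃ U : T.left.Opens, t ∈ U ∧ IsUnit (U.ι.appTop (1 - q.a))) := by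
  rcases mem_basicOpen_or (show q.a + (1 - q.a) = 1 by ring) t with h | h
  · exact Or.inl ⟨_, h, isUnit_ι_appTop le_rfl⟩
  · exact Or.inr ⟨_, h, isUnit_ι_appTop le_rfl⟩

/-- A section of the subbundle. -/
def fixedOf {S : Over T.left} (t : Triple E.toVectorBundle ((Over.map T.hom).obj S)) : q.Fixed S :=
  ⟨(q.at' S).proj t, (q.at' S).proj_proj t⟩

theorem fixedMap_fixedOf {S S' : Over T.left} (g : S' ⟶ S)
    (t : Triple E.toVectorBundle ((Over.map T.hom).obj S)) :
    (q.fixedMap g (q.fixedOf t)).1 = (q.at' S').proj (Triple.map t ((Over.map T.hom).map g)) := by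
  change Triple.map ((q.at' S).proj t) _ = _
  rw [← q.at'_map g, proj_map]

theorem exists_frame (t : T.left) : ∃ U : T.left.Opens, t ∈ U ∧
    ∃ b : Fin 2 → q.Fixed (Over.mk U.ι), ∀ (S : Over T.left) (g : S ⟶ Over.mk U.ι) (v : q.Fixed S),
      ∃! c : Fin 2 → Γ(S.left, ⊤), v = ∑ i, c i • q.fixedMap g (b i) := by
  have main : ∃ U : T.left.Opens, t ∈ U ∧
    ∃ b : Fin 2 → q.Fixed (Over.mk U.ι), ∀ (S : Over T.left) (g : S ⟶ Over.mk U.ι) (v : q.Fixed S),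
      ∃! c : Fin 2 → Γ(((Over.map T.hom).obj S).left, ⊤),
        v.1 = ∑ i, c i • (q.fixedMap g (b i)).1 := by
    have hg {U : T.left.Opens} {S : Over T.left} (g : S ⟶ Over.mk U.ι) (a : Γ(T.left, ⊤)) :
        g.left.appTop (U.ι.appTop a) = S.hom.appTop a := by
      rw [← Over.w g, Scheme.Hom.comp_appTop]; rfl
    -- Since `a + (1 - a) = 1`, near `t` one of the two is invertible. In the first case the
    -- projections of `(1, 0, 0)` and `(0, 0, 1)` form a frame, in the second the projections of a
    -- frame of `E`.
    rcases q.exists_unit t with ⟨U, hU, hu⟩ | ⟨U, hU, hu⟩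
    · obtain ⟨r, hr⟩ := hu.exists_left_inv
      refine ⟨U, hU, ![q.fixedOf (1, 0, 0), q.fixedOf (0, 0, 1)], fun S g v => ?_⟩
      refine existsUnique_frame_left (r := g.left.appTop r) (φ := E.form _) ?_ v.2 _
        ((q.fixedMap_fixedOf g _).trans ?_) ((q.fixedMap_fixedOf g _).trans ?_)
      · have := congrArg g.left.appTop hr
        rwa [map_mul, map_one, hg] at this
      · simp only [Triple.map, map_one, map_zero, E.comp_zero]; rfl
      · simp only [Triple.map, map_one, map_zero, E.comp_zero]; rfl
    · obtain ⟨U', hU', b, hb⟩ := E.exists_frame_at T t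
      obtain ⟨r, hr⟩ := hu.exists_left_inv
      let i₁ : Over.mk (U ⊓ U').ι ⟶ Over.mk U.ι := Over.homMk (T.left.homOfLE inf_le_left)
        (Scheme.homOfLE_ι _ _)
      let i₂ : resOver T (U ⊓ U') ⟶ resOver T U' := resLE T inf_le_right
      refine ⟨U ⊓ U', ⟨hU, hU'⟩, fun i => q.fixedOf (0, i₂ ≫ b i, 0), fun S g v => ?_⟩
      refine existsUnique_frame_right (r := (g ≫ i₁).left.appTop r) (φ := E.form _) ?_ v.2
        (fun i => (Over.map T.hom).map g ≫ i₂ ≫ b i) ?_ _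
        (fun i => (q.fixedMap_fixedOf g _).trans ?_)
      · have := congrArg (g ≫ i₁).left.appTop hr
        rw [map_mul, map_one, hg, map_sub, map_one] at this
        exact this
      · simpa only [Category.assoc] using hb _ ((Over.map T.hom).map g ≫ i₂) v.1.2.1
      · simp only [Triple.map, map_zero]; rfl
  obtain ⟨U, hU, b, hb⟩ := main
  refine ⟨U, hU, b, fun S g v => ?_⟩
  have key (c : Fin 2 → Γ(S.left, ⊤)) : v = ∑ i, c i • q.fixedMap g (b i) ↔
      v.1 = ∑ i, (show Γ(((Over.map T.hom).obj S).left, ⊤) from c i) • (q.fixedMap g (b i)).1 := by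
    rw [← Subtype.coe_inj, Fin.sum_univ_two, Fin.sum_univ_two]
    rfl
  simp only [key]
  exact hb S g v

/-- The subbundle with given coordinates, as a vector bundle. -/
def vectorBundle : VectorBundle T.left 2 :=
  VectorBundle.ofEquiv q.tot q.Fixed q.totEquiv q.fixedMap q.totEquiv_comp
    (fun _ _ _ => Subtype.ext (Triple.map_add _ _ _))
    (fun _ _ _ => Subtype.ext (Triple.map_smul _ _ _)) q.exists_frame

/-- The sections of the subbundle, as a module. -/
def coord (S : Over T.left) : (S ⟶ q.vectorBundle.tot) ≃ₗ[Γ(S.left, ⊤)] q.Fixed S :=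
  { q.totEquiv S with
    map_add' := fun _ _ => (q.totEquiv S).apply_symm_apply _
    map_smul' := fun _ _ => (q.totEquiv S).apply_symm_apply _ }

theorem coord_comp {S S' : Over T.left} (g : S' ⟶ S) (v : S ⟶ q.vectorBundle.tot) :
    q.coord S' (g ≫ v) = q.fixedMap g (q.coord S v) := q.totEquiv_comp g v

/-- The form on the sections of the subbundle. -/
def fixedForm (S : Over T.left) : LinearMap.BilinForm Γ(S.left, ⊤) (q.Fixed S) :=
  letI B : LinearMap.BilinForm Γ(((Over.map T.hom).obj S).left, ⊤)
      (LinearMap.eqLocus (q.at' S).proj LinearMap.id) :=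
    LinearMap.compl₁₂ (tripleForm (E.form ((Over.map T.hom).obj S)))
      (LinearMap.eqLocus (q.at' S).proj LinearMap.id).subtype
      (LinearMap.eqLocus (q.at' S).proj LinearMap.id).subtype
  B

/-- The subbundle with given coordinates. -/
def bundle : SympBundle T.left 2 where
  toVectorBundle := q.vectorBundle
  form S := (q.fixedForm S).compl₁₂ (q.coord S).toLinearMap (q.coord S).toLinearMap
  form_self S v := tripleForm_self _ (E.form_self _) _
  form_comp {S S'} g v v' := by
    have h := tripleForm_map E ((Over.map T.hom).map g) (q.coord S v).1 (q.coord S v').1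
    change tripleForm (E.form _) (q.coord S' (g ≫ v)).1 (q.coord S' (g ≫ v')).1 = _
    rw [coord_comp, coord_comp]
    exact h
  nondeg S hS := by
    have h : (q.fixedForm S).IsPerfPair := isPerfPair_eqLocus
      (tripleForm (E.form ((Over.map T.hom).obj S))) (tripleForm_self _ (E.form_self _))
      (tripleForm_isPerfPair _ (E.form_self _) (E.nondeg _ hS)) (q.at' S).proj (q.at' S).proj_proj
      (q.at' S).form_proj
    exact LinearMap.IsPerfPair.compl₁₂ _ (q.coord S) (q.coord S)

/-- The inclusion of the subbundle with given coordinates. -/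
def incl : BundleMap T.hom q.vectorBundle (tripleBundle E.toVectorBundle) :=
  BundleMap.ofPoints (fun S v => (tripleCoord E.toVectorBundle _).symm (q.coord S v).1)
    (fun g v => by rw [coord_comp, tripleCoord_symm_comp]; rfl)
    (fun S v v' => by
      rw [map_add]
      exact map_add (tripleCoord E.toVectorBundle _).symm _ _)
    (fun S a v => by
      rw [map_smul]
      exact map_smul (tripleCoord E.toVectorBundle _).symm _ _)

theorem tripleCoord_incl_app (S : Over T.left) (v : S ⟶ q.vectorBundle.tot) :
    tripleCoord E.toVectorBundle _ (q.incl.app S v) = (q.coord S v).1 := by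
  rw [BundleMap.app_eq q.incl
    (fun S v => (tripleCoord E.toVectorBundle _).symm (q.coord S v).1)
    (fun g v => by rw [coord_comp, tripleCoord_symm_comp]; rfl) rfl S v,
    LinearEquiv.apply_symm_apply]

theorem incl_isIsometric : BundleMap.IsIsometric (W := q.bundle) (E := hypExt E) q.incl := by
  intro S v v'
  exact congrArg₂ (fun a b => tripleForm (E.form _) a b) (q.tripleCoord_incl_app S v)
    (q.tripleCoord_incl_app S v')

theorem incl_isSubbundle : q.incl.IsSubbundle := by
  intro S v v' h
  apply (q.coord S).injective
  apply Subtype.ext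
  rw [← tripleCoord_incl_app, ← tripleCoord_incl_app, h]

theorem lies_incl_iff {T' : Over X} (s : T' ⟶ T) (x : T' ⟶ (tripleBundle E.toVectorBundle).tot) :
    Lies q.incl s x ↔
      (q.map s).proj (tripleCoord E.toVectorBundle _ x) = tripleCoord E.toVectorBundle _ x := by
  have h1 : Lies q.incl s x ↔ (q.at' (Over.mk s.left)).proj
      (tripleCoord E.toVectorBundle _ (backHom s ≫ x)) =
        tripleCoord E.toVectorBundle _ (backHom s ≫ x) := by
    rw [lies_iff]
    constructor
    · rintro ⟨u, hu⟩
      rw [← hu, tripleCoord_incl_app]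
      exact (q.coord _ u).2
    · intro h
      refine ⟨(q.coord _).symm ⟨_, h⟩, ?_⟩
      apply (tripleCoord E.toVectorBundle _).injective
      rw [tripleCoord_incl_app, LinearEquiv.apply_symm_apply]
  rw [h1, at', ← backHom_comp, ← map_map, tripleCoord_comp, proj_map]
  constructor
  · intro h
    have := congrArg (fun t => Triple.map t (fwdHom s)) h
    simpa only [Triple.map_map, fwdHom_backHom, Triple.map_id] using this
  · intro h
    rw [h]

end Quad

end QuadBundle

/-! ### Symplectic subbundles of rank two in coordinates -/

section Pairs

variable {X : Scheme.{u}} {n r : ℕ}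

/-- The form induced by a bundle map on the sections of its source. -/
def BundleMap.restrictForm {Y : Scheme.{u}} {f : Y ⟶ X} {W : VectorBundle Y r} {F : SympBundle X n}
    (j : BundleMap f W F.toVectorBundle) (S : Over Y) :
    LinearMap.BilinForm Γ(S.left, ⊤) (S ⟶ W.tot) :=
  letI : Module Γ(S.left, ⊤) ((Over.map f).obj S ⟶ F.tot) := F.mod ((Over.map f).obj S)
  letI l : (S ⟶ W.tot) →ₗ[Γ(S.left, ⊤)] ((Over.map f).obj S ⟶ F.tot) :=
    { toFun := j.app S
      map_add' := fun v v' => j.app_add v v'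
      map_smul' := fun a v => j.app_smul a v }
  LinearMap.compl₁₂ (F.form ((Over.map f).obj S)) l l

theorem BundleMap.isPlucker_restrictForm {Y : Scheme.{u}} {f : Y ⟶ X} {W : VectorBundle Y 2}
    {F : SympBundle X n} (j : BundleMap f W F.toVectorBundle) (S : Over Y) :
    IsPlucker (j.restrictForm S) :=
  W.isPlucker j.restrictForm (fun S v => F.form_self _ _) (fun {S S'} g v v' => by
    refine Eq.trans ?_ (F.form_comp ((Over.map f).map g) (j.app S v) (j.app S v'))
    rw [← BundleMap.app_comp, ← BundleMap.app_comp]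
    rfl) S

/-- The Plücker relation for the induced form on the rank two bundle `W`, with the leading product
equal to one. Nondegeneracy of the induced form need not be known; a pair with product one suffices.
-/
theorem BundleMap.eq_of_pair {Y : Scheme.{u}} {f : Y ⟶ X} {W : VectorBundle Y 2}
    {F : SympBundle X n} (j : BundleMap f W F.toVectorBundle) {S : Over Y} (w₁ w₂ w : S ⟶ W.tot)
    (h : F.form _ (j.app S w₁) (j.app S w₂) = 1) :
    j.app S w = F.form _ (j.app S w) (j.app S w₂) • j.app S w₁ -
      F.form _ (j.app S w) (j.app S w₁) • j.app S w₂ := by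
  have h0 : j.restrictForm S w₁ w₂ = 1 := h
  have h1 := j.isPlucker_restrictForm S w₁ w₂ w
  have hs : ∀ v, j.restrictForm S v v = 0 := fun v => F.form_self _ _
  rw [h0, one_smul, alt_swap hs w₁ w, alt_swap hs w₂ w] at h1
  have h2 : w = j.restrictForm S w w₂ • w₁ - j.restrictForm S w w₁ • w₂ := by
    linear_combination (norm := module) h1
  refine (congrArg (j.app S) h2).trans ?_
  rw [j.app_sub, j.app_smul, j.app_smul]
  rfl

theorem Lies.eq_of_pair {T : Over X} {W : VectorBundle T.left 2} {F : SympBundle X n}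
    {j : BundleMap T.hom W F.toVectorBundle} {S : Over X} {s : S ⟶ T} {x₁ x₂ x : S ⟶ F.tot}
    (h₁ : Lies j s x₁) (h₂ : Lies j s x₂) (hx : Lies j s x) (h : F.form S x₁ x₂ = 1) :
    x = F.form S x x₂ • x₁ - F.form S x x₁ • x₂ := by
  rw [lies_iff] at h₁ h₂ hx
  obtain ⟨u₁, h₁⟩ := h₁
  obtain ⟨u₂, h₂⟩ := h₂
  obtain ⟨u, hu⟩ := hx
  have h0 := j.eq_of_pair u₁ u₂ u (by
    rw [h₁, h₂, F.form_comp, h, map_one])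
  rw [h₁, h₂, hu, F.form_comp, F.form_comp, ← F.comp_smul, ← F.comp_smul, ← F.comp_sub] at h0
  have h1 := congrArg (fun y => fwdHom s ≫ y) h0
  simpa only [← Category.assoc, fwdHom_backHom, Category.id_comp] using h1

/-- The projector attached to a pair maps into the subbundle, as the pair lies there, and by
`Lies.eq_of_pair` it fixes every vector of the subbundle. So locally a subbundle is the fixed locus
of such a projector. -/
theorem lies_iff_ofPair {E : SympBundle X 2} {T : Over X} {W : VectorBundle T.left 2}
    {j : BundleMap T.hom W (tripleBundle E.toVectorBundle)} {S : Over X} {s : S ⟶ T}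
    {x₁ x₂ : S ⟶ (tripleBundle E.toVectorBundle).tot} (h₁ : Lies j s x₁) (h₂ : Lies j s x₂)
    (h : tripleForm (E.form S) (tripleCoord E.toVectorBundle S x₁)
      (tripleCoord E.toVectorBundle S x₂) = 1) (x : S ⟶ (tripleBundle E.toVectorBundle).tot) :
    Lies j s x ↔ (Quad.ofPair (tripleCoord E.toVectorBundle S x₁)
      (tripleCoord E.toVectorBundle S x₂) h).proj (tripleCoord E.toVectorBundle S x) =
        tripleCoord E.toVectorBundle S x := by
  rw [Quad.proj_ofPair, ← map_smul, ← map_smul, ← map_sub,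
    (tripleCoord E.toVectorBundle S).injective.eq_iff]
  constructor
  · exact fun hx => (Lies.eq_of_pair (F := hypExt E) h₁ h₂ hx h).symm
  · intro hx
    rw [← hx]
    exact (h₁.smul _).sub (h₂.smul _)

theorem Quad.ofPair_map {E : SympBundle X 2} {T T' : Over X} (w₁ w₂ : Triple E.toVectorBundle T)
    (h : tripleForm (E.form T) w₁ w₂ = 1) (g : T' ⟶ T) :
    (Quad.ofPair w₁ w₂ h).map g = Quad.ofPair (Triple.map w₁ g) (Triple.map w₂ g)
      (by rw [tripleForm_map, h, map_one]) := by
  refine Quad.ext ?_ ?_ ?_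
  · simp only [Quad.map, Quad.ofPair, pairVec, Triple.map, map_sub, map_mul]
  · simp only [Quad.map, Quad.ofPair, pairVec, Triple.map, E.comp_sub, E.comp_smul]
  · simp only [Quad.map, Quad.ofPair, pairVec, Triple.map, E.comp_sub, E.comp_smul]

/-- The subbundle `j` has coordinates `q`. -/
def HasCoord {E : SympBundle X 2} {T : Over X} {W : VectorBundle T.left 2}
    (j : BundleMap T.hom W (tripleBundle E.toVectorBundle)) {T' : Over X} (g : T' ⟶ T)
    (q : Quad E T') : Prop :=
  ∀ (S : Over X) (s : S ⟶ T') (x : S ⟶ (tripleBundle E.toVectorBundle).tot), Lies j (s ≫ g) x ↔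
    (q.map s).proj (tripleCoord E.toVectorBundle S x) = tripleCoord E.toVectorBundle S x

theorem Quad.eq_iff_lies {E : SympBundle X 2} {T : Over X} {q q' : Quad E T} : q = q' ↔
    ∀ (S : Over X) (s : S ⟶ T) (x : S ⟶ (tripleBundle E.toVectorBundle).tot),
      ((q.map s).proj (tripleCoord E.toVectorBundle S x) = tripleCoord E.toVectorBundle S x ↔
      (q'.map s).proj (tripleCoord E.toVectorBundle S x) = tripleCoord E.toVectorBundle S x) := by
  refine ⟨fun h S s x => by rw [h], fun h => Quad.ext_of_fixed fun S s t => ?_⟩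
  simpa only [LinearEquiv.apply_symm_apply] using
    h S s ((tripleCoord E.toVectorBundle S).symm t)

/-- A rank two subbundle of `𝒪 ⊕ E ⊕ 𝒪` containing symplectic pairs locally has coordinates. -/
theorem exists_quad {E : SympBundle X 2} {T : Over X} {W : VectorBundle T.left 2}
    {j : BundleMap T.hom W (tripleBundle E.toVectorBundle)} (hj : j.IsSubbundle)
    (hloc : ∀ t : T.left, ∃ U : T.left.Opens, t ∈ U ∧
      ∃ x₁ x₂ : resOver T U ⟶ (tripleBundle E.toVectorBundle).tot,
      Lies j (resι T U) x₁ ∧ Lies j (resι T U) x₂ ∧ tripleForm (E.form _)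
        (tripleCoord E.toVectorBundle _ x₁) (tripleCoord E.toVectorBundle _ x₂) = 1) :
    ∃ q : Quad E T, HasCoord j (𝟙 T) q := by
  -- Coordinates are unique because they are recovered from the vectors they fix, so the coordinates
  -- of local pairs glue even though the pairs do not.
  obtain ⟨q, hq⟩ := Quad.exists_glue (T := T) (E := E)
    (fun {T'} s q => HasCoord j s q)
    (fun r s q h S r' x => by rw [Quad.map_map, ← Category.assoc]; exact h S (r' ≫ r) x)
    (fun s q q' h h' => Quad.eq_iff_lies.2 fun S r x => (h S r x).symm.trans (h' S r x))
    (fun t => by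
      obtain ⟨U, hU, x₁, x₂, h₁, h₂, h⟩ := hloc t
      refine ⟨U, hU, Quad.ofPair _ _ h, fun S r x => ?_⟩
      have h' : tripleForm (E.form S) (tripleCoord E.toVectorBundle _ (r ≫ x₁))
          (tripleCoord E.toVectorBundle _ (r ≫ x₂)) = 1 := by
        rw [tripleCoord_comp, tripleCoord_comp, tripleForm_map, h, map_one]
      rw [lies_iff_ofPair (h₁.comp r) (h₂.comp r) h', Quad.ofPair_map]
      simp only [tripleCoord_comp])
  refine ⟨q, fun S s x => ?_⟩
  rw [Category.comp_id]
  have key (t : S.left) : ∃ U : S.left.Opens, t ∈ U ∧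
      (Lies j (resι S U ≫ s) (resι S U ≫ x) ↔ ((q.map s).map (resι S U)).proj
        (Triple.map (tripleCoord E.toVectorBundle S x) (resι S U)) =
          Triple.map (tripleCoord E.toVectorBundle S x) (resι S U)) := by
    obtain ⟨U, hU, h⟩ := hq (s.left t)
    let r : resOver S (s.left ⁻¹ᵁ U) ⟶ resOver T U := Over.homMk (s.left ∣_ U) (by simp)
    have hr : r ≫ resι T U = resι S (s.left ⁻¹ᵁ U) ≫ s := by
      ext1
      simp [r]
    refine ⟨s.left ⁻¹ᵁ U, hU, ?_⟩
    have := h _ r (resι S (s.left ⁻¹ᵁ U) ≫ x)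
    rwa [hr, Quad.map_map, hr, ← Quad.map_map, tripleCoord_comp] at this
  constructor
  · intro h
    apply (tripleCoord E.toVectorBundle S).symm.injective
    refine over_hom_ext_local fun t => ?_
    obtain ⟨U, hU, hk⟩ := key t
    refine ⟨U, hU, ?_⟩
    rw [tripleCoord_symm_comp, tripleCoord_symm_comp, ← Quad.proj_map, hk.1 (h.comp _)]
  · intro h
    refine lies_of_local hj s x fun t => ?_
    obtain ⟨U, hU, hk⟩ := key t
    exact ⟨U, hU, hk.2 (by rw [Quad.proj_map, h])⟩

/-- The coordinates with respect to a frame. -/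
def VectorBundle.IsFrame.equiv {E : VectorBundle X n} {S : Over X} {b : Fin n → (S ⟶ E.tot)}
    (hb : E.IsFrame b) : (Fin n → Γ(S.left, ⊤)) ≃ₗ[Γ(S.left, ⊤)] (S ⟶ E.tot) :=
  LinearEquiv.ofBijective (Fintype.linearCombination Γ(S.left, ⊤) b) <| by
    have h (v) : ∃! c : Fin n → Γ(S.left, ⊤), v = ∑ i, c i • b i := by
      simpa using hb S (𝟙 S) v
    constructor
    · intro c c' hc
      exact (h (Fintype.linearCombination Γ(S.left, ⊤) b c)).unique
        (Fintype.linearCombination_apply _ _ _)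
        (hc.trans (Fintype.linearCombination_apply _ _ _))
    · intro v
      obtain ⟨c, hc, -⟩ := h v
      exact ⟨c, (Fintype.linearCombination_apply _ _ _).trans hc.symm⟩

theorem VectorBundle.IsFrame.equiv_single {E : VectorBundle X n} {S : Over X}
    {b : Fin n → (S ⟶ E.tot)} (hb : E.IsFrame b) (i : Fin n) :
    hb.equiv (Pi.single i 1) = b i := by
  refine (Fintype.linearCombination_apply_single _ _ _ _).trans ?_
  exact one_smul _ _

theorem SympBundle.exists_pair (W : SympBundle X 2) (t : X) : ∃ U : X.Opens, t ∈ U ∧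
    ∃ w₁ w₂ : Over.mk U.ι ⟶ W.tot, W.form _ w₁ w₂ = 1 := by
  obtain ⟨U, hU, hUa, b, hb⟩ := W.exists_affine_frame t
  refine ⟨U, hU, ?_⟩
  have hnd := W.nondeg (Over.mk U.ι) hUa
  have hb : W.IsFrame b := hb
  -- The vector `w` represents the first coordinate function of the frame, which takes the value one
  -- on `b 0`.
  obtain ⟨w, hw⟩ := hnd.bijective_left.2 (LinearMap.proj 0 ∘ₗ hb.equiv.symm.toLinearMap)
  refine ⟨w, b 0, (LinearMap.congr_fun hw (b 0)).trans ?_⟩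
  change hb.equiv.symm (b 0) 0 = 1
  rw [← hb.equiv_single 0, LinearEquiv.symm_apply_apply, Pi.single_eq_same]

/-- Vectors with equal images under `j` have equal products with every vector of `W`, so over affine
opens they coincide by nondegeneracy. -/
theorem BundleMap.IsIsometric.isSubbundle {Y : Scheme.{u}} {f : Y ⟶ X} {W : SympBundle Y r}
    {F : SympBundle X n} {j : BundleMap f W.toVectorBundle F.toVectorBundle} (hj : j.IsIsometric) :
    j.IsSubbundle := by
  intro S v v' h
  refine over_hom_ext_local fun t => ?_
  obtain ⟨U, hU, htU, -⟩ := exists_isAffineOpen_mem_and_subset (X := S.left) (x := t)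
    (U := ⊤) trivial
  refine ⟨U, htU, ?_⟩
  apply (W.nondeg (resOver S U) hU).bijective_left.1
  refine LinearMap.ext fun w => ?_
  rw [← hj, ← hj, BundleMap.app_comp, BundleMap.app_comp, h]

theorem exists_quad_of_isometric {E : SympBundle X 2} {T : Over X} {W : SympBundle T.left 2}
    {j : BundleMap T.hom W.toVectorBundle (tripleBundle E.toVectorBundle)}
    (hj : BundleMap.IsIsometric (W := W) (E := hypExt E) j) :
    ∃ q : Quad E T, HasCoord j (𝟙 T) q := by
  refine exists_quad (BundleMap.IsIsometric.isSubbundle hj) fun t => ?_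
  obtain ⟨U, hU, w₁, w₂, h⟩ := W.exists_pair t
  exact ⟨U, hU, j.app _ w₁, j.app _ w₂, lies_app j w₁, lies_app j w₂, (hj _ _ _).trans h⟩

theorem Quad.hasCoord_incl {E : SympBundle X 2} {T : Over X} (q : Quad E T) :
    HasCoord q.incl (𝟙 T) q := fun S s x => by
  rw [Category.comp_id]
  exact q.lies_incl_iff s x

/-- A morphism classifies a subbundle if and only if it has the right coordinates. -/
theorem HasCoord.classifies_iff {E : SympBundle X 2} {Y T : Over X} {𝒰 : VectorBundle Y.left 2}
    {ι : BundleMap Y.hom 𝒰 (tripleBundle E.toVectorBundle)} (hι : ι.IsSubbundle)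
    {W : VectorBundle T.left 2} {j : BundleMap T.hom W (tripleBundle E.toVectorBundle)}
    (hj : j.IsSubbundle) {p : Quad E Y} {q : Quad E T} (hp : HasCoord ι (𝟙 Y) p)
    (hq : HasCoord j (𝟙 T) q) (g : T ⟶ Y) : Classifies ι W j.left g ↔ p.map g = q := by
  rw [Symplectic.classifies_iff hι hj, Quad.eq_iff_lies]
  refine forall_congr' fun S => forall_congr' fun s => forall_congr' fun x => ?_
  have h1 := hq S s x
  have h2 := hp S (s ≫ g) x
  rw [Category.comp_id] at h1 h2
  rw [h1, h2, Quad.map_map]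
  exact Iff.comm

end Pairs

/-! ### The quaternionic projective bundle -/

section HP

variable {X : Scheme.{u}} (E : SympBundle X 2)

/-- The universal coordinates. -/
def univQuad : Quad E (quadScheme E) := quadEquiv E _ (𝟙 _)

theorem univQuad_map {T : Over X} (g : T ⟶ quadScheme E) : (univQuad E).map g = quadEquiv E T g := by
  rw [univQuad, ← quadEquiv_comp, Category.comp_id]

/-- The quaternionic projective bundle of `𝒪 ⊕ E ⊕ 𝒪` as the scheme of coordinates. -/
def quadHP : HPBundle (hypExt E) where
  tot := quadScheme E
  taut := (univQuad E).bundle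
  incl := (univQuad E).incl
  isometric := (univQuad E).incl_isIsometric
  existsUnique T W j hj := by
    obtain ⟨q, hq⟩ := exists_quad_of_isometric hj
    have key (g : T ⟶ quadScheme E) :
        Classifies (univQuad E).incl W.toVectorBundle j.left g ↔ quadEquiv E T g = q := by
      rw [← univQuad_map]
      exact HasCoord.classifies_iff (univQuad E).incl_isSubbundle (BundleMap.IsIsometric.isSubbundle hj)
        (univQuad E).hasCoord_incl hq g
    obtain ⟨g, hg, hg'⟩ := (quadEquiv E T).bijective.existsUnique q
    exact ⟨g, (key g).2 hg, fun g' h => hg' g' ((key g').1 h)⟩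

namespace HPBundle

variable {E} (P : HPBundle (hypExt E))

/-- The coordinates of the tautological bundle. -/
def quad : Quad E P.tot := (exists_quad_of_isometric P.isometric).choose

/-- The inclusion of the tautological bundle into `𝒪 ⊕ E ⊕ 𝒪`. -/
abbrev inclTriple : BundleMap P.tot.hom P.taut.toVectorBundle (tripleBundle E.toVectorBundle) :=
  P.incl

theorem hasCoord : HasCoord P.inclTriple (𝟙 _) P.quad :=
  (exists_quad_of_isometric P.isometric).choose_spec

theorem lies_iff {T : Over X} (s : T ⟶ P.tot) (x : T ⟶ (tripleBundle E.toVectorBundle).tot) :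
    Lies P.inclTriple s x ↔
    (P.quad.map s).proj (tripleCoord E.toVectorBundle T x) = tripleCoord E.toVectorBundle T x := by
  have := P.hasCoord T s x
  rwa [Category.comp_id] at this

theorem isSubbundle : P.inclTriple.IsSubbundle := BundleMap.IsIsometric.isSubbundle P.isometric

/-- The universal property of `P` is applied to the subbundle cut out by the projector of `q`. Every
model of the projective bundle thereby represents coordinates, and all later computations can use an
arbitrary model. -/
theorem existsUnique_quad {T : Over X} (q : Quad E T) : ∃! g : T ⟶ P.tot, P.quad.map g = q := by
  obtain ⟨g, hg, hg'⟩ := P.existsUnique T q.bundle q.incl q.incl_isIsometric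
  have key := HasCoord.classifies_iff P.isSubbundle q.incl_isSubbundle P.hasCoord q.hasCoord_incl
  exact ⟨g, (key g).1 hg, fun g' h => hg' g' ((key g').2 h)⟩

/-- The points of a quaternionic projective bundle. -/
def equiv (T : Over X) : (T ⟶ P.tot) ≃ Quad E T :=
  Equiv.ofBijective (fun g => P.quad.map g)
    ((Function.bijective_iff_existsUnique _).2 fun q => P.existsUnique_quad q)

theorem equiv_apply {T : Over X} (g : T ⟶ P.tot) : P.equiv T g = P.quad.map g := rfl

theorem equiv_comp {T T' : Over X} (s : T' ⟶ T) (g : T ⟶ P.tot) :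
    P.equiv T' (s ≫ g) = (P.equiv T g).map s := (Quad.map_map _ _ _).symm

theorem quad_map_equiv_symm {T : Over X} (q : Quad E T) : P.quad.map ((P.equiv T).symm q) = q :=
  (P.equiv T).apply_symm_apply q

/-- The comparison with the scheme of coordinates. -/
def isoQuadScheme : P.tot ≅ quadScheme E where
  hom := (quadEquiv E _).symm P.quad
  inv := (P.equiv _).symm (univQuad E)
  hom_inv_id := (P.equiv _).injective (by
    rw [equiv_comp, Equiv.apply_symm_apply, univQuad_map, Equiv.apply_symm_apply, equiv_apply,
      Quad.map_id])
  inv_hom_id := (quadEquiv E _).injective (by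
    rw [quadEquiv_comp, Equiv.apply_symm_apply, quad_map_equiv_symm]
    rfl)

instance isAffineHom_tot : IsAffineHom P.tot.hom := by
  have h : P.isoQuadScheme.hom.left ≫ (quadScheme E).hom = P.tot.hom :=
    Over.w P.isoQuadScheme.hom
  rw [← h]
  exact isAffineHom_comp _ _
    (inferInstanceAs (IsAffineHom ((Over.forget X).mapIso P.isoQuadScheme).hom))
    (isAffineHom_quadScheme E)

end HPBundle

end HP

/-! ### Open subschemes of Grassmannian bundles -/

section Grassmannian

variable {X : Scheme.{u}} {n r : ℕ} {E : VectorBundle X n}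

/-- The restriction of a morphism over an open subset of the target. -/
def resPull {T T' : Over X} (g : T' ⟶ T) (U : T.left.Opens) :
    resOver T' (g.left ⁻¹ᵁ U) ⟶ resOver T U :=
  Over.homMk (g.left ∣_ U) (by simp)

theorem resPull_ι {T T' : Over X} (g : T' ⟶ T) (U : T.left.Opens) :
    resPull g U ≫ resι T U = resι T' (g.left ⁻¹ᵁ U) ≫ g := by
  ext1
  simp [resPull]

theorem Lies.eq_sum {T : Over X} {W : VectorBundle T.left r} {j : BundleMap T.hom W E}
    {U : T.left.Opens} (b : Fin r → (Over.mk U.ι ⟶ W.tot)) (hb : W.IsFrame b) {S : Over X}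
    (s : S ⟶ resOver T U) {x : S ⟶ E.tot} (hx : Lies j (s ≫ resι T U) x) :
    ∃ c : Fin r → Γ(S.left, ⊤), x = ∑ i, c i • (s ≫ (show resOver T U ⟶ E.tot from j.app _ (b i))) := by
  obtain ⟨u, hu⟩ := (lies_iff _ _ _).1 hx
  let g : Over.mk (s ≫ resι T U).left ⟶ Over.mk U.ι := Over.homMk s.left
  obtain ⟨c, hc, -⟩ := hb _ g u
  refine ⟨c, ?_⟩
  have h1 : x = fwdHom (s ≫ resι T U) ≫ j.app _ u := by
    rw [hu, ← Category.assoc, fwdHom_backHom, Category.id_comp]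
  have h2 : j.app _ u = ∑ i, (show Γ(((Over.map T.hom).obj
      (Over.mk (s ≫ resι T U).left)).left, ⊤) from c i) • ((Over.map T.hom).map g ≫ j.app _ (b i)) := by
    rw [hc]
    have h3 := map_sum (AddMonoidHom.mk' (j.app _) fun v v' => j.app_add v v')
      (fun i => c i • (g ≫ b i)) Finset.univ
    refine h3.trans (Finset.sum_congr rfl fun i _ => ?_)
    refine (j.app_smul _ _).trans ?_
    rw [← BundleMap.app_comp]
  rw [h1, h2, E.comp_sum]
  refine Finset.sum_congr rfl fun i _ => ?_
  rw [E.comp_smul]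
  congr 1

theorem lies_comp_iff {T T' : Over X} {W : VectorBundle T.left r} {j : BundleMap T.hom W E}
    (hj : j.IsSubbundle) (t : T' ⟶ T) {W' : VectorBundle T'.left r} {c : BundleMap t.left W' W}
    (hc : c.IsCartesian) {S : Over X} (s : S ⟶ T') (x : S ⟶ E.tot) :
    Lies (c.comp j (Over.w t)) s x ↔ Lies j (s ≫ t) x :=
  (classifies_iff hj (BundleMap.IsSubbundle.comp (fun T => (hc T).1) hj (Over.w t)) t).1
    ⟨c, hc, (BundleMap.comp_left _ _ _).symm⟩ S s x

/-- A criterion for being open in a Grassmannian bundle: the subscheme where a function `Ω` of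
frames is invertible. -/
theorem isOpenInGrassmannian_of_function {Y : Over X} {𝒰 : VectorBundle Y.left r}
    {ι : BundleMap Y.hom 𝒰 E} (hι : ι.IsSubbundle)
    (Ω : ∀ S : Over X, (Fin r → (S ⟶ E.tot)) → Γ(S.left, ⊤))
    (hΩ : ∀ {S S' : Over X} (g : S' ⟶ S) (b : Fin r → (S ⟶ E.tot)),
      Ω S' (fun i => g ≫ b i) = g.left.appTop (Ω S b))
    (hdvd : ∀ (S : Over X) (b w : Fin r → (S ⟶ E.tot)) (c : Fin r → Fin r → Γ(S.left, ⊤)),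
      (∀ i, w i = ∑ k, c i k • b k) → Ω S b ∣ Ω S w)
    (hY : ∀ y : Y.left, ∃ U : Y.left.Opens, y ∈ U ∧ ∃ b : Fin r → (resOver Y U ⟶ E.tot),
      (∀ i, Lies ι (resι Y U) (b i)) ∧ IsUnit (Ω _ b))
    (hclass : ∀ (T : Over X) (W : VectorBundle T.left r) (j : BundleMap T.hom W E),
      j.IsSubbundle → (∀ t : T.left, ∃ U : T.left.Opens, t ∈ U ∧
        ∃ b : Fin r → (resOver T U ⟶ E.tot), (∀ i, Lies j (resι T U) (b i)) ∧ IsUnit (Ω _ b)) →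
      ∃! g : T ⟶ Y, Classifies ι W j.left g) :
    IsOpenInGrassmannian E r Y := by
  refine ⟨𝒰, ι, hι, fun T W j hj => ?_⟩
  refine ⟨⟨{t | ∃ U : T.left.Opens, t ∈ U ∧ ∃ b : Fin r → (resOver T U ⟶ E.tot),
    (∀ i, Lies j (resι T U) (b i)) ∧ IsUnit (Ω _ b)}, ?_⟩, fun T' t W' c hc => ?_⟩
  · refine isOpen_iff_forall_mem_open.2 fun t ⟨U, hU, hb⟩ => ⟨U, fun t' ht' => ⟨U, ht', hb⟩, U.2, hU⟩
  rw [← BundleMap.comp_left c j (Over.w t)]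
  have hsub : (c.comp j (Over.w t)).IsSubbundle :=
    BundleMap.IsSubbundle.comp (fun T => (hc T).1) hj (Over.w t)
  constructor
  · intro ht
    refine hclass T' W' _ hsub fun t' => ?_
    obtain ⟨U, hU, b, hb, hu⟩ := ht ⟨t', rfl⟩
    refine ⟨t.left ⁻¹ᵁ U, hU, fun i => resPull t U ≫ b i, fun i => ?_, ?_⟩
    · rw [lies_comp_iff hj t hc, ← resPull_ι]
      exact (hb i).comp _
    · rw [hΩ]
      exact hu.map _
  -- The test vectors now live on `Y`; they have to be traded for vectors of `W` over an open subset
  -- of `T`, namely a local frame of `W`.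
  · rintro ⟨g, hg⟩ _ ⟨t', rfl⟩
    rw [classifies_iff hι hsub] at hg
    obtain ⟨U, hU, b, hb, hu⟩ := hY (g.left t')
    obtain ⟨U', hU', e, he⟩ := W.exists_frame (t.left t')
    let V : T'.left.Opens := g.left ⁻¹ᵁ U ⊓ t.left ⁻¹ᵁ U'
    let s₁ : resOver T' V ⟶ resOver Y U :=
      resLE T' inf_le_left ≫ resPull g U
    let s₂ : resOver T' V ⟶ resOver T U' :=
      resLE T' inf_le_right ≫ resPull t U'
    have h₁ : s₁ ≫ resι Y U = resι T' V ≫ g := by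
      rw [Category.assoc, resPull_ι, ← Category.assoc, resLE_ι]
    have h₂ : s₂ ≫ resι T U' = resι T' V ≫ t := by
      rw [Category.assoc, resPull_ι, ← Category.assoc, resLE_ι]
    have hl (i) : Lies j (s₂ ≫ resι T U') (s₁ ≫ b i) := by
      rw [h₂, ← lies_comp_iff hj t hc, hg, ← h₁]
      exact (hb i).comp s₁
    choose c hc using fun i => (hl i).eq_sum e he s₂
    let e' (i : Fin r) : resOver T U' ⟶ E.tot := j.app _ (e i)
    -- The test vectors pulled back from `Y` are combinations of the frame of `W`, so `Ω` of the
    -- frame divides a unit.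
    have hd : IsUnit (Ω (resOver T' V) fun i => s₂ ≫ e' i) := by
      refine isUnit_of_dvd_unit (hdvd _ _ _ c hc) ?_
      rw [hΩ]
      exact hu.map _
    rw [hΩ] at hd
    have hmem : (⟨t.left t', hU'⟩ : U'.toScheme) ∈ U'.toScheme.basicOpen (Ω _ e') := by
      have h3 : s₂.left ⁻¹ᵁ (U'.toScheme.basicOpen (Ω _ e')) = ⊤ :=
        (Scheme.preimage_basicOpen _ _).trans (Scheme.basicOpen_of_isUnit _ hd)
      have h4 : (⟨t', hU, hU'⟩ : V.toScheme) ∈ s₂.left ⁻¹ᵁ (U'.toScheme.basicOpen (Ω _ e')) := by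
        rw [h3]; trivial
      have h5 : s₂.left (⟨t', hU, hU'⟩ : V.toScheme) = (⟨t.left t', hU'⟩ : U'.toScheme) := by
        apply Subtype.ext
        have := congrArg (fun f => f.left (⟨t', hU, hU'⟩ : V.toScheme)) h₂
        exact this
      rw [← h5]
      exact h4
    -- The locus where `Ω` of the frame is invertible is open in `T`; it contains the image of `t'`.
    let D : T.left.Opens := U'.ι ''ᵁ (U'.toScheme.basicOpen (Ω _ e'))
    have hD : D ≤ U' := by
      rintro _ ⟨y, -, rfl⟩
      exact y.2
    refine ⟨D, ⟨_, hmem, rfl⟩, fun i => resLE T hD ≫ e' i, fun i => ?_, ?_⟩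
    · rw [← resLE_ι T hD]
      exact (lies_app j (e i)).comp (resLE T hD)
    · rw [hΩ]
      apply isUnit_of_basicOpen_eq_top
      rw [← Scheme.preimage_basicOpen_top]
      refine top_le_iff.1 ?_
      rintro ⟨_, y, hy, rfl⟩ -
      have h5 : (resLE T hD).left (⟨U'.ι y, y, hy, rfl⟩ : D.toScheme) = y := by
        apply Subtype.ext
        exact congrArg (fun f => f.left (⟨U'.ι y, y, hy, rfl⟩ : D.toScheme)) (resLE_ι T hD)
      refine (congrArg (· ∈ U'.toScheme.basicOpen (Ω _ e')) h5).mpr ?_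
      exact hy

end Grassmannian

/-! ### Vector bundles as open subschemes of projective bundles -/

section AddTrivial

variable {X : Scheme.{u}} {n : ℕ}

/-- The points of the trivial line bundle. -/
def lineBundleEquiv (X : Scheme.{u}) (T : Over X) :
    (T ⟶ lineOver (Over.mk (𝟙 X))) ≃ Γ(T.left, ⊤) :=
  (lineEquiv (Over.mk (𝟙 X)) T).trans
    { toFun := fun p => p.2
      invFun := fun c => (Over.homMk T.hom (Category.comp_id _), c)
      left_inv := fun p => Prod.ext (by
        ext1
        exact ((Category.comp_id _).symm.trans (Over.w p.1)).symm) rfl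
      right_inv := fun _ => rfl }

theorem lineBundleEquiv_comp {T T' : Over X} (g : T' ⟶ T) (v : T ⟶ lineOver (Over.mk (𝟙 X))) :
    lineBundleEquiv X T' (g ≫ v) = g.left.appTop (lineBundleEquiv X T v) :=
  congrArg Prod.snd (lineEquiv_comp (Over.mk (𝟙 X)) g v)

/-- The trivial line bundle. -/
def lineBundle (X : Scheme.{u}) : VectorBundle X 1 :=
  VectorBundle.ofEquiv (lineOver (Over.mk (𝟙 X))) (fun T => Γ(T.left, ⊤)) (lineBundleEquiv X)
    (fun g m => g.left.appTop m) lineBundleEquiv_comp (fun g m m' => map_add _ _ _)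
    (fun g a m => map_mul _ _ _)
    (fun x => ⟨⊤, trivial, fun _ => 1, fun T g v => by
      refine ⟨fun _ => v, ?_, fun c hc => ?_⟩
      · simp
      · funext i
        have : v = ∑ i, c i • g.left.appTop 1 := hc
        rw [this, Subsingleton.elim i 0]
        simp⟩)

/-- The coordinate on the trivial line bundle. -/
def lineCoord (T : Over X) : (T ⟶ (lineBundle X).tot) ≃ₗ[Γ(T.left, ⊤)] Γ(T.left, ⊤) :=
  { lineBundleEquiv X T with
    map_add' := fun _ _ => (lineBundleEquiv X T).apply_symm_apply _
    map_smul' := fun _ _ => (lineBundleEquiv X T).apply_symm_apply _ }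

theorem lineCoord_comp {T T' : Over X} (g : T' ⟶ T) (v : T ⟶ (lineBundle X).tot) :
    lineCoord T' (g ≫ v) = g.left.appTop (lineCoord T v) := lineBundleEquiv_comp g v

variable (E : VectorBundle X n)

/-- The bundle `E ⊕ 𝒪`. -/
def addTrivial : VectorBundle X (n + 1) :=
  VectorBundle.ofEquiv (lineOver E.tot) (fun T => (T ⟶ E.tot) × Γ(T.left, ⊤)) (lineEquiv E.tot)
    (fun g m => (g ≫ m.1, g.left.appTop m.2)) (lineEquiv_comp E.tot)
    (fun g m m' => Prod.ext (E.comp_add _ _ _) (map_add _ _ _))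
    (fun g a m => Prod.ext (E.comp_smul _ _ _) (map_mul _ _ _))
    (fun x => by
      obtain ⟨U, hx, b, hb⟩ := E.exists_frame x
      refine ⟨U, hx, Fin.snoc (fun i => (b i, 0)) (0, 1), fun T g v => ?_⟩
      have key : ∀ c : Fin (n + 1) → Γ(T.left, ⊤),
          (∑ i, c i • ((fun m : (Over.mk U.ι ⟶ E.tot) × Γ((Over.mk U.ι).left, ⊤) =>
            ((g ≫ m.1, g.left.appTop m.2) : (T ⟶ E.tot) × Γ(T.left, ⊤)))
            ((Fin.snoc (fun i => (b i, 0)) (0, 1) :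
              Fin (n + 1) → (Over.mk U.ι ⟶ E.tot) × Γ((Over.mk U.ι).left, ⊤)) i))) =
          (∑ i : Fin n, c i.castSucc • (g ≫ b i), c (Fin.last n)) := by
        intro c
        rw [Fin.sum_univ_castSucc]
        simp only [Fin.snoc_castSucc, Fin.snoc_last, map_one,
          map_zero, E.comp_zero, Prod.smul_mk, smul_zero, smul_eq_mul, mul_one]
        refine Prod.ext ?_ ?_
        · simp [Prod.fst_sum]
        · simp [Prod.snd_sum]
      obtain ⟨c, hc, hc'⟩ := hb T g v.1
      refine ⟨(Fin.snoc c v.2 : Fin (n + 1) → Γ(T.left, ⊤)), ?_, ?_⟩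
      · refine Eq.trans ?_ (key _).symm
        refine Prod.ext ?_ ?_
        · simpa using hc
        · simp
      · intro d hd
        have hd' := hd.trans (key d)
        have h2 : v.1 = ∑ i : Fin n, d i.castSucc • (g ≫ b i) := congrArg (fun p => p.1) hd'
        have h3 : v.2 = d (Fin.last n) := congrArg (fun p => p.2) hd'
        have h4 := hc' (fun i => d i.castSucc) h2
        funext i
        refine Fin.lastCases ?_ (fun i => ?_) i
        · simp [h3]
        · simp [← h4])

/-- The coordinates on `E ⊕ 𝒪`. -/
def addTrivialCoord (T : Over X) :
    (T ⟶ (addTrivial E).tot) ≃ₗ[Γ(T.left, ⊤)] (T ⟶ E.tot) × Γ(T.left, ⊤) :=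
  { lineEquiv E.tot T with
    map_add' := fun _ _ => (lineEquiv E.tot T).apply_symm_apply _
    map_smul' := fun _ _ => (lineEquiv E.tot T).apply_symm_apply _ }

theorem addTrivialCoord_comp {T T' : Over X} (g : T' ⟶ T) (v : T ⟶ (addTrivial E).tot) :
    addTrivialCoord E T' (g ≫ v) =
      (g ≫ (addTrivialCoord E T v).1, g.left.appTop (addTrivialCoord E T v).2) :=
  lineEquiv_comp E.tot g v

theorem addTrivialCoord_symm_comp {T T' : Over X} (g : T' ⟶ T)
    (v : (T ⟶ E.tot) × Γ(T.left, ⊤)) :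
    g ≫ (addTrivialCoord E T).symm v =
      (addTrivialCoord E T').symm (g ≫ v.1, g.left.appTop v.2) := by
  apply (addTrivialCoord E T').injective
  rw [addTrivialCoord_comp, LinearEquiv.apply_symm_apply, LinearEquiv.apply_symm_apply]

/-- The coordinates of the line spanned by `(v, 1)`. -/
def graphPoint (S : Over E.tot.left) (v : S ⟶ (lineBundle E.tot.left).tot) :
    ((Over.map E.tot.hom).obj S ⟶ E.tot) × Γ(((Over.map E.tot.hom).obj S).left, ⊤) :=
  (show Γ(((Over.map E.tot.hom).obj S).left, ⊤) from lineCoord S v) • (structHom S, 1)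

theorem graphPoint_comp {S S' : Over E.tot.left} (g : S' ⟶ S)
    (v : S ⟶ (lineBundle E.tot.left).tot) : graphPoint E S' (g ≫ v) =
      ((Over.map E.tot.hom).map g ≫ (graphPoint E S v).1,
        ((Over.map E.tot.hom).map g).left.appTop (graphPoint E S v).2) := by
  refine Prod.ext ?_ ?_
  · change (show Γ(((Over.map E.tot.hom).obj S').left, ⊤) from lineCoord S' (g ≫ v)) • structHom S' =
      (Over.map E.tot.hom).map g ≫
        ((show Γ(((Over.map E.tot.hom).obj S).left, ⊤) from lineCoord S v) • structHom S)
    rw [E.comp_smul, lineCoord_comp]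
    congr 1
    ext1
    exact (Over.w g).symm
  · change lineCoord S' (g ≫ v) * 1 = ((Over.map E.tot.hom).map g).left.appTop (_ * 1)
    rw [mul_one, mul_one, lineCoord_comp]
    rfl

/-- The tautological line in `E ⊕ 𝒪` over `E`. -/
def graphIncl : BundleMap E.tot.hom (lineBundle E.tot.left) (addTrivial E) :=
  BundleMap.ofPoints (fun S v => (addTrivialCoord E _).symm (graphPoint E S v))
    (fun g v => by rw [graphPoint_comp, addTrivialCoord_symm_comp])
    (fun S v v' => by
      rw [← map_add]
      congr 1
      rw [graphPoint, map_add]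
      exact add_smul _ _ _)
    (fun S a v => by
      rw [← map_smul]
      congr 1
      rw [graphPoint, map_smul]
      exact mul_smul _ _ _)

theorem addTrivialCoord_graphIncl_app (S : Over E.tot.left)
    (v : S ⟶ (lineBundle E.tot.left).tot) :
    addTrivialCoord E _ ((graphIncl E).app S v) = graphPoint E S v := by
  rw [BundleMap.app_eq (graphIncl E) (fun S v => (addTrivialCoord E _).symm (graphPoint E S v))
    (fun g v => by rw [graphPoint_comp, addTrivialCoord_symm_comp]) rfl S v,
    LinearEquiv.apply_symm_apply]

theorem graphPoint_snd (S : Over E.tot.left) (v : S ⟶ (lineBundle E.tot.left).tot) :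
    (graphPoint E S v).2 = lineCoord S v := mul_one _

theorem graphIncl_isSubbundle : (graphIncl E).IsSubbundle := by
  intro S v v' h
  apply (lineCoord S).injective
  rw [← graphPoint_snd, ← graphPoint_snd, ← addTrivialCoord_graphIncl_app,
    ← addTrivialCoord_graphIncl_app, h]

theorem lies_graphIncl_iff {T : Over X} (s : T ⟶ E.tot) (x : T ⟶ (addTrivial E).tot) :
    Lies (graphIncl E) s x ↔
      addTrivialCoord E T x = (addTrivialCoord E T x).2 • (s, 1) := by
  rw [lies_iff]
  constructor
  · rintro ⟨u, hu⟩
    have h1 : x = fwdHom s ≫ (graphIncl E).app _ u := by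
      rw [hu, ← Category.assoc, fwdHom_backHom, Category.id_comp]
    have h2 : fwdHom s ≫ structHom (Over.mk s.left) = s := by
      ext1; exact Category.id_comp _
    have h3 (c : Γ(((Over.map E.tot.hom).obj (Over.mk s.left)).left, ⊤)) :
        fwdHom s ≫ (c • structHom (Over.mk s.left)) = (fwdHom s).left.appTop (c * 1) • s := by
      rw [E.comp_smul, h2, mul_one]
    rw [h1, addTrivialCoord_comp, addTrivialCoord_graphIncl_app]
    refine Prod.ext ?_ (mul_one _).symm
    exact h3 _
  · intro h
    refine ⟨(lineCoord _).symm (addTrivialCoord E T x).2, ?_⟩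
    apply (addTrivialCoord E _).injective
    rw [addTrivialCoord_comp, addTrivialCoord_graphIncl_app, graphPoint,
      LinearEquiv.apply_symm_apply, congrArg Prod.fst h]
    have : (backHom s).left.appTop (addTrivialCoord E T x).2 = (addTrivialCoord E T x).2 := by
      simp [backHom]
    refine Prod.ext ?_ ?_
    · refine Eq.trans ?_ (E.comp_smul (backHom s) _ s).symm
      rw [backHom_comp]
      exact congrArg (· • structHom (Over.mk s.left)) this.symm
    · exact (mul_one _).trans this.symm

theorem Lies.rank_one {T : Over X} {W : VectorBundle T.left 1} {F : VectorBundle X n}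
    {j : BundleMap T.hom W F} {S : Over X} {s : S ⟶ T} {x x' : S ⟶ F.tot}
    (hx : Lies j s x) (hx' : Lies j s x')
    (l : ∀ S : Over X, (S ⟶ F.tot) →ₗ[Γ(S.left, ⊤)] Γ(S.left, ⊤))
    (hl : ∀ {S S' : Over X} (g : S' ⟶ S) (x : S ⟶ F.tot), l S' (g ≫ x) = g.left.appTop (l S x)) :
    l S x • x' = l S x' • x := by
  refine over_hom_ext_local fun t => ?_
  obtain ⟨U, hU, b, hb⟩ := W.exists_frame (s.left t)
  refine ⟨s.left ⁻¹ᵁ U, hU, ?_⟩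
  have h (y) (hy : Lies j s y) := Lies.eq_sum b hb (resPull s U) (by
    rw [resPull_ι]
    exact hy.comp (resι S (s.left ⁻¹ᵁ U)))
  obtain ⟨c, hc⟩ := h x hx
  obtain ⟨c', hc'⟩ := h x' hx'
  rw [Fin.sum_univ_one] at hc hc'
  rw [F.comp_smul, F.comp_smul, ← hl, ← hl, hc, hc', map_smul, map_smul, smul_smul, smul_smul,
    smul_eq_mul, smul_eq_mul]
  congr 1
  ring

/-- A vector bundle `E` is an open subscheme of the projective bundle of `E ⊕ 𝒪`. -/
theorem isOpenInGrassmannian_tot : IsOpenInGrassmannian (addTrivial E) 1 E.tot := by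
  -- Here `Ω` is the `𝒪`-component of a generator. It is invertible exactly where the line is
  -- spanned by some `(v, 1)`, and then `v` is the corresponding point of `E`.
  refine isOpenInGrassmannian_of_function (graphIncl_isSubbundle E)
    (fun S b => (addTrivialCoord E S (b 0)).2) (fun g b => by rw [addTrivialCoord_comp])
    (fun S b w c h => ⟨c 0 0, ?_⟩) (fun y => ⟨⊤, trivial,
      fun _ => (addTrivialCoord E _).symm (resι E.tot ⊤, 1), fun _ => ?_, ?_⟩)
    (fun T W j hj hloc => ?_)
  · rw [h, Fin.sum_univ_one, map_smul]
    exact mul_comm _ _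
  · rw [lies_graphIncl_iff, LinearEquiv.apply_symm_apply, one_smul]
  · rw [LinearEquiv.apply_symm_apply]
    exact isUnit_one
  have huniq {S : Over X} (s : S ⟶ T) {g g' : S ⟶ E.tot}
      (h : Lies j s ((addTrivialCoord E S).symm (g, 1)))
      (h' : Lies j s ((addTrivialCoord E S).symm (g', 1))) : g = g' := by
    have := h.rank_one h' (fun S => LinearMap.snd _ _ _ ∘ₗ (addTrivialCoord E S).toLinearMap)
      (fun g x => congrArg Prod.snd (addTrivialCoord_comp E g x))
    simp only [LinearMap.comp_apply, LinearEquiv.coe_coe, LinearEquiv.apply_symm_apply,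
      LinearMap.snd_apply, one_smul] at this
    exact (congrArg Prod.fst ((addTrivialCoord E S).symm.injective this)).symm
  obtain ⟨g, hg⟩ := over_exists_glue (T := T) (Y := E.tot)
    (fun {S} s g => Lies j s ((addTrivialCoord E S).symm (g, 1)))
    (fun r s g h => by
      have := h.comp r
      rwa [addTrivialCoord_symm_comp, map_one] at this) (fun s g g' h h' => huniq s h h')
    (fun t => by
      obtain ⟨U, hU, b, hb, hu⟩ := hloc t
      obtain ⟨r, hr⟩ := hu.exists_left_inv
      -- Dividing the generator by its invertible last component normalises it to the form `(v, 1)`.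
      refine ⟨U, hU, r • (addTrivialCoord E _ (b 0)).1, ?_⟩
      have := (hb 0).smul r
      convert this using 1
      apply (addTrivialCoord E _).injective
      rw [LinearEquiv.apply_symm_apply, map_smul]
      exact Prod.ext rfl hr.symm)
  have hg1 : Lies j (𝟙 T) ((addTrivialCoord E T).symm (g, 1)) := lies_of_local hj _ _ fun t => by
    obtain ⟨U, hU, h⟩ := hg t
    refine ⟨U, hU, ?_⟩
    rwa [addTrivialCoord_symm_comp, map_one, Category.comp_id]
  have hg2 {S : Over X} (s : S ⟶ T) : Lies j s ((addTrivialCoord E S).symm (s ≫ g, 1)) := by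
    have := hg1.comp s
    rwa [addTrivialCoord_symm_comp, map_one, Category.comp_id] at this
  refine ⟨g, (classifies_iff (graphIncl_isSubbundle E) hj g).2 fun S s x => ?_, fun g' hg' => ?_⟩
  · rw [lies_graphIncl_iff]
    constructor
    · intro h
      have := (hg2 s).rank_one h (fun S => LinearMap.snd _ _ _ ∘ₗ (addTrivialCoord E S).toLinearMap)
        (fun g x => congrArg Prod.snd (addTrivialCoord_comp E g x))
      simp only [LinearMap.comp_apply, LinearEquiv.coe_coe, LinearEquiv.apply_symm_apply,
        LinearMap.snd_apply, one_smul, ← map_smul] at this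
      exact (congrArg (addTrivialCoord E S) this).trans (LinearEquiv.apply_symm_apply _ _)
    · intro h
      have := (hg2 s).smul (addTrivialCoord E S x).2
      rwa [← map_smul, ← h, LinearEquiv.symm_apply_apply] at this
  · have h := (classifies_iff (graphIncl_isSubbundle E) hj g').1 hg'
    refine huniq (𝟙 T) ((h T (𝟙 T) _).2 ?_) hg1
    rw [lies_graphIncl_iff, LinearEquiv.apply_symm_apply, one_smul, Category.id_comp]

end AddTrivial

/-! ### Schemes in `𝒱` -/

section Membership

variable {X : Scheme.{u}}

/-- `HP_X(𝒪 ⊕ E ⊕ 𝒪)` is an open subscheme of the Grassmannian bundle. -/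
theorem isOpenInGrassmannian_HP {E : SympBundle X 2} (P : HPBundle (hypExt E)) :
    IsOpenInGrassmannian (tripleBundle E.toVectorBundle) 2 P.tot := by
  let Ω (S : Over X) (b : Fin 2 → (S ⟶ (tripleBundle E.toVectorBundle).tot)) : Γ(S.left, ⊤) :=
    tripleForm (E.form S) (tripleCoord E.toVectorBundle S (b 0)) (tripleCoord E.toVectorBundle S (b 1))
  refine isOpenInGrassmannian_of_function P.isSubbundle Ω
    (fun g b => by simp only [Ω, tripleCoord_comp, tripleForm_map])
    -- The product of two vectors changes by the determinant of the transition matrix.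
    (fun S b w c h => ⟨c 0 0 * c 1 1 - c 0 1 * c 1 0, ?_⟩) (fun y => ?_)
    (fun T W j hj hloc => ?_)
  · have hs := tripleForm_self _ (E.form_self S)
    simp only [Ω, h, Fin.sum_univ_two, map_add, map_smul, LinearMap.add_apply,
      LinearMap.smul_apply, hs, smul_eq_mul]
    rw [alt_swap hs (tripleCoord E.toVectorBundle S (b 1))]
    ring
  · obtain ⟨U, hU, w₁, w₂, h⟩ := P.taut.exists_pair y
    refine ⟨U, hU, ![P.inclTriple.app _ w₁, P.inclTriple.app _ w₂], fun i => ?_, ?_⟩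
    · fin_cases i
      · exact lies_app P.inclTriple w₁
      · exact lies_app P.inclTriple w₂
    · have : Ω (resOver P.tot U) ![P.inclTriple.app _ w₁, P.inclTriple.app _ w₂] = 1 :=
        (P.isometric _ w₁ w₂).trans h
      rw [this]
      exact isUnit_one
  · obtain ⟨q, hq⟩ := exists_quad hj fun t => by
      obtain ⟨U, hU, b, hb, hu⟩ := hloc t
      obtain ⟨r, hr⟩ := hu.exists_left_inv
      -- Rescaling one vector turns an invertible product into a symplectic pair, which is what
      -- coordinates require.
      refine ⟨U, hU, r • b 0, b 1, (hb 0).smul r, hb 1, ?_⟩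
      rw [map_smul, map_smul, LinearMap.smul_apply]
      exact hr
    obtain ⟨g, hg, hg'⟩ := P.existsUnique_quad q
    have key := HasCoord.classifies_iff P.isSubbundle hj P.hasCoord hq
    exact ⟨g, (key g).2 hg, fun g' h => hg' g' ((key g').1 h)⟩

variable {k : Scheme.{u}}

namespace SchemeCategory

variable (V : SchemeCategory k)

theorem mem_of_iso {X Y : Over k} (hX : V.mem X) (e : Y ≅ X) : V.mem Y := by
  have : CompactSpace ((Over.forget k).obj X) := V.quasiCompact X hX
  refine V.opens e.hom
    (inferInstanceAs (IsOpenImmersion ((Over.forget k).mapIso e).hom)) ?_ hX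
  exact (Scheme.homeoOfIso ((Over.forget k).mapIso e)).symm.compactSpace

/-- The total space is affine over `X` and is the part of the projective bundle of `E ⊕ 𝒪` where the
last component does not vanish, so the closure property for Grassmannian bundles applies. -/
theorem mem_tot {X : Over k} (hX : V.mem X) {n : ℕ} (E : VectorBundle X.left n) :
    V.mem (overBase E.tot) :=
  V.grassmannian hX (addTrivial E) 1 E.tot E.isAffineHom_tot (isOpenInGrassmannian_tot E)

theorem mem_HP {X : Over k} (hX : V.mem X) {E : SympBundle X.left 2} (P : HPBundle (hypExt E)) :
    V.mem (overBase P.tot) :=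
  V.grassmannian hX (tripleBundle E.toVectorBundle) 2 P.tot P.isAffineHom_tot
    (isOpenInGrassmannian_HP P)

theorem mem_line {X : Over k} (hX : V.mem X) : V.mem (lineOver X) :=
  V.mem_of_iso (V.mem_tot hX (lineBundle X.left))
    (Over.isoMk (Iso.refl _) (by
      change 𝟙 _ ≫ ((𝔸(PUnit.{u + 1}; X.left) ↘ X.left) ≫ 𝟙 X.left) ≫ X.hom = _
      simp))

/-- The fibre square of `E` is the total space of the pullback of `E` to `E`, so membership of total
spaces is used twice. -/
theorem mem_pairScheme {X : Over k} (hX : V.mem X) (E : SympBundle X.left 2) :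
    V.mem (overBase (pairScheme E)) :=
  V.mem_of_iso (V.mem_tot (V.mem_tot hX E.toVectorBundle)
      (VectorBundle.pull E.tot.hom E.toVectorBundle))
    (Over.isoMk (Iso.refl _) (by
      change 𝟙 _ ≫ pullback.snd E.tot.hom E.tot.hom ≫ E.tot.hom ≫ X.hom =
        (pullback.snd E.tot.hom E.tot.hom ≫ E.tot.hom) ≫ X.hom
      simp))

theorem mem_tripleScheme {X : Over k} (hX : V.mem X) (E : SympBundle X.left 2) :
    V.mem (overBase (tripleScheme E)) :=
  V.mem_of_iso (V.mem_line (V.mem_pairScheme hX E)) (Over.isoMk (Iso.refl _) (by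
    change 𝟙 _ ≫ (𝔸(PUnit.{u + 1}; (pairScheme E).left) ↘ (pairScheme E).left) ≫
      (pairScheme E).hom ≫ X.hom = ((𝔸(PUnit.{u + 1}; (pairScheme E).left) ↘
        (pairScheme E).left) ≫ (pairScheme E).hom) ≫ X.hom
    simp))

theorem adm_zeroLocus {X : Over k} (hX : V.mem X) {n : ℕ} (E : VectorBundle X.left n) :
    V.Adm (overBase E.tot) E.zeroLocus :=
  have := V.quasiCompact X hX
  ⟨V.mem_tot hX E, E.isClosed_zeroLocus, E.isCompact_compl_zeroLocus⟩

theorem quasiCompact_hom {X Y : Over k} (hX : V.mem X) (hY : V.mem Y) (f : X ⟶ Y) :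
    QuasiCompact f.left :=
  have := V.quasiCompact X hX
  have := V.quasiSeparated Y hY
  inferInstance

theorem Adm.preimage {V : SchemeCategory k} {X Y : Over k} {Z : Set X.left} (hZ : V.Adm X Z)
    (hY : V.mem Y) (f : Y ⟶ X) : V.Adm Y (f.left ⁻¹' Z) := by
  refine ⟨hY, hZ.2.1.preimage f.left.continuous, ?_⟩
  have := V.quasiCompact_hom hY hZ.1 f
  rw [← Set.preimage_compl]
  exact QuasiCompact.isCompact_preimage (f := f.left) _ hZ.2.1.isOpen_compl hZ.2.2

end SchemeCategory

end Membership

/-! ### The locus `N⁺` and the inclusion of `E` -/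

section PlusLocus

namespace HPBundle

variable {X : Scheme.{u}} {E : SympBundle X 2} (P : HPBundle (hypExt E))

/-- The third component of the projector is `(a', v, b') ↦ φ(x, v) + a b'`. Over the residue field
it vanishes identically if and only if `a = 0` and `φ(x, ·) = 0`, and the latter means `x = 0` by
nondegeneracy. -/
theorem mem_plusLocus_iff (t : P.tot.left) : t ∈ P.plusLocus ↔
    (P.quad.map (pointι P.tot t)).a = 0 ∧ (P.quad.map (pointι P.tot t)).x = 0 := by
  let q := P.quad.map (pointι P.tot t)
  have h1 : t ∈ P.plusLocus ↔ ∀ z : Triple E.toVectorBundle (pointOver P.tot t),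
      q.proj z = z → z.2.2 = 0 := by
    constructor
    · intro h z hz
      obtain ⟨u, hu⟩ := (lies_iff_exists_app P.inclTriple
        (S := Over.mk (P.tot.left.fromSpecResidueField t))
        ((tripleCoord E.toVectorBundle (pointOver P.tot t)).symm z)).1 ((P.lies_iff (pointι P.tot t) _).2 (by
          rw [LinearEquiv.apply_symm_apply]; exact hz))
      have h2 : (tripleCoord E.toVectorBundle _ (P.inclTriple.app _ u)).2.2 = 0 := h u
      have h3 : tripleCoord E.toVectorBundle (pointOver P.tot t) (P.inclTriple.app _ u) = z :=
        (congrArg _ hu).trans (LinearEquiv.apply_symm_apply _ _)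
      exact (congrArg (fun z => z.2.2) h3).symm.trans h2
    · intro h u
      exact h (tripleCoord E.toVectorBundle _ (P.inclTriple.app _ u))
        ((P.lies_iff (pointι P.tot t) _).1 (lies_app P.inclTriple u))
  rw [h1]
  constructor
  · intro h
    have h2 (z) : (q.proj z).2.2 = 0 := h _ (q.proj_proj z)
    simp only [Quad.proj, tripleProj_apply] at h2
    refine ⟨by simpa using h2 (0, 0, 1), ?_⟩
    have hnd := E.nondeg (pointOver P.tot t) (inferInstanceAs (IsAffine (Spec _)))
    apply hnd.bijective_left.1
    refine LinearMap.ext fun w => ?_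
    simpa using h2 (0, w, 0)
  · rintro ⟨ha, hx⟩ z hz
    have hz' := congrArg (fun z => z.2.2) hz
    simp only [Quad.proj, tripleProj_apply] at hz'
    rw [← hz', show q.a = 0 from ha, show q.x = 0 from hx]
    simp

theorem plusLocus_eq : P.plusLocus =
    {t | t ∉ P.tot.left.basicOpen P.quad.a} ∩ P.quad.x.left ⁻¹' E.zeroLocus := by
  ext t
  rw [mem_plusLocus_iff]
  exact and_congr (notMem_basicOpen_iff t P.quad.a).symm
    (E.toVectorBundle.mem_zeroLocus_iff P.quad.x t).symm

theorem isClosed_plusLocus : IsClosed P.plusLocus := by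
  rw [plusLocus_eq]
  exact (P.tot.left.basicOpen P.quad.a).2.isClosed_compl.inter
    (E.isClosed_zeroLocus.preimage P.quad.x.left.continuous)

theorem isCompact_compl_plusLocus {k : Scheme.{u}} (V : SchemeCategory k) {X : Over k}
    (hX : V.mem X) {E : SympBundle X.left 2} (P : HPBundle (hypExt E)) :
    IsCompact P.plusLocusᶜ := by
  have := V.quasiCompact _ (V.mem_HP hX P)
  rw [plusLocus_eq, Set.compl_inter]
  refine IsCompact.union ?_ ?_
  · convert isCompact_basicOpen P.tot.left (U := ⊤) (isCompact_univ_iff.2 this) P.quad.a using 1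
    ext t
    simp
  · let f : overBase P.tot ⟶ overBase E.tot := Over.homMk P.quad.x.left (by
      change P.quad.x.left ≫ E.tot.hom ≫ X.hom = P.tot.hom ≫ X.hom
      rw [← Category.assoc, Over.w P.quad.x])
    exact ((V.adm_zeroLocus hX E.toVectorBundle).preimage (V.mem_HP hX P) f).2.2

theorem adm_plusLocus {k : Scheme.{u}} (V : SchemeCategory k) {X : Over k}
    (hX : V.mem X) {E : SympBundle X.left 2} (P : HPBundle (hypExt E)) :
    V.Adm (overBase P.tot) P.plusLocus :=
  ⟨V.mem_HP hX P, P.isClosed_plusLocus, isCompact_compl_plusLocus V hX P⟩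

/-- The coordinates of the inclusion of `E`. -/
def minusQuad {T : Over X} (v : T ⟶ E.tot) : Quad E T := ⟨0, v, 0, by rw [map_zero, zero_mul]⟩

theorem minusQuad_map {T T' : Over X} (v : T ⟶ E.tot) (g : T' ⟶ T) :
    (minusQuad v).map g = minusQuad (g ≫ v) := by
  refine Quad.ext ?_ rfl ?_
  · exact map_zero _
  · exact E.comp_zero g

theorem minusQuad_proj_eq_iff {T : Over X} (v : T ⟶ E.tot) (z : Triple E.toVectorBundle T) :
    (minusQuad v).proj z = z ↔ z.1 = 0 ∧ z.2.2 = E.form T v z.2.1 := by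
  obtain ⟨a, w, b⟩ := z
  simp only [Quad.proj, tripleProj_apply, minusQuad, Prod.mk.injEq]
  simp
  constructor
  · rintro ⟨h1, h2, h3⟩
    exact ⟨h1.symm, h3.symm⟩
  · rintro ⟨h1, h3⟩
    simp [h1, h3]

/-- The inclusion `v ↦ {(0, w, φ(v, w))}` of `E`. -/
def minus : E.tot ⟶ P.tot := (P.equiv _).symm (minusQuad (𝟙 _))

theorem quad_map_comp_minus {T : Over X} (v : T ⟶ E.tot) :
    P.quad.map (v ≫ P.minus) = minusQuad v := by
  rw [← Quad.map_map, minus, quad_map_equiv_symm, minusQuad_map, Category.comp_id]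

/-- The defining condition says that the subbundle classified by `f` consists of the vectors fixed
by the projector `(0, v, 0)`. Coordinates are determined by the fixed vectors, so this pins down
`f`. -/
theorem isMinusInclusion_iff (f : E.tot ⟶ P.tot) : P.IsMinusInclusion f ↔ f = P.minus := by
  have h1 : P.IsMinusInclusion f ↔ ∀ (T : Over X) (v : T ⟶ E.tot)
      (x : T ⟶ (tripleBundle E.toVectorBundle).tot), ((P.quad.map f).map v).proj
        (tripleCoord E.toVectorBundle T x) = tripleCoord E.toVectorBundle T x ↔
          ((minusQuad (𝟙 _)).map v).proj (tripleCoord E.toVectorBundle T x) =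
            tripleCoord E.toVectorBundle T x := by
    refine forall_congr' fun T => forall_congr' fun v => forall_congr' fun x => ?_
    rw [Quad.map_map, minusQuad_map, Category.comp_id, minusQuad_proj_eq_iff]
    exact iff_congr (P.lies_iff (v ≫ f) x) Iff.rfl
  rw [h1, ← Quad.eq_iff_lies, ← P.equiv_apply, minus, Equiv.eq_symm_apply]

/-- Along `minus` the coordinate `a` is zero and `x` is the identity of `E`, so of the equations of
`N⁺` only the vanishing of the vector itself remains. -/
theorem minus_preimage_plusLocus : P.minus.left ⁻¹' P.plusLocus = E.zeroLocus := by
  have ha : P.minus.left.appTop P.quad.a = 0 := congrArg Quad.a (P.quad_map_comp_minus (𝟙 _))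
  have hx : P.minus ≫ P.quad.x = 𝟙 _ := congrArg Quad.x (P.quad_map_comp_minus (𝟙 _))
  rw [plusLocus_eq, Set.preimage_inter, ← Set.preimage_comp]
  have h1 : P.minus.left ⁻¹' {t | t ∉ P.tot.left.basicOpen P.quad.a} = Set.univ := by
    refine Set.eq_univ_of_forall fun v hv => ?_
    have h2 : P.minus.left ⁻¹ᵁ P.tot.left.basicOpen P.quad.a = ⊥ := by
      rw [Scheme.preimage_basicOpen_top, ha, Scheme.basicOpen_zero]
    have : v ∈ P.minus.left ⁻¹ᵁ P.tot.left.basicOpen P.quad.a := hv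
    rwa [h2] at this
  have h2 : P.quad.x.left ∘ P.minus.left = id := by
    funext v
    exact congrArg (fun f => f.left v) hx
  rw [h1, h2, Set.univ_inter, Set.preimage_id]

end HPBundle

end PlusLocus

/-! ### Formal properties of cohomology theories -/

section Formal

variable {k : Scheme.{u}} {V : SchemeCategory k}

namespace CohomologyTheory

variable (B : CohomologyTheory.{u, w} V)

theorem pull_pull {P Q R : SPair V} (a : P ⟶ Q) (b : Q ⟶ R) (x : B.grp R) :
    B.pull a (B.pull b x) = B.pull (a ≫ b) x := by
  change (B.A.map a.op) ((B.A.map b.op) x) = (B.A.map (a ≫ b).op) x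
  rw [op_comp, B.A.map_comp]
  rfl

theorem pull_id (P : SPair V) (x : B.grp P) : B.pull (𝟙 P) x = x := by
  change (B.A.map (𝟙 P).op) x = x
  rw [op_id, B.A.map_id]
  rfl

theorem pull_congr {P Q : SPair V} {a b : P ⟶ Q} (h : a.f = b.f) : B.pull a = B.pull b := by
  rw [SPair.Hom.ext h]

theorem pull_eq_self {P : SPair V} {a : P ⟶ P} (h : a.f = 𝟙 P.X) (x : B.grp P) :
    B.pull a x = x := by
  rw [B.pull_congr (b := 𝟙 P) h, pull_id]

theorem pull_comm {P Q Q' R : SPair V} {a : P ⟶ Q} {b : Q ⟶ R} {c : P ⟶ Q'} {d : Q' ⟶ R}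
    (h : a.f ≫ b.f = c.f ≫ d.f) (x : B.grp R) :
    B.pull a (B.pull b x) = B.pull c (B.pull d x) := by
  rw [pull_pull, pull_pull]
  exact DFunLike.congr_fun (B.pull_congr h) x

theorem pull_pull_eq {P Q R : SPair V} {a : P ⟶ Q} {b : Q ⟶ R} {c : P ⟶ R}
    (h : a.f ≫ b.f = c.f) (x : B.grp R) : B.pull a (B.pull b x) = B.pull c x := by
  rw [pull_pull]
  exact DFunLike.congr_fun (B.pull_congr h) x

theorem pull_pull_eq_self {P Q : SPair V} {a : P ⟶ Q} {b : Q ⟶ P} (h : a.f ≫ b.f = 𝟙 _)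
    (x : B.grp P) : B.pull a (B.pull b x) = x := by
  rw [pull_pull]
  exact B.pull_eq_self h x

theorem bijective_pull_of_isIso {P Q : SPair V} (a : P ⟶ Q) (b : Q ⟶ P) (h : a.f ≫ b.f = 𝟙 _)
    (h' : b.f ≫ a.f = 𝟙 _) : Function.Bijective (B.pull a) :=
  Function.bijective_iff_has_inverse.2 ⟨B.pull b, B.pull_pull_eq_self h', B.pull_pull_eq_self h⟩

/-- The map on the whole schemes. -/
abbrev topHom {P Q : SPair V} (a : P ⟶ Q) : SPair.top P.adm.1 ⟶ SPair.top Q.adm.1 :=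
  SPair.topMap Q.adm.1 P.adm.1 a.f

/-- The map on the open complements. -/
abbrev complHom {P Q : SPair V} (a : P ⟶ Q) : SPair.top P.mem_open ⟶ SPair.top Q.mem_open :=
  SPair.topMap Q.mem_open P.mem_open (SPair.openHom a)

theorem openHom_openι {P Q : SPair V} (a : P ⟶ Q) :
    SPair.openHom a ≫ Q.openι = P.openι ≫ a.f := by
  ext1
  have : IsOpenImmersion Q.compl.ι := Scheme.Opens.instIsOpenImmersionι _
  exact IsOpenImmersion.lift_fac Q.compl.ι _ _

/-- The five lemma for the localization sequences, with the supported group in the middle. -/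
theorem bijective_pull_of_top_of_compl {P Q : SPair V} (a : P ⟶ Q)
    (h : Function.Bijective (B.pull (topHom a))) (h' : Function.Bijective (B.pull (complHom a))) :
    Function.Bijective (B.pull a) := by
  have e1 (x) : B.pull (complHom a) (B.pull (SPair.topMap Q.adm.1 Q.mem_open Q.openι) x) =
      B.pull (SPair.topMap P.adm.1 P.mem_open P.openι) (B.pull (topHom a) x) :=
    B.pull_comm (openHom_openι a) x
  refine AddMonoidHom.bijective_of_surjective_of_bijective_of_bijective_of_injective
    (B.pull (SPair.topMap Q.adm.1 Q.mem_open Q.openι)) (B.bd Q)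
    (B.pull (SPair.incl Q.adm (V.adm_univ Q.adm.1) (Set.subset_univ _)))
    (B.pull (SPair.topMap Q.adm.1 Q.mem_open Q.openι))
    (B.pull (SPair.topMap P.adm.1 P.mem_open P.openι)) (B.bd P)
    (B.pull (SPair.incl P.adm (V.adm_univ P.adm.1) (Set.subset_univ _)))
    (B.pull (SPair.topMap P.adm.1 P.mem_open P.openι))
    (B.pull (topHom a)) (B.pull (complHom a)) (B.pull a) (B.pull (topHom a)) (B.pull (complHom a))
    ?_ ?_ ?_ ?_ (B.exact_open Q) (B.exact_supp Q) (B.exact_total Q) (B.exact_open P)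
    (B.exact_supp P) (B.exact_total P) h.2 h' h h'.1
  · exact AddMonoidHom.ext fun x => (e1 x).symm
  · exact AddMonoidHom.ext fun x => (B.bd_naturality a x).symm
  · exact AddMonoidHom.ext fun x =>
      B.pull_comm ((Category.id_comp _).trans (Category.comp_id _).symm) x
  · exact AddMonoidHom.ext fun x => (e1 x).symm

/-- The same localization sequence read one step further on, with the unsupported group in the
middle. -/
theorem bijective_pull_top {P Q : SPair V} (a : P ⟶ Q)
    (h : Function.Bijective (B.pull a)) (h' : Function.Bijective (B.pull (complHom a))) :
    Function.Bijective (B.pull (topHom a)) := by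
  have e1 (x) : B.pull (complHom a) (B.pull (SPair.topMap Q.adm.1 Q.mem_open Q.openι) x) =
      B.pull (SPair.topMap P.adm.1 P.mem_open P.openι) (B.pull (topHom a) x) :=
    B.pull_comm (openHom_openι a) x
  refine AddMonoidHom.bijective_of_surjective_of_bijective_of_bijective_of_injective
    (B.bd Q)
    (B.pull (SPair.incl Q.adm (V.adm_univ Q.adm.1) (Set.subset_univ _)))
    (B.pull (SPair.topMap Q.adm.1 Q.mem_open Q.openι)) (B.bd Q)
    (B.bd P)
    (B.pull (SPair.incl P.adm (V.adm_univ P.adm.1) (Set.subset_univ _)))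
    (B.pull (SPair.topMap P.adm.1 P.mem_open P.openι)) (B.bd P)
    (B.pull (complHom a)) (B.pull a) (B.pull (topHom a)) (B.pull (complHom a)) (B.pull a)
    ?_ ?_ ?_ ?_ (B.exact_supp Q) (B.exact_total Q) (B.exact_open Q)
    (B.exact_supp P) (B.exact_total P) (B.exact_open P) h'.2 h h' h.1
  · exact AddMonoidHom.ext fun x => (B.bd_naturality a x).symm
  · exact AddMonoidHom.ext fun x =>
      B.pull_comm ((Category.id_comp _).trans (Category.comp_id _).symm) x
  · exact AddMonoidHom.ext fun x => (e1 x).symm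
  · exact AddMonoidHom.ext fun x => (B.bd_naturality a x).symm

/-- Excision for open immersions. -/
theorem bijective_pull_of_isOpenImmersion {P Q : SPair V} (a : P ⟶ Q) (ha : IsOpenImmersion a.f.left)
    (hZ : a.f.left ⁻¹' Q.Z = P.Z) (hr : Q.Z ⊆ Set.range a.f.left) : Function.Bijective (B.pull a) := by
  refine B.excision a inferInstance hZ ?_
  -- The base change of the open immersion to `Z` is an open immersion, and it is surjective because
  -- `Z` lies in the image.
  refine isIso_of_isOpenImmersion_of_opensRange_eq_top _ (top_le_iff.1 fun z _ => ?_)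
  let i := (Scheme.IdealSheafData.vanishingIdeal ⟨Q.Z, Q.adm.2.1⟩).subschemeι
  have hz : i z ∈ Set.range a.f.left := hr (by
    have h : i z ∈ Set.range i := ⟨z, rfl⟩
    rw [Scheme.IdealSheafData.range_subschemeι,
      Scheme.IdealSheafData.coe_support_vanishingIdeal] at h
    exact h)
  obtain ⟨y, hy⟩ := hz
  obtain ⟨t, -, ht⟩ := Scheme.Pullback.exists_preimage_pullback y z hy
  exact ⟨t, ht⟩

/-! ### Homotopy invariance -/

/-- The section of the affine line given by a function. -/
def lineSec (Y : Scheme.{u}) (c : Γ(Y, ⊤)) : Y ⟶ 𝔸(PUnit.{u + 1}; Y) :=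
  AffineSpace.homOfVector (𝟙 Y) fun _ => c

/-- The pullbacks along the sections `0` and `1` of `Y × 𝔸¹ ⟶ Y` both invert the isomorphism given
by the projection, so they are equal. -/
theorem pullTop_eq_of_homotopy {X Y : Over k} (hX : V.mem X) (hY : V.mem Y) {f g : Y ⟶ X}
    (H : lineOver Y ⟶ X) (hf : lineSec Y.left 0 ≫ H.left = f.left)
    (hg : lineSec Y.left 1 ≫ H.left = g.left) : B.pullTop hX hY f = B.pullTop hX hY g := by
  let pr : lineOver Y ⟶ Y := Over.homMk (𝔸(PUnit; Y.left) ↘ Y.left)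
  let s (c : Γ(Y.left, ⊤)) : Y ⟶ lineOver Y := Over.homMk (lineSec Y.left c) (by simp [lineSec])
  have hs (c) : s c ≫ pr = 𝟙 Y := by
    ext1
    simp [s, pr, lineSec]
  have hb := B.homotopy hY (V.mem_line hY)
  have key (c x) : B.pullTop (V.mem_line hY) hY (s c) x =
      (Equiv.ofBijective _ hb).symm x := by
    obtain ⟨x, rfl⟩ := hb.2 x
    rw [Equiv.ofBijective_symm_apply_apply]
    exact B.pull_pull_eq_self (a := SPair.topMap (V.mem_line hY) hY (s c))
      (b := SPair.topMap hY (V.mem_line hY) pr) (hs c) x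
  have h0 : s 0 ≫ H = f := by
    ext1; exact hf
  have h1 : s 1 ≫ H = g := by
    ext1; exact hg
  refine AddMonoidHom.ext fun x => ?_
  refine (B.pull_pull_eq (a := SPair.topMap (V.mem_line hY) hY (s 0))
    (b := SPair.topMap hX (V.mem_line hY) H) (c := SPair.topMap hX hY f) h0 x).symm.trans ?_
  refine Eq.trans ?_ (B.pull_pull_eq (a := SPair.topMap (V.mem_line hY) hY (s 1))
    (b := SPair.topMap hX (V.mem_line hY) H) (c := SPair.topMap hX hY g) h1 x)
  exact (key 0 _).trans (key 1 _).symm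

end CohomologyTheory

/-! ### Fibrewise convex morphisms and Mayer–Vietoris -/

/-- The points of the fibres of `f` can be joined by affine lines, functorially. -/
structure FibrewiseConvex {Y X : Scheme.{u}} (f : Y ⟶ X) where
  conv : ∀ {T : Scheme.{u}} (y y' : T ⟶ Y), y ≫ f = y' ≫ f → Γ(T, ⊤) → (T ⟶ Y)
  conv_comp : ∀ {T : Scheme.{u}} (y y' : T ⟶ Y) (h : y ≫ f = y' ≫ f) (c : Γ(T, ⊤)),
    conv y y' h c ≫ f = y ≫ f
  comp_conv : ∀ {T T' : Scheme.{u}} (g : T' ⟶ T) (y y' : T ⟶ Y) (h : y ≫ f = y' ≫ f)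
    (c : Γ(T, ⊤)), g ≫ conv y y' h c = conv (g ≫ y) (g ≫ y') (by simp [h]) (g.appTop c)
  conv_zero : ∀ {T : Scheme.{u}} (y y' : T ⟶ Y) (h : y ≫ f = y' ≫ f), conv y y' h 0 = y'
  conv_one : ∀ {T : Scheme.{u}} (y y' : T ⟶ Y) (h : y ≫ f = y' ≫ f), conv y y' h 1 = y

namespace FibrewiseConvex

theorem conv_congr {Y X : Scheme.{u}} {f : Y ⟶ X} (C : FibrewiseConvex f) {T : Scheme.{u}}
    {y z y' z' : T ⟶ Y} (h : y ≫ f = y' ≫ f) {c d : Γ(T, ⊤)} (hy : y = z) (hy' : y' = z')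
    (hc : c = d) : C.conv y y' h c = C.conv z z' (by rw [← hy, ← hy', h]) d := by
  subst hy hy' hc
  rfl

/-- Restriction to open subsets. -/
def restrict {Y X U U' : Scheme.{u}} {f : Y ⟶ X} (C : FibrewiseConvex f) (u : U ⟶ X) (u' : U' ⟶ Y)
    (g : U' ⟶ U) [IsOpenImmersion u'] (hr : Set.range u' = f ⁻¹' Set.range u)
    (hg : g ≫ u = u' ≫ f) [Mono u] : FibrewiseConvex g where
  conv {T} y y' h c := IsOpenImmersion.lift u' (C.conv (y ≫ u') (y' ≫ u') (by
    rw [Category.assoc, Category.assoc, ← hg, ← Category.assoc, h, Category.assoc]) c) (by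
    rw [hr]
    rintro _ ⟨t, rfl⟩
    refine ⟨(y ≫ g) t, ?_⟩
    have := C.conv_comp (y ≫ u') (y' ≫ u') (by
      rw [Category.assoc, Category.assoc, ← hg, ← Category.assoc, h, Category.assoc]) c
    have h2 : (y ≫ u') ≫ f = (y ≫ g) ≫ u := by
      rw [Category.assoc, ← hg, Category.assoc]
    exact (congrArg (fun f => f t) (this.trans h2)).symm)
  conv_comp y y' h c := by
    rw [← cancel_mono u, Category.assoc]
    refine (congrArg (_ ≫ ·) hg).trans ?_
    rw [← Category.assoc, IsOpenImmersion.lift_fac, C.conv_comp, Category.assoc, Category.assoc]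
    exact congrArg _ hg.symm
  comp_conv g y y' h c := by
    rw [← cancel_mono u', Category.assoc, IsOpenImmersion.lift_fac, IsOpenImmersion.lift_fac,
      C.comp_conv]
    exact C.conv_congr _ (Category.assoc _ _ _).symm (Category.assoc _ _ _).symm rfl
  conv_zero y y' h := by
    rw [← cancel_mono u', IsOpenImmersion.lift_fac, C.conv_zero]
  conv_one y y' h := by
    rw [← cancel_mono u', IsOpenImmersion.lift_fac, C.conv_one]

variable (B : CohomologyTheory.{u, w} V)

/-- The section is a homotopy inverse: the straight line from each point to the value of the section
in the same fibre is a homotopy between `f ≫ s` and the identity. -/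
theorem bijective_of_section {X Y : Over k} (hX : V.mem X) (hY : V.mem Y) {f : Y ⟶ X}
    (C : FibrewiseConvex f.left) (s : X.left ⟶ Y.left) (hs : s ≫ f.left = 𝟙 X.left) :
    Function.Bijective (B.pullTop hX hY f) := by
  have hsf : s ≫ Y.hom = X.hom := by
    rw [← Over.w f, ← Category.assoc, hs, Category.id_comp]
  let s' : X ⟶ Y := Over.homMk s hsf
  have hs' : s' ≫ f = 𝟙 X := by
    ext1; exact hs
  let p : 𝔸(PUnit.{u + 1}; Y.left) ⟶ Y.left := 𝔸(PUnit; Y.left) ↘ Y.left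
  have hp (c) : CohomologyTheory.lineSec Y.left c ≫ p = 𝟙 _ := by simp [CohomologyTheory.lineSec, p]
  have e : p ≫ f.left = (p ≫ f.left ≫ s) ≫ f.left := by
    rw [Category.assoc, Category.assoc, hs, Category.comp_id]
  -- The parameter is the coordinate of the affine line: at `0` the combination is `f ≫ s`, at `1`
  -- it is the identity.
  let H₀ := C.conv p (p ≫ f.left ≫ s) e (AffineSpace.coord _ PUnit.unit)
  have hH (c) : CohomologyTheory.lineSec Y.left c ≫ H₀ = C.conv (𝟙 _) (f.left ≫ s) (by
      rw [Category.assoc, hs, Category.comp_id, Category.id_comp]) c := by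
    rw [C.comp_conv]
    refine C.conv_congr _ (hp c) ?_ ?_
    · rw [← Category.assoc, hp, Category.id_comp]
    · exact AffineSpace.homOfVector_appTop_coord _ _ _
  let H : lineOver Y ⟶ Y := Over.homMk H₀ (by
    change H₀ ≫ Y.hom = p ≫ Y.hom
    rw [← Over.w f, ← Category.assoc, C.conv_comp, Category.assoc])
  have h1 : B.pullTop hY hY (f ≫ s') = B.pullTop hY hY (𝟙 Y) :=
    B.pullTop_eq_of_homotopy hY hY H ((hH 0).trans (C.conv_zero _ _ _))
      ((hH 1).trans (C.conv_one _ _ _))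
  refine Function.bijective_iff_has_inverse.2 ⟨B.pullTop hY hX s', fun x => ?_, fun x => ?_⟩
  · exact B.pull_pull_eq_self (a := SPair.topMap hY hX s') (b := SPair.topMap hX hY f) hs' x
  · refine (B.pull_pull_eq (a := SPair.topMap hX hY f) (b := SPair.topMap hY hX s')
      (c := SPair.topMap hY hY (f ≫ s')) rfl x).trans ?_
    rw [show B.pull (SPair.topMap hY hY (f ≫ s')) = _ from h1]
    exact B.pull_eq_self (a := SPair.topMap hY hY (𝟙 Y)) rfl x

/-- The condition that the restrictions of `f` over open subsets of `W` induce isomorphisms. -/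
def IsoOver {X Y : Over k} (f : Y ⟶ X) (W : X.left.Opens) : Prop :=
  ∀ ⦃U U' : Over k⦄ (u : U ⟶ X) (u' : U' ⟶ Y) (g : U' ⟶ U), IsOpenImmersion u.left →
    IsOpenImmersion u'.left → Set.range u.left ⊆ W →
    Set.range u'.left = f.left ⁻¹' Set.range u.left → g ≫ u = u' ≫ f →
    ∀ (hU : V.mem U) (hU' : V.mem U'), Function.Bijective (B.pullTop hU hU' g)

theorem isoOver_of_section {X Y : Over k} {f : Y ⟶ X} (C : FibrewiseConvex f.left)
    {W : X.left.Opens} (s : W.toScheme ⟶ Y.left) (hs : s ≫ f.left = W.ι) : IsoOver B f W := by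
  intro U U' u u' g hu hu' hr hr' hg hU hU'
  have hg' : g.left ≫ u.left = u'.left ≫ f.left := congrArg Over.Hom.left hg
  let l : U.left ⟶ W.toScheme := IsOpenImmersion.lift W.ι u.left (by
    rw [Scheme.Opens.range_ι]; exact hr)
  have hl : l ≫ W.ι = u.left := IsOpenImmersion.lift_fac _ _ _
  let σ : U.left ⟶ U'.left := IsOpenImmersion.lift u'.left (l ≫ s) (by
    rw [hr']
    rintro _ ⟨t, rfl⟩
    refine ⟨t, ?_⟩
    have : (l ≫ s) ≫ f.left = u.left := by rw [Category.assoc, hs, hl]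
    exact (congrArg (fun f => f t) this).symm)
  have hσ : σ ≫ u'.left = l ≫ s := IsOpenImmersion.lift_fac _ _ _
  refine (C.restrict u.left u'.left g.left hr' hg').bijective_of_section B hU hU' σ ?_
  rw [← cancel_mono u.left, Category.assoc, hg', ← Category.assoc, hσ, Category.assoc, hs, hl,
    Category.id_comp]

theorem IsoOver.bot {X Y : Over k} (f : Y ⟶ X) : IsoOver B f ⊥ := by
  intro U U' u u' g hu hu' hr hr' hg hU hU'
  have h1 : IsEmpty U.left := ⟨fun t => hr ⟨t, rfl⟩⟩
  have h2 : IsEmpty U'.left := ⟨fun t => h1.false (g.left t)⟩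
  have : IsIso g.left := isIso_of_isEmpty _
  let g' : U ⟶ U' := Over.homMk (inv g.left) (by
    rw [IsIso.inv_comp_eq]; exact (Over.w g).symm)
  refine B.bijective_pull_of_isIso _ (SPair.topMap hU' hU g') ?_ ?_
  · ext1; exact IsIso.hom_inv_id g.left
  · ext1; exact IsIso.inv_hom_id g.left

theorem range_openι_comp {X Y : Over k} {f : Y ⟶ X} {P Q : SPair V} (a : P ⟶ Q)
    (hZ : a.f.left ⁻¹' Q.Z = P.Z) (u : Q.X ⟶ X) (u' : P.X ⟶ Y) (hu : IsOpenImmersion u.left)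
    (hr : Set.range u'.left = f.left ⁻¹' Set.range u.left) (hg : a.f ≫ u = u' ≫ f) :
    Set.range (P.openι ≫ u').left = f.left ⁻¹' Set.range (Q.openι ≫ u).left := by
  have hg' (t) : u.left (a.f.left t) = f.left (u'.left t) := congrArg (fun f => f.left t) hg
  have hP (y : Y.left) : y ∈ Set.range (P.openι ≫ u').left ↔ ∃ t ∉ P.Z, u'.left t = y :=
    ⟨fun ⟨t, ht⟩ => ⟨_, t.2, ht⟩, fun ⟨t, ht, h⟩ => ⟨⟨t, ht⟩, h⟩⟩
  have hQ (y : X.left) : y ∈ Set.range (Q.openι ≫ u).left ↔ ∃ t ∉ Q.Z, u.left t = y :=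
    ⟨fun ⟨t, ht⟩ => ⟨_, t.2, ht⟩, fun ⟨t, ht, h⟩ => ⟨⟨t, ht⟩, h⟩⟩
  ext y
  rw [hP, Set.mem_preimage, hQ]
  constructor
  · rintro ⟨t, ht, rfl⟩
    exact ⟨a.f.left t, fun h => ht (hZ ▸ h), hg' t⟩
  · rintro ⟨t, ht, h⟩
    have hy : y ∈ Set.range u'.left := by
      rw [hr]
      exact ⟨t, h⟩
    obtain ⟨t', rfl⟩ := hy
    refine ⟨t', fun h' => ht ?_, rfl⟩
    rw [← hZ] at h'
    rwa [← u.left.isOpenEmbedding.injective ((hg' t').trans h.symm)]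

/-- A Mayer–Vietoris argument. The cohomology supported off `W₁` can be computed inside `W₂` by
excision, where `h₂` controls it; together with `h₁` on the complement of this support, localization
gives the union. -/
theorem IsoOver.sup {X Y : Over k} {f : Y ⟶ X} (hX : V.mem X) {W₁ W₂ : X.left.Opens}
    (hW₁ : IsCompact (W₁ : Set X.left)) (hW₂ : IsCompact (W₂ : Set X.left))
    (h₁ : IsoOver B f W₁) (h₂ : IsoOver B f W₂) : IsoOver B f (W₁ ⊔ W₂) := by
  intro U U' u u' g hu hu' hr hr' hg hU hU'
  have hadm (W : X.left.Opens) (hW : IsCompact (W : Set X.left)) : V.Adm X (W : Set X.left)ᶜ :=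
    ⟨hX, W.2.isClosed_compl, by rwa [compl_compl]⟩
  -- The support of `Q` is the part of `U` outside `W₁`, and that of `R` the part outside `W₂`; so
  -- `R.openScheme` is the part of `U` in `W₂`. `P` and `R'` are the preimages upstairs.
  let Q : SPair V := ⟨U, _, (hadm W₁ hW₁).preimage hU u⟩
  let P : SPair V := ⟨U', _, Q.adm.preimage hU' g⟩
  let R : SPair V := ⟨U, _, (hadm W₂ hW₂).preimage hU u⟩
  let R' : SPair V := ⟨U', _, R.adm.preimage hU' g⟩
  let a : P ⟶ Q := ⟨g, subset_rfl⟩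
  let r : R' ⟶ R := ⟨g, subset_rfl⟩
  let Q₂ : SPair V := ⟨R.openScheme, _, Q.adm.preimage R.mem_open R.openι⟩
  let P₂ : SPair V := ⟨R'.openScheme, _, P.adm.preimage R'.mem_open R'.openι⟩
  let jQ : Q₂ ⟶ Q := ⟨R.openι, subset_rfl⟩
  let jP : P₂ ⟶ P := ⟨R'.openι, subset_rfl⟩
  have hrg : SPair.openHom r ≫ R.openι = R'.openι ≫ g := CohomologyTheory.openHom_openι r
  have hpre : (SPair.openHom r).left ⁻¹' Q₂.Z = P₂.Z := by
    ext t
    have : R.openι.left ((SPair.openHom r).left t) = g.left (R'.openι.left t) :=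
      congrArg (fun f => f.left t) hrg
    change R.openι.left ((SPair.openHom r).left t) ∈ Q.Z ↔ g.left (R'.openι.left t) ∈ Q.Z
    rw [this]
  let a₂ : P₂ ⟶ Q₂ := ⟨SPair.openHom r, hpre.subset⟩
  have hoι (S : SPair V) : IsOpenImmersion S.openι.left := inferInstanceAs (IsOpenImmersion S.compl.ι)
  have hcomp {A B C : Over k} (f : A ⟶ B) (g : B ⟶ C) (hf : IsOpenImmersion f.left)
      (hg : IsOpenImmersion g.left) : IsOpenImmersion (f ≫ g).left :=
    inferInstanceAs (IsOpenImmersion (f.left ≫ g.left))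
  have hrange (S : SPair V) : Set.range S.openι.left = S.Zᶜ := Scheme.Opens.range_ι S.compl
  -- As the image of `U` lies in the union, points outside `W₁` lie in `W₂`, so excision applies.
  have hjQ : Function.Bijective (B.pull jQ) := by
    refine B.bijective_pull_of_isOpenImmersion jQ (hoι R) rfl ?_
    intro t ht
    change t ∈ Set.range R.openι.left
    rw [hrange]
    have := hr ⟨t, rfl⟩
    exact fun h => this.elim ht h
  have hjP : Function.Bijective (B.pull jP) := by
    refine B.bijective_pull_of_isOpenImmersion jP (hoι R') rfl ?_
    intro t ht
    change t ∈ Set.range R'.openι.left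
    rw [hrange]
    have := hr ⟨g.left t, rfl⟩
    exact fun h => this.elim ht h
  have hsub₂ : Set.range (R.openι ≫ u).left ⊆ W₂ := by
    rintro _ ⟨t, rfl⟩
    by_contra h
    exact t.2 h
  have hpr₂ := range_openι_comp (f := f) r rfl u u' hu hr' hg
  have hg₂ : SPair.openHom r ≫ R.openι ≫ u = (R'.openι ≫ u') ≫ f := by
    rw [← Category.assoc, hrg, Category.assoc, hg, Category.assoc]
  -- Both the part of `U` in `W₂` and its intersection with `W₁` lie over `W₂`, so `h₂` settles the
  -- two unsupported groups.
  have ha₂ : Function.Bijective (B.pull a₂) := by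
    refine B.bijective_pull_of_top_of_compl a₂ ?_ ?_
    · exact h₂ (R.openι ≫ u) (R'.openι ≫ u') (SPair.openHom r) (hcomp _ _ (hoι R) hu)
        (hcomp _ _ (hoι R') hu') hsub₂ hpr₂ hg₂ R.mem_open R'.mem_open
    · refine h₂ (Q₂.openι ≫ R.openι ≫ u) (P₂.openι ≫ R'.openι ≫ u') (SPair.openHom a₂)
        (hcomp _ _ (hoι Q₂) (hcomp _ _ (hoι R) hu)) (hcomp _ _ (hoι P₂) (hcomp _ _ (hoι R') hu'))
        ?_ ?_ ?_ Q₂.mem_open P₂.mem_open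
      · rintro _ ⟨t, rfl⟩
        exact hsub₂ ⟨Q₂.openι.left t, rfl⟩
      · exact range_openι_comp (f := f) a₂ hpre (R.openι ≫ u) (R'.openι ≫ u')
          (hcomp _ _ (hoι R) hu) hpr₂ hg₂
      · have := CohomologyTheory.openHom_openι a₂
        rw [← Category.assoc, this, Category.assoc, Category.assoc]
        exact congrArg _ hg₂
  refine B.bijective_pull_top a ?_ ?_
  · have h : B.pull a₂ ∘ B.pull jQ = B.pull jP ∘ B.pull a := funext fun x => B.pull_comm hrg x
    have h' : Function.Bijective (B.pull jP ∘ B.pull a) := by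
      rw [← h]
      exact ha₂.comp hjQ
    exact (Function.Bijective.of_comp_iff' hjP _).1 h'
  · refine h₁ (Q.openι ≫ u) (P.openι ≫ u') (SPair.openHom a) (hcomp _ _ (hoι Q) hu)
      (hcomp _ _ (hoι P) hu') ?_ (range_openι_comp (f := f) a rfl u u' hu hr' hg) ?_
      Q.mem_open P.mem_open
    · rintro _ ⟨t, rfl⟩
      by_contra h
      exact t.2 h
    · rw [← Category.assoc, CohomologyTheory.openHom_openι a, Category.assoc, Category.assoc]
      exact congrArg _ hg

/-- A fibrewise convex morphism with local sections induces an isomorphism. -/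
theorem bijective_of_local_section {X Y : Over k} (hX : V.mem X) (hY : V.mem Y) {f : Y ⟶ X}
    (C : FibrewiseConvex f.left) (hloc : ∀ x : X.left, ∃ W : X.left.Opens, x ∈ W ∧
      ∃ s : W.toScheme ⟶ Y.left, s ≫ f.left = W.ι) : Function.Bijective (B.pullTop hX hY f) := by
  have hloc' (x : X.left) : ∃ W : X.left.Opens, x ∈ W ∧ IsCompact (W : Set X.left) ∧
      IsoOver B f W := by
    obtain ⟨W, hW, s, hs⟩ := hloc x
    obtain ⟨W', hW', hx, hle⟩ := exists_isAffineOpen_mem_and_subset hW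
    refine ⟨W', hx, hW'.isCompact, C.isoOver_of_section B (X.left.homOfLE (show W' ≤ W from hle) ≫ s) ?_⟩
    rw [Category.assoc, hs]
    exact Scheme.homOfLE_ι _ _
  choose W hxW hW hiso using hloc'
  have := V.quasiCompact X hX
  obtain ⟨t, -, ht⟩ := isCompact_univ.elim_nhds_subcover (fun x => (W x : Set X.left))
    (fun x _ => (W x).isOpen.mem_nhds (hxW x))
  -- Compactness is carried along in the induction because complements of non-compact opens are not
  -- admissible supports.
  have key : IsCompact ((t.sup W : X.left.Opens) : Set X.left) ∧ IsoOver B f (t.sup W) := by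
    refine Finset.sup_induction (p := fun W : X.left.Opens => IsCompact (W : Set X.left) ∧
      IsoOver B f W) ⟨by simp, IsoOver.bot B f⟩ (fun W₁ h₁ W₂ h₂ => ⟨?_, ?_⟩)
      (fun x _ => ⟨hW x, hiso x⟩)
    · rw [Opens.coe_sup]
      exact h₁.1.union h₂.1
    · exact IsoOver.sup B hX h₁.1 h₂.1 h₁.2 h₂.2
  refine key.2 (𝟙 X) (𝟙 Y) f (inferInstanceAs (IsOpenImmersion (𝟙 X.left)))
    (inferInstanceAs (IsOpenImmersion (𝟙 Y.left))) ?_ ?_ (by simp) hX hY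
  · intro x _
    obtain ⟨y, hy, hxy⟩ := Set.mem_iUnion₂.1 (ht (Set.mem_univ x))
    exact (Finset.le_sup (f := W) hy) hxy
  · simp

/-- A fibrewise convex morphism with a section induces isomorphisms with supports. -/
theorem bijective_pull_of_section {P Q : SPair V} (a : P ⟶ Q) (hZ : a.f.left ⁻¹' Q.Z = P.Z)
    (C : FibrewiseConvex a.f.left) (s : Q.X.left ⟶ P.X.left) (hs : s ≫ a.f.left = 𝟙 _) :
    Function.Bijective (B.pull a) := by
  have hiso : IsoOver B a.f ⊤ := C.isoOver_of_section B (Scheme.Opens.ι _ ≫ s) (by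
    rw [Category.assoc, hs, Category.comp_id])
  refine B.bijective_pull_of_top_of_compl a (C.bijective_of_section B _ _ s hs) ?_
  have hr := range_openι_comp (f := a.f) a hZ (𝟙 _) (𝟙 _)
    (inferInstanceAs (IsOpenImmersion (𝟙 Q.X.left))) (by simp) (by simp)
  exact hiso Q.openι P.openι (SPair.openHom a) (inferInstanceAs (IsOpenImmersion Q.compl.ι))
    (inferInstanceAs (IsOpenImmersion P.compl.ι)) (fun _ _ => trivial)
    (by simpa using hr)
    (CohomologyTheory.openHom_openι a) Q.mem_open P.mem_open

end FibrewiseConvex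

end Formal

/-! ### Affine combinations of points -/

section Convex

variable {X : Scheme.{u}}

/-- A version of `FibrewiseConvex` for morphisms over a base. -/
structure OverConvex {Y Z : Over X} (f : Y ⟶ Z) where
  conv : ∀ {T : Over X} (y y' : T ⟶ Y), y ≫ f = y' ≫ f → Γ(T.left, ⊤) → (T ⟶ Y)
  conv_comp : ∀ {T : Over X} (y y' : T ⟶ Y) (h : y ≫ f = y' ≫ f) (c : Γ(T.left, ⊤)),
    conv y y' h c ≫ f = y ≫ f
  comp_conv : ∀ {T T' : Over X} (g : T' ⟶ T) (y y' : T ⟶ Y) (h : y ≫ f = y' ≫ f)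
    (c : Γ(T.left, ⊤)), g ≫ conv y y' h c = conv (g ≫ y) (g ≫ y') (by simp [h]) (g.left.appTop c)
  conv_zero : ∀ {T : Over X} (y y' : T ⟶ Y) (h : y ≫ f = y' ≫ f), conv y y' h 0 = y'
  conv_one : ∀ {T : Over X} (y y' : T ⟶ Y) (h : y ≫ f = y' ≫ f), conv y y' h 1 = y

/-- Forgetting the base. -/
def OverConvex.toFibrewiseConvex {Y Z : Over X} {f : Y ⟶ Z} (C : OverConvex f) :
    FibrewiseConvex f.left :=
  have hw {T : Scheme.{u}} {y y' : T ⟶ Y.left} (h : y ≫ f.left = y' ≫ f.left) :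
      y' ≫ Y.hom = y ≫ Y.hom := by
    rw [← Over.w f, ← Category.assoc, ← Category.assoc, h]
  { conv := fun {T} y y' h c => (C.conv (T := Over.mk (y ≫ Y.hom)) (Over.homMk y)
      (Over.homMk y' (hw h)) (by ext1; exact h) c).left
    conv_comp := fun y y' h c => congrArg Over.Hom.left (C.conv_comp _ _ _ _)
    comp_conv := fun {T T'} g y y' h c => by
      let g' : Over.mk ((g ≫ y) ≫ Y.hom) ⟶ Over.mk (y ≫ Y.hom) :=
        Over.homMk g (Category.assoc _ _ _).symm
      exact congrArg Over.Hom.left (C.comp_conv g' (Over.homMk y) (Over.homMk y' (hw h))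
        (by ext1; exact h) c)
    conv_zero := fun y y' h => congrArg Over.Hom.left (C.conv_zero _ _ _)
    conv_one := fun y y' h => congrArg Over.Hom.left (C.conv_one _ _ _) }

/-- Cancelling a monomorphism. -/
def FibrewiseConvex.ofComp {Y Z W : Scheme.{u}} {f : Y ⟶ Z} {i : Z ⟶ W} [Mono i] {g : Y ⟶ W}
    (e : f ≫ i = g) (C : FibrewiseConvex g) : FibrewiseConvex f where
  conv y y' h c := C.conv y y' (by rw [← e, ← Category.assoc, h, Category.assoc]) c
  conv_comp y y' h c := by
    rw [← cancel_mono i]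
    exact (Category.assoc _ _ _).trans ((congrArg (_ ≫ ·) e).trans ((C.conv_comp _ _ _ _).trans
      ((congrArg (_ ≫ ·) e.symm).trans (Category.assoc _ _ _).symm)))
  comp_conv g y y' h c := C.comp_conv g y y' _ c
  conv_zero y y' h := C.conv_zero y y' _
  conv_one y y' h := C.conv_one y y' _

variable {n : ℕ}

namespace VectorBundle

/-- The affine combination `c v + (1 - c) v'`. -/
def mix (E : VectorBundle X n) {T : Over X} (c : Γ(T.left, ⊤)) (v v' : T ⟶ E.tot) : T ⟶ E.tot :=
  c • v + (1 - c) • v'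

theorem comp_mix (E : VectorBundle X n) {T T' : Over X} (g : T' ⟶ T) (c : Γ(T.left, ⊤))
    (v v' : T ⟶ E.tot) : g ≫ E.mix c v v' = E.mix (g.left.appTop c) (g ≫ v) (g ≫ v') := by
  rw [mix, E.comp_add, E.comp_smul, E.comp_smul, map_sub, map_one, mix]

theorem mix_zero (E : VectorBundle X n) {T : Over X} (v v' : T ⟶ E.tot) : E.mix 0 v v' = v' := by
  rw [mix, zero_smul, sub_zero, one_smul, zero_add]

theorem mix_one (E : VectorBundle X n) {T : Over X} (v v' : T ⟶ E.tot) : E.mix 1 v v' = v := by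
  rw [mix, one_smul, sub_self, zero_smul, add_zero]

/-- Vector bundles are convex over the base. -/
def convex (E : VectorBundle X n) : FibrewiseConvex E.tot.hom :=
  OverConvex.toFibrewiseConvex (Z := Over.mk (𝟙 X))
    (f := Over.homMk E.tot.hom (Category.comp_id _))
    { conv := fun v v' _ c => E.mix c v v'
      conv_comp := fun v v' h c => by
        ext1
        exact (Over.w (E.mix c v v')).trans (Over.w v).symm
      comp_conv := fun g v v' _ c => E.comp_mix g c v v'
      conv_zero := fun v v' _ => E.mix_zero v v'
      conv_one := fun v v' _ => E.mix_one v v' }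

end VectorBundle

/-- The affine combination of functions. -/
def mixFun {T : Scheme.{u}} (c a a' : Γ(T, ⊤)) : Γ(T, ⊤) := c * a + (1 - c) * a'

theorem map_mixFun {T T' : Scheme.{u}} (g : T' ⟶ T) (c a a' : Γ(T, ⊤)) :
    g.appTop (mixFun c a a') = mixFun (g.appTop c) (g.appTop a) (g.appTop a') := by
  simp only [mixFun, map_add, map_mul, map_sub, map_one]

variable (E : SympBundle X 2)

/-- The scheme of triples `(x, v, a)` is convex over the base. -/
def tripleScheme_convex : FibrewiseConvex (tripleScheme E).hom :=
  OverConvex.toFibrewiseConvex (Z := Over.mk (𝟙 X))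
    (f := Over.homMk (tripleScheme E).hom (Category.comp_id _))
    { conv := fun {T} p p' _ c => (tripleSchemeEquiv E T).symm
        ((E.mix c (tripleSchemeEquiv E T p).1.1 (tripleSchemeEquiv E T p').1.1,
          E.mix c (tripleSchemeEquiv E T p).1.2 (tripleSchemeEquiv E T p').1.2),
          mixFun c (tripleSchemeEquiv E T p).2 (tripleSchemeEquiv E T p').2)
      conv_comp := fun {T} v v' h c => by
        ext1
        exact (Over.w _).trans (Over.w v).symm
      comp_conv := fun {T T'} g v v' _ c => by
        apply (tripleSchemeEquiv E T').injective
        simp only [tripleSchemeEquiv_comp, Equiv.apply_symm_apply, E.comp_mix, map_mixFun]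
      conv_zero := fun {T} v v' _ => by
        apply (tripleSchemeEquiv E T).injective
        simp [E.mix_zero, mixFun]
      conv_one := fun {T} v v' _ => by
        apply (tripleSchemeEquiv E T).injective
        simp [E.mix_one, mixFun] }

/-! ### The torsor over the complement of `N⁺` -/

variable {E}

theorem alt_smul_form {R M : Type*} [CommRing R] [AddCommGroup M] [Module R M]
    {φ : LinearMap.BilinForm R M} (hφ : ∀ v, φ v v = 0) (x v : M) (a : R) :
    φ x ((1 - φ x v) • v - a • x) = (1 - φ x v) * (1 - (1 - φ x v)) := by
  rw [map_sub, map_smul, map_smul, hφ, smul_zero, sub_zero, smul_eq_mul, sub_sub_cancel]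

/-- The point `(1 - φ(x, v), x, α v - a x)`. -/
def torsorQuad {T : Over X} (x v : T ⟶ E.tot) (a : Γ(T.left, ⊤)) : Quad E T where
  a := 1 - E.form T x v
  x := x
  y := (1 - E.form T x v) • v - a • x
  rel := alt_smul_form (E.form_self T) x v a

theorem torsorQuad_map {T T' : Over X} (x v : T ⟶ E.tot) (a : Γ(T.left, ⊤)) (g : T' ⟶ T) :
    (torsorQuad x v a).map g = torsorQuad (g ≫ x) (g ≫ v) (g.left.appTop a) := by
  refine Quad.ext ?_ rfl ?_
  · simp only [Quad.map, torsorQuad, map_sub, map_one, E.form_comp]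
  · simp only [Quad.map, torsorQuad, E.comp_sub, E.comp_smul, map_sub, map_one, E.form_comp]

/-- In a fibre of the map, `x` and the value `φ(x, v)` are fixed, and then `y` depends linearly on
`(v, a)`. Affine combinations therefore stay in the fibre. -/
theorem torsorQuad_mix {T : Over X} (x v v' : T ⟶ E.tot) (a a' c : Γ(T.left, ⊤))
    (h : torsorQuad x v a = torsorQuad x v' a') :
    torsorQuad x (E.mix c v v') (mixFun c a a') = torsorQuad x v a := by
  have h1 : 1 - E.form T x v = 1 - E.form T x v' := congrArg Quad.a h
  have h2 : (1 - E.form T x v) • v - a • x = (1 - E.form T x v') • v' - a' • x :=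
    congrArg Quad.y h
  have h1' : E.form T x v' = E.form T x v := by linear_combination h1
  have h3 : E.form T x (E.mix c v v') = E.form T x v := by
    rw [VectorBundle.mix, map_add, map_smul, map_smul, h1', smul_eq_mul, smul_eq_mul]
    ring
  rw [h1'] at h2
  refine Quad.ext ?_ rfl ?_
  · simp only [torsorQuad, h3]
  · simp only [torsorQuad, h3]
    rw [VectorBundle.mix, mixFun]
    linear_combination (norm := module) (c - 1) • h2

/-- Local sections of the torsor. -/
theorem torsorQuad_section {T : Over X} (q : Quad E T) (w : T ⟶ E.tot) (c : Γ(T.left, ⊤))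
    (h : E.form T q.x w + q.a * c = 1) :
    torsorQuad q.x ((1 - q.a) • w + c • q.y) (-E.form T q.y w) = q := by
  -- The vector is chosen so that `φ(x, v) = (1 - a) (φ(x, w) + a c)`, using `φ(x, y) = a (1 - a)`;
  -- by `h` the second factor is one.
  have hv : E.form T q.x ((1 - q.a) • w + c • q.y) = 1 - q.a := by
    rw [map_add, map_smul, map_smul, q.rel, smul_eq_mul, smul_eq_mul]
    linear_combination (1 - q.a) * h
  -- The Plücker relation rewrites `a (1 - a) w` as `φ(x, w) y - φ(y, w) x`. The term in `x` cancels
  -- against the last parameter `-φ(y, w)`, and `h` leaves `y`.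
  have hp := E.isPlucker T q.x q.y w
  rw [q.rel] at hp
  refine Quad.ext ?_ rfl ?_
  · simp only [torsorQuad, hv, sub_sub_cancel]
  · simp only [torsorQuad, hv, sub_sub_cancel]
    have h' := congrArg (· • q.y) h
    simp only [one_smul] at h'
    linear_combination (norm := module) hp + h'

/-- The dual of a nowhere vanishing vector, locally. -/
theorem exists_form_add_eq_one {T : Over X} (q : Quad E T) (t : T.left)
    (ht : ¬ ((q.map (pointι T t)).a = 0 ∧ (q.map (pointι T t)).x = 0)) :
    ∃ U : T.left.Opens, t ∈ U ∧ ∃ (w : resOver T U ⟶ E.tot) (c : Γ((resOver T U).left, ⊤)),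
      E.form _ (q.map (resι T U)).x w + (q.map (resι T U)).a * c = 1 := by
  by_cases ha : t ∈ T.left.basicOpen q.a
  -- Where `a` is invertible, `w = 0` and `c = a⁻¹` suffice; otherwise `x` is nonzero at `t` and is
  -- paired with a suitable `w`, with `c = 0`.
  · obtain ⟨r, hr⟩ := (isUnit_ι_appTop (le_refl (T.left.basicOpen q.a))).exists_right_inv
    exact ⟨_, ha, 0, r, by rw [map_zero, zero_add]; exact hr⟩
  have hx : pointι T t ≫ q.x ≠ 0 := fun h => ht ⟨(notMem_basicOpen_iff t q.a).1 ha, h⟩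
  obtain ⟨U₀, hU₀, b₀, hb₀⟩ := E.exists_frame_at T t
  obtain ⟨U, hU, htU, hle⟩ := exists_isAffineOpen_mem_and_subset hU₀
  let b : Fin 2 → (resOver T U ⟶ E.tot) := fun i => resLE T (show U ≤ U₀ from hle) ≫ b₀ i
  have hb : E.IsFrame b := hb₀.comp _
  let c := hb.equiv.symm (resι T U ≫ q.x)
  have hc : resι T U ≫ q.x = ∑ i, c i • b i := by
    rw [← Fintype.linearCombination_apply]
    exact (hb.equiv.apply_symm_apply _).symm
  let t' : U.toScheme := ⟨t, htU⟩
  have hi : ∃ i, t' ∈ U.toScheme.basicOpen (c i) := by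
    by_contra! hcon
    have h1 : pointι (resOver T U) t' ≫ resι T U ≫ q.x = 0 := by
      rw [hc, E.comp_sum]
      refine Finset.sum_eq_zero fun i _ => ?_
      rw [E.comp_smul]
      have : (pointι (resOver T U) t').left.appTop (c i) = 0 :=
        (notMem_basicOpen_iff (T := U.toScheme) t' (c i)).1 (hcon i)
      rw [this, zero_smul]
    have h2 := (E.mem_zeroLocus_iff (resι T U ≫ q.x) t').2 h1
    exact hx ((E.mem_zeroLocus_iff q.x t).1 h2)
  obtain ⟨i, hi⟩ := hi
  have hnd := E.nondeg (resOver T U) hU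
  obtain ⟨w, hw⟩ := hnd.bijective_left.2 (LinearMap.proj i ∘ₗ hb.equiv.symm.toLinearMap)
  -- The vector `w` represents the `i`-th coordinate in the first slot of the form; moving it to the
  -- second slot costs a sign.
  have hw' : E.form _ (resι T U ≫ q.x) (-w) = c i := by
    rw [map_neg, alt_swap (E.form_self _), neg_neg]
    exact LinearMap.congr_fun hw (resι T U ≫ q.x)
  let D : T.left.Opens := U.ι ''ᵁ (U.toScheme.basicOpen (c i))
  have hD : D ≤ U := by
    rintro _ ⟨y, -, rfl⟩
    exact y.2
  have hu : IsUnit ((resLE T hD).left.appTop (c i)) := by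
    apply isUnit_of_basicOpen_eq_top
    rw [← Scheme.preimage_basicOpen_top]
    refine top_le_iff.1 ?_
    rintro ⟨_, y, hy, rfl⟩ -
    have h5 : (resLE T hD).left (⟨U.ι y, y, hy, rfl⟩ : D.toScheme) = y := by
      apply Subtype.ext
      exact congrArg (fun f => f.left (⟨U.ι y, y, hy, rfl⟩ : D.toScheme)) (resLE_ι T hD)
    refine (congrArg (· ∈ U.toScheme.basicOpen (c i)) h5).mpr ?_
    exact hy
  obtain ⟨r, hr⟩ := hu.exists_left_inv
  refine ⟨D, ⟨t', hi, rfl⟩, r • (resLE T hD ≫ (-w)), 0, ?_⟩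
  have h6 : (q.map (resι T D)).x = resLE T hD ≫ resι T U ≫ q.x := by
    rw [← Category.assoc, resLE_ι]
    rfl
  rw [mul_zero, add_zero, map_smul, h6, E.form_comp, hw']
  exact hr

/-- The torsor over the complement of `N⁺`, as a morphism to `HP`. -/
def torsorHom (P : HPBundle (hypExt E)) : tripleScheme E ⟶ P.tot :=
  (P.equiv _).symm (torsorQuad (tripleSchemeEquiv E _ (𝟙 _)).1.1 (tripleSchemeEquiv E _ (𝟙 _)).1.2
    (tripleSchemeEquiv E _ (𝟙 _)).2)

theorem quad_map_comp_torsorHom (P : HPBundle (hypExt E)) {T : Over X} (v : T ⟶ tripleScheme E) :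
    P.quad.map (v ≫ torsorHom P) = torsorQuad (tripleSchemeEquiv E _ v).1.1
      (tripleSchemeEquiv E _ v).1.2 (tripleSchemeEquiv E _ v).2 := by
  have h := tripleSchemeEquiv_comp E v (𝟙 _)
  rw [Category.comp_id] at h
  rw [← Quad.map_map, torsorHom, P.quad_map_equiv_symm, torsorQuad_map, h]

/-- The fibres of the torsor are convex. -/
def torsorHom_convex (P : HPBundle (hypExt E)) : OverConvex (torsorHom P) where
  conv {T} p p' _ c := (tripleSchemeEquiv E T).symm
    (((tripleSchemeEquiv E T p).1.1,
      E.mix c (tripleSchemeEquiv E T p).1.2 (tripleSchemeEquiv E T p').1.2),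
      mixFun c (tripleSchemeEquiv E T p).2 (tripleSchemeEquiv E T p').2)
  conv_comp {T} v v' h c := by
    apply (P.equiv T).injective
    have h' := congrArg (P.equiv T) h
    rw [P.equiv_apply, P.equiv_apply, quad_map_comp_torsorHom, quad_map_comp_torsorHom] at h' ⊢
    have hx : (tripleSchemeEquiv E T v).1.1 = (tripleSchemeEquiv E T v').1.1 := congrArg Quad.x h'
    rw [Equiv.apply_symm_apply]
    rw [← hx] at h'
    exact torsorQuad_mix _ _ _ _ _ c h'
  comp_conv {T T'} g v v' _ c := by
    apply (tripleSchemeEquiv E T').injective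
    simp only [tripleSchemeEquiv_comp, Equiv.apply_symm_apply, E.comp_mix, map_mixFun]
  conv_zero {T} v v' h := by
    have h' := congrArg (P.equiv T) h
    rw [P.equiv_apply, P.equiv_apply, quad_map_comp_torsorHom, quad_map_comp_torsorHom] at h'
    have hx : (tripleSchemeEquiv E T v).1.1 = (tripleSchemeEquiv E T v').1.1 := congrArg Quad.x h'
    apply (tripleSchemeEquiv E T).injective
    simp [E.mix_zero, mixFun, hx]
  conv_one {T} v v' _ := by
    apply (tripleSchemeEquiv E T).injective
    simp [E.mix_one, mixFun]

theorem HPBundle.left_mem_plusLocus_iff (P : HPBundle (hypExt E)) {T : Over X} (g : T ⟶ P.tot)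
    (t : T.left) : g.left t ∈ P.plusLocus ↔
      (P.quad.map (pointι T t ≫ g)).a = 0 ∧ (P.quad.map (pointι T t ≫ g)).x = 0 := by
  rw [P.plusLocus_eq, ← Quad.map_map]
  have h1 : g.left t ∈ P.tot.left.basicOpen P.quad.a ↔
      t ∈ T.left.basicOpen (P.quad.map g).a := by
    refine Iff.trans ?_ (iff_of_eq (congrArg (t ∈ ·) (Scheme.preimage_basicOpen_top g.left P.quad.a)))
    rfl
  exact and_congr ((not_congr h1).trans (notMem_basicOpen_iff t _))
    (E.mem_zeroLocus_iff (P.quad.map g).x t)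

end Convex

/-! ### Schemes over a `k`-scheme as `k`-schemes -/

section Torsor

variable {k : Scheme.{u}} {V : SchemeCategory k}

/-- A morphism of `X`-schemes, as a morphism of `k`-schemes. -/
abbrev overBaseMap {X : Over k} {Y Z : Over X.left} (g : Y ⟶ Z) : overBase Y ⟶ overBase Z :=
  Over.homMk g.left (by
    change g.left ≫ Z.hom ≫ X.hom = Y.hom ≫ X.hom
    rw [← Category.assoc, Over.w g])

instance SPair.isOpenImmersion_openι (N : SPair V) : IsOpenImmersion N.openι.left :=
  inferInstanceAs (IsOpenImmersion N.compl.ι)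

theorem SPair.range_openι (N : SPair V) : Set.range N.openι.left = N.Zᶜ :=
  Scheme.Opens.range_ι N.compl

/-- A morphism to `X` avoiding `Z`, as a morphism to `X ∖ Z`. -/
def SPair.liftOpen (N : SPair V) {Y : Over k} (f : Y ⟶ N.X) (h : ∀ t, f.left t ∉ N.Z) :
    Y ⟶ N.openScheme :=
  have h' : Set.range f.left ⊆ Set.range N.openι.left := by
    rw [N.range_openι]
    rintro _ ⟨t, rfl⟩
    exact h t
  Over.homMk (IsOpenImmersion.lift N.openι.left f.left h') (by
    rw [← Over.w N.openι, ← Category.assoc, IsOpenImmersion.lift_fac]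
    exact Over.w f)

theorem SPair.liftOpen_openι (N : SPair V) {Y : Over k} (f : Y ⟶ N.X) (h : ∀ t, f.left t ∉ N.Z) :
    N.liftOpen f h ≫ N.openι = f := by
  ext1
  exact IsOpenImmersion.lift_fac _ _ _

variable {X : Over k} {E : SympBundle X.left 2}

namespace HPBundle

/-- The pair `(P, N⁺)`. -/
abbrev plusPair (hX : V.mem X) (P : HPBundle (hypExt E)) : SPair V :=
  ⟨overBase P.tot, P.plusLocus, adm_plusLocus V hX P⟩

/-- If `x` vanishes at a point, then `a = 1 - φ(x, v)` equals one there. -/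
theorem torsorHom_notMem (P : HPBundle (hypExt E)) (t : (tripleScheme E).left) :
    (torsorHom P).left t ∉ P.plusLocus := by
  rw [P.left_mem_plusLocus_iff, quad_map_comp_torsorHom]
  rintro ⟨h1, h2⟩
  change 1 - E.form _ _ _ = 0 at h1
  have h2 : (tripleSchemeEquiv E _ (pointι (tripleScheme E) t)).1.1 = 0 := h2
  rw [h2, map_zero, LinearMap.zero_apply, sub_zero] at h1
  have h3 : t ∉ (tripleScheme E).left.basicOpen (1 : Γ((tripleScheme E).left, ⊤)) := by
    rw [notMem_basicOpen_iff, map_one]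
    exact h1
  apply h3
  rw [Scheme.basicOpen_of_isUnit _ isUnit_one]
  trivial

/-- The torsor over the complement of `N⁺`. -/
def torsor (hX : V.mem X) (P : HPBundle (hypExt E)) :
    overBase (tripleScheme E) ⟶ (P.plusPair hX).openScheme :=
  (P.plusPair hX).liftOpen (overBaseMap (torsorHom P)) P.torsorHom_notMem

theorem torsor_openι (hX : V.mem X) (P : HPBundle (hypExt E)) :
    P.torsor hX ≫ (P.plusPair hX).openι = overBaseMap (torsorHom P) :=
  (P.plusPair hX).liftOpen_openι _ _

/-- Off `N⁺` one of `a`, `x` is nonzero, so locally there are `w`, `c` with `φ(x, w) + a c = 1`, and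
`torsorQuad_section` turns these into a local section. -/
theorem exists_torsor_section (hX : V.mem X) (P : HPBundle (hypExt E))
    (o : (P.plusPair hX).openScheme.left) :
    ∃ W : (P.plusPair hX).openScheme.left.Opens, o ∈ W ∧
      ∃ s : W.toScheme ⟶ (tripleScheme E).left, s ≫ (P.torsor hX).left = W.ι := by
  let N := P.plusPair hX
  let T : Over X.left := Over.mk (N.compl.ι ≫ P.tot.hom)
  let i : T ⟶ P.tot := Over.homMk N.compl.ι
  let t : T.left := o
  have ht : ¬ i.left t ∈ P.plusLocus := o.2
  rw [P.left_mem_plusLocus_iff, ← Quad.map_map] at ht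
  obtain ⟨W, hW, w, c, h⟩ := exists_form_add_eq_one (P.quad.map i) t ht
  let q := (P.quad.map i).map (resι T W)
  let s : resOver T W ⟶ tripleScheme E := (tripleSchemeEquiv E _).symm
    ((q.x, (1 - q.a) • w + c • q.y), -E.form _ q.y w)
  refine ⟨W, hW, s.left, ?_⟩
  have hs : s ≫ torsorHom P = resι T W ≫ i := by
    apply (P.equiv _).injective
    rw [P.equiv_apply, P.equiv_apply, quad_map_comp_torsorHom, Equiv.apply_symm_apply,
      ← Quad.map_map]
    exact torsorQuad_section q w c h
  refine (cancel_mono N.openι.left).1 ?_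
  refine (Category.assoc _ _ _).trans ?_
  have e : (P.torsor hX).left ≫ N.openι.left = (torsorHom P).left :=
    congrArg Over.Hom.left (P.torsor_openι hX)
  refine (congrArg (s.left ≫ ·) e).trans ?_
  exact congrArg Over.Hom.left hs

variable (B : CohomologyTheory.{u, w} V)

/-- The cohomology of the complement of `N⁺`. -/
theorem bijective_pullTop_open (hX : V.mem X) (P : HPBundle (hypExt E)) :
    Function.Bijective (B.pullTop hX (P.plusPair hX).mem_open
      ((P.plusPair hX).openι ≫ overBaseHom P.tot)) := by
  have hT := V.mem_tripleScheme hX E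
  have h1 : Function.Bijective (B.pullTop (P.plusPair hX).mem_open hT (P.torsor hX)) := by
    refine FibrewiseConvex.bijective_of_local_section B _ _ ?_ (P.exists_torsor_section hX)
    exact (torsorHom_convex P).toFibrewiseConvex.ofComp
      (congrArg Over.Hom.left (P.torsor_openι hX))
  have h2 : Function.Bijective (B.pullTop hX hT (overBaseHom (tripleScheme E))) :=
    (tripleScheme_convex E).bijective_of_section B hX hT
      ((tripleSchemeEquiv E (Over.mk (𝟙 X.left))).symm ((0, 0), 0)).left (Over.w _)
  have h3 : P.torsor hX ≫ (P.plusPair hX).openι ≫ overBaseHom P.tot =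
      overBaseHom (tripleScheme E) := by
    rw [← Category.assoc, torsor_openι]
    ext1
    exact Over.w (torsorHom P)
  -- The space `E × E × 𝔸¹` lies over both the complement of `N⁺` and `X`; both pullbacks to it are
  -- isomorphisms, hence so is the pullback from `X` to the complement.
  refine (Function.Bijective.of_comp_iff' h1 _).1 ?_
  convert h2 using 1
  funext x
  exact B.pull_pull_eq (a := SPair.topMap (P.plusPair hX).mem_open hT (P.torsor hX))
    (b := SPair.topMap hX (P.plusPair hX).mem_open ((P.plusPair hX).openι ≫ overBaseHom P.tot))
    (c := SPair.topMap hX hT (overBaseHom (tripleScheme E))) h3 x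

/-- Every class on the complement comes from `X`, hence extends to `P` by pulling back from `X`. -/
theorem surjective_pullTop_openι (hX : V.mem X) (P : HPBundle (hypExt E)) :
    Function.Surjective (B.pullTop (P.plusPair hX).adm.1 (P.plusPair hX).mem_open
      (P.plusPair hX).openι) := by
  intro y
  obtain ⟨x, rfl⟩ := (P.bijective_pullTop_open B hX).2 y
  exact ⟨B.pullTop hX (P.plusPair hX).adm.1 (overBaseHom P.tot) x,
    B.pull_pull_eq (c := SPair.topMap hX (P.plusPair hX).mem_open
      ((P.plusPair hX).openι ≫ overBaseHom P.tot)) rfl x⟩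

/-- Extension of supports from `N⁺` is injective. -/
theorem injective_extTop (hX : V.mem X) (P : HPBundle (hypExt E)) :
    Function.Injective (B.extTop (P.plusPair hX).adm) := by
  refine (injective_iff_map_eq_zero _).2 fun x hx => ?_
  -- A class in the kernel is a boundary, and boundaries vanish since restriction to the complement
  -- is surjective.
  obtain ⟨y, rfl⟩ := (B.exact_supp (P.plusPair hX) x).1 hx
  exact (B.exact_open (P.plusPair hX) y).2 (P.surjective_pullTop_openι B hX y)

end HPBundle

end Torsor

/-! ### Isometries with the tautological bundle -/

section Isometry

variable {X Y : Scheme.{u}} {m n : ℕ}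

theorem form_overCast (F : SympBundle X n) {L : Scheme.{u}} {h h' : L ⟶ X} (e : h = h')
    (v v' : Over.mk h' ⟶ F.tot) :
    F.form (Over.mk h) (overCast e ≫ v) (overCast e ≫ v') = F.form (Over.mk h') v v' := by
  rw [F.form_comp]
  exact overCast_left_appTop e _

/-- Classification only identifies the bundles compatibly with their maps to `𝒪 ⊕ E ⊕ 𝒪`. As both
maps are isometric, the identification is an isometry. -/
theorem HPBundle.exists_isometry {E : SympBundle X 2} (P : HPBundle (hypExt E)) {T : Over X}
    {W : SympBundle T.left 2} {j : BundleMap T.hom W.toVectorBundle (tripleBundle E.toVectorBundle)}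
    (hj : BundleMap.IsIsometric (E := hypExt E) j) (g : T ⟶ P.tot)
    (h : HasCoord j (𝟙 T) (P.quad.map g)) :
    ∃ c : BundleMap g.left W.toVectorBundle P.taut.toVectorBundle, c.IsCartesian ∧ c.IsIsometric ∧
      c.left ≫ P.inclTriple.left = j.left := by
  obtain ⟨c, hc, hcj⟩ := (HasCoord.classifies_iff P.isSubbundle (BundleMap.IsIsometric.isSubbundle hj)
    P.hasCoord h g).2 rfl
  refine ⟨c, hc, fun S v v' => ?_, hcj⟩
  have e : (S.hom ≫ g.left) ≫ P.tot.hom = S.hom ≫ T.hom := by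
    rw [Category.assoc]; exact congrArg _ (Over.w g)
  have key (v : S ⟶ W.tot) : P.inclTriple.app _ (c.app S v) = overCast e ≫ j.app S v := by
    ext1
    refine (Category.assoc v.left c.left P.inclTriple.left).trans ?_
    exact (congrArg (v.left ≫ ·) hcj).trans (Category.id_comp _).symm
  refine (P.isometric _ (c.app S v) (c.app S v')).symm.trans ?_
  refine (congrArg₂ (fun x y => (hypExt E).form _ x y) (key v) (key v')).trans ?_
  exact (form_overCast (hypExt E) e (j.app S v) (j.app S v')).trans (hj S v v')

/-! ### Subbundles given by formulas on points -/

/-- A natural linear family of maps from the points of `W` to the points of `F` over a scheme `T`. -/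
structure PointMap (T : Over X) (W : VectorBundle X m) (F : VectorBundle X n) where
  toFun : ∀ {S : Over X}, (S ⟶ T) → (S ⟶ W.tot) → (S ⟶ F.tot)
  comp : ∀ {S S' : Over X} (r : S' ⟶ S) (s : S ⟶ T) (w : S ⟶ W.tot),
    r ≫ toFun s w = toFun (r ≫ s) (r ≫ w)
  add : ∀ {S : Over X} (s : S ⟶ T) (w w' : S ⟶ W.tot), toFun s (w + w') = toFun s w + toFun s w'
  smul : ∀ {S : Over X} (s : S ⟶ T) (a : Γ(S.left, ⊤)) (w : S ⟶ W.tot),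
    toFun s (a • w) = a • toFun s w

namespace PointMap

variable {T : Over X} {W : VectorBundle X m} {F : VectorBundle X n} (Φ : PointMap T W F)

/-- The bundle map on the pullback given by a family of maps of points. -/
def bundleMap : BundleMap T.hom (W.pull T.hom) F :=
  BundleMap.ofPoints (fun S w => Φ.toFun (structHom S) ((W.pullMap T.hom).app S w))
    (fun {S S'} g v => by
      rw [Φ.comp, BundleMap.app_comp]
      congr 1
      ext1
      exact (Over.w g).symm)
    (fun S v v' => by rw [BundleMap.app_add, Φ.add])
    (fun S a v => by rw [BundleMap.app_smul, Φ.smul])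

theorem bundleMap_app (S : Over T.left) (w : S ⟶ (W.pull T.hom).tot) :
    Φ.bundleMap.app S w = Φ.toFun (structHom S) ((W.pullMap T.hom).app S w) :=
  BundleMap.app_eq Φ.bundleMap
    (fun S w => Φ.toFun (structHom S) ((W.pullMap T.hom).app S w)) (fun {S S'} g v => by
      rw [Φ.comp, BundleMap.app_comp]
      congr 1
      ext1
      exact (Over.w g).symm) rfl S w

theorem lies_iff {S : Over X} (s : S ⟶ T) (x : S ⟶ F.tot) :
    Lies Φ.bundleMap s x ↔ ∃ w : S ⟶ W.tot, Φ.toFun s w = x := by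
  let S' : Over T.left := Over.mk s.left
  have e : S.hom = S'.hom ≫ T.hom := (Over.w s).symm
  let i : S ⟶ (Over.map T.hom).obj S' := Over.homMk (𝟙 _) (by
    rw [Category.id_comp]; exact e.symm)
  let i' : (Over.map T.hom).obj S' ⟶ S := Over.homMk (𝟙 _) (by
    rw [Category.id_comp]; exact e)
  have hi : i ≫ i' = 𝟙 _ := by ext1; exact Category.id_comp _
  have hi' : i' ≫ i = 𝟙 _ := by ext1; exact Category.id_comp _
  have hs : i ≫ structHom S' = s := by ext1; exact Category.id_comp _
  have key (u : S' ⟶ (W.pull T.hom).tot) : i ≫ Φ.bundleMap.app S' u =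
      Φ.toFun s (i ≫ (W.pullMap T.hom).app S' u) := by
    rw [bundleMap_app, Φ.comp, hs]
  constructor
  · rintro ⟨u, hu, hu'⟩
    refine ⟨_, (key (Over.homMk u hu)).symm.trans ?_⟩
    ext1
    exact (Category.id_comp _).trans hu'
  · rintro ⟨w, hw⟩
    obtain ⟨u, hu⟩ := (W.pullMap_isCartesian T.hom S').2 (i' ≫ w)
    refine ⟨u.left, Over.w u, ?_⟩
    have h := key u
    rw [hu, ← Category.assoc, hi, Category.id_comp, hw] at h
    rw [← h]
    exact (Category.id_comp _).symm

theorem isIsometric {W : SympBundle X m} {F : SympBundle X n}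
    (Φ : PointMap T W.toVectorBundle F.toVectorBundle)
    (h : ∀ {S : Over X} (s : S ⟶ T) (w w' : S ⟶ W.tot),
      F.form S (Φ.toFun s w) (Φ.toFun s w') = W.form S w w') :
    BundleMap.IsIsometric (W := W.pull T.hom) (E := F) Φ.bundleMap := fun S v v' => by
  refine (congrArg₂ (fun x y => F.form _ x y) (Φ.bundleMap_app S v) (Φ.bundleMap_app S v')).trans ?_
  exact h _ _ _

end PointMap

variable {E : SympBundle X 2}

/-- The family `w ↦ (0, w, φ(v, w))` over `E`. -/
def minusPointMap (E : SympBundle X 2) :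
    PointMap E.tot E.toVectorBundle (tripleBundle E.toVectorBundle) where
  toFun {S} v w := (tripleCoord E.toVectorBundle S).symm (0, w, E.form S v w)
  comp r s w := by
    rw [tripleCoord_symm_comp, E.form_comp, Triple.map, map_zero]
  add s w w' := by
    rw [← map_add]
    congr 1
    simp
  smul s a w := by
    rw [← map_smul]
    congr 1
    simp

/-- The pullback of `E` to `E` is the pullback of the tautological bundle. -/
theorem HPBundle.exists_minus_isometry (P : HPBundle (hypExt E)) :
    ∃ c : BundleMap P.minus.left (E.pull E.tot.hom).toVectorBundle P.taut.toVectorBundle,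
      c.IsCartesian ∧ c.IsIsometric ∧
      c.left ≫ P.inclTriple.left = (minusPointMap E).bundleMap.left := by
  refine P.exists_isometry (W := E.pull E.tot.hom) ?_ P.minus ?_
  · refine PointMap.isIsometric (F := hypExt E) (minusPointMap E) fun {S} v w w' => ?_
    change tripleForm (E.form S) (tripleCoord _ S ((tripleCoord _ S).symm _))
      (tripleCoord _ S ((tripleCoord _ S).symm _)) = _
    rw [LinearEquiv.apply_symm_apply, LinearEquiv.apply_symm_apply, tripleForm_apply]
    simp
  · intro S s x
    rw [Category.comp_id, Quad.map_map, quad_map_comp_minus, minusQuad_proj_eq_iff]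
    refine ((minusPointMap E).lies_iff s x).trans ?_
    constructor
    · rintro ⟨w, rfl⟩
      change (tripleCoord _ S ((tripleCoord _ S).symm _)).1 = 0 ∧
        (tripleCoord _ S ((tripleCoord _ S).symm _)).2.2 =
          E.form S s (tripleCoord _ S ((tripleCoord _ S).symm _)).2.1
      rw [LinearEquiv.apply_symm_apply]
      exact ⟨rfl, rfl⟩
    · rintro ⟨h1, h2⟩
      refine ⟨(tripleCoord _ S x).2.1, ?_⟩
      refine (LinearEquiv.symm_apply_eq _).2 ?_
      exact Prod.ext h1.symm (Prod.ext rfl h2.symm)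

/-- The coordinates of the hyperbolic plane `𝒪 ⊕ 0 ⊕ 𝒪`. -/
def hypQuad (T : Over X) : Quad E T := ⟨1, 0, 0, by simp⟩

theorem hypQuad_map {T T' : Over X} (g : T' ⟶ T) : (hypQuad T : Quad E T).map g = hypQuad T' :=
  Quad.ext (map_one _) (E.comp_zero g) (E.comp_zero g)

theorem trivialCoord_comp {T T' : Over X} (g : T' ⟶ T) (v : T ⟶ (trivialBundle X).tot) :
    trivialCoord X T' (g ≫ v) = fun i => g.left.appTop (trivialCoord X T v i) :=
  trivialEquiv_comp X g v

/-- The family `(w₀, w₁) ↦ (w₁, 0, w₀)`. -/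
def hypPointMap (E : SympBundle X 2) :
    PointMap (Over.mk (𝟙 X)) (trivialBundle X) (tripleBundle E.toVectorBundle) where
  toFun {S} v w := (tripleCoord E.toVectorBundle S).symm
    (trivialCoord X S w 1, 0, trivialCoord X S w 0)
  comp r s w := by
    rw [tripleCoord_symm_comp, trivialCoord_comp, Triple.map, E.comp_zero]
  add s w w' := by
    rw [← map_add, map_add]
    congr 1
    simp
  smul s a w := by
    rw [← map_smul, map_smul]
    congr 1
    simp

/-- The hyperbolic plane is the image of the projector with `a = 1`, `x = y = 0`. The order `(w₁, 0,
w₀)` of coordinates matches the signs of the trivial form, whose matrix is `(0, -1; 1, 0)`. -/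
theorem HPBundle.exists_hyp_isometry (P : HPBundle (hypExt E)) (g : Over.mk (𝟙 X) ⟶ P.tot)
    (hg : P.quad.map g = hypQuad _) :
    ∃ c : BundleMap g.left ((trivialSymp X).pull (𝟙 X)).toVectorBundle P.taut.toVectorBundle,
      c.IsCartesian ∧ c.IsIsometric := by
  refine (P.exists_isometry (T := Over.mk (𝟙 X)) (W := (trivialSymp X).pull (𝟙 X))
    (j := (hypPointMap E).bundleMap) ?_ g ?_).imp fun c h => ⟨h.1, h.2.1⟩
  · refine PointMap.isIsometric (W := trivialSymp X) (F := hypExt E) (hypPointMap E)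
      fun {S} v w w' => ?_
    change tripleForm (E.form S) (tripleCoord _ S ((tripleCoord _ S).symm _))
      (tripleCoord _ S ((tripleCoord _ S).symm _)) = hypForm _ _ _
    rw [LinearEquiv.apply_symm_apply, LinearEquiv.apply_symm_apply, tripleForm_apply,
      hypForm_apply]
    simp
  · intro S s x
    rw [Category.comp_id, hg, hypQuad_map]
    refine ((hypPointMap E).lies_iff s x).trans ?_
    constructor
    · rintro ⟨w, rfl⟩
      change (hypQuad S).proj (tripleCoord _ S ((tripleCoord _ S).symm _)) =
        tripleCoord _ S ((tripleCoord _ S).symm _)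
      rw [LinearEquiv.apply_symm_apply]
      simp [Quad.proj, tripleProj_apply, hypQuad]
    · intro h
      have h1 : (tripleCoord E.toVectorBundle S x).2.1 = 0 := by
        rw [← h]
        simp [Quad.proj, tripleProj_apply, hypQuad]
      refine ⟨(trivialCoord X S).symm ![(tripleCoord _ S x).2.2, (tripleCoord _ S x).1], ?_⟩
      refine (LinearEquiv.symm_apply_eq _).2 ?_
      rw [LinearEquiv.apply_symm_apply]
      exact Prod.ext rfl (Prod.ext h1.symm rfl)

theorem trivialMap_nat (f : Y ⟶ X) {T T' : Over Y} (g : T' ⟶ T) (v : T ⟶ (trivialBundle Y).tot) :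
    (trivialCoord X ((Over.map f).obj T')).symm (trivialCoord Y T' (g ≫ v)) =
      (Over.map f).map g ≫ (trivialCoord X ((Over.map f).obj T)).symm (trivialCoord Y T v) := by
  refine (LinearEquiv.symm_apply_eq _).2 ?_
  refine (trivialCoord_comp g v).trans (Eq.trans ?_ (trivialCoord_comp ((Over.map f).map g) _).symm)
  exact congrArg (fun c : Fin 2 → Γ(T.left, ⊤) => fun i => g.left.appTop (c i))
    (LinearEquiv.apply_symm_apply (trivialCoord X ((Over.map f).obj T)) _).symm

/-- The canonical map between trivial bundles. -/
def trivialMap (f : Y ⟶ X) : BundleMap f (trivialBundle Y) (trivialBundle X) :=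
  BundleMap.ofPoints (fun T v => (trivialCoord X ((Over.map f).obj T)).symm (trivialCoord Y T v))
    (trivialMap_nat f)
    (fun T v v' => by rw [map_add]; exact map_add _ _ _)
    (fun T a v => by rw [map_smul]; exact map_smul (trivialCoord X ((Over.map f).obj T)).symm _ _)

theorem trivialMap_app (f : Y ⟶ X) (T : Over Y) (v : T ⟶ (trivialBundle Y).tot) :
    (trivialMap f).app T v =
      (trivialCoord X ((Over.map f).obj T)).symm (trivialCoord Y T v) :=
  BundleMap.app_eq (trivialMap f)
    (fun T v => (trivialCoord X ((Over.map f).obj T)).symm (trivialCoord Y T v))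
    (trivialMap_nat f) rfl T v

theorem trivialMap_isCartesian (f : Y ⟶ X) : (trivialMap f).IsCartesian := by
  intro T
  have : (trivialMap f).app T = (trivialCoord X ((Over.map f).obj T)).symm ∘ trivialCoord Y T :=
    funext fun v => trivialMap_app f T v
  rw [this]
  exact (trivialCoord X _).symm.bijective.comp (trivialCoord Y T).bijective

theorem trivialMap_isIsometric (f : Y ⟶ X) :
    BundleMap.IsIsometric (W := trivialSymp Y) (E := trivialSymp X) (trivialMap f) := by
  intro T v v'
  have key (v : T ⟶ (trivialBundle Y).tot) :
      trivialCoord X _ ((trivialMap f).app T v) = trivialCoord Y T v :=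
    (congrArg _ (trivialMap_app f T v)).trans (LinearEquiv.apply_symm_apply _ _)
  exact congrArg₂ (fun x y => hypForm Γ(T.left, ⊤) x y) (key v) (key v')

end Isometry

/-! ### The class `θ` -/

section Theta

variable {k : Scheme.{u}} {V : SchemeCategory k} {X : Over k} {E : SympBundle X.left 2}

/-- The section of `HP` given by the hyperbolic plane. -/
def HPBundle.hyp {X : Scheme.{u}} {E : SympBundle X 2} (P : HPBundle (hypExt E)) :
    Over.mk (𝟙 X) ⟶ P.tot :=
  (P.equiv _).symm (hypQuad _)

theorem HPBundle.hyp_notMem {X : Scheme.{u}} {E : SympBundle X 2} (P : HPBundle (hypExt E))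
    (t : X) : P.hyp.left t ∉ P.plusLocus := by
  refine (not_congr (P.left_mem_plusLocus_iff P.hyp t)).2 ?_
  rintro ⟨h, -⟩
  rw [← Quad.map_map, hyp, P.quad_map_equiv_symm, hypQuad_map] at h
  have h3 : t ∉ X.basicOpen (1 : Γ(X, ⊤)) := by
    refine (notMem_basicOpen_iff (T := X) t 1).2 ?_
    rw [map_one]
    exact h
  apply h3
  rw [Scheme.basicOpen_of_isUnit _ isUnit_one]
  trivial

/-- The section of `HP` given by the hyperbolic plane, as a morphism of `k`-schemes. -/
def HPBundle.hypOver (P : HPBundle (hypExt E)) : X ⟶ overBase P.tot :=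
  Over.homMk P.hyp.left (by
    have : P.hyp.left ≫ P.tot.hom = 𝟙 X.left := Over.w P.hyp
    change P.hyp.left ≫ P.tot.hom ≫ X.hom = _
    rw [← Category.assoc, this]
    exact Category.id_comp _)

theorem HPBundle.hypOver_comp (P : HPBundle (hypExt E)) :
    P.hypOver ≫ overBaseHom P.tot = 𝟙 X := by
  ext1
  exact Over.w P.hyp

variable {B : RingCohomologyTheory.{u, w} V} (p : PontryaginStructure B)

namespace PontryaginStructure

theorem cls_trivialSymp (hX : V.mem X) : p.cls hX (trivialSymp X.left) = 0 := by
  let f : X ⟶ Over.mk (𝟙 k) := Over.homMk X.hom (Category.comp_id _)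
  rw [← p.pull V.base hX f (trivialSymp k) (trivialSymp X.left) (trivialMap f.left)
    (trivialMap_isCartesian _) (trivialMap_isIsometric _), p.cls_trivial, map_zero]

theorem pullTop_hypOver (hX : V.mem X) (P : HPBundle (hypExt E)) :
    B.pullTop (P.plusPair hX).adm.1 hX P.hypOver (p.cls (P.plusPair hX).adm.1 P.taut) = 0 := by
  obtain ⟨c, h, h'⟩ := P.exists_hyp_isometry P.hyp (P.quad_map_equiv_symm _)
  let W : SympBundle X.left 2 := (trivialSymp X.left).pull (𝟙 X.left)
  have h1 : B.pullTop (P.plusPair hX).adm.1 hX P.hypOver (p.cls (P.plusPair hX).adm.1 P.taut) =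
      p.cls hX W := p.pull (X := overBase P.tot) _ hX P.hypOver P.taut W c h h'
  have h2 : B.pullTop hX hX (𝟙 X) (p.cls hX (trivialSymp X.left)) = p.cls hX W :=
    p.pull hX hX (𝟙 X) (trivialSymp X.left) W ((trivialSymp X.left).pullMap (𝟙 X.left))
      (VectorBundle.pullMap_isCartesian _ _) (SympBundle.pullMap_isIsometric _ _)
  rw [h1, ← h2, p.cls_trivialSymp, map_zero]

/-- Classes on the complement of `N⁺` come from `X`, so they are detected by any section of the
complement over `X`. At the hyperbolic plane the tautological bundle is trivial, and its class is
zero. -/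
theorem pullTop_openι_taut (hX : V.mem X) (P : HPBundle (hypExt E)) :
    B.pullTop (P.plusPair hX).adm.1 (P.plusPair hX).mem_open (P.plusPair hX).openι
      (p.cls (P.plusPair hX).adm.1 P.taut) = 0 := by
  let N := P.plusPair hX
  let s : X ⟶ N.openScheme := N.liftOpen P.hypOver P.hyp_notMem
  have hs : s ≫ N.openι = P.hypOver := N.liftOpen_openι _ _
  obtain ⟨c, hc⟩ := (P.bijective_pullTop_open B.toCohomologyTheory hX).2
    (B.pullTop N.adm.1 N.mem_open N.openι (p.cls N.adm.1 P.taut))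
  rw [← hc]
  have h1 : B.pullTop N.mem_open hX s (B.pullTop N.adm.1 N.mem_open N.openι
      (p.cls N.adm.1 P.taut)) = 0 :=
    (B.pull_pull_eq (a := SPair.topMap N.mem_open hX s) (b := SPair.topMap N.adm.1 N.mem_open N.openι)
      (c := SPair.topMap N.adm.1 hX P.hypOver) hs _).trans (p.pullTop_hypOver hX P)
  have h2 : B.pullTop N.mem_open hX s (B.pullTop hX N.mem_open
      (N.openι ≫ overBaseHom P.tot) c) = c := by
    refine B.pull_pull_eq_self (a := SPair.topMap N.mem_open hX s)
      (b := SPair.topMap hX N.mem_open (N.openι ≫ overBaseHom P.tot)) ?_ c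
    change s ≫ N.openι ≫ overBaseHom P.tot = 𝟙 X
    rw [← Category.assoc, hs, P.hypOver_comp]
  have h3 : c = 0 := by
    rw [← h2, hc, h1]
  rw [h3, map_zero]

theorem exists_theta (hX : V.mem X) (P : HPBundle (hypExt E)) :
    ∃ θ : B.grp (P.plusPair hX), B.extTop (P.plusPair hX).adm θ =
      p.cls (P.plusPair hX).adm.1 P.taut :=
  (B.exact_total (P.plusPair hX) _).1 (p.pullTop_openι_taut hX P)

/-- The class supported on `N⁺` lifting the Pontryagin class of the tautological bundle. -/
def theta (hX : V.mem X) (P : HPBundle (hypExt E)) : B.grp (P.plusPair hX) :=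
  (p.exists_theta hX P).choose

theorem extTop_theta (hX : V.mem X) (P : HPBundle (hypExt E)) :
    B.extTop (P.plusPair hX).adm (p.theta hX P) = p.cls (P.plusPair hX).adm.1 P.taut :=
  (p.exists_theta hX P).choose_spec

theorem eq_theta (hX : V.mem X) (P : HPBundle (hypExt E)) {θ : B.grp (P.plusPair hX)}
    (h : B.extTop (P.plusPair hX).adm θ = p.cls (P.plusPair hX).adm.1 P.taut) :
    θ = p.theta hX P :=
  P.injective_extTop B.toCohomologyTheory hX (h.trans (p.extTop_theta hX P).symm)

end PontryaginStructure

end Theta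

/-! ### Base change of quaternionic projective bundles -/

section BaseChange

variable {X Y : Scheme.{u}} {f : Y ⟶ X}

/-- The map `𝒪 ⊕ E' ⊕ 𝒪 ⟶ 𝒪 ⊕ E ⊕ 𝒪`. -/
def tripleMap {n : ℕ} {E' : VectorBundle Y n} {E : VectorBundle X n} (j : BundleMap f E' E) :
    BundleMap f (tripleBundle E') (tripleBundle E) :=
  BundleMap.ofPoints (fun T v => (tripleCoord E ((Over.map f).obj T)).symm
      ((tripleCoord E' T v).1, j.app T (tripleCoord E' T v).2.1, (tripleCoord E' T v).2.2))
    (fun {T T'} g v => by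
      rw [tripleCoord_comp]
      refine Eq.trans ?_ (tripleCoord_symm_comp E ((Over.map f).map g) _).symm
      refine congrArg _ (Prod.ext rfl (Prod.ext (j.app_comp g _) rfl)))
    (fun T v v' => by
      refine Eq.trans ?_ (map_add (tripleCoord E ((Over.map f).obj T)).symm _ _)
      rw [map_add]
      exact congrArg _ (Prod.ext rfl (Prod.ext (j.app_add _ _) rfl)))
    (fun T a v => by
      refine Eq.trans ?_ (map_smul (tripleCoord E ((Over.map f).obj T)).symm _ _)
      rw [map_smul]
      exact congrArg _ (Prod.ext rfl (Prod.ext (j.app_smul _ _) rfl)))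

end BaseChange

/-! ### Base change of quaternionic projective bundles -/

section BaseChange

variable {X Y : Scheme.{u}} {f : Y ⟶ X}

/-- Every morphism to a `Y`-scheme over `X` comes from a morphism over `Y`. -/
theorem over_map_induction {Z : Over Y} {motive : ∀ S : Over X, (S ⟶ (Over.map f).obj Z) → Prop}
    (h : ∀ (S : Over Y) (s : S ⟶ Z), motive ((Over.map f).obj S) ((Over.map f).map s))
    (S : Over X) (s : S ⟶ (Over.map f).obj Z) : motive S s := by
  have key (L : Scheme.{u}) (l : L ⟶ Z.left) (g : L ⟶ X) (e : (l ≫ Z.hom) ≫ f = g) :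
      motive (Over.mk g) (Over.homMk l (by rw [← e, Category.assoc]; rfl)) := by
    subst e
    exact h (Over.mk (l ≫ Z.hom)) (Over.homMk l)
  exact key S.left s.left S.hom (by rw [Category.assoc]; exact Over.w s)

theorem BundleMap.zeroLocus_preimage {m n : ℕ} {W : VectorBundle Y m} {E : VectorBundle X n}
    (j : BundleMap f W E) (hj : j.IsSubbundle) : j.left ⁻¹' E.zeroLocus = W.zeroLocus := by
  refine (j.preimage_zeroLocus hj).antisymm ?_
  rintro _ ⟨y, rfl⟩
  let s : (Over.map f).obj (Over.mk (𝟙 Y)) ⟶ Over.mk (𝟙 X) :=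
    Over.homMk f ((Category.comp_id f).trans (Category.id_comp f).symm)
  have h : j.app _ W.zero = s ≫ E.zero := j.app_zero.trans (E.comp_zero s).symm
  exact ⟨f y, (congrArg (fun g => g.left y) h).symm⟩

theorem tripleMap_app {n : ℕ} {E' : VectorBundle Y n} {E : VectorBundle X n} (j : BundleMap f E' E)
    (T : Over Y) (v : T ⟶ (tripleBundle E').tot) : (tripleMap j).app T v =
      (tripleCoord E ((Over.map f).obj T)).symm
        ((tripleCoord E' T v).1, j.app T (tripleCoord E' T v).2.1, (tripleCoord E' T v).2.2) :=
  BundleMap.app_eq (tripleMap j) (fun T v => (tripleCoord E ((Over.map f).obj T)).symm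
      ((tripleCoord E' T v).1, j.app T (tripleCoord E' T v).2.1, (tripleCoord E' T v).2.2))
    (fun {T T'} g v => by
      rw [tripleCoord_comp]
      refine Eq.trans ?_ (tripleCoord_symm_comp E ((Over.map f).map g) _).symm
      refine congrArg _ (Prod.ext rfl (Prod.ext (j.app_comp g _) rfl))) rfl T v

/-- The map on coordinates. -/
def BundleMap.tripleApp {n : ℕ} {E' : VectorBundle Y n} {E : VectorBundle X n} (j : BundleMap f E' E)
    {T : Over Y} (t : Triple E' T) : Triple E ((Over.map f).obj T) :=
  ⟨t.1, j.app T t.2.1, t.2.2⟩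

theorem tripleCoord_tripleMap_app {n : ℕ} {E' : VectorBundle Y n} {E : VectorBundle X n}
    (j : BundleMap f E' E) (T : Over Y) (v : T ⟶ (tripleBundle E').tot) :
    tripleCoord E _ ((tripleMap j).app T v) = j.tripleApp (tripleCoord E' T v) :=
  (congrArg _ (tripleMap_app j T v)).trans (LinearEquiv.apply_symm_apply _ _)

theorem BundleMap.IsCartesian.bijective_tripleApp {n : ℕ} {E' : VectorBundle Y n}
    {E : VectorBundle X n} {j : BundleMap f E' E} (hj : j.IsCartesian) (T : Over Y) :
    Function.Bijective (j.tripleApp (T := T)) := by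
  constructor
  · intro t t' h
    have h1 : t.1 = t'.1 := congrArg (fun z : Triple E ((Over.map f).obj T) => z.1) h
    have h2 : t.2.2 = t'.2.2 := congrArg (fun z : Triple E ((Over.map f).obj T) => z.2.2) h
    exact Prod.ext h1 (Prod.ext ((hj T).1 (congrArg (fun z => z.2.1) h)) h2)
  · intro t
    obtain ⟨v, hv⟩ := (hj T).2 t.2.1
    exact ⟨(t.1, v, t.2.2), Prod.ext rfl (Prod.ext hv rfl)⟩

theorem tripleMap_isCartesian {n : ℕ} {E' : VectorBundle Y n} {E : VectorBundle X n}
    {j : BundleMap f E' E} (hj : j.IsCartesian) : (tripleMap j).IsCartesian := by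
  intro T
  have : (tripleMap j).app T = (tripleCoord E ((Over.map f).obj T)).symm ∘ j.tripleApp ∘
      tripleCoord E' T := funext fun v => tripleMap_app j T v
  rw [this]
  exact (LinearEquiv.bijective _).comp ((hj.bijective_tripleApp T).comp (LinearEquiv.bijective _))

variable {E' : SympBundle Y 2} {E : SympBundle X 2}
  {j : BundleMap f E'.toVectorBundle E.toVectorBundle}

theorem tripleForm_tripleApp (hj : j.IsIsometric) {T : Over Y}
    (t t' : Triple E'.toVectorBundle T) : tripleForm (E.form ((Over.map f).obj T))
      (j.tripleApp t) (j.tripleApp t') = tripleForm (E'.form T) t t' := by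
  rw [tripleForm_apply, tripleForm_apply]
  exact congrArg (fun c => t.1 * t'.2.2 + c - t.2.2 * t'.1) (hj T t.2.1 t'.2.1)

theorem tripleMap_isIsometric (hj : j.IsIsometric) :
    BundleMap.IsIsometric (W := hypExt E') (E := hypExt E) (tripleMap j) := fun T v v' =>
  (congrArg₂ (fun x y => tripleForm (E.form ((Over.map f).obj T)) x y)
    (tripleCoord_tripleMap_app j T v) (tripleCoord_tripleMap_app j T v')).trans
    (tripleForm_tripleApp hj _ _)

/-- The image of coordinates. -/
def Quad.push (hj : j.IsIsometric) {T : Over Y} (q : Quad E' T) :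
    Quad E ((Over.map f).obj T) where
  a := q.a
  x := j.app T q.x
  y := j.app T q.y
  rel := (hj T q.x q.y).trans q.rel

theorem Quad.push_map (hj : j.IsIsometric) {T T' : Over Y} (q : Quad E' T) (g : T' ⟶ T) :
    (q.push hj).map ((Over.map f).map g) = (q.map g).push hj :=
  Quad.ext rfl (j.app_comp g q.x).symm (j.app_comp g q.y).symm

theorem Quad.bijective_push (hj : j.IsIsometric) (hc : j.IsCartesian) (T : Over Y) :
    Function.Bijective (Quad.push hj (T := T)) := by
  constructor
  · intro q q' h
    have h1 : q.a = q'.a := congrArg (fun z : Quad E ((Over.map f).obj T) => z.a) h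
    exact Quad.ext h1 ((hc T).1 (congrArg Quad.x h)) ((hc T).1 (congrArg Quad.y h))
  · intro q
    obtain ⟨x, hx⟩ := (hc T).2 q.x
    obtain ⟨y, hy⟩ := (hc T).2 q.y
    refine ⟨⟨q.a, x, y, ?_⟩, Quad.ext rfl hx hy⟩
    exact (hj T x y).symm.trans ((congrArg₂ (fun x y => E.form _ x y) hx hy).trans q.rel)

theorem Quad.push_proj (hj : j.IsIsometric) {T : Over Y} (q : Quad E' T)
    (t : Triple E'.toVectorBundle T) : (q.push hj).proj (j.tripleApp t) = j.tripleApp (q.proj t) := by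
  simp only [Quad.proj, tripleProj_apply]
  refine Prod.ext ?_ (Prod.ext ?_ ?_)
  · exact congrArg (fun c => q.a * t.1 - c) (hj T q.y t.2.1)
  · refine Eq.symm ((j.app_add _ _).trans ?_)
    refine congrArg₂ HAdd.hAdd ((j.app_add _ _).trans ?_) (j.app_smul _ _)
    exact congrArg₂ HAdd.hAdd (j.app_smul _ _) (j.app_smul _ _)
  · exact congrArg (fun c => c + q.a * t.2.2) (hj T q.x t.2.1)

variable (P' : HPBundle (hypExt E')) (P : HPBundle (hypExt E))

/-- The tautological bundle, mapped to `𝒪 ⊕ E ⊕ 𝒪`. -/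
def HPBundle.inclMap (j : BundleMap f E'.toVectorBundle E.toVectorBundle) :
    BundleMap ((Over.map f).obj P'.tot).hom P'.taut.toVectorBundle
      (tripleBundle E.toVectorBundle) :=
  P'.inclTriple.comp (tripleMap j) rfl

theorem HPBundle.inclMap_isIsometric (hj : j.IsIsometric) :
    BundleMap.IsIsometric (W := P'.taut) (E := hypExt E) (P'.inclMap j) := by
  intro S v v'
  have e : S.hom ≫ P'.tot.hom ≫ f = (S.hom ≫ P'.tot.hom) ≫ f := (Category.assoc _ _ _).symm
  have key (v : S ⟶ P'.taut.tot) : (P'.inclMap j).app S v =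
      overCast e ≫ (tripleMap j).app _ (P'.inclTriple.app S v) :=
    BundleMap.app_comp_bundleMap _ _ _ _ _
  refine (congrArg₂ (fun x y => (hypExt E).form _ x y) (key v) (key v')).trans ?_
  refine (form_overCast (hypExt E) e ((tripleMap j).app _ (P'.inclTriple.app S v))
    ((tripleMap j).app _ (P'.inclTriple.app S v'))).trans ?_
  have h1 := tripleMap_isIsometric hj ((Over.map P'.tot.hom).obj S) (P'.inclTriple.app S v)
    (P'.inclTriple.app S v')
  have h2 := P'.isometric S v v'
  refine Eq.trans ?_ h2
  refine Eq.trans ?_ h1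
  rfl

theorem HPBundle.inclMap_hasCoord (hc : j.IsCartesian) (hj : j.IsIsometric) :
    HasCoord (T := (Over.map f).obj P'.tot) (P'.inclMap j) (𝟙 _) (P'.quad.push hj) := by
  refine over_map_induction fun S s x => ?_
  obtain ⟨y, rfl⟩ := (tripleMap_isCartesian hc S).2 x
  rw [Category.comp_id, Quad.push_map, tripleCoord_tripleMap_app, Quad.push_proj,
    (hc.bijective_tripleApp S).1.eq_iff, ← P'.lies_iff]
  refine exists_congr fun u => and_congr_right fun hu => ?_
  have e : (P'.inclMap j).left = P'.inclTriple.left ≫ (tripleMap j).left :=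
    BundleMap.comp_left _ _ _
  have hw : P'.inclTriple.left ≫ (tripleBundle E'.toVectorBundle).tot.hom =
    P'.taut.tot.hom ≫ P'.tot.hom := Over.w P'.inclTriple.hom
  rw [e, ← Category.assoc]
  constructor
  · intro h
    refine BundleMap.IsSubbundle.hom_ext (fun T => (tripleMap_isCartesian hc T).1) ?_ h
    rw [Category.assoc, hw, ← Category.assoc, hu]
    exact (Over.w s).trans (Over.w y).symm
  · intro h
    rw [h]
    rfl

/-- The base change morphism between quaternionic projective bundles. -/
def HPBundle.baseMap (hj : j.IsIsometric) : (Over.map f).obj P'.tot ⟶ P.tot :=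
  (P.equiv _).symm (P'.quad.push hj)

theorem HPBundle.quad_map_comp_baseMap (hj : j.IsIsometric) {T : Over Y} (s : T ⟶ P'.tot) :
    P.quad.map ((Over.map f).map s ≫ P'.baseMap P hj) = (P'.quad.map s).push hj := by
  rw [← Quad.map_map, baseMap, P.quad_map_equiv_symm, Quad.push_map]

theorem HPBundle.exists_baseMap_isometry (hc : j.IsCartesian) (hj : j.IsIsometric) :
    ∃ c : BundleMap (P'.baseMap P hj).left P'.taut.toVectorBundle P.taut.toVectorBundle,
      c.IsCartesian ∧ c.IsIsometric := by
  refine (P.exists_isometry (T := (Over.map f).obj P'.tot) (P'.inclMap_isIsometric hj)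
    (P'.baseMap P hj) ?_).imp fun c h => ⟨h.1, h.2.1⟩
  rw [baseMap, P.quad_map_equiv_symm]
  exact P'.inclMap_hasCoord hc hj

/-- In terms of points, `P'` is the base change of `P`: both represent coordinates, and for a
Cartesian isometry coordinates over `E'` and over `E` correspond. -/
theorem HPBundle.bijective_comp_baseMap (hc : j.IsCartesian) (hj : j.IsIsometric) (T : Over Y) :
    Function.Bijective fun s : T ⟶ P'.tot => (Over.map f).map s ≫ P'.baseMap P hj := by
  have h : P.equiv _ ∘ (fun s : T ⟶ P'.tot => (Over.map f).map s ≫ P'.baseMap P hj) =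
      Quad.push hj ∘ P'.equiv T := funext fun s => P'.quad_map_comp_baseMap P hj s
  refine (Function.Bijective.of_comp_iff' (P.equiv _).bijective _).1 ?_
  rw [h]
  exact (Quad.bijective_push hj hc T).comp (P'.equiv T).bijective

theorem HPBundle.baseMap_preimage (hc : j.IsCartesian) (hj : j.IsIsometric) :
    (P'.baseMap P hj).left ⁻¹' P.plusLocus = P'.plusLocus := by
  have h : P.quad.map (P'.baseMap P hj) = P'.quad.push hj := P.quad_map_equiv_symm _
  have ha : (P'.baseMap P hj).left.appTop P.quad.a = P'.quad.a := congrArg Quad.a h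
  have hx : (P'.baseMap P hj).left ≫ P.quad.x.left = P'.quad.x.left ≫ j.left :=
    congrArg (fun q => q.x.left) h
  rw [P.plusLocus_eq, P'.plusLocus_eq, Set.preimage_inter, ← j.zeroLocus_preimage fun T => (hc T).1]
  refine congrArg₂ (· ∩ ·) ?_ ?_
  · rw [← ha, ← Scheme.preimage_basicOpen_top]
    rfl
  · ext t
    exact iff_of_eq (congrArg (fun g => g t ∈ E.zeroLocus) hx)

theorem HPBundle.minus_baseMap (hj : j.IsIsometric) :
    (Over.map f).map P'.minus ≫ P'.baseMap P hj = j.hom ≫ P.minus := by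
  apply (P.equiv _).injective
  rw [P.equiv_apply, P.equiv_apply, P'.quad_map_comp_baseMap, P.quad_map_comp_minus,
    ← Category.id_comp P'.minus, P'.quad_map_comp_minus]
  refine Quad.ext rfl ?_ j.app_zero
  exact (congrArg (· ≫ j.hom) ((Over.map f).map_id E'.tot)).trans (Category.id_comp _)

end BaseChange

/-! ### A chart of the quaternionic projective bundle around `N⁺` -/

section Chart

variable {X : Scheme.{u}}

/-- A morphism along which the function `a` is invertible factors through the locus where `a` is
invertible. -/
def resLift {T T' : Over X} (g : T' ⟶ T) (a : Γ(T.left, ⊤)) (h : IsUnit (g.left.appTop a)) :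
    T' ⟶ resOver T (T.left.basicOpen a) :=
  have h' : Set.range g.left ⊆ Set.range (T.left.basicOpen a).ι := by
    rw [Scheme.Opens.range_ι]
    rintro _ ⟨t, rfl⟩
    have : t ∈ g.left ⁻¹ᵁ T.left.basicOpen a := by
      rw [Scheme.preimage_basicOpen_top, Scheme.basicOpen_of_isUnit _ h]
      trivial
    exact this
  Over.homMk (IsOpenImmersion.lift (T.left.basicOpen a).ι g.left h') (by
    change _ ≫ (T.left.basicOpen a).ι ≫ T.hom = _
    rw [← Category.assoc, IsOpenImmersion.lift_fac]
    exact Over.w g)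

theorem resLift_resι {T T' : Over X} (g : T' ⟶ T) (a : Γ(T.left, ⊤))
    (h : IsUnit (g.left.appTop a)) : resLift g a h ≫ resι T (T.left.basicOpen a) = g := by
  ext1
  exact IsOpenImmersion.lift_fac _ _ _

instance mono_resι (T : Over X) (U : T.left.Opens) : Mono (resι T U) := by
  constructor
  intro Z g h e
  ext1
  rw [← cancel_mono U.ι]
  exact congrArg Over.Hom.left e

variable {E : SympBundle X 2}

/-- The point with affine coordinates `(x, y)`. -/
def chartQuad {T : Over X} (x y : T ⟶ E.tot) (b : Γ(T.left, ⊤)) (h : b * (1 + E.form T x y) = 1) :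
    Quad E T where
  a := 1 - b
  x := b • x
  y := b • y
  rel := by
    rw [map_smul, map_smul, LinearMap.smul_apply, smul_eq_mul, smul_eq_mul]
    linear_combination b * h

/-- With `r = (1 - a)⁻¹` the left side is `1 + r² a (1 - a) = 1 + a (1 - a)⁻¹`, which is `r`. So the
affine coordinates know the scaling factor. -/
theorem Quad.chart_form {T : Over X} (q : Quad E T) {r : Γ(T.left, ⊤)} (hr : r * (1 - q.a) = 1) :
    1 + E.form T (r • q.x) (r • q.y) = r := by
  rw [map_smul, map_smul, LinearMap.smul_apply, smul_eq_mul, smul_eq_mul, q.rel]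
  linear_combination (r * q.a - 1) * hr

theorem pairEquiv_symm_comp (A B : Over X) {T T' : Over X} (g : T' ⟶ T)
    (p : (T ⟶ A) × (T ⟶ B)) :
    g ≫ (pairEquiv A B T).symm p = (pairEquiv A B T').symm (g ≫ p.1, g ≫ p.2) := by
  apply (pairEquiv A B T').injective
  rw [pairEquiv_comp, Equiv.apply_symm_apply, Equiv.apply_symm_apply]

/-- The first projection of `E ×_X E`. -/
def pairFst (E : SympBundle X 2) : pairScheme E ⟶ E.tot := (pairEquiv E.tot E.tot _ (𝟙 _)).1

/-- The second projection of `E ×_X E`. -/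
def pairSnd (E : SympBundle X 2) : pairScheme E ⟶ E.tot := (pairEquiv E.tot E.tot _ (𝟙 _)).2

theorem comp_pairFst {T : Over X} (g : T ⟶ pairScheme E) :
    g ≫ pairFst E = (pairEquiv E.tot E.tot T g).1 := by
  have h := pairEquiv_comp E.tot E.tot g (𝟙 (pairScheme E))
  rw [Category.comp_id] at h
  rw [h]
  rfl

theorem comp_pairSnd {T : Over X} (g : T ⟶ pairScheme E) :
    g ≫ pairSnd E = (pairEquiv E.tot E.tot T g).2 := by
  have h := pairEquiv_comp E.tot E.tot g (𝟙 (pairScheme E))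
  rw [Category.comp_id] at h
  rw [h]
  rfl

theorem pairScheme_hom_ext {T : Over X} {g g' : T ⟶ pairScheme E}
    (h : g ≫ pairFst E = g' ≫ pairFst E) (h' : g ≫ pairSnd E = g' ≫ pairSnd E) : g = g' := by
  rw [comp_pairFst, comp_pairFst] at h
  rw [comp_pairSnd, comp_pairSnd] at h'
  exact (pairEquiv E.tot E.tot T).injective (Prod.ext h h')

/-- The fibres of the first projection are convex. -/
def pairFst_convex (E : SympBundle X 2) : OverConvex (pairFst E) where
  conv {T} p p' _ c := (pairEquiv E.tot E.tot T).symm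
    (p ≫ pairFst E, E.mix c (p ≫ pairSnd E) (p' ≫ pairSnd E))
  conv_comp {T} v v' h c := by
    rw [comp_pairFst, Equiv.apply_symm_apply]
  comp_conv {T T'} g v v' _ c := by
    rw [pairEquiv_symm_comp, E.comp_mix, Category.assoc, Category.assoc, Category.assoc]
  conv_zero {T} v v' h := by
    rw [E.mix_zero, h, comp_pairFst, comp_pairSnd]
    exact Equiv.symm_apply_apply _ _
  conv_one {T} v v' h := by
    rw [E.mix_one, comp_pairFst, comp_pairSnd]
    exact Equiv.symm_apply_apply _ _

/-- The function `1 + φ` on `E ×_X E`. -/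
def chartFun (E : SympBundle X 2) : Γ((pairScheme E).left, ⊤) :=
  1 + E.form _ (pairFst E) (pairSnd E)

theorem appTop_chartFun {T : Over X} (g : T ⟶ pairScheme E) :
    g.left.appTop (chartFun E) = 1 + E.form T (g ≫ pairFst E) (g ≫ pairSnd E) := by
  rw [chartFun, map_add, map_one, E.form_comp]

namespace HPBundle

variable (P : HPBundle (hypExt E))

/-- The open subset of `P` where `1 - a` is invertible. -/
abbrev chartOpen : P.tot.left.Opens := P.tot.left.basicOpen (1 - P.quad.a)

/-- The open subset of `P` where `1 - a` is invertible, as a scheme. -/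
abbrev chart : Over X := resOver P.tot P.chartOpen

theorem exists_inv : ∃ r, r * (1 - (P.quad.map (resι P.tot P.chartOpen)).a) = 1 := by
  obtain ⟨r, hr⟩ := (isUnit_ι_appTop (le_refl P.chartOpen)).exists_left_inv
  rw [map_sub, map_one] at hr
  exact ⟨r, hr⟩

/-- The inverse of `1 - a`. -/
def inv : Γ(P.chart.left, ⊤) := P.exists_inv.choose

theorem inv_mul : P.inv * (1 - (P.quad.map (resι P.tot P.chartOpen)).a) = 1 :=
  P.exists_inv.choose_spec

/-- The affine coordinates on the chart. -/
def chartHom : P.chart ⟶ pairScheme E :=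
  (pairEquiv E.tot E.tot _).symm (P.inv • (P.quad.map (resι P.tot P.chartOpen)).x,
    P.inv • (P.quad.map (resι P.tot P.chartOpen)).y)

theorem comp_chartHom_fst {T : Over X} (g : T ⟶ P.chart) : (g ≫ P.chartHom) ≫ pairFst E =
    g.left.appTop P.inv • (P.quad.map (g ≫ resι P.tot P.chartOpen)).x := by
  rw [Category.assoc, comp_pairFst, chartHom, Equiv.apply_symm_apply, ← Quad.map_map]
  exact E.comp_smul _ _ _

theorem comp_chartHom_snd {T : Over X} (g : T ⟶ P.chart) : (g ≫ P.chartHom) ≫ pairSnd E =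
    g.left.appTop P.inv • (P.quad.map (g ≫ resι P.tot P.chartOpen)).y := by
  rw [Category.assoc, comp_pairSnd, chartHom, Equiv.apply_symm_apply, ← Quad.map_map]
  exact E.comp_smul _ _ _

theorem appTop_inv_mul {T : Over X} (g : T ⟶ P.chart) :
    g.left.appTop P.inv * (1 - (P.quad.map (g ≫ resι P.tot P.chartOpen)).a) = 1 := by
  have h := congrArg g.left.appTop P.inv_mul
  rw [map_mul, map_sub, map_one] at h
  rw [← Quad.map_map]
  exact h

theorem appTop_chartFun_comp {T : Over X} (g : T ⟶ P.chart) :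
    (g ≫ P.chartHom).left.appTop (chartFun E) = g.left.appTop P.inv := by
  rw [appTop_chartFun, comp_chartHom_fst, comp_chartHom_snd]
  exact Quad.chart_form _ (P.appTop_inv_mul g)

/-- The point of the chart with given affine coordinates. -/
theorem exists_chart_lift {T : Over X} (v : T ⟶ pairScheme E)
    (h : IsUnit (v.left.appTop (chartFun E))) : ∃ g : T ⟶ P.chart, g ≫ P.chartHom = v := by
  obtain ⟨b, hb⟩ := h.exists_left_inv
  have hb' := hb
  rw [appTop_chartFun] at hb'
  -- The scaling is undone with `b = (1 + φ(x, y))⁻¹`, and `1 - b` takes the place of `a`.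
  let q := chartQuad (v ≫ pairFst E) (v ≫ pairSnd E) b hb'
  let g₀ : T ⟶ P.tot := (P.equiv T).symm q
  have hg₀ : P.quad.map g₀ = q := P.quad_map_equiv_symm q
  have ha : g₀.left.appTop (1 - P.quad.a) = b := by
    have h1 : g₀.left.appTop P.quad.a = 1 - b := congrArg Quad.a hg₀
    rw [map_sub, map_one, h1, sub_sub_cancel]
  let g : T ⟶ P.chart := resLift g₀ (1 - P.quad.a) (by
    rw [ha]
    exact IsUnit.of_mul_eq_one _ hb)
  have hg : g ≫ resι P.tot P.chartOpen = g₀ := resLift_resι _ _ _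
  have hr := P.appTop_inv_mul g
  rw [hg, hg₀] at hr
  have hr' : g.left.appTop P.inv * b = 1 := by
    rw [← hr]
    simp [q, chartQuad]
  refine ⟨g, pairScheme_hom_ext ?_ ?_⟩
  · rw [comp_chartHom_fst, hg, hg₀]
    change _ • (b • (v ≫ pairFst E)) = _
    rw [smul_smul, hr', one_smul]
  · rw [comp_chartHom_snd, hg, hg₀]
    change _ • (b • (v ≫ pairSnd E)) = _
    rw [smul_smul, hr', one_smul]

/-- The function `1 + φ` of the affine coordinates recovers `(1 - a)⁻¹`, hence `a`, and then
rescaling recovers `x` and `y`. -/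
instance mono_chartHom : Mono P.chartHom := by
  constructor
  intro T g g' h
  have hr := P.appTop_chartFun_comp g
  have hr' := P.appTop_chartFun_comp g'
  have e1 := P.comp_chartHom_fst g
  have e2 := P.comp_chartHom_snd g
  have u := P.appTop_inv_mul g
  have u' := P.appTop_inv_mul g'
  rw [h] at hr e1 e2
  rw [comp_chartHom_fst] at e1
  rw [comp_chartHom_snd] at e2
  have hrr := hr.symm.trans hr'
  rw [← hrr] at u' e1 e2
  let r := g.left.appTop P.inv
  rw [← cancel_mono (resι P.tot P.chartOpen)]
  apply (P.equiv T).injective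
  have hc {z z' : T ⟶ E.tot} (hz : r • z = r • z') : z = z' := by
    have := congrArg ((1 - (P.quad.map (g ≫ resι P.tot P.chartOpen)).a) • ·) hz
    simpa only [smul_smul, mul_comm _ r, r, u, one_smul] using this
  refine Quad.ext ?_ (hc e1).symm (hc e2).symm
  have h1 : (P.quad.map (g ≫ resι P.tot P.chartOpen)).a =
      (P.quad.map (g' ≫ resι P.tot P.chartOpen)).a := by
    linear_combination ((P.quad.map (g ≫ resι P.tot P.chartOpen)).a -
      (P.quad.map (g' ≫ resι P.tot P.chartOpen)).a) * (-u) +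
      (1 - (P.quad.map (g ≫ resι P.tot P.chartOpen)).a) * (u' - u)
  exact h1

/-- The affine coordinates are an open immersion. -/
theorem exists_chart_iso : ∃ i : P.chart ≅ resOver (pairScheme E)
    ((pairScheme E).left.basicOpen (chartFun E)), i.hom ≫ resι _ _ = P.chartHom := by
  obtain ⟨g, hg⟩ := P.exists_chart_lift (resι _ ((pairScheme E).left.basicOpen (chartFun E)))
    (isUnit_ι_appTop le_rfl)
  have hu : IsUnit (P.chartHom.left.appTop (chartFun E)) := by
    have := P.appTop_chartFun_comp (𝟙 _)
    rw [Category.id_comp] at this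
    rw [this]
    have h := P.appTop_inv_mul (𝟙 _)
    exact IsUnit.of_mul_eq_one _ h
  refine ⟨⟨resLift P.chartHom _ hu, g, ?_, ?_⟩, resLift_resι _ _ hu⟩
  · rw [← cancel_mono P.chartHom, Category.assoc, hg, resLift_resι, Category.id_comp]
  · rw [← cancel_mono (resι _ _), Category.assoc, resLift_resι, hg, Category.id_comp]

instance isOpenImmersion_chartHom : IsOpenImmersion P.chartHom.left := by
  obtain ⟨i, hi⟩ := P.exists_chart_iso
  rw [← hi]
  have : IsIso i.hom.left := inferInstanceAs (IsIso ((Over.forget X).mapIso i).hom)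
  exact inferInstanceAs (IsOpenImmersion
    (i.hom.left ≫ ((pairScheme E).left.basicOpen (chartFun E)).ι))

end HPBundle

end Chart

/-! ### Restriction from `N⁺` to the zero section -/

section Minus

variable {k : Scheme.{u}} {V : SchemeCategory k} {X : Over k} {E : SympBundle X.left 2}

namespace HPBundle

/-- The zero section of the first projection. -/
def pairZero {X : Scheme.{u}} (E : SympBundle X 2) : E.tot ⟶ pairScheme E :=
  (pairEquiv E.tot E.tot _).symm (𝟙 _, 0)

theorem pairZero_fst {X : Scheme.{u}} (E : SympBundle X 2) : pairZero E ≫ pairFst E = 𝟙 _ := by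
  rw [comp_pairFst, pairZero, Equiv.apply_symm_apply]

theorem pairZero_snd {X : Scheme.{u}} (E : SympBundle X 2) : pairZero E ≫ pairSnd E = 0 := by
  rw [comp_pairSnd, pairZero, Equiv.apply_symm_apply]

/-- Along `minus` one has `a = 0`, so the rescaling by `1 - a` is trivial and `(0, v, 0)` has affine
coordinates `(v, 0)`. -/
theorem exists_minus_lift {X : Scheme.{u}} {E : SympBundle X 2} (P : HPBundle (hypExt E)) :
    ∃ g : E.tot ⟶ P.chart, g ≫ resι P.tot P.chartOpen = P.minus ∧ g ≫ P.chartHom = pairZero E := by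
  have hq : P.quad.map P.minus = minusQuad (𝟙 _) := P.quad_map_equiv_symm _
  have ha : P.minus.left.appTop P.quad.a = 0 := congrArg Quad.a hq
  have ha' : P.minus.left.appTop (1 - P.quad.a) = 1 := by
    rw [map_sub, map_one, ha, sub_zero]
  let g := resLift P.minus (1 - P.quad.a) (by rw [ha']; exact isUnit_one)
  have hg : g ≫ resι P.tot P.chartOpen = P.minus := resLift_resι _ _ _
  have hi := P.appTop_inv_mul g
  rw [hg, hq] at hi
  have hi' : g.left.appTop P.inv = 1 := by
    rw [← hi]
    simp [minusQuad]
  refine ⟨g, hg, pairScheme_hom_ext ?_ ?_⟩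
  · rw [comp_chartHom_fst, hg, hq, hi', pairZero_fst, one_smul]
    rfl
  · rw [comp_chartHom_snd, hg, hq, hi', pairZero_snd, one_smul]
    rfl

/-- If `x = 0`, then `a (1 - a) = 0`, and invertibility of `1 - a` gives `a = 0`. So on the chart
the equation `x = 0` alone cuts out `N⁺`. -/
theorem chart_plusLocus_iff {X : Scheme.{u}} {E : SympBundle X 2} (P : HPBundle (hypExt E))
    (t : P.chart.left) : (resι P.tot P.chartOpen).left t ∈ P.plusLocus ↔
      (P.chartHom ≫ pairFst E).left t ∈ E.zeroLocus := by
  rw [P.left_mem_plusLocus_iff]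
  refine Iff.trans ?_ (E.toVectorBundle.mem_zeroLocus_iff (P.chartHom ≫ pairFst E) t).symm
  let g := pointι P.chart t
  let q := P.quad.map (g ≫ resι P.tot P.chartOpen)
  have hi : g.left.appTop P.inv * (1 - q.a) = 1 := P.appTop_inv_mul g
  have h1 : g ≫ P.chartHom ≫ pairFst E = g.left.appTop P.inv • q.x :=
    (Category.assoc _ _ _).symm.trans (P.comp_chartHom_fst g)
  rw [h1]
  constructor
  · rintro ⟨-, h⟩
    rw [show q.x = 0 from h, smul_zero]
  · intro h
    have hx : q.x = 0 := by
      have := congrArg ((1 - q.a) • ·) h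
      simpa only [smul_smul, mul_comm _ (g.left.appTop P.inv), hi, one_smul, smul_zero] using this
    refine ⟨?_, hx⟩
    have hr := q.rel
    rw [hx, map_zero, LinearMap.zero_apply] at hr
    have : q.a = 0 := by
      linear_combination (-q.a) * hi - g.left.appTop P.inv * hr
    exact this

theorem plusLocus_subset_chart {X : Scheme.{u}} {E : SympBundle X 2} (P : HPBundle (hypExt E)) :
    P.plusLocus ⊆ P.chartOpen := by
  intro t ht
  have h := (P.plusLocus_eq ▸ ht).1
  exact (mem_basicOpen_or (add_sub_cancel P.quad.a 1) t).resolve_left h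

/-- Where the first vector vanishes, `1 + φ` equals one, so the point satisfies the condition
defining the image of the chart. -/
theorem zero_mem_range_chart {X : Scheme.{u}} {E : SympBundle X 2} (P : HPBundle (hypExt E))
    (t : (pairScheme E).left) (ht : (pairFst E).left t ∈ E.zeroLocus) :
    t ∈ Set.range P.chartHom.left := by
  have h1 : pointι _ t ≫ pairFst E = 0 := (E.toVectorBundle.mem_zeroLocus_iff (pairFst E) t).1 ht
  obtain ⟨g, hg⟩ := P.exists_chart_lift (pointι _ t) (by
    rw [appTop_chartFun, h1, map_zero, LinearMap.zero_apply, add_zero]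
    exact isUnit_one)
  have h2 : g.left ≫ P.chartHom.left = (pairScheme E).left.fromSpecResidueField t :=
    congrArg Over.Hom.left hg
  have h3 : t ∈ Set.range ((pairScheme E).left.fromSpecResidueField t) := by
    rw [Scheme.range_fromSpecResidueField]
    rfl
  obtain ⟨s, hs⟩ := h3
  exact ⟨g.left s, (congrArg (fun f => f s) h2).trans hs⟩

/-- The morphism `E ⟶ P`, as a morphism of pairs. -/
abbrev minusPair (hX : V.mem X) (P : HPBundle (hypExt E))
    (hE : V.Adm (overBase E.tot) E.zeroLocus) :
    (⟨overBase E.tot, E.zeroLocus, hE⟩ : SPair V) ⟶ P.plusPair hX :=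
  ⟨overBaseMap P.minus, P.minus_preimage_plusLocus.subset⟩

variable (B : CohomologyTheory.{u, w} V)

/-- The chart and its image in `E × E` are excisive neighbourhoods, so the cohomology of `P`
supported on `N⁺` is that of `E × E` supported on `0 × E`. Projection to the first factor is convex
on fibres, and the morphism to be studied becomes its section `v ↦ (v, 0)`. -/
theorem bijective_pull_minusPair (hX : V.mem X) (P : HPBundle (hypExt E))
    (hE : V.Adm (overBase E.tot) E.zeroLocus) :
    Function.Bijective (B.pull (P.minusPair hX hE)) := by
  obtain ⟨g, hg, hg'⟩ := P.exists_minus_lift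
  have hP := V.mem_HP hX P
  have hcomp : CompactSpace P.tot.left := V.quasiCompact _ hP
  have hU : V.mem (overBase P.chart) := by
    refine V.opens (overBaseMap (resι P.tot P.chartOpen)) (inferInstanceAs (IsOpenImmersion
      P.chartOpen.ι)) ?_ hP
    refine isCompact_iff_compactSpace.mp ?_
    exact isCompact_basicOpen P.tot.left (U := ⊤) isCompact_univ _
  have hM : V.mem (overBase (pairScheme E)) := V.mem_pairScheme hX E
  let O : SPair V := ⟨overBase E.tot, E.zeroLocus, hE⟩
  let N := P.plusPair hX
  let C : SPair V := ⟨overBase P.chart, _, N.adm.preimage hU (overBaseMap (resι P.tot P.chartOpen))⟩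
  let M : SPair V := ⟨overBase (pairScheme E), _, hE.preimage hM (overBaseMap (pairFst E))⟩
  let a : C ⟶ N := ⟨overBaseMap (resι P.tot P.chartOpen), subset_rfl⟩
  have hpre : P.chartHom.left ⁻¹' M.Z = C.Z := by
    ext t
    exact (P.chart_plusLocus_iff t).symm
  let b : C ⟶ M := ⟨overBaseMap P.chartHom, hpre.subset⟩
  let c : M ⟶ O := ⟨overBaseMap (pairFst E), subset_rfl⟩
  have hz (t) : (pairFst E).left ((pairZero E).left t) = t :=
    congrArg (fun f => f.left t) (pairZero_fst E)
  have hzl : (pairZero E).left ≫ (pairFst E).left = 𝟙 _ := congrArg Over.Hom.left (pairZero_fst E)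
  have hgl : g.left ≫ P.chartOpen.ι = P.minus.left := congrArg Over.Hom.left hg
  have hgl' : g.left ≫ P.chartHom.left = (pairZero E).left := congrArg Over.Hom.left hg'
  let z : O ⟶ M := ⟨overBaseMap (pairZero E), fun t ht => by
    have ht' : (pairFst E).left ((pairZero E).left t) ∈ E.zeroLocus := ht
    rwa [hz] at ht'⟩
  let d : O ⟶ C := ⟨overBaseMap g, fun t ht => by
    have ht' : (resι P.tot P.chartOpen).left (g.left t) ∈ P.plusLocus := ht
    have h : (resι P.tot P.chartOpen).left (g.left t) = P.minus.left t :=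
      congrArg (fun f => f.left t) hg
    rw [h] at ht'
    exact P.minus_preimage_plusLocus.subset ht'⟩
  have ha : Function.Bijective (B.pull a) := by
    refine B.bijective_pull_of_isOpenImmersion a (inferInstanceAs (IsOpenImmersion
      P.chartOpen.ι)) rfl ?_
    intro t ht
    exact ⟨⟨t, P.plusLocus_subset_chart ht⟩, rfl⟩
  have hb : Function.Bijective (B.pull b) :=
    B.bijective_pull_of_isOpenImmersion b P.isOpenImmersion_chartHom hpre P.zero_mem_range_chart
  -- Here the support is the full preimage of the zero section, so homotopy invariance holds with
  -- supports.
  have hc : Function.Bijective (B.pull c) :=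
    (pairFst_convex E).toFibrewiseConvex.bijective_pull_of_section B c rfl (pairZero E).left hzl
  have hzc (x) : B.pull z (B.pull c x) = x := B.pull_pull_eq_self (by
    ext1; exact hzl) x
  have hzb : Function.Bijective (B.pull z) := by
    refine (Function.Bijective.of_comp_iff (B.pull z) hc).1 ?_
    have : B.pull z ∘ B.pull c = id := funext hzc
    rw [this]
    exact Function.bijective_id
  have hdb : Function.Bijective (B.pull d) := by
    refine (Function.Bijective.of_comp_iff (B.pull d) hb).1 ?_
    have : B.pull d ∘ B.pull b = B.pull z := funext fun x => B.pull_pull_eq (by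
      ext1; exact hgl') x
    rw [this]
    exact hzb
  have : ⇑(B.pull (P.minusPair hX hE)) = B.pull d ∘ B.pull a := funext fun x =>
    (B.pull_pull_eq (by ext1; exact hgl) x).symm
  rw [this]
  exact hdb.comp ha

end HPBundle

end Minus

/-! ### Products and pullbacks -/

section Products

variable {k : Scheme.{u}} {V : SchemeCategory k} (B : RingCohomologyTheory.{u, w} V)

namespace RingCohomologyTheory

theorem pull_lmul {P Q : SPair V} (b : P ⟶ Q) (a : B.coh Q.adm.1) (x : B.grp Q) :
    B.pull b (B.lmul Q.adm a x) =
      B.lmul P.adm (B.pullTop Q.adm.1 P.adm.1 b.f a) (B.pull b x) := by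
  have h := B.cup_pull (V.adm_univ Q.adm.1) Q.adm (V.adm_univ P.adm.1) P.adm b.f
    (fun _ _ => trivial) b.sub a x
  refine Eq.trans ?_ (congrArg (B.ext ((V.adm_univ P.adm.1).inter P.adm) P.adm
    Set.inter_subset_right) h)
  exact B.pull_comm ((Category.comp_id _).trans (Category.id_comp _).symm) _

theorem pull_rmul {P Q : SPair V} (b : P ⟶ Q) (a : B.coh Q.adm.1) (x : B.grp Q) :
    B.pull b (B.rmul Q.adm x a) =
      B.rmul P.adm (B.pull b x) (B.pullTop Q.adm.1 P.adm.1 b.f a) := by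
  have h := B.cup_pull Q.adm (V.adm_univ Q.adm.1) P.adm (V.adm_univ P.adm.1) b.f
    b.sub (fun _ _ => trivial) x a
  refine Eq.trans ?_ (congrArg (B.ext (P.adm.inter (V.adm_univ P.adm.1)) P.adm
    Set.inter_subset_left) h)
  exact B.pull_comm ((Category.comp_id _).trans (Category.id_comp _).symm) _

theorem pullTop_id {X : Over k} (hX : V.mem X) (a : B.coh hX) : B.pullTop hX hX (𝟙 X) a = a :=
  B.pull_eq_self (a := SPair.topMap hX hX (𝟙 X)) rfl a

theorem extTop_lmul (P : SPair V) (a : B.coh P.adm.1) (x : B.grp P) :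
    B.extTop P.adm (B.lmul P.adm a x) = B.mul P.adm.1 a (B.extTop P.adm x) := by
  refine (B.pull_lmul (SPair.incl P.adm (V.adm_univ P.adm.1) (Set.subset_univ _)) a x).trans ?_
  exact congrArg (fun c => B.mul P.adm.1 c (B.extTop P.adm x)) (B.pullTop_id _ a)

theorem extTop_rmul (P : SPair V) (a : B.coh P.adm.1) (x : B.grp P) :
    B.extTop P.adm (B.rmul P.adm x a) = B.mul P.adm.1 (B.extTop P.adm x) a := by
  refine (B.pull_rmul (SPair.incl P.adm (V.adm_univ P.adm.1) (Set.subset_univ _)) a x).trans ?_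
  exact congrArg (fun c => B.mul P.adm.1 (B.extTop P.adm x) c) (B.pullTop_id _ a)

theorem pullTop_mul {X Y : Over k} (hX : V.mem X) (hY : V.mem Y) (f : Y ⟶ X) (a b : B.coh hX) :
    B.pullTop hX hY f (B.mul hX a b) = B.mul hY (B.pullTop hX hY f a) (B.pullTop hX hY f b) :=
  B.pull_lmul (SPair.topMap hX hY f) a b

theorem pullTop_pullTop {X Y Z : Over k} (hX : V.mem X) (hY : V.mem Y) (hZ : V.mem Z) {f : Y ⟶ X}
    {g : Z ⟶ Y} {h : Z ⟶ X} (e : g ≫ f = h) (a : B.coh hX) :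
    B.pullTop hY hZ g (B.pullTop hX hY f a) = B.pullTop hX hZ h a :=
  B.pull_pull_eq (a := SPair.topMap hY hZ g) (b := SPair.topMap hX hY f)
    (c := SPair.topMap hX hZ h) e a

theorem extTop_pull {P Q : SPair V} (b : P ⟶ Q) (x : B.grp Q) : B.extTop P.adm (B.pull b x) =
    B.pullTop Q.adm.1 P.adm.1 b.f (B.extTop Q.adm x) :=
  B.pull_comm ((Category.id_comp _).trans (Category.comp_id _).symm) x

theorem lmul_zero {X : Over k} {Z : Set X.left} (hZ : V.Adm X Z) (a : B.coh hZ.1) :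
    B.lmul hZ a 0 = 0 := by
  rw [lmul, map_zero, map_zero]

theorem lmul_neg {X : Over k} {Z : Set X.left} (hZ : V.Adm X Z) (a : B.coh hZ.1)
    (x : B.grp ⟨X, Z, hZ⟩) : B.lmul hZ a (-x) = -B.lmul hZ a x := by
  rw [lmul, map_neg, map_neg, lmul]

theorem rmul_neg {X : Over k} {Z : Set X.left} (hZ : V.Adm X Z) (a : B.coh hZ.1)
    (x : B.grp ⟨X, Z, hZ⟩) : B.rmul hZ (-x) a = -B.rmul hZ x a := by
  rw [rmul, map_neg]
  exact map_neg (B.ext (hZ.inter (V.adm_univ hZ.1)) hZ Set.inter_subset_left)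
    (B.cup hZ (V.adm_univ hZ.1) x a)

end RingCohomologyTheory

end Products

/-! ### Naturality of `θ` -/

section Naturality

variable {k : Scheme.{u}} {V : SchemeCategory k}

/-- A morphism over `f : Y ⟶ X`, as a morphism of `k`-schemes. -/
abbrev overMapHom {X Y : Over k} {f : Y ⟶ X} {Z' : Over Y.left} {Z : Over X.left}
    (g : (Over.map f.left).obj Z' ⟶ Z) : overBase Z' ⟶ overBase Z :=
  Over.homMk g.left (by
    have h : g.left ≫ Z.hom = Z'.hom ≫ f.left := Over.w g
    change g.left ≫ Z.hom ≫ X.hom = Z'.hom ≫ Y.hom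
    rw [← Category.assoc, h, Category.assoc]
    exact congrArg _ (Over.w f))

variable {X Y : Over k} {f : Y ⟶ X} {E' : SympBundle Y.left 2} {E : SympBundle X.left 2}
  {j : BundleMap f.left E'.toVectorBundle E.toVectorBundle}
  (P' : HPBundle (hypExt E')) (P : HPBundle (hypExt E))

/-- The base change morphism, as a morphism of pairs. -/
abbrev HPBundle.basePair (hX : V.mem X) (hY : V.mem Y) (hc : j.IsCartesian) (hj : j.IsIsometric) :
    P'.plusPair hY ⟶ P.plusPair hX :=
  ⟨overMapHom (f := f) (P'.baseMap P hj), (P'.baseMap_preimage P hc hj).subset⟩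

variable {B : RingCohomologyTheory.{u, w} V} (p : PontryaginStructure B)

namespace PontryaginStructure

theorem pullTop_baseMap (hX : V.mem X) (hY : V.mem Y) (hc : j.IsCartesian) (hj : j.IsIsometric) :
    B.pullTop (P.plusPair hX).adm.1 (P'.plusPair hY).adm.1 (overMapHom (f := f) (P'.baseMap P hj))
      (p.cls (P.plusPair hX).adm.1 P.taut) = p.cls (P'.plusPair hY).adm.1 P'.taut := by
  obtain ⟨c, h, h'⟩ := P'.exists_baseMap_isometry P hc hj
  exact p.pull (X := overBase P.tot) (Y := overBase P'.tot) _ _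
    (overMapHom (f := f) (P'.baseMap P hj)) P.taut P'.taut c h h'

/-- The pulled back class maps to `p` of the tautological bundle of `P'`, and `θ` is the only class
with this property. -/
theorem pull_theta (hX : V.mem X) (hY : V.mem Y) (hc : j.IsCartesian) (hj : j.IsIsometric) :
    B.pull (P'.basePair P hX hY hc hj) (p.theta hX P) = p.theta hY P' := by
  apply p.eq_theta hY P'
  rw [B.extTop_pull, p.extTop_theta]
  exact p.pullTop_baseMap P' P hX hY hc hj

/-- The Thom class computed on a given quaternionic projective bundle. -/
def thomClass (hX : V.mem X) (P : HPBundle (hypExt E)) (hE : V.Adm (overBase E.tot) E.zeroLocus) :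
    B.grp ⟨overBase E.tot, E.zeroLocus, hE⟩ :=
  -B.pull (P.minusPair hX hE) (p.theta hX P)

theorem pull_thomClass (hX : V.mem X) (hY : V.mem Y) (hE : V.Adm (overBase E.tot) E.zeroLocus)
    (hE' : V.Adm (overBase E'.tot) E'.zeroLocus) (hc : j.IsCartesian) (hj : j.IsIsometric) :
    B.pull (SPair.homMk hE hE' (totMap j) (j.preimage_zeroLocus fun T => (hc T).1))
      (p.thomClass hX P hE) = p.thomClass hY P' hE' := by
  rw [thomClass, thomClass, map_neg, ← p.pull_theta P' P hX hY hc hj]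
  refine congrArg _ (B.pull_comm ?_ _)
  ext1
  exact (congrArg Over.Hom.left (P'.minus_baseMap P hj)).symm

end PontryaginStructure

/-- The identity of a bundle, as a bundle map. -/
def BundleMap.id {X : Scheme.{u}} {n : ℕ} (E : VectorBundle X n) : BundleMap (𝟙 X) E E :=
  BundleMap.ofPoints (fun T v => overCast (h := T.hom ≫ 𝟙 X) (h' := T.hom) (Category.comp_id _) ≫ v)
    (fun g v => by
      ext1
      change 𝟙 _ ≫ g.left ≫ v.left = g.left ≫ 𝟙 _ ≫ v.left
      simp)
    (fun T v v' => E.comp_add _ _ _)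
    (fun T a v => (E.comp_smul _ _ _).trans
      (congrArg (· • _) (overCast_left_appTop (Category.comp_id T.hom) a)))

theorem BundleMap.id_left {X : Scheme.{u}} {n : ℕ} (E : VectorBundle X n) :
    (BundleMap.id E).left = 𝟙 _ := Category.id_comp (𝟙 E.tot.left)

theorem BundleMap.id_app_left {X : Scheme.{u}} {n : ℕ} (E : VectorBundle X n) {T : Over X}
    (v : T ⟶ E.tot) : ((BundleMap.id E).app T v).left = v.left := by
  rw [BundleMap.app_left, BundleMap.id_left, Category.comp_id]

theorem BundleMap.id_isCartesian {X : Scheme.{u}} {n : ℕ} (E : VectorBundle X n) :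
    (BundleMap.id E).IsCartesian := by
  intro T
  constructor
  · intro v v' h
    ext1
    rw [← BundleMap.id_app_left E v, h, BundleMap.id_app_left]
  · intro v
    refine ⟨Over.homMk v.left ((Over.w v).trans (Category.comp_id _)), ?_⟩
    ext1
    exact BundleMap.id_app_left E _

theorem BundleMap.id_isIsometric {X : Scheme.{u}} {n : ℕ} (E : SympBundle X n) :
    BundleMap.IsIsometric (W := E) (E := E) (BundleMap.id E.toVectorBundle) := by
  intro T v v'
  have key (v : T ⟶ E.tot) : (BundleMap.id E.toVectorBundle).app T v =
      overCast (h := T.hom ≫ 𝟙 X) (h' := T.hom) (Category.comp_id _) ≫ v := by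
    ext1
    exact (BundleMap.id_app_left _ v).trans (Category.id_comp _).symm
  refine (congrArg₂ (fun x y => E.form _ x y) (key v) (key v')).trans ?_
  exact form_overCast E _ v v'

/-- The Thom class does not depend on the choice of `HP`. -/
theorem PontryaginStructure.thomClass_eq (hX : V.mem X) (P P' : HPBundle (hypExt E))
    (hE : V.Adm (overBase E.tot) E.zeroLocus) : p.thomClass hX P hE = p.thomClass hX P' hE := by
  -- Two models are compared by base change along the identity of `X`.
  rw [← p.pull_thomClass (f := 𝟙 X) P' P hX hX hE hE (BundleMap.id_isCartesian E.toVectorBundle)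
    (BundleMap.id_isIsometric E)]
  refine (B.pull_eq_self ?_ _).symm
  ext1
  exact BundleMap.id_left E.toVectorBundle

namespace PontryaginStructure

/-- After extension of supports this is the centrality of `p`, and extension of supports from `N⁺`
is injective. -/
theorem theta_central (hX : V.mem X) (a : B.coh (P.plusPair hX).adm.1) :
    B.lmul (P.plusPair hX).adm a (p.theta hX P) = B.rmul (P.plusPair hX).adm (p.theta hX P) a := by
  apply P.injective_extTop B.toCohomologyTheory hX
  refine (B.extTop_lmul (P.plusPair hX) _ _).trans (Eq.trans ?_ (B.extTop_rmul (P.plusPair hX) _ _).symm)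
  rw [p.extTop_theta, p.central]

theorem thomClass_central (hX : V.mem X) (hE : V.Adm (overBase E.tot) E.zeroLocus) (a : B.coh hX) :
    B.lmul hE (B.pullTop hX hE.1 (overBaseHom E.tot) a) (p.thomClass hX P hE) =
      B.rmul hE (p.thomClass hX P hE) (B.pullTop hX hE.1 (overBaseHom E.tot) a) := by
  have e : overBaseMap P.minus ≫ overBaseHom P.tot = overBaseHom E.tot := by
    ext1
    exact Over.w P.minus
  rw [thomClass, B.lmul_neg, B.rmul_neg,
    ← B.pullTop_pullTop hX (P.plusPair hX).adm.1 hE.1 e]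
  refine congrArg _ ?_
  refine (B.pull_lmul (P.minusPair hX hE) _ _).symm.trans ?_
  rw [p.theta_central]
  exact B.pull_rmul (P.minusPair hX hE) _ _

end PontryaginStructure

end Naturality

/-! ### Nondegeneracy -/

section Nondegenerate

variable {k : Scheme.{u}} {V : SchemeCategory k} {X : Over k}

/-- The structure morphism, as a morphism of `k`-schemes. -/
abbrev toBase (X : Over k) : X ⟶ Over.mk (𝟙 k) := Over.homMk X.hom (Category.comp_id _)

namespace HPBundle

variable {E : SympBundle X.left 2} {E₀ : SympBundle k 2} (P : HPBundle (hypExt E))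
  (P₀ : HPBundle (hypExt E₀)) {j : BundleMap X.hom E.toVectorBundle E₀.toVectorBundle}
  (hj : j.IsIsometric)

/-- The morphism from a quaternionic projective bundle to one over the base. -/
abbrev toHPBase : overBase P.tot ⟶ overBase (X := Over.mk (𝟙 k)) P₀.tot :=
  overMapHom (f := toBase X) (P.baseMap P₀ hj)

/-- The morphism from a constant quaternionic projective bundle to the product. -/
abbrev toProd : overBase P.tot ⟶ overBase (X := Over.mk (𝟙 k)) P₀.tot ⨯ X :=
  Limits.prod.lift (P.toHPBase P₀ hj) (overBaseHom P.tot)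

/-- A point of the product is a `T`-point of `P₀` together with a structure of `X`-scheme on `T`,
and this is a point of `P` by the bijection of `bijective_comp_baseMap`. -/
theorem exists_inverse_toProd (hc : j.IsCartesian) : ∃ i : overBase (X := Over.mk (𝟙 k)) P₀.tot ⨯ X ⟶ overBase P.tot,
    P.toProd P₀ hj ≫ i = 𝟙 _ ∧ i ≫ P.toProd P₀ hj = 𝟙 _ := by
  let Q : Over k := overBase (X := Over.mk (𝟙 k)) P₀.tot ⨯ X
  let a : Q ⟶ overBase (X := Over.mk (𝟙 k)) P₀.tot := Limits.prod.fst
  let b : Q ⟶ X := Limits.prod.snd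
  let Z : Over X.left := Over.mk b.left
  have ha : a.left ≫ P₀.tot.hom = Q.hom := by
    have h := Over.w a
    change a.left ≫ P₀.tot.hom ≫ 𝟙 k = Q.hom at h
    rwa [Category.comp_id] at h
  let v : (Over.map X.hom).obj Z ⟶ P₀.tot := Over.homMk a.left (ha.trans (Over.w b).symm)
  have hbij := P.bijective_comp_baseMap P₀ hc hj
  obtain ⟨h, hh⟩ := (hbij Z).2 v
  have hh' : h.left ≫ (P.toHPBase P₀ hj).left = a.left := congrArg Over.Hom.left hh
  have hw : h.left ≫ P.tot.hom = b.left := Over.w h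
  let i : Q ⟶ overBase P.tot := Over.homMk h.left (by
    change h.left ≫ P.tot.hom ≫ X.hom = Q.hom
    rw [← Category.assoc, hw]
    exact Over.w b)
  have hta : P.toProd P₀ hj ≫ a = P.toHPBase P₀ hj := Limits.prod.lift_fst _ _
  have htb : P.toProd P₀ hj ≫ b = overBaseHom P.tot := Limits.prod.lift_snd _ _
  refine ⟨i, ?_, ?_⟩
  · let t : P.tot ⟶ Z := Over.homMk (P.toProd P₀ hj).left (congrArg Over.Hom.left htb)
    have h1 : t ≫ h = 𝟙 _ := by
      apply (hbij P.tot).1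
      ext1
      change ((P.toProd P₀ hj).left ≫ h.left) ≫ (P.toHPBase P₀ hj).left = 𝟙 _ ≫ (P.toHPBase P₀ hj).left
      rw [Category.assoc, Category.id_comp]
      refine (congrArg ((P.toProd P₀ hj).left ≫ ·) hh').trans ?_
      exact congrArg Over.Hom.left hta
    have h2 : (P.toProd P₀ hj).left ≫ h.left = 𝟙 _ := congrArg Over.Hom.left h1
    ext1
    exact h2
  · refine Limits.prod.hom_ext ?_ ?_
    · rw [Category.assoc, Category.id_comp]
      refine (congrArg (i ≫ ·) hta).trans ?_
      ext1
      exact hh'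
    · rw [Category.assoc, Category.id_comp]
      refine (congrArg (i ≫ ·) htb).trans ?_
      ext1
      exact hw

end HPBundle

variable {B : RingCohomologyTheory.{u, w} V} (p : PontryaginStructure B)

namespace PontryaginStructure

/-- The projective bundle theorem over `X`. -/
theorem bijective_projective (hX : V.mem X) (P : HPBundle (hypExt (trivialSymp X.left)))
    (hP : V.mem (overBase P.tot)) :
    Function.Bijective fun a : B.coh hX × B.coh hX =>
      B.pullTop hX hP (overBaseHom P.tot) a.1 +
      B.mul hP (B.pullTop hX hP (overBaseHom P.tot) a.2) (p.cls hP P.taut) := by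
  let P₀ := quadHP (trivialSymp k)
  let j : BundleMap X.hom (trivialSymp X.left).toVectorBundle (trivialSymp k).toVectorBundle :=
    trivialMap X.hom
  have hj : j.IsIsometric := trivialMap_isIsometric X.hom
  have hc : j.IsCartesian := trivialMap_isCartesian X.hom
  have hP₀ : V.mem (overBase (X := Over.mk (𝟙 k)) P₀.tot) :=
    V.mem_HP (X := Over.mk (𝟙 k)) V.base P₀
  have hQ := V.prod _ _ hP₀ hX
  obtain ⟨i, hi, hi'⟩ := P.exists_inverse_toProd P₀ hj hc
  have h1 : Function.Bijective (B.pullTop hQ hP (P.toProd P₀ hj)) :=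
    B.bijective_pull_of_isIso (SPair.topMap hQ hP (P.toProd P₀ hj)) (SPair.topMap hP hQ i) hi hi'
  have h2 := h1.comp (p.projective P₀ hP₀ hX)
  have h3 (a) : B.pullTop hQ hP (P.toProd P₀ hj) (B.pullTop hX hQ Limits.prod.snd a) =
      B.pullTop hX hP (overBaseHom P.tot) a :=
    B.pullTop_pullTop hX hQ hP (Limits.prod.lift_snd _ _) a
  have h4 (a) : B.pullTop hQ hP (P.toProd P₀ hj) (B.pullTop hP₀ hQ Limits.prod.fst a) =
      B.pullTop hP₀ hP (P.toHPBase P₀ hj) a :=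
    B.pullTop_pullTop hP₀ hQ hP (Limits.prod.lift_fst _ _) a
  have h5 : B.pullTop hP₀ hP (P.toHPBase P₀ hj) (p.cls hP₀ P₀.taut) = p.cls hP P.taut :=
    p.pullTop_baseMap (f := toBase X) P P₀ V.base hX hc hj
  convert h2 using 1
  funext a
  refine Eq.symm ((map_add _ _ _).trans ?_)
  refine congrArg₂ HAdd.hAdd (h3 a.1) ?_
  refine (B.pullTop_mul hQ hP (P.toProd P₀ hj) _ _).trans ?_
  refine congrArg₂ (fun x y => B.mul hP x y) (h3 a.2) ((h4 _).trans h5)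

theorem mul_zero {X : Over k} (hX : V.mem X) (a : B.coh hX) : B.mul hX a 0 = 0 :=
  B.lmul_zero (V.adm_univ hX) a

/-- After extending supports, multiplication by `θ` becomes multiplication by `p(𝒰)`, i.e. the
inclusion of the second summand of `B(P) ≅ B(X) ⊕ B(X) p(𝒰)`. The classes supported on `N⁺` are
exactly this summand. -/
theorem bijective_lmul_theta (hX : V.mem X) (P : HPBundle (hypExt (trivialSymp X.left))) :
    Function.Bijective fun a : B.coh hX => B.lmul (P.plusPair hX).adm
      (B.pullTop hX (P.plusPair hX).adm.1 (overBaseHom P.tot) a) (p.theta hX P) := by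
  let N := P.plusPair hX
  have hb := p.bijective_projective hX P N.adm.1
  have he (a : B.coh hX) : B.extTop N.adm (B.lmul N.adm
      (B.pullTop hX N.adm.1 (overBaseHom P.tot) a) (p.theta hX P)) =
      B.mul N.adm.1 (B.pullTop hX N.adm.1 (overBaseHom P.tot) a) (p.cls N.adm.1 P.taut) := by
    rw [← p.extTop_theta hX P]
    exact B.extTop_lmul N _ _
  constructor
  · intro a a' h
    have h1 := congrArg (B.extTop N.adm) h
    have h2 : ((0, a) : B.coh hX × B.coh hX) = (0, a') := by
      apply hb.1
      change _ + _ = _ + _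
      rw [← he, ← he]
      exact congrArg (_ + ·) h1
    exact congrArg Prod.snd h2
  · intro y
    obtain ⟨⟨a, b⟩, hab⟩ := hb.2 (B.extTop N.adm y)
    have h1 : B.pullTop N.adm.1 N.mem_open N.openι (B.extTop N.adm y) = 0 :=
      (B.exact_total N _).2 ⟨y, rfl⟩
    -- On the complement of `N⁺` the class `p(𝒰)` vanishes, so only the first summand survives; it
    -- must be zero because `B(X)` injects there.
    have h2 : B.pullTop hX N.mem_open (N.openι ≫ overBaseHom P.tot) a = 0 := by
      rw [← hab, map_add, B.pullTop_mul, p.pullTop_openι_taut hX P, mul_zero, add_zero] at h1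
      rw [← h1]
      exact (B.pullTop_pullTop hX N.adm.1 N.mem_open rfl a).symm
    have h3 : a = 0 := (P.bijective_pullTop_open B.toCohomologyTheory hX).1
      (h2.trans (map_zero _).symm)
    refine ⟨b, P.injective_extTop B.toCohomologyTheory hX ?_⟩
    refine (he b).trans ?_
    rw [← hab, h3]
    change _ = B.pullTop hX N.adm.1 (overBaseHom P.tot) 0 + _
    rw [map_zero, zero_add]

theorem thomClass_nondeg (hX : V.mem X) (P : HPBundle (hypExt (trivialSymp X.left)))
    (hE : V.Adm (overBase (trivialSymp X.left).tot) (trivialSymp X.left).zeroLocus) :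
    Function.Bijective fun a : B.coh hX =>
      B.lmul hE (B.pullTop hX hE.1 (overBaseHom (trivialSymp X.left).tot) a)
        (p.thomClass hX P hE) := by
  have h1 := (Equiv.neg _).bijective.comp ((P.bijective_pull_minusPair B.toCohomologyTheory hX hE).comp
    (p.bijective_lmul_theta hX P))
  have e : overBaseMap P.minus ≫ overBaseHom P.tot = overBaseHom (trivialSymp X.left).tot := by
    ext1
    exact Over.w P.minus
  convert h1 using 1
  funext a
  refine (B.lmul_neg hE _ _).trans (congrArg Neg.neg ?_)
  refine Eq.trans ?_ (B.pull_lmul (P.minusPair hX hE) _ _).symm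
  refine congrArg (fun x => B.lmul hE x _) ?_
  exact (B.pullTop_pullTop hX (P.plusPair hX).adm.1 hE.1 e a).symm

end PontryaginStructure

end Nondegenerate

/-! ### The Thom structure of a Pontryagin structure -/

section Thom

variable {k : Scheme.{u}} {V : SchemeCategory k} {B : RingCohomologyTheory.{u, w} V}
  (p : PontryaginStructure B)

/-- The Thom structure of a Pontryagin structure. -/
def PontryaginStructure.thom : ThomStructure B where
  cls hX E hE := p.thomClass hX (quadHP E) hE
  central hX E hE a := p.thomClass_central (quadHP E) hX hE a
  pull hX hY _ E E' hE hE' _ hj hj' :=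
    p.pull_thomClass (quadHP E') (quadHP E) hX hY hE hE' hj hj'
  nondeg hX hE := p.thomClass_nondeg hX (quadHP (trivialSymp _)) hE

variable {X : Over k} {E : SympBundle X.left 2}

theorem zeroSection_comp {n : ℕ} (E : VectorBundle X.left n) :
    zeroSection E ≫ overBaseHom E.tot = 𝟙 X := by
  ext1
  exact Over.w E.zero

/-- Extending supports turns `θ` into `p(𝒰)`, whose pullback along `minus` is `p` of the pullback of
`E` to its own total space. Restricting to the zero section gives `p(E)`, and the two signs cancel.
-/
theorem PontryaginStructure.pontryaginClass_thomClass (hX : V.mem X) (P : HPBundle (hypExt E))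
    (hE : V.Adm (overBase E.tot) E.zeroLocus) :
    -B.pullTop hE.1 hX (zeroSection E.toVectorBundle) (B.extTop hE (p.thomClass hX P hE)) =
      p.cls hX E := by
  obtain ⟨c, hc, hc', -⟩ := P.exists_minus_isometry
  let W : SympBundle E.tot.left 2 := E.pull E.tot.hom
  have h1 : B.pullTop (P.plusPair hX).adm.1 hE.1 (overBaseMap P.minus)
      (p.cls (P.plusPair hX).adm.1 P.taut) = p.cls hE.1 W :=
    p.pull (X := overBase P.tot) (Y := overBase E.tot) _ hE.1 (overBaseMap P.minus) P.taut W c hc hc'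
  have h2 : B.pullTop hX hE.1 (overBaseHom E.tot) (p.cls hX E) = p.cls hE.1 W :=
    p.pull (X := X) (Y := overBase E.tot) hX hE.1 (overBaseHom E.tot) E W (E.pullMap E.tot.hom)
      (VectorBundle.pullMap_isCartesian _ _) (SympBundle.pullMap_isIsometric _ _)
  have h3 : B.extTop hE (B.pull (P.minusPair hX hE) (p.theta hX P)) =
      B.pullTop hX hE.1 (overBaseHom E.tot) (p.cls hX E) := by
    rw [h2, ← h1, ← p.extTop_theta]
    exact B.extTop_pull (P.minusPair hX hE) _
  rw [thomClass, map_neg, map_neg, neg_neg]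
  refine (congrArg (B.pullTop hE.1 hX (zeroSection E.toVectorBundle)) h3).trans ?_
  refine (B.pullTop_pullTop hX hE.1 hX (zeroSection_comp _) _).trans ?_
  exact B.pullTop_id hX _

/-! ### Uniqueness -/

/-- Restriction to any section of a vector bundle is restriction to the zero section. -/
theorem pullTop_section_eq (B : RingCohomologyTheory.{u, w} V) {n : ℕ} (E : VectorBundle X.left n)
    (hX : V.mem X) (hE : V.mem (overBase E.tot)) (s s' : X ⟶ overBase E.tot)
    (hs : s ≫ overBaseHom E.tot = 𝟙 X) (hs' : s' ≫ overBaseHom E.tot = 𝟙 X)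
    (a : B.coh hE) : B.pullTop hE hX s a = B.pullTop hE hX s' a := by
  have hb : Function.Bijective (B.pullTop hX hE (overBaseHom E.tot)) :=
    E.convex.bijective_of_section B.toCohomologyTheory hX hE E.zero.left (Over.w E.zero)
  obtain ⟨a, rfl⟩ := hb.2 a
  exact (B.pullTop_pullTop hX hE hX hs a).trans (B.pullTop_pullTop hX hE hX hs' a).symm

namespace HPBundle

/-- The section `e(1, 0, 0)` of `𝒪 ⊕ E ⊕ 𝒪` on `P`, where `e` is the projector onto the tautological
bundle. -/
def projOne {X : Scheme.{u}} {E : SympBundle X 2} (P : HPBundle (hypExt E)) :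
    P.tot ⟶ (tripleBundle E.toVectorBundle).tot :=
  (tripleCoord E.toVectorBundle P.tot).symm (P.quad.a, P.quad.x, 0)

theorem exists_section {X : Scheme.{u}} {E : SympBundle X 2} (P : HPBundle (hypExt E)) :
    ∃ σ : P.tot.left ⟶ P.taut.tot.left, σ ≫ P.taut.tot.hom = 𝟙 _ ∧
      σ ≫ P.inclTriple.left = P.projOne.left := by
  refine (P.lies_iff (𝟙 _) P.projOne).2 ?_
  have h : P.quad.proj (1, 0, 0) = (P.quad.a, P.quad.x, 0) := by
    simp [Quad.proj, tripleProj_apply]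
  rw [Quad.map_id, projOne, LinearEquiv.apply_symm_apply, ← h, Quad.proj_proj]

/-- The section is `(a, x, 0)`, so its zeros satisfy the equations `a = 0`, `x = 0` of `N⁺`. -/
theorem section_preimage {X : Scheme.{u}} {E : SympBundle X 2} (P : HPBundle (hypExt E))
    {σ : P.tot.left ⟶ P.taut.tot.left} (hσ : σ ≫ P.inclTriple.left = P.projOne.left) :
    σ ⁻¹' P.taut.zeroLocus ⊆ P.plusLocus := by
  intro t ht
  have ht : σ t ∈ P.taut.zeroLocus := ht
  rw [← P.inclTriple.zeroLocus_preimage P.isSubbundle] at ht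
  have h1 : P.projOne.left t ∈ (tripleBundle E.toVectorBundle).zeroLocus := by
    rw [← hσ]
    exact ht
  rw [VectorBundle.mem_zeroLocus_iff, projOne, tripleCoord_symm_comp,
    LinearEquiv.map_eq_zero_iff] at h1
  rw [P.mem_plusLocus_iff]
  exact ⟨congrArg (fun z => z.1) h1, congrArg (fun z => z.2.1) h1⟩

/-- The diagonal section of the pullback of `E` to `E`, and its image in the tautological bundle. -/
theorem exists_diagonal {X : Scheme.{u}} {E : SympBundle X 2} (P : HPBundle (hypExt E))
    {σ : P.tot.left ⟶ P.taut.tot.left} (hσ' : σ ≫ P.taut.tot.hom = 𝟙 _)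
    (hσ : σ ≫ P.inclTriple.left = P.projOne.left)
    {c : BundleMap P.minus.left (E.pull E.tot.hom).toVectorBundle P.taut.toVectorBundle}
    (hc : c.left ≫ P.inclTriple.left = (minusPointMap E).bundleMap.left) :
    ∃ δ : E.tot.left ⟶ (E.pull E.tot.hom).tot.left, δ ≫ (E.pull E.tot.hom).tot.hom = 𝟙 _ ∧
      δ ≫ (E.pullMap E.tot.hom).left = 𝟙 _ ∧ δ ≫ c.left = P.minus.left ≫ σ := by
  let S : Over E.tot.left := Over.mk (𝟙 _)
  obtain ⟨v, hv⟩ := (VectorBundle.pullMap_isCartesian E.tot.hom E.toVectorBundle S).2 (structHom S)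
  have hw : v.left ≫ (E.pull E.tot.hom).tot.hom = 𝟙 _ := Over.w v
  let δ : E.tot.left ⟶ (E.pull E.tot.hom).tot.left := v.left
  refine ⟨δ, hw, congrArg Over.Hom.left hv, ?_⟩
  have hcw : c.left ≫ P.taut.tot.hom = (E.pull E.tot.hom).tot.hom ≫ P.minus.left := Over.w c.hom
  refine P.isSubbundle.hom_ext ?_ ?_
  · rw [Category.assoc, Category.assoc, hcw, ← Category.assoc, hσ', Category.comp_id]
    exact (congrArg (· ≫ P.minus.left) hw).trans (Category.id_comp _)
  · rw [Category.assoc, Category.assoc]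
    refine (congrArg (δ ≫ ·) hc).trans (Eq.trans ?_ (congrArg (P.minus.left ≫ ·) hσ).symm)
    -- Along `minus` the section `(a, x, 0)` becomes `(0, v, 0)` with `v` the universal vector,
    -- while the diagonal gives `(0, v, φ(v, v))`. They agree since the form is alternating.
    have h1 : (minusPointMap E).bundleMap.app S v = structHom S ≫ P.minus ≫ P.projOne := by
      rw [PointMap.bundleMap_app, hv, projOne, tripleCoord_symm_comp, tripleCoord_symm_comp]
      refine congrArg (tripleCoord E.toVectorBundle _).symm ?_
      have hq : P.quad.map P.minus = minusQuad (𝟙 _) := P.quad_map_equiv_symm _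
      have ha : P.minus.left.appTop P.quad.a = 0 := congrArg Quad.a hq
      have hx : P.minus ≫ P.quad.x = 𝟙 _ := congrArg Quad.x hq
      refine Prod.ext ?_ (Prod.ext ?_ ?_)
      · simp only [Triple.map, ha, map_zero]
      · simp only [Triple.map, hx, Category.comp_id]
      · simp only [Triple.map, map_zero, E.form_self]
    have h2 := congrArg Over.Hom.left h1
    exact h2.trans (Category.id_comp _)

end HPBundle

/-- A Thom structure is determined by its Pontryagin classes. -/
theorem PontryaginStructure.eq_thomClass (Th : ThomStructure B)
    (h : ∀ {X : Over k} (hX : V.mem X) (E : SympBundle X.left 2)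
      (hE : V.Adm (overBase E.tot) E.zeroLocus), Th.pontryaginClass hX E hE = p.cls hX E)
    (hX : V.mem X) (P : HPBundle (hypExt E)) (hE : V.Adm (overBase E.tot) E.zeroLocus) :
    Th.cls hX E hE = p.thomClass hX P hE := by
  obtain ⟨c, hc, hc', hcl⟩ := P.exists_minus_isometry
  obtain ⟨σ, hσ', hσ⟩ := P.exists_section
  obtain ⟨δ, hδ, hδ', hδc⟩ := P.exists_diagonal hσ' hσ hcl
  let N := P.plusPair hX
  let W : SympBundle (overBase E.tot).left 2 := E.pull E.tot.hom
  let U : SympBundle (overBase P.tot).left 2 := P.taut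
  have hU : V.Adm (overBase U.tot) U.zeroLocus := V.adm_zeroLocus N.adm.1 U.toVectorBundle
  have hW : V.Adm (overBase W.tot) W.zeroLocus := V.adm_zeroLocus hE.1 W.toVectorBundle
  let s : overBase P.tot ⟶ overBase U.tot := Over.homMk σ (by
    change σ ≫ P.taut.tot.hom ≫ P.tot.hom ≫ X.hom = P.tot.hom ≫ X.hom
    rw [← Category.assoc, hσ', Category.id_comp])
  have hs : s ≫ overBaseHom U.tot = 𝟙 _ := by
    ext1
    exact hσ'
  let S : N ⟶ ⟨overBase U.tot, U.zeroLocus, hU⟩ := ⟨s, P.section_preimage hσ⟩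
  -- By uniqueness of `θ` only the image without supports matters, and there `σ` may be replaced by
  -- the zero section, which computes the Pontryagin class up to sign.
  have h1 : -B.pull S (Th.cls N.adm.1 U hU) = p.theta hX P := by
    apply p.eq_theta
    rw [map_neg]
    refine Eq.trans ?_ (h N.adm.1 U hU)
    refine congrArg Neg.neg ((B.extTop_pull S _).trans ?_)
    exact pullTop_section_eq B U.toVectorBundle N.adm.1 hU.1 s (zeroSection U.toVectorBundle) hs
      (zeroSection_comp _) _
  let c' : BundleMap (overBaseMap P.minus).left W.toVectorBundle U.toVectorBundle := c
  let n : BundleMap (overBaseHom E.tot).left W.toVectorBundle E.toVectorBundle :=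
    E.pullMap E.tot.hom
  have hn : n.IsCartesian := VectorBundle.pullMap_isCartesian _ _
  have h2 := Th.pull (X := overBase P.tot) (Y := overBase E.tot) N.adm.1 hE.1 (overBaseMap P.minus)
    U W hU hW c' hc hc'
  have h3 := Th.pull hX hE.1 (overBaseHom E.tot) E W hE hW n hn
    (SympBundle.pullMap_isIsometric _ _)
  let d : overBase E.tot ⟶ overBase W.tot := Over.homMk δ (by
    change δ ≫ (E.pull E.tot.hom).tot.hom ≫ E.tot.hom ≫ X.hom = E.tot.hom ≫ X.hom
    rw [← Category.assoc, hδ, Category.id_comp])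
  have hd : d.left ⁻¹' W.zeroLocus ⊆ E.zeroLocus := by
    intro t ht
    have ht : δ t ∈ W.zeroLocus := ht
    rw [← n.zeroLocus_preimage fun T => (hn T).1] at ht
    have ht' : (δ ≫ n.left) t ∈ E.zeroLocus := ht
    exact (congrArg (fun g => g t ∈ E.zeroLocus) hδ').mp ht'
  let D : (⟨overBase E.tot, E.zeroLocus, hE⟩ : SPair V) ⟶ ⟨overBase W.tot, W.zeroLocus, hW⟩ := ⟨d, hd⟩
  -- The diagonal section followed by the projection from the pulled back bundle to `E` is the
  -- identity of `E`.
  have h4 : B.pull D (Th.cls hE.1 W hW) = Th.cls hX E hE := by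
    rw [← h3]
    exact B.pull_pull_eq_self (by ext1; exact hδ') _
  rw [thomClass, ← h1, map_neg, neg_neg, ← h4, ← h2]
  exact B.pull_comm (by ext1; exact hδc) _

end Thom

end Symplectic

end

/-- Every Pontryagin structure on a ring cohomology theory is the system of Pontryagin classes of a
unique symplectic Thom structure, whose classes are `Th(E, φ) = - f^B(θ)`. -/
theorem theoremT {k : Scheme.{u}} (V : SchemeCategory k) (B : RingCohomologyTheory.{u, w} V)
    (p : PontryaginStructure B) :
    ∃ Th : ThomStructure B,
      (∀ {X : Over k} (hX : V.mem X) (E : SympBundle X.left 2)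
        (hE : V.Adm (overBase E.tot) E.zeroLocus),
        Th.pontryaginClass hX E hE = p.cls hX E) ∧
      (∀ Th' : ThomStructure B,
        (∀ {X : Over k} (hX : V.mem X) (E : SympBundle X.left 2)
          (hE : V.Adm (overBase E.tot) E.zeroLocus),
          Th'.pontryaginClass hX E hE = p.cls hX E) → Th' = Th) ∧
      ∀ {X : Over k} (hX : V.mem X) (E : SympBundle X.left 2),
        ∃ hE : V.Adm (overBase E.tot) E.zeroLocus,
          Nonempty (HPBundle (hypExt E)) ∧
          ∀ P : HPBundle (hypExt E),
            ∃ f : E.tot ⟶ P.tot, P.IsMinusInclusion f ∧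
              (∀ f' : E.tot ⟶ P.tot, P.IsMinusInclusion f' → f' = f) ∧
              ∃ (hN : V.Adm (overBase P.tot) P.plusLocus)
                (hf : f.left ⁻¹' P.plusLocus ⊆ E.zeroLocus)
                (θ : B.grp ⟨overBase P.tot, P.plusLocus, hN⟩),
                B.extTop hN θ = p.cls hN.1 P.taut ∧
                (∀ θ' : B.grp ⟨overBase P.tot, P.plusLocus, hN⟩,
                  B.extTop hN θ' = p.cls hN.1 P.taut → θ' = θ) ∧
                Th.cls hX E hE =
                  -B.pull (SPair.homMk hN hE (Over.homMk f.left (by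
                    change f.left ≫ P.tot.hom ≫ X.hom = E.tot.hom ≫ X.hom
                    rw [← Category.assoc]
                    exact congrArg (· ≫ X.hom) (Over.w f))) hf) θ := by
  refine ⟨p.thom, fun hX E hE => p.pontryaginClass_thomClass hX (quadHP E) hE, fun Th' h => ?_,
    fun {X} hX E => ⟨V.adm_zeroLocus hX E.toVectorBundle, ⟨quadHP E⟩, fun P =>
      ⟨P.minus, (P.isMinusInclusion_iff _).2 rfl, fun f' hf' => (P.isMinusInclusion_iff _).1 hf',
        P.adm_plusLocus V hX, P.minus_preimage_plusLocus.subset, p.theta hX P,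
        p.extTop_theta hX P, fun θ' hθ' => p.eq_theta hX P hθ', ?_⟩⟩⟩
  · refine ThomStructure.ext ?_
    funext X hX E hE
    exact p.eq_thomClass Th' h hX (quadHP E) hE
  -- The Thom structure is built from the model `quadHP E`; the formula for an arbitrary model
  -- follows by independence of the choice.
  · exact p.thomClass_eq hX (quadHP E) P (V.adm_zeroLocus hX E.toVectorBundle)
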